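/- All vector spaces are over $\mathbb{Q}$. A graded Lie algebra is $L_*=\bigoplus_{n\ge 0}L_n$ with a bilinear bracket of degree $0$ satisfying graded antisymmetry and the graded Jacobi identity; it is connected if $L_0=0$. A DGL is a graded Lie algebra with a differential of degree $-1$ that is a graded derivation, and $H'_*$ denotes the homology of its underlying complex, a graded Lie algebra. A differential bigraded Lie algebra $A_{*,*}=\bigoplus_{p,s\ge0}A_{p,s}$ has a differential of bidegree $(-1,0)$ and signs given by the total degree $p+s$; regrading by $p+s$ gives its associated DGL. A bigraded model $\phi\colon A_{*,*}\to L_*$ is a differential bigraded Lie algebra $A_{*,*}$ which is free as a bigraded Lie algebra, satisfies $\partial_A(A)\subseteq[A,A]$, and is equipped with a quasi-isomorphism $\phi$ from its associated DGL to $(L_*,0)$ that vanishes on $A_{p,*}$ for $p>0$. A $d\mathcal{L}$-$n$-sphere is the free graded Lie algebra on one generator of degree $n$, with zero differential; a $d\mathcal{L}$-$(n+1)$-disk is the free graded Lie algebra on $x$ and $\partial x$, with $|x|=n+1$. A simplicial DGL $C_{\bullet,*}$ is $\mathcal{M}$-free if each $C_{n,*}$ is a coproduct of $d\mathcal{L}$-spheres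 and $d\mathcal{L}$-disks, the degeneracies being inclusions of sub-coproducts that carry spheres to spheres and disks to disks; a sphere is non-degenerate if its generator is not in the image of a degeneracy. An augmentation $\varepsilon\colon C_{\bullet,*}\to L$ is a resolution if it induces isomorphisms $\pi_sH'_t(C_{\bullet,*})\to\pi_sH'_t(L)$ for all $s,t$, where $L$ is regarded as a constant simplicial DGL. A CW-resolution of a graded Lie algebra $B$ is a simplicial graded Lie algebra $G_\bullet$ with an augmentation $G_0\to B$ that is a resolution ($\pi_0G_\bullet\cong B$ and $\pi_nG_\bullet=0$ for $n\geq1$), such that each $G_n$ is free on a graded set $T^n$, the degeneracies take $T^n$ to $T^{n+1}$, and $d_i$ vanishes for $1\le i\le n$ on the subalgebra $\bar G_n\subseteq G_n$ generated by the non-degenerate elements of $T^n$. The sequence $(\bar G_n)_{n\ge0}$ is its CW basis. The resolution is minimal if no proper subalgebra can replace any $\bar G_n$: no proper graded subalgebra of $\bar G_0=G_0$ maps onto $B$; and for each $n\ge0$, if $S\subseteq\bar G_{n+1}$ is a graded subalgebra such that $d_0$ maps those Moore chains (elements $x$ with $d_ix=0$ for all $i\geq1$) of $G_{n+1}$ that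 lie in the subalgebra generated by $S$ and the degenerate elements onto the Moore $n$-cycles (the elements of $G_n$ annihilated by all faces, or, for $n=0$, by the augmentation), then $S=\bar G_{n+1}$. **Proposition.** Let $L_*$ be a connected graded Lie algebra, let $L=(L_*,0)$, let $\phi\colon A_{*,*}\to L_*$ be a bigraded model, and let $X_{*,*}$ be a bigraded set of free generators of $A_{*,*}$. Then there are an $\mathcal{M}$-free simplicial DGL resolution $C_{\bullet,*}\to L$ and a bijection $\theta$ from $X_{*,*}$ onto the set of non-degenerate $d\mathcal{L}$-spheres of $C_{\bullet,*}$, taking each $x\in X_{n,k}$ to a $k$-sphere in $C_{n,*}$. Moreover, $H'_*(C_{\bullet,*})$, with the augmentation induced by that of $C_{\bullet,*}$, is a minimal CW-resolution of $L_*$, for a CW structure whose non-degenerate generators in each simplicial dimension $n$ are exactly the homology classes of the generators of the spheres in $\operatorname{Im}(\theta)$ lying in $C_{n,*}$; so its CW basis is generated by $\operatorname{Im}(\theta)$. -/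

import Mathlib

open CategoryTheory

universe u

/-! ### Graded Lie algebras -/

/-- Graded Lie algebras over `ℚ`, graded by an additive monoid `ι`; the signs are governed by the
total degree `tot : ι →+ ℕ`.  The object is the direct sum of its homogeneous parts `gr i`. -/
structure GrLie (ι : Type) [AddCommMonoid ι] [DecidableEq ι] (tot : ι →+ ℕ) where
  carrier : Type u
  [addCommGroup : AddCommGroup carrier]
  [module : Module ℚ carrier]
  gr : ι → Submodule ℚ carrier
  internal : DirectSum.IsInternal gr
  bracket : carrier →ₗ[ℚ] carrier →ₗ[ℚ] carrier
  bracket_mem : ∀ {i j x y}, x ∈ gr i → y ∈ gr j → bracket x y ∈ gr (i + j)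
  skew : ∀ {i j x y}, x ∈ gr i → y ∈ gr j →
    bracket x y = (-1 : ℚ) ^ (tot i * tot j + 1) • bracket y x
  jacobi : ∀ {i j k x y z}, x ∈ gr i → y ∈ gr j → z ∈ gr k →
    (-1 : ℚ) ^ (tot i * tot k) • bracket (bracket x y) z +
      (-1 : ℚ) ^ (tot j * tot i) • bracket (bracket y z) x +
      (-1 : ℚ) ^ (tot k * tot j) • bracket (bracket z x) y = 0

attribute [instance] GrLie.addCommGroup GrLie.module

namespace GrLie

variable {ι : Type} [AddCommMonoid ι] [DecidableEq ι] {tot : ι →+ ℕ}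

/-- Morphisms: linear maps preserving degrees and brackets. -/
@[ext]
structure Hom (G H : GrLie.{u} ι tot) where
  toLin : G.carrier →ₗ[ℚ] H.carrier
  map_gr : ∀ {i x}, x ∈ G.gr i → toLin x ∈ H.gr i
  map_bracket : ∀ x y, toLin (G.bracket x y) = H.bracket (toLin x) (toLin y)

instance : Category (GrLie.{u} ι tot) where
  Hom G H := Hom G H
  id G := ⟨LinearMap.id, fun h => h, fun _ _ => rfl⟩
  comp f g := ⟨g.toLin ∘ₗ f.toLin, fun h => g.map_gr (f.map_gr h), fun x y => by
    simp [f.map_bracket, g.map_bracket]⟩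

/-- The underlying linear map of a morphism. -/
abbrev lin {G H : GrLie.{u} ι tot} (f : G ⟶ H) : G.carrier →ₗ[ℚ] H.carrier := Hom.toLin f

theorem iSup_gr (G : GrLie.{u} ι tot) : ⨆ i, G.gr i = ⊤ :=
  G.internal.submodule_iSup_eq_top

/-- The family `b`, with `b t` homogeneous of degree `deg t`, freely generates the graded Lie
algebra `G`: degree-preserving maps from the graded set to graded Lie algebras extend uniquely. -/
def IsFreeOn (G : GrLie.{u} ι tot) {T : Type u} (deg : T → ι) (b : T → G.carrier) : Prop :=
  (∀ t, b t ∈ G.gr (deg t)) ∧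
    ∀ (H : GrLie.{u} ι tot) (f : T → H.carrier), (∀ t, f t ∈ H.gr (deg t)) →
      ∃! φ : G ⟶ H, ∀ t, lin φ (b t) = f t

/-- The subspace `[G, G]` of decomposable elements. -/
def decomposables (G : GrLie.{u} ι tot) : Submodule ℚ G.carrier :=
  Submodule.span ℚ {z | ∃ x y, z = G.bracket x y}

/-- Closed under the bracket. -/
def BracketClosed (G : GrLie.{u} ι tot) (B : Submodule ℚ G.carrier) : Prop :=
  ∀ x ∈ B, ∀ y ∈ B, G.bracket x y ∈ B

/-- Graded Lie subalgebras: bracket-closed and spanned by homogeneous elements. -/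
def IsGradedSubalgebra (G : GrLie.{u} ι tot) (B : Submodule ℚ G.carrier) : Prop :=
  G.BracketClosed B ∧ ⨆ i, B ⊓ G.gr i = B

/-- The Lie subalgebra generated by a set. -/
def lieSpan (G : GrLie.{u} ι tot) (S : Set G.carrier) : Submodule ℚ G.carrier :=
  sInf {B | S ⊆ B ∧ G.BracketClosed B}

/-- A projection criterion for internal direct sums. -/
theorem isInternal_of_proj {κ : Type} [DecidableEq κ] {M : Type u} [AddCommGroup M] [Module ℚ M]
    (g : κ → Submodule ℚ M) (P : κ → M →ₗ[ℚ] M) (hs : ⨆ i, g i = ⊤)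
    (h1 : ∀ i, ∀ x ∈ g i, P i x = x) (h2 : ∀ i j, i ≠ j → ∀ x ∈ g j, P i x = 0) :
    DirectSum.IsInternal g := by
  refine DirectSum.isInternal_submodule_of_iSupIndep_of_iSup_eq_top (fun i => ?_) hs
  rw [Submodule.disjoint_def]
  intro x hx hx'
  have : (⨆ j, ⨆ (_ : j ≠ i), g j) ≤ LinearMap.ker (P i) :=
    iSup_le fun j => iSup_le fun hj y hy => h2 i j (Ne.symm hj) y hy
  rw [← h1 i x hx]
  exact this hx'

/-- The projection onto the part of degree `i`. -/
noncomputable def proj (G : GrLie.{u} ι tot) (i : ι) : G.carrier →ₗ[ℚ] G.carrier :=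
  letI := G.internal.chooseDecomposition
  (G.gr i).subtype ∘ₗ (DirectSum.component ℚ ι (fun i => G.gr i) i) ∘ₗ
    (DirectSum.decomposeLinearEquiv G.gr).toLinearMap

theorem proj_same (G : GrLie.{u} ι tot) {i : ι} {x : G.carrier} (hx : x ∈ G.gr i) :
    G.proj i x = x := by
  let := G.internal.chooseDecomposition
  exact DirectSum.decompose_of_mem_same G.gr hx

theorem proj_ne (G : GrLie.{u} ι tot) {i j : ι} {x : G.carrier} (hx : x ∈ G.gr j) (h : j ≠ i) :
    G.proj i x = 0 := by
  let := G.internal.chooseDecomposition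
  exact DirectSum.decompose_of_mem_ne G.gr hx h

theorem proj_mem (G : GrLie.{u} ι tot) (i : ι) (x : G.carrier) : G.proj i x ∈ G.gr i := by
  simp [proj]

theorem induct (G : GrLie.{u} ι tot) {p : G.carrier → Prop} (x : G.carrier)
    (h : ∀ i, ∀ x ∈ G.gr i, p x) (h0 : p 0) (ha : ∀ x y, p x → p y → p (x + y)) : p x :=
  Submodule.iSup_induction G.gr (motive := p) (by rw [G.iSup_gr]; trivial) h h0 ha

theorem mem_of_proj_mem (G : GrLie.{u} ι tot) (x : G.carrier) (B : Submodule ℚ G.carrier)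
    (h : ∀ i, G.proj i x ∈ B) : x ∈ B := by
  let := G.internal.chooseDecomposition
  classical
  rw [← DirectSum.sum_support_decompose G.gr x]
  exact Submodule.sum_mem _ fun i _ => h i

end GrLie

/-- Graded Lie algebras `L = ⨁ₙ Lₙ`. -/
abbrev GLie := GrLie.{u} ℕ (AddMonoidHom.id ℕ)

/-- The total degree of a bidegree. -/
def totalDegree : ℕ × ℕ →+ ℕ where
  toFun i := i.1 + i.2
  map_zero' := rfl
  map_add' i j := by simp only [Prod.fst_add, Prod.snd_add]; omega

/-- Bigraded Lie algebras, with signs given by the total degree. -/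
abbrev BGLie := GrLie.{u} (ℕ × ℕ) totalDegree

/-- Regrading a bigraded Lie algebra by the total degree: `Lₙ = ⨁_{p+q=n} L_{p,q}`. -/
def BGLie.total (A : BGLie.{u}) : GLie.{u} where
  carrier := A.carrier
  gr n := ⨆ i : {i : ℕ × ℕ // totalDegree i = n}, A.gr i
  internal := by
    classical
    refine GrLie.isInternal_of_proj _ (fun n => ∑ i ∈ Finset.HasAntidiagonal.antidiagonal n, A.proj i) ?_ ?_ ?_
    · rw [eq_top_iff, ← A.iSup_gr]
      exact iSup_le fun i => le_iSup_of_le (totalDegree i) (le_iSup_of_le ⟨i, rfl⟩ le_rfl)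
    · intro n x hx
      induction hx using Submodule.iSup_induction' with
      | mem i x hx =>
        rw [LinearMap.sum_apply, Finset.sum_eq_single i.1, A.proj_same hx]
        · exact fun j _ hj => A.proj_ne hx hj.symm
        · exact fun h => absurd (Finset.HasAntidiagonal.mem_antidiagonal.2 i.2) h
      | zero => simp
      | add x y _ _ hx hy => rw [map_add, hx, hy]
    · intro n m hnm x hx
      induction hx using Submodule.iSup_induction' with
      | mem i x hx =>
        rw [LinearMap.sum_apply]
        refine Finset.sum_eq_zero fun j hj => A.proj_ne hx ?_
        rintro rfl
        exact hnm ((Finset.HasAntidiagonal.mem_antidiagonal.1 hj).symm.trans i.2)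
      | zero => simp
      | add x y _ _ hx hy => rw [map_add, hx, hy, add_zero]
  bracket := A.bracket
  bracket_mem := by
    intro n m x y hx hy
    induction hx using Submodule.iSup_induction' with
    | mem i x hx =>
      induction hy using Submodule.iSup_induction' with
      | mem j y hy =>
        exact Submodule.mem_iSup_of_mem
          (⟨i.1 + j.1, by rw [map_add, i.2, j.2]⟩ : {k : ℕ × ℕ // totalDegree k = n + m})
          (A.bracket_mem hx hy)
      | zero => simp
      | add y z _ _ h h' => rw [map_add]; exact add_mem h h'
    | zero => simp
    | add y z _ _ h h' => rw [map_add, LinearMap.add_apply]; exact add_mem h h'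
  skew := by
    intro n m x y hx hy
    induction hx using Submodule.iSup_induction' with
    | mem i x hx =>
      induction hy using Submodule.iSup_induction' with
      | mem j y hy =>
        have := A.skew hx hy
        rwa [i.2, j.2] at this
      | zero => simp
      | add y z _ _ h h' => rw [map_add, h, h', map_add, LinearMap.add_apply, smul_add]
    | zero => simp
    | add y z _ _ h h' => rw [map_add, LinearMap.add_apply, h, h', map_add, smul_add]
  jacobi := by
    intro n m l x y z hx hy hz
    induction hx using Submodule.iSup_induction' with
    | mem i x hx =>
      induction hy using Submodule.iSup_induction' with
      | mem j y hy =>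
        induction hz using Submodule.iSup_induction' with
        | mem k z hz =>
          have := A.jacobi hx hy hz
          rwa [i.2, j.2, k.2] at this
        | zero => simp
        | add z w _ _ h h' =>
          simp only [map_add, LinearMap.add_apply, smul_add]
          rw [← add_zero (0 : A.carrier)]
          nth_rw 1 [← h]
          nth_rw 1 [← h']
          abel
      | zero => simp
      | add z w _ _ h h' =>
        simp only [map_add, LinearMap.add_apply, smul_add]
        rw [← add_zero (0 : A.carrier)]
        nth_rw 1 [← h]
        nth_rw 1 [← h']
        abel
    | zero => simp
    | add z w _ _ h h' =>
      simp only [map_add, LinearMap.add_apply, smul_add]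
      rw [← add_zero (0 : A.carrier)]
      nth_rw 1 [← h]
      nth_rw 1 [← h']
      abel

/-! ### Differential graded and differential bigraded Lie algebras -/

/-- Differential graded Lie algebras (DGLs), with differential of degree `-1`. -/
structure DGL extends GrLie.{u} ℕ (AddMonoidHom.id ℕ) where
  d : carrier →ₗ[ℚ] carrier
  d_succ : ∀ {n x}, x ∈ gr (n + 1) → d x ∈ gr n
  d_zero : ∀ {x}, x ∈ gr 0 → d x = 0
  d_d : ∀ x, d (d x) = 0
  leibniz : ∀ {n x}, x ∈ gr n → ∀ y,
    d (bracket x y) = bracket (d x) y + (-1 : ℚ) ^ n • bracket x (d y)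

/-- Differential bigraded Lie algebras, with differential of bidegree `(-1, 0)`. -/
structure DBGL extends GrLie.{u} (ℕ × ℕ) totalDegree where
  d : carrier →ₗ[ℚ] carrier
  d_succ : ∀ {p s x}, x ∈ gr (p + 1, s) → d x ∈ gr (p, s)
  d_zero : ∀ {s x}, x ∈ gr (0, s) → d x = 0
  d_d : ∀ x, d (d x) = 0
  leibniz : ∀ {p s x}, x ∈ gr (p, s) → ∀ y,
    d (bracket x y) = bracket (d x) y + (-1 : ℚ) ^ (p + s) • bracket x (d y)

/-- The DGL associated to a differential bigraded Lie algebra. -/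
def DBGL.assoc (A : DBGL.{u}) : DGL.{u} where
  toGrLie := BGLie.total A.toGrLie
  d := A.d
  d_succ := by
    intro n x hx
    change A.d x ∈ ⨆ i : {i : ℕ × ℕ // totalDegree i = n}, A.gr i
    replace hx : x ∈ ⨆ i : {i : ℕ × ℕ // totalDegree i = n + 1}, A.gr i := hx
    induction hx using Submodule.iSup_induction' with
    | mem i x hx =>
      obtain ⟨⟨p, s⟩, h⟩ := i
      cases p with
      | zero => rw [A.d_zero hx]; exact zero_mem _
      | succ p =>
        exact Submodule.mem_iSup_of_mem
          (⟨(p, s), by change p + 1 + s = n + 1 at h; change p + s = n; omega⟩ :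
            {i : ℕ × ℕ // totalDegree i = n}) (A.d_succ hx)
    | zero => exact (map_zero A.d).symm ▸ zero_mem _
    | add x y _ _ hx hy => exact (map_add A.d x y).symm ▸ add_mem hx hy
  d_zero := by
    intro x hx
    replace hx : x ∈ ⨆ i : {i : ℕ × ℕ // totalDegree i = 0}, A.gr i := hx
    induction hx using Submodule.iSup_induction' with
    | mem i x hx =>
      obtain ⟨⟨p, s⟩, h⟩ := i
      change p + s = 0 at h
      obtain rfl : p = 0 := by omega
      exact A.d_zero hx
    | zero => exact map_zero A.d
    | add x y _ _ hx hy => exact ((map_add A.d x y).trans (congrArg₂ (· + ·) hx hy)).trans (add_zero 0)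
  d_d := A.d_d
  leibniz := by
    intro n (x : A.carrier) hx (y : A.carrier)
    change A.d (A.bracket x y) = A.bracket (A.d x) y + (-1 : ℚ) ^ n • A.bracket x (A.d y)
    replace hx : x ∈ ⨆ i : {i : ℕ × ℕ // totalDegree i = n}, A.gr i := hx
    induction hx using Submodule.iSup_induction' with
    | mem i x hx =>
      obtain ⟨⟨p, s⟩, h⟩ := i
      rw [A.leibniz hx y, ← h]; rfl
    | zero =>
      change A.d (A.bracket (0 : A.carrier) y) = A.bracket (A.d (0 : A.carrier)) y +
        (-1 : ℚ) ^ n • A.bracket (0 : A.carrier) (A.d y)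
      simp
    | add x z _ _ hx hz =>
      change A.d (A.bracket ((x : A.carrier) + (z : A.carrier)) y) =
        A.bracket (A.d ((x : A.carrier) + (z : A.carrier))) y +
        (-1 : ℚ) ^ n • A.bracket ((x : A.carrier) + (z : A.carrier)) (A.d y)
      simp only [map_add, LinearMap.add_apply, smul_add, hx, hz]
      abel

namespace DGL

/-- Morphisms of DGLs. -/
@[ext]
structure Hom (D E : DGL.{u}) extends GrLie.Hom D.toGrLie E.toGrLie where
  comm : ∀ x, toLin (D.d x) = E.d (toLin x)

instance : Category DGL.{u} where
  Hom D E := Hom D E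
  id D := ⟨⟨LinearMap.id, fun h => h, fun _ _ => rfl⟩, fun _ => rfl⟩
  comp f g := ⟨⟨g.toLin ∘ₗ f.toLin, fun h => g.map_gr (f.map_gr h), fun x y => by
    simp [f.map_bracket, g.map_bracket]⟩, fun x => by simp [f.comm, g.comm]⟩

/-- The underlying linear map of a morphism. -/
abbrev lin {D E : DGL.{u}} (f : D ⟶ E) : D.carrier →ₗ[ℚ] E.carrier := (Hom.toHom f).toLin

/-- The DGL `(L, 0)`. -/
def trivial (L : GLie.{u}) : DGL.{u} where
  toGrLie := L
  d := 0
  d_succ _ := zero_mem _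
  d_zero _ := rfl
  d_d _ := rfl
  leibniz _ _ := by simp

/-! ### The homology Lie algebra of a DGL -/

/-- The cycles of a DGL. -/
abbrev cycles (D : DGL.{u}) : Submodule ℚ D.carrier := LinearMap.ker D.d

/-- The boundaries of a DGL, as a subspace of the cycles. -/
abbrev boundaries (D : DGL.{u}) : Submodule ℚ D.cycles :=
  (LinearMap.range D.d).comap D.cycles.subtype

theorem proj_d (D : DGL.{u}) (n : ℕ) (x : D.carrier) :
    D.proj n (D.d x) = D.d (D.proj (n + 1) x) := by
  refine D.induct (p := fun x => D.proj n (D.d x) = D.d (D.proj (n + 1) x)) x ?_ (by simp)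
    (fun x y hx hy => by simp only [map_add, hx, hy])
  intro i x hx
  by_cases h : i = n + 1
  · subst h
    rw [D.proj_same hx, D.proj_same (D.d_succ hx)]
  · rw [D.proj_ne hx h, map_zero]
    cases i with
    | zero => rw [D.d_zero hx, map_zero]
    | succ i => exact D.proj_ne (D.d_succ hx) (by omega)

theorem proj_mem_cycles (D : DGL.{u}) (n : ℕ) {x : D.carrier} (hx : x ∈ D.cycles) :
    D.proj n x ∈ D.cycles := by
  rw [LinearMap.mem_ker] at hx ⊢
  cases n with
  | zero => exact D.d_zero (D.proj_mem 0 x)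
  | succ n => rw [← D.proj_d, hx, map_zero]

theorem cycles_induct (D : DGL.{u}) {p : D.carrier → Prop} {x : D.carrier} (hx : x ∈ D.cycles)
    (h : ∀ n, ∀ x ∈ D.gr n, x ∈ D.cycles → p x) (h0 : p 0)
    (ha : ∀ x y, p x → p y → p (x + y)) : p x := by
  have : x ∈ ⨆ n, D.gr n ⊓ D.cycles := D.mem_of_proj_mem x _ fun n =>
    Submodule.mem_iSup_of_mem n ⟨D.proj_mem n x, D.proj_mem_cycles n hx⟩
  exact Submodule.iSup_induction _ (motive := p) this (fun n x hx => h n x hx.1 hx.2) h0 ha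

theorem bracket_mem_cycles (D : DGL.{u}) {x y : D.carrier} (hx : x ∈ D.cycles)
    (hy : y ∈ D.cycles) : D.bracket x y ∈ D.cycles := by
  refine D.cycles_induct (p := fun x => D.bracket x y ∈ D.cycles) hx ?_ (by simp)
    (fun x z hx hz => by rw [map_add, LinearMap.add_apply]; exact add_mem hx hz)
  intro n x hx hx'
  rw [LinearMap.mem_ker] at hx' hy ⊢
  rw [D.leibniz hx, hx', hy]
  simp

theorem bracket_d_left (D : DGL.{u}) (w : D.carrier) {y : D.carrier} (hy : y ∈ D.cycles) :
    D.bracket (D.d w) y ∈ LinearMap.range D.d := by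
  refine D.induct (p := fun w => D.bracket (D.d w) y ∈ LinearMap.range D.d) w ?_ (by simp)
    (fun x z hx hz => by
      rw [map_add, map_add, LinearMap.add_apply]; exact add_mem hx hz)
  intro n w hw
  refine ⟨D.bracket w y, ?_⟩
  rw [LinearMap.mem_ker] at hy
  rw [D.leibniz hw, hy]
  simp

theorem bracket_d_right (D : DGL.{u}) (w : D.carrier) {x : D.carrier} (hx : x ∈ D.cycles) :
    D.bracket x (D.d w) ∈ LinearMap.range D.d := by
  refine D.cycles_induct (p := fun x => D.bracket x (D.d w) ∈ LinearMap.range D.d) hx ?_ (by simp)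
    (fun x z hx hz => by
      rw [map_add, LinearMap.add_apply]; exact add_mem hx hz)
  intro n x hx hx'
  refine ⟨(-1 : ℚ) ^ n • D.bracket x w, ?_⟩
  rw [LinearMap.mem_ker] at hx'
  rw [map_smul, D.leibniz hx, hx', map_zero, LinearMap.zero_apply, zero_add, smul_smul,
    ← mul_pow]
  simp

/-- The bracket of cycles. -/
def cyclesBracket (D : DGL.{u}) : D.cycles →ₗ[ℚ] D.cycles →ₗ[ℚ] D.cycles :=
  LinearMap.mk₂ ℚ (fun x y => ⟨D.bracket x y, D.bracket_mem_cycles x.2 y.2⟩)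
    (fun _ _ _ => Subtype.ext (by simp)) (fun _ _ _ => Subtype.ext (by simp))
    (fun _ _ _ => Subtype.ext (by simp)) (fun _ _ _ => Subtype.ext (by simp))

/-- The projection of the homology onto its part of degree `n`. -/
noncomputable def homologyProj (D : DGL.{u}) (n : ℕ) :
    (D.cycles ⧸ D.boundaries) →ₗ[ℚ] (D.cycles ⧸ D.boundaries) :=
  D.boundaries.mapQ D.boundaries
    ((D.proj n).restrict fun _ hx => D.proj_mem_cycles n hx) (by
      rintro ⟨x, hx⟩ ⟨w, hw⟩
      exact ⟨D.proj (n + 1) w, by rw [← D.proj_d]; exact congrArg _ hw⟩)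

/-- The homology of a DGL, with the induced bracket. -/
def homology (D : DGL.{u}) : GLie.{u} where
  carrier := D.cycles ⧸ D.boundaries
  gr n := ((D.gr n).comap D.cycles.subtype).map D.boundaries.mkQ
  internal := by
    refine GrLie.isInternal_of_proj _ D.homologyProj ?_ ?_ ?_
    · rw [eq_top_iff]
      rintro q -
      obtain ⟨⟨x, hx⟩, rfl⟩ := D.boundaries.mkQ_surjective q
      let Q : Submodule ℚ (D.cycles ⧸ D.boundaries) :=
        ⨆ n, ((D.gr n).comap D.cycles.subtype).map D.boundaries.mkQ
      have key : ∀ y ∈ D.cycles, ∃ h : y ∈ D.cycles, D.boundaries.mkQ ⟨y, h⟩ ∈ Q := by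
        intro y hy
        refine D.cycles_induct (p := fun y => ∃ h : y ∈ D.cycles, D.boundaries.mkQ ⟨y, h⟩ ∈ Q) hy
          ?_ ⟨zero_mem _, ?_⟩ ?_
        · exact fun n y hy hy' => ⟨hy', Submodule.mem_iSup_of_mem n ⟨⟨y, hy'⟩, hy, rfl⟩⟩
        · exact (map_zero D.boundaries.mkQ).symm ▸ zero_mem Q
        · rintro y z ⟨hy, hy'⟩ ⟨hz, hz'⟩
          exact ⟨add_mem hy hz, (map_add D.boundaries.mkQ ⟨y, hy⟩ ⟨z, hz⟩).symm ▸ add_mem hy' hz'⟩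
      exact (key x hx).2
    · rintro n _ ⟨⟨x, hx⟩, hx', rfl⟩
      exact congrArg D.boundaries.mkQ (Subtype.ext (D.proj_same hx'))
    · rintro n m hnm _ ⟨⟨x, hx⟩, hx', rfl⟩
      have : (D.proj n).restrict (fun _ hx => D.proj_mem_cycles n hx) ⟨x, hx⟩ = 0 :=
        Subtype.ext (D.proj_ne hx' hnm.symm)
      exact (congrArg D.boundaries.mkQ this).trans (map_zero _)
  bracket := D.boundaries.liftQ
    (LinearMap.flip (D.boundaries.liftQ (LinearMap.flip (D.cyclesBracket.compr₂ D.boundaries.mkQ))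
      (by
        rintro ⟨y, hy⟩ ⟨w, rfl⟩
        refine LinearMap.ext fun x => ?_
        exact (Submodule.Quotient.mk_eq_zero _).2 (D.bracket_d_right w x.2))))
    (by
      rintro ⟨x, hx⟩ ⟨w, rfl⟩
      refine LinearMap.ext fun q => ?_
      obtain ⟨y, rfl⟩ := D.boundaries.mkQ_surjective q
      exact (Submodule.Quotient.mk_eq_zero _).2 (D.bracket_d_left w y.2))
  bracket_mem := by
    rintro n m _ _ ⟨x, hx, rfl⟩ ⟨y, hy, rfl⟩
    exact ⟨D.cyclesBracket x y, D.bracket_mem hx hy, rfl⟩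
  skew := by
    rintro n m _ _ ⟨x, hx, rfl⟩ ⟨y, hy, rfl⟩
    exact congrArg D.boundaries.mkQ
      (Subtype.ext (D.skew hx hy) :
        D.cyclesBracket x y = (-1 : ℚ) ^ (n * m + 1) • D.cyclesBracket y x)
  jacobi := by
    rintro n m l _ _ _ ⟨x, hx, rfl⟩ ⟨y, hy, rfl⟩ ⟨z, hz, rfl⟩
    exact congrArg D.boundaries.mkQ
      (Subtype.ext (D.jacobi hx hy hz) :
        (-1 : ℚ) ^ (n * l) • D.cyclesBracket (D.cyclesBracket x y) z +
          (-1 : ℚ) ^ (m * n) • D.cyclesBracket (D.cyclesBracket y z) x +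
          (-1 : ℚ) ^ (l * m) • D.cyclesBracket (D.cyclesBracket z x) y = 0)

/-- The homology class of a cycle. -/
def homologyClass (D : DGL.{u}) (x : D.carrier) (hx : D.d x = 0) : D.homology.carrier :=
  D.boundaries.mkQ ⟨x, hx⟩

/-- The restriction of a morphism to cycles. -/
def cyclesMap {D E : DGL.{u}} (f : D ⟶ E) : D.cycles →ₗ[ℚ] E.cycles :=
  (lin f).restrict fun x hx => by
    rw [LinearMap.mem_ker] at hx ⊢
    exact ((Hom.comm f x).symm.trans (congrArg _ hx)).trans (map_zero _)

/-- The map induced by a morphism in homology. -/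
def homologyMap {D E : DGL.{u}} (f : D ⟶ E) : D.homology ⟶ E.homology where
  toLin := D.boundaries.mapQ E.boundaries (cyclesMap f) (by
    rintro ⟨x, hx⟩ ⟨w, hw⟩
    exact ⟨lin f w, (Hom.comm f w).symm.trans (congrArg _ hw)⟩)
  map_gr := by
    rintro n _ ⟨x, hx, rfl⟩
    exact ⟨cyclesMap f x, GrLie.Hom.map_gr (Hom.toHom f) hx, rfl⟩
  map_bracket := by
    intro q r
    obtain ⟨x, rfl⟩ := D.boundaries.mkQ_surjective q
    obtain ⟨y, rfl⟩ := D.boundaries.mkQ_surjective r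
    exact congrArg E.boundaries.mkQ (Subtype.ext (GrLie.Hom.map_bracket (Hom.toHom f) x y) :
      cyclesMap f (D.cyclesBracket x y) = E.cyclesBracket (cyclesMap f x) (cyclesMap f y))

/-- The homology functor from DGLs to graded Lie algebras. -/
def homologyFunctor : DGL.{u} ⥤ GLie.{u} where
  obj := homology
  map := homologyMap
  map_id D := GrLie.Hom.ext (LinearMap.ext fun q => by
    obtain ⟨x, rfl⟩ := D.boundaries.mkQ_surjective q
    rfl)
  map_comp {D _ _} f g := GrLie.Hom.ext (LinearMap.ext fun q => by
    obtain ⟨x, rfl⟩ := D.boundaries.mkQ_surjective q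
    rfl)

/-- The identification of the homology of `(L, 0)` with `L`. -/
def homologyTrivial (L : GLie.{u}) : (trivial L).homology ⟶ L where
  toLin := (trivial L).boundaries.liftQ (trivial L).cycles.subtype (by
    rintro ⟨x, hx⟩ ⟨w, hw⟩
    exact hw.symm)
  map_gr := by
    rintro n _ ⟨x, hx, rfl⟩
    exact hx
  map_bracket := by
    intro q r
    obtain ⟨x, rfl⟩ := (trivial L).boundaries.mkQ_surjective q
    obtain ⟨y, rfl⟩ := (trivial L).boundaries.mkQ_surjective r
    rfl

theorem homologyTrivial_bijective (L : GLie.{u}) :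
    Function.Bijective (GrLie.lin (homologyTrivial L)) := by
  constructor
  · rw [injective_iff_map_eq_zero]
    intro q hq
    obtain ⟨⟨x, hx⟩, rfl⟩ := (trivial L).boundaries.mkQ_surjective q
    obtain rfl : x = 0 := hq
    exact map_zero (trivial L).boundaries.mkQ
  · exact fun x => ⟨(trivial L).homologyClass x rfl, rfl⟩

/-- Quasi-isomorphisms of DGLs. -/
def QuasiIso {D E : DGL.{u}} (f : D ⟶ E) : Prop :=
  Function.Bijective (GrLie.lin (homologyMap f))

end DGL

/-! ### Bigraded models -/

/-- `φ : A → L` is a bigraded model of the graded Lie algebra `L`: the differential bigraded Lie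
algebra `A` is free, its differential takes decomposable values, and `φ` is a quasi-isomorphism to
`(L, 0)` that respects the bigradings, `L` being concentrated in homological degree `0`. -/
structure IsBigradedModel {L : GLie.{u}} {A : DBGL.{u}} (φ : A.assoc ⟶ DGL.trivial L) : Prop where
  free : ∃ (X : Type u) (deg : X → ℕ × ℕ) (b : X → A.carrier), A.IsFreeOn deg b
  minimal : ∀ x, A.d x ∈ A.decomposables
  bigraded : ∀ {p s x}, x ∈ A.gr (p + 1, s) → DGL.lin φ x = 0
  quasiIso : DGL.QuasiIso φ

/-! ### Simplicial graded Lie algebras -/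

/-- The object of `n`-simplices of a simplicial object. -/
abbrev lev {𝒞 : Type*} [Category 𝒞] (A : SimplicialObject 𝒞) (n : ℕ) : 𝒞 :=
  A.obj (Opposite.op (SimplexCategory.mk n))

namespace SGLie

/-- Elements of a simplicial graded Lie algebra in the image of some degeneracy. -/
def IsDegenerate (A : SimplicialObject GLie.{u}) : (n : ℕ) → (lev A n).carrier → Prop
  | 0, _ => False
  | n + 1, x => ∃ (j : Fin (n + 1)) (y : (lev A n).carrier), GrLie.lin (A.σ j) y = x

/-- The Moore chains: the elements annihilated by the faces `d_i` with `i ≥ 1`. -/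
def mooreChains (A : SimplicialObject GLie.{u}) : (n : ℕ) → Submodule ℚ (lev A n).carrier
  | 0 => ⊤
  | n + 1 => ⨅ i : Fin (n + 1), LinearMap.ker (GrLie.lin (A.δ i.succ))

/-- The Moore cycles of an augmented simplicial graded Lie algebra: the elements annihilated by
all the faces, or, in dimension `0`, by the augmentation. -/
def augCycles (A : SimplicialObject GLie.{u}) {B : GLie.{u}} (ε : lev A 0 ⟶ B) :
    (n : ℕ) → Submodule ℚ (lev A n).carrier
  | 0 => LinearMap.ker (GrLie.lin ε)
  | n + 1 => ⨅ i : Fin (n + 2), LinearMap.ker (GrLie.lin (A.δ i))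

/-- The augmentation `ε` makes `A` a resolution of `B`, i.e. the induced map from `A` to the
constant simplicial object on `B` is a weak equivalence: `π₀ A ≅ B` and `πₙ A = 0` for `n ≥ 1`,
homotopy groups being the homology of the Moore complex. -/
structure IsResolution (A : SimplicialObject GLie.{u}) {B : GLie.{u}} (ε : lev A 0 ⟶ B) :
    Prop where
  aug : A.δ 0 ≫ ε = A.δ 1 ≫ ε
  surjective : Function.Surjective (GrLie.lin ε)
  exact : ∀ n, (mooreChains A (n + 1)).map (GrLie.lin (A.δ 0)) = augCycles A ε n

/-- A CW structure: every `Aₙ` is free on a graded set `Tⁿ`, the degeneracies take `Tⁿ` to `Tⁿ⁺¹`,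
and the faces `d_i`, `i ≥ 1`, vanish on the non-degenerate elements of `Tⁿ`. -/
structure CWStructure (A : SimplicialObject GLie.{u}) where
  T : ℕ → Type u
  deg : ∀ n, T n → ℕ
  gen : ∀ n, T n → (lev A n).carrier
  free : ∀ n, (lev A n).IsFreeOn (deg n) (gen n)
  degen : ∀ n (j : Fin (n + 1)) (t : T n), ∃ t' : T (n + 1),
    GrLie.lin (A.σ j) (gen n t) = gen (n + 1) t'
  attach : ∀ n (t : T (n + 1)), ¬ IsDegenerate A (n + 1) (gen (n + 1) t) →
    ∀ i : Fin (n + 1), GrLie.lin (A.δ i.succ) (gen (n + 1) t) = 0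

/-- The non-degenerate elements of `Tⁿ`. -/
def CWStructure.cells {A : SimplicialObject GLie.{u}} (W : CWStructure A) (n : ℕ) :
    Set (lev A n).carrier :=
  {x | ¬ IsDegenerate A n x ∧ ∃ t, W.gen n t = x}

/-- The CW basis: the subalgebra of `Aₙ` generated by the non-degenerate elements of `Tⁿ`. -/
def CWStructure.basis {A : SimplicialObject GLie.{u}} (W : CWStructure A) (n : ℕ) :
    Submodule ℚ (lev A n).carrier :=
  (lev A n).lieSpan (W.cells n)

/-- Minimality of a CW resolution `A → B`: no proper subalgebra of the CW basis can replace it.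
That is, no proper subalgebra of the CW basis in dimension `0` maps onto `B`; and if a subalgebra
`S` of the CW basis in dimension `n + 1` is such that the Moore chains lying in the subalgebra
generated by `S` and the degenerate elements are mapped by `d₀` onto the Moore `n`-cycles, then `S`
is the whole CW basis. -/
structure CWStructure.IsMinimal {A : SimplicialObject GLie.{u}} (W : CWStructure A) {B : GLie.{u}}
    (ε : lev A 0 ⟶ B) : Prop where
  zero : ∀ S : Submodule ℚ (lev A 0).carrier, (lev A 0).IsGradedSubalgebra S → S ≤ W.basis 0 →
    S.map (GrLie.lin ε) = ⊤ → S = W.basis 0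
  succ : ∀ (n : ℕ) (S : Submodule ℚ (lev A (n + 1)).carrier), (lev A (n + 1)).IsGradedSubalgebra S →
    S ≤ W.basis (n + 1) →
    (mooreChains A (n + 1) ⊓
      (lev A (n + 1)).lieSpan (S ∪ {x | IsDegenerate A (n + 1) x})).map (GrLie.lin (A.δ 0)) =
        augCycles A ε n →
    S = W.basis (n + 1)

/-- Minimal CW resolutions. -/
structure IsMinimalCWResolution {A : SimplicialObject GLie.{u}} (W : CWStructure A) {B : GLie.{u}}
    (ε : lev A 0 ⟶ B) : Prop where
  resolution : IsResolution A ε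
  minimal : W.IsMinimal ε

end SGLie

/-! ### Simplicial DGLs -/

/-- A decomposition of a DGL as a coproduct of spheres and disks.  A sphere of degree `n` is the
free Lie algebra on one cycle of degree `n`; a disk is the free Lie algebra on a generator of
degree `n + 1` and its boundary, of degree `n = dskDeg`.  So `D` is free on the spheres, the disk
generators, and the boundaries of the latter, all of these being distinct generators. -/
structure DGL.FreeDecomposition (D : DGL.{u}) where
  Sph : Type u
  Dsk : Type u
  sphDeg : Sph → ℕ
  dskDeg : Dsk → ℕ
  sph : Sph → D.carrier
  dsk : Dsk → D.carrier
  sph_cycle : ∀ a, D.d (sph a) = 0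
  free : D.IsFreeOn (T := Sph ⊕ Dsk ⊕ Dsk)
    (Sum.elim sphDeg (Sum.elim (fun e => dskDeg e + 1) dskDeg))
    (Sum.elim sph (Sum.elim dsk (fun e => D.d (dsk e))))

namespace SDGL

/-- Elements of a simplicial DGL in the image of some degeneracy. -/
def IsDegenerate (C : SimplicialObject DGL.{u}) : (n : ℕ) → (lev C n).carrier → Prop
  | 0, _ => False
  | n + 1, x => ∃ (j : Fin (n + 1)) (y : (lev C n).carrier), DGL.lin (C.σ j) y = x

/-- An `M`-free structure on a simplicial DGL: in every dimension it is a coproduct of spheres and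
disks, and the degeneracies are inclusions of sub-coproducts, taking spheres to spheres and disks
to disks. -/
structure MFreeStructure (C : SimplicialObject DGL.{u}) where
  dec : ∀ n, (lev C n).FreeDecomposition
  degen_sph : ∀ n (j : Fin (n + 1)) (a : (dec n).Sph), ∃ a' : (dec (n + 1)).Sph,
    DGL.lin (C.σ j) ((dec n).sph a) = (dec (n + 1)).sph a'
  degen_dsk : ∀ n (j : Fin (n + 1)) (e : (dec n).Dsk), ∃ e' : (dec (n + 1)).Dsk,
    DGL.lin (C.σ j) ((dec n).dsk e) = (dec (n + 1)).dsk e'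

/-- The non-degenerate spheres of an `M`-free simplicial DGL, in all simplicial dimensions. -/
def MFreeStructure.NonDegSphere {C : SimplicialObject DGL.{u}} (M : MFreeStructure C) : Type u :=
  Σ n : ℕ, {a : (M.dec n).Sph // ¬ IsDegenerate C n ((M.dec n).sph a)}

/-- The bidegree of a non-degenerate sphere: its simplicial dimension, and its degree. -/
def MFreeStructure.NonDegSphere.bideg {C : SimplicialObject DGL.{u}} {M : MFreeStructure C}
    (a : M.NonDegSphere) : ℕ × ℕ :=
  (a.1, (M.dec a.1).sphDeg a.2.1)

/-- The simplicial graded Lie algebra obtained by applying homology in each dimension. -/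
abbrev homology (C : SimplicialObject DGL.{u}) : SimplicialObject GLie.{u} :=
  C ⋙ DGL.homologyFunctor

/-- The homology class represented by a non-degenerate sphere. -/
def MFreeStructure.NonDegSphere.homologyClass {C : SimplicialObject DGL.{u}}
    {M : MFreeStructure C} (a : M.NonDegSphere) : (lev (homology C) a.1).carrier :=
  (lev C a.1).homologyClass ((M.dec a.1).sph a.2.1) ((M.dec a.1).sph_cycle a.2.1)

/-- The augmentation `ε` makes the simplicial DGL `C` a resolution of the DGL `L`: the map induced
by `ε` to the constant simplicial DGL on `L` is an isomorphism on `π_s H_t` for all `s` and `t`. -/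
structure IsResolution (C : SimplicialObject DGL.{u}) {L : DGL.{u}} (ε : lev C 0 ⟶ L) :
    Prop where
  aug : C.δ 0 ≫ ε = C.δ 1 ≫ ε
  weakEquiv : SGLie.IsResolution (homology C) (DGL.homologyMap ε)

end SDGL

/-! Let `d` be the differential of A on the free Lie algebra on X. A generator x of homological
degree p is to become a p-cell whose only possibly nonzero face is d_0 x, and d_0 x has to encode
dx. In dimension n the generators are pairs (x, I), with I a p-element subset of the n steps of [n],
that is, with a surjection [n] → [p]; the cells are those with I the full set. The internal
differential is zero and there are no disks, so homology merely recovers this simplicial Lie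
algebra.

The simplicial operators come from a generating function. With one odd variable ω_k for each step,
put E(x) = Σ_I ω_I (x, I) and extend E to an algebra map from the tensor algebra on X to forms. A
monotone map α : [m] → [n] substitutes for each variable of [m] the sum of the variables in its
block, and acts by E(a) ↦ α_*(E a) + θ α_*(E(da)), where θ is the sum of the variables of the steps
below α(0). This is exp(θd): the Leibniz rule and θ² = 0 make it multiplicative (`opForm_mul`),
while d² = 0 and the additivity of θ (`pushBlk_theta`) make it functorial (`map_opForm_gen`,
`op_comp`). Lie elements have forms with Lie coefficients (`E_mem_lie`), so the free Lie algebras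
are preserved. When α(0) = 0 the correction disappears, hence only d_0 sees d. The top coefficient
Ψ(a) of E(a) is a Moore chain, and d_0 Ψ(a) = Ψ(da) (`op_face_zero_Psi`).

Thus Ψ compares (A, d) with the Moore complex. Filter by word length. Since d takes decomposable
values, the associated graded object is the case d = 0, where a word of generators is a tensor
product of simplicial spheres, and there the Künneth theorem is made explicit. Call a word sorted if
its letters are consecutive intervals exhausting the steps. Boundaries have zero coefficients on
sorted words (`cf_bd_wd`); a cycle with zero sorted coefficients is a boundary, by an explicit
homotopy (`exists_bd_eq`); and Ψ, a signed sum over shuffles, has a diagonal matrix of sorted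
coefficients with nonzero entries (`cf_Psi_ne_zero`, `cf_Psi_eq_zero`). This is the
Alexander–Whitney and Eilenberg–Zilber pair. Right-normed bracketing `rb` commutes with Ψ and with
the operators for d = 0, and multiplies Lie elements of length l by l, so over ℚ the result descends
to Lie elements (`IsCyc.exists_eq`). The Dold–Kan projector turns primitives for the alternating sum
of faces into Moore chains.

The passage back from the associated graded (`IsTwisted.exists_eq`) stops after finitely many steps:
connectedness of L forces every generator to have positive internal degree (`deg_pos`), so internal
degree bounds word length. Exactness of A then gives the resolution.

Minimality: no generator with full step set occurs linearly in d_0 of a Moore chain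
(`cf_op_face_zero`), because sorted coefficients of boundaries vanish and the correction by d is
decomposable. Hence a subalgebra that suffices contains, for every cell, an element with the same
linear part on the cells, and induction on internal degree (`mem_of_indecomposables`) produces the
cell itself. -/

/-! ### The tensor algebra on a set, with its basis of words -/

/-- The free associative algebra on `Γ`, with the words in `Γ` as a basis. -/
abbrev Tens (Γ : Type*) := MonoidAlgebra ℚ (FreeMonoid Γ)

namespace Tens

variable {Γ Γ' : Type*} {M N : Type*} [AddCommGroup M] [Module ℚ M] [AddCommGroup N] [Module ℚ N]

/-- The basis element given by a word. -/
noncomputable def wd (w : List Γ) : Tens Γ := MonoidAlgebra.single (FreeMonoid.ofList w) 1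

/-- Linear maps out of the tensor algebra are determined by their values on words. -/
noncomputable def lift (f : List Γ → M) : Tens Γ →ₗ[ℚ] M :=
  Finsupp.lift M ℚ (FreeMonoid Γ) (fun w => f (FreeMonoid.toList w)) ∘ₗ
    (MonoidAlgebra.coeffLinearEquiv ℚ).toLinearMap

@[simp] theorem lift_wd (f : List Γ → M) (w : List Γ) : lift f (wd w) = f w := by
  simp [lift, wd]

/-- The coefficient of a word. -/
noncomputable def cf (w : List Γ) : Tens Γ →ₗ[ℚ] ℚ :=
  Finsupp.lapply (FreeMonoid.ofList w) ∘ₗ (MonoidAlgebra.coeffLinearEquiv ℚ).toLinearMap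

theorem cf_wd_self (w : List Γ) : cf w (wd w) = 1 := by
  simp [cf, wd]

theorem cf_wd_ne {w w' : List Γ} (h : w ≠ w') : cf w (wd w') = 0 := by
  have : FreeMonoid.ofList w' ≠ FreeMonoid.ofList w := fun h' =>
    h (FreeMonoid.ofList.injective h').symm
  simp [cf, wd, this]

/-- The words occurring in an element. -/
noncomputable def support (x : Tens Γ) : Finset (List Γ) :=
  (x.coeff.support).map FreeMonoid.toList.toEmbedding

theorem mem_support {x : Tens Γ} {w : List Γ} : w ∈ support x ↔ cf w x ≠ 0 := by
  simp only [support, Finset.mem_map_equiv, Finsupp.mem_support_iff]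
  rfl

theorem sum_support (x : Tens Γ) : ∑ w ∈ support x, cf w x • wd w = x := by
  apply (MonoidAlgebra.coeffLinearEquiv (S := ℚ) ℚ).injective
  conv_rhs => rw [← Finsupp.sum_single ((MonoidAlgebra.coeffLinearEquiv (S := ℚ) ℚ) x)]
  rw [map_sum, support, Finset.sum_map, Finsupp.sum]
  refine Finset.sum_congr rfl fun w _ => ?_
  simp [wd, cf]

theorem span_wd : Submodule.span ℚ (Set.range (wd : List Γ → Tens Γ)) = ⊤ := by
  rw [eq_top_iff]
  intro x _
  rw [← sum_support x]
  exact Submodule.sum_mem _ fun w _ => Submodule.smul_mem _ _ (Submodule.subset_span ⟨w, rfl⟩)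

theorem lin_ext {f g : Tens Γ →ₗ[ℚ] M} (h : ∀ w, f (wd w) = g (wd w)) : f = g :=
  LinearMap.ext_on_range span_wd h

theorem ext_cf {x y : Tens Γ} (h : ∀ w, cf w x = cf w y) : x = y := by
  apply MonoidAlgebra.coeff_injective
  ext w
  exact h (FreeMonoid.toList w)

theorem wd_nil : wd ([] : List Γ) = 1 := rfl

theorem wd_mul (w w' : List Γ) : wd w * wd w' = wd (w ++ w') := by
  simp [wd, MonoidAlgebra.single_mul_single]

theorem wd_cons (g : Γ) (w : List Γ) : wd (g :: w) = wd [g] * wd w := by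
  rw [wd_mul]; rfl

theorem bilin_ext {f g : Tens Γ →ₗ[ℚ] Tens Γ' →ₗ[ℚ] M}
    (h : ∀ w w', f (wd w) (wd w') = g (wd w) (wd w')) : f = g :=
  lin_ext fun w => lin_ext fun w' => h w w'

/-- The subspace spanned by the words satisfying a predicate. -/
noncomputable def sup (P : List Γ → Prop) : Submodule ℚ (Tens Γ) := Submodule.span ℚ (wd '' {w | P w})

theorem wd_mem_sup {P : List Γ → Prop} {w : List Γ} (h : P w) : wd w ∈ sup P :=
  Submodule.subset_span ⟨w, h, rfl⟩

theorem sup_le {P : List Γ → Prop} {B : Submodule ℚ (Tens Γ)} (h : ∀ w, P w → wd w ∈ B) :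
    sup P ≤ B := by
  refine Submodule.span_le.2 ?_
  rintro _ ⟨w, hw, rfl⟩
  exact h w hw

theorem eq_on_sup {P : List Γ → Prop} {f g : Tens Γ →ₗ[ℚ] M}
    (h : ∀ w, P w → f (wd w) = g (wd w)) {x : Tens Γ} (hx : x ∈ sup P) : f x = g x := by
  have : sup P ≤ LinearMap.eqLocus f g := sup_le h
  exact this hx

theorem bilin_eq_on_sup {P : List Γ → Prop} {Q : List Γ' → Prop}
    {f g : Tens Γ →ₗ[ℚ] Tens Γ' →ₗ[ℚ] M}
    (h : ∀ w w', P w → Q w' → f (wd w) (wd w') = g (wd w) (wd w')) {x : Tens Γ} (hx : x ∈ sup P)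
    {y : Tens Γ'} (hy : y ∈ sup Q) : f x y = g x y := by
  refine eq_on_sup (f := f.flip y) (g := g.flip y) (fun w hw => ?_) hx
  exact eq_on_sup (fun w' hw' => h w w' hw hw') hy

theorem map_mem_of_sup {P : List Γ → Prop} {f : Tens Γ →ₗ[ℚ] M} {B : Submodule ℚ M}
    (h : ∀ w, P w → f (wd w) ∈ B) {x : Tens Γ} (hx : x ∈ sup P) : f x ∈ B := by
  have : sup P ≤ B.comap f := sup_le h
  exact this hx

theorem map_mem_of_bilin {P : List Γ → Prop} {Q : List Γ' → Prop}
    {f : Tens Γ →ₗ[ℚ] Tens Γ' →ₗ[ℚ] M} {B : Submodule ℚ M}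
    (h : ∀ w w', P w → Q w' → f (wd w) (wd w') ∈ B) {x : Tens Γ} (hx : x ∈ sup P)
    {y : Tens Γ'} (hy : y ∈ sup Q) : f x y ∈ B := by
  refine map_mem_of_sup (f := f.flip y) (fun w hw => ?_) hx
  exact map_mem_of_sup (fun w' hw' => h w w' hw hw') hy

theorem mul_mem_sup {P Q R : List Γ → Prop} (h : ∀ w w', P w → Q w' → R (w ++ w'))
    {x y : Tens Γ} (hx : x ∈ sup P) (hy : y ∈ sup Q) : x * y ∈ sup R :=
  map_mem_of_bilin (f := LinearMap.mul ℚ (Tens Γ))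
    (fun w w' hw hw' => by
      rw [LinearMap.mul_apply', wd_mul]; exact wd_mem_sup (h w w' hw hw')) hx hy

theorem mem_sup_iff {P : List Γ → Prop} {x : Tens Γ} : x ∈ sup P ↔ ∀ w, cf w x ≠ 0 → P w := by
  constructor
  · intro hx w hw
    by_contra hP
    refine hw (eq_on_sup (g := 0) (fun w' hw' => ?_) hx)
    rw [cf_wd_ne (by rintro rfl; exact hP hw')]; rfl
  · intro h
    rw [← sum_support x]
    exact Submodule.sum_mem _ fun w hw => Submodule.smul_mem _ _ (wd_mem_sup (h w (mem_support.1 hw)))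

theorem sup_mono {P Q : List Γ → Prop} (h : ∀ w, P w → Q w) : sup P ≤ sup Q :=
  sup_le fun w hw => wd_mem_sup (h w hw)

theorem mem_sup_top (x : Tens Γ) : x ∈ sup (fun _ => True) := mem_sup_iff.2 fun _ _ => trivial

open Classical in
/-- The projection onto the span of the words satisfying a predicate. -/
noncomputable def sel (P : List Γ → Prop) : Tens Γ →ₗ[ℚ] Tens Γ :=
  lift fun w => if P w then wd w else 0

theorem sel_wd_pos {P : List Γ → Prop} {w : List Γ} (h : P w) : sel P (wd w) = wd w := by
  simp [sel, h]

theorem sel_wd_neg {P : List Γ → Prop} {w : List Γ} (h : ¬ P w) : sel P (wd w) = 0 := by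
  simp [sel, h]

theorem sel_mem (P : List Γ → Prop) (x : Tens Γ) : sel P x ∈ sup P := by
  refine map_mem_of_sup (fun w _ => ?_) (mem_sup_top x)
  by_cases h : P w
  · rw [sel_wd_pos h]; exact wd_mem_sup h
  · rw [sel_wd_neg h]; exact zero_mem _

theorem sel_of_mem {P : List Γ → Prop} {x : Tens Γ} (h : x ∈ sup P) : sel P x = x :=
  eq_on_sup (g := LinearMap.id) (fun _ hw => sel_wd_pos hw) h

theorem sel_of_mem_disjoint {P Q : List Γ → Prop} (hPQ : ∀ w, Q w → ¬ P w) {x : Tens Γ}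
    (h : x ∈ sup Q) : sel P x = 0 :=
  eq_on_sup (g := 0) (fun w hw => sel_wd_neg (hPQ w hw)) h

/-- Maps preserving a statistic on words commute with the projections. -/
theorem sel_comm {f : Tens Γ →ₗ[ℚ] Tens Γ'} {κ : Type*} {st : List Γ → κ} {st' : List Γ' → κ}
    (h : ∀ w, f (wd w) ∈ sup (fun w' => st' w' = st w)) (k : κ) (x : Tens Γ) :
    sel (fun w => st' w = k) (f x) = f (sel (fun w => st w = k) x) := by
  refine LinearMap.congr_fun (f := sel (fun w => st' w = k) ∘ₗ f)
    (g := f ∘ₗ sel (fun w => st w = k)) (lin_ext fun w => ?_) x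
  simp only [LinearMap.comp_apply]
  by_cases hk : st w = k
  · rw [sel_wd_pos (P := fun w => st w = k) hk]
    exact sel_of_mem (hk ▸ h w)
  · rw [sel_wd_neg (P := fun w => st w = k) hk, map_zero]
    exact sel_of_mem_disjoint (fun w' hw' hk' => hk (hw'.symm.trans hk')) (h w)

theorem sel_mem_sup {P Q : List Γ → Prop} {x : Tens Γ} (hx : x ∈ sup P) : sel Q x ∈ sup P := by
  refine map_mem_of_sup (fun w hw => ?_) hx
  by_cases h : Q w
  · rw [sel_wd_pos h]; exact wd_mem_sup hw
  · rw [sel_wd_neg h]; exact zero_mem _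

theorem cf_sel_pos {P : List Γ → Prop} {w : List Γ} (h : P w) (x : Tens Γ) :
    cf w (sel P x) = cf w x := by
  refine LinearMap.congr_fun (f := cf w ∘ₗ sel P) (lin_ext fun w' => ?_) x
  rw [LinearMap.comp_apply]
  by_cases hw : P w'
  · rw [sel_wd_pos hw]
  · rw [sel_wd_neg hw, map_zero, cf_wd_ne]
    rintro rfl; exact hw h

theorem cf_of_mem {P : List Γ → Prop} {w : List Γ} (h : ¬ P w) {x : Tens Γ} (hx : x ∈ sup P) :
    cf w x = 0 := by
  by_contra h'
  exact h (mem_sup_iff.1 hx w h')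

/-- Decomposition along a statistic. -/
theorem mem_of_sel_mem {κ : Type*} (st : List Γ → κ) (x : Tens Γ) (B : Submodule ℚ (Tens Γ))
    (h : ∀ k, sel (fun w => st w = k) x ∈ B) : x ∈ B := by
  classical
  have hx : x = ∑ k ∈ (support x).image st, sel (fun w => st w = k) x := by
    refine ext_cf fun w => ?_
    rw [map_sum]
    by_cases hw : w ∈ support x
    · rw [Finset.sum_eq_single (st w)]
      · exact (cf_sel_pos (P := fun v => st v = st w) rfl x).symm
      · exact fun k _ hk => cf_of_mem (fun h => hk h.symm) (sel_mem _ x)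
      · exact fun h => absurd (Finset.mem_image_of_mem st hw) h
    · have h0 : cf w x = 0 := by
        by_contra h'
        exact hw (mem_support.2 h')
      rw [h0, Finset.sum_eq_zero]
      intro k _
      by_contra h'
      have : st w = k := mem_sup_iff.1 (sel_mem (fun w => st w = k) x) w h'
      rw [cf_sel_pos (P := fun v => st v = k) this] at h'
      exact h' h0
  rw [hx]
  exact Submodule.sum_mem _ fun k _ => h k

/-- The algebra map given on generators. -/
noncomputable def algLift {A : Type*} [Semiring A] [Algebra ℚ A] (f : Γ → A) : Tens Γ →ₐ[ℚ] A :=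
  MonoidAlgebra.lift ℚ A (FreeMonoid Γ) (FreeMonoid.lift f)

@[simp] theorem algLift_gen {A : Type*} [Semiring A] [Algebra ℚ A] (f : Γ → A) (g : Γ) :
    algLift f (wd [g]) = f g := by
  simp [algLift, wd]

theorem algHom_ext {A : Type*} [Ring A] [Algebra ℚ A] {f g : Tens Γ →ₐ[ℚ] A}
    (h : ∀ t, f (wd [t]) = g (wd [t])) : f = g := by
  refine AlgHom.ext fun x => LinearMap.congr_fun (f := f.toLinearMap) (g := g.toLinearMap)
    (lin_ext fun w => ?_) x
  change f (wd w) = g (wd w)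
  induction w with
  | nil => rw [wd_nil, map_one, map_one]
  | cons t w ih => rw [wd_cons, map_mul, map_mul, ih, h]

end Tens

/-! ### Free graded Lie algebras inside tensor algebras -/

section GradedTensor

variable {Γ : Type u} {ι : Type} [AddCommMonoid ι]

/-- The degree of a word. -/
def wdeg (deg : Γ → ι) (w : List Γ) : ι := (w.map deg).sum

@[simp] theorem wdeg_nil (deg : Γ → ι) : wdeg deg [] = 0 := rfl

@[simp] theorem wdeg_cons (deg : Γ → ι) (g : Γ) (w : List Γ) :
    wdeg deg (g :: w) = deg g + wdeg deg w := by simp [wdeg]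

@[simp] theorem wdeg_append (deg : Γ → ι) (w w' : List Γ) :
    wdeg deg (w ++ w') = wdeg deg w + wdeg deg w' := by simp [wdeg]

theorem wdeg_comp {κ : Type} [AddCommMonoid κ] (tot : ι →+ κ) (deg : Γ → ι) (w : List Γ) :
    wdeg (fun g => tot (deg g)) w = tot (wdeg deg w) := by
  induction w with
  | nil => simp
  | cons g w ih => simp [ih]

open Tens

/-- The homogeneous part of the tensor algebra of a given degree. -/
noncomputable abbrev tgr (deg : Γ → ι) (i : ι) : Submodule ℚ (Tens Γ) := sup fun w => wdeg deg w = i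

/-- The part of the tensor algebra of a given word length. -/
noncomputable abbrev tlen (n : ℕ) : Submodule ℚ (Tens Γ) := sup fun w : List Γ => w.length = n

/-- The graded commutator. -/
noncomputable def lbr (e : Γ → ℕ) : Tens Γ →ₗ[ℚ] Tens Γ →ₗ[ℚ] Tens Γ :=
  lift fun w => lift fun w' => wd (w ++ w') - (-1 : ℚ) ^ (wdeg e w * wdeg e w') • wd (w' ++ w)

theorem lbr_wd (e : Γ → ℕ) (w w' : List Γ) : lbr e (wd w) (wd w') =
    wd (w ++ w') - (-1 : ℚ) ^ (wdeg e w * wdeg e w') • wd (w' ++ w) := by simp [lbr]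

theorem lbr_of_mem {e : Γ → ℕ} {i j : ℕ} {x y : Tens Γ} (hx : x ∈ tgr e i) (hy : y ∈ tgr e j) :
    lbr e x y = x * y - (-1 : ℚ) ^ (i * j) • (y * x) := by
  refine bilin_eq_on_sup (g := LinearMap.mul ℚ (Tens Γ) -
    (-1 : ℚ) ^ (i * j) • (LinearMap.mul ℚ (Tens Γ)).flip) (fun w w' hw hw' => ?_) hx hy
  subst hw hw'
  simp [lbr_wd, wd_mul]

theorem tgr_tot (tot : ι →+ ℕ) {deg : Γ → ι} {i : ι} {x : Tens Γ} (hx : x ∈ tgr deg i) :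
    x ∈ tgr (fun g => tot (deg g)) (tot i) :=
  sup_mono (fun w hw => by rw [wdeg_comp, hw]) hx

variable {tot : ι →+ ℕ} {deg : Γ → ι}

theorem lbr_homog {i j : ι} {x y : Tens Γ} (hx : x ∈ tgr deg i) (hy : y ∈ tgr deg j) :
    lbr (fun g => tot (deg g)) x y = x * y - (-1 : ℚ) ^ (tot i * tot j) • (y * x) :=
  lbr_of_mem (tgr_tot tot hx) (tgr_tot tot hy)

theorem mul_mem_tgr {i j : ι} {x y : Tens Γ} (hx : x ∈ tgr deg i) (hy : y ∈ tgr deg j) :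
    x * y ∈ tgr deg (i + j) :=
  mul_mem_sup (fun w w' hw hw' => by rw [wdeg_append, hw, hw']) hx hy

theorem mul_mem_tlen {n m : ℕ} {x y : Tens Γ} (hx : x ∈ tlen n) (hy : y ∈ tlen m) :
    x * y ∈ tlen (n + m) :=
  mul_mem_sup (fun w w' hw hw' => by rw [List.length_append, hw, hw']) hx hy

theorem lbr_mem_tgr {i j : ι} {x y : Tens Γ} (hx : x ∈ tgr deg i) (hy : y ∈ tgr deg j) :
    lbr (fun g => tot (deg g)) x y ∈ tgr deg (i + j) := by
  rw [lbr_homog hx hy]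
  exact sub_mem (mul_mem_tgr hx hy)
    (Submodule.smul_mem _ _ (by rw [add_comm]; exact mul_mem_tgr hy hx))

theorem lbr_mem_tlen {e : Γ → ℕ} {n m : ℕ} {x y : Tens Γ} (hx : x ∈ tlen n) (hy : y ∈ tlen m) :
    lbr e x y ∈ tlen (n + m) := by
  refine map_mem_of_bilin (fun w w' hw hw' => ?_) hx hy
  rw [lbr_wd]
  refine sub_mem (wd_mem_sup ?_) (Submodule.smul_mem _ _ (wd_mem_sup ?_))
  · rw [List.length_append, hw, hw']
  · rw [List.length_append, hw, hw', add_comm]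

theorem lbr_skew {i j : ι} {x y : Tens Γ} (hx : x ∈ tgr deg i) (hy : y ∈ tgr deg j) :
    lbr (fun g => tot (deg g)) x y =
      (-1 : ℚ) ^ (tot i * tot j + 1) • lbr (fun g => tot (deg g)) y x := by
  rw [lbr_homog hx hy, lbr_homog hy hx, pow_succ, mul_comm (tot j)]
  rcases neg_one_pow_eq_or ℚ (tot i * tot j) with h | h <;> rw [h] <;> simp [add_comm]

theorem lbr_jacobi {i j k : ι} {x y z : Tens Γ} (hx : x ∈ tgr deg i) (hy : y ∈ tgr deg j)
    (hz : z ∈ tgr deg k) :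
    (-1 : ℚ) ^ (tot i * tot k) •
        lbr (fun g => tot (deg g)) (lbr (fun g => tot (deg g)) x y) z +
      (-1 : ℚ) ^ (tot j * tot i) •
        lbr (fun g => tot (deg g)) (lbr (fun g => tot (deg g)) y z) x +
      (-1 : ℚ) ^ (tot k * tot j) •
        lbr (fun g => tot (deg g)) (lbr (fun g => tot (deg g)) z x) y = 0 := by
  rw [lbr_homog (lbr_mem_tgr hx hy) hz, lbr_homog (lbr_mem_tgr hy hz) hx,
    lbr_homog (lbr_mem_tgr hz hx) hy, lbr_homog hx hy, lbr_homog hy hz, lbr_homog hz hx]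
  simp only [map_add, add_mul, pow_add]
  rw [mul_comm (tot j) (tot i), mul_comm (tot k) (tot j), mul_comm (tot k) (tot i)]
  rcases neg_one_pow_eq_or ℚ (tot i * tot j) with h1 | h1 <;>
  rcases neg_one_pow_eq_or ℚ (tot j * tot k) with h2 | h2 <;>
  rcases neg_one_pow_eq_or ℚ (tot i * tot k) with h3 | h3 <;>
  rw [h1, h2, h3] <;> simp only [one_smul, neg_smul, mul_one, mul_neg, neg_neg] <;>
  noncomm_ring

/-- Iterated brackets of generators, with their degree and length. -/
inductive LieMon (tot : ι →+ ℕ) (deg : Γ → ι) : ι → ℕ → Tens Γ → Prop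
  | gen (g : Γ) : LieMon tot deg (deg g) 1 (wd [g])
  | bracket {i j : ι} {n m : ℕ} {x y : Tens Γ} : LieMon tot deg i n x → LieMon tot deg j m y →
      LieMon tot deg (i + j) (n + m) (lbr (fun g => tot (deg g)) x y)

theorem LieMon.mem_tgr {i : ι} {n : ℕ} {x : Tens Γ} (h : LieMon tot deg i n x) : x ∈ tgr deg i := by
  induction h with
  | gen g => exact wd_mem_sup (by simp)
  | bracket _ _ hx hy => exact lbr_mem_tgr hx hy

theorem LieMon.mem_tlen {i : ι} {n : ℕ} {x : Tens Γ} (h : LieMon tot deg i n x) : x ∈ tlen n := by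
  induction h with
  | gen g => exact wd_mem_sup rfl
  | bracket _ _ hx hy => exact lbr_mem_tlen hx hy

theorem LieMon.pos {i : ι} {n : ℕ} {x : Tens Γ} (h : LieMon tot deg i n x) : 0 < n := by
  induction h with
  | gen g => exact one_pos
  | bracket _ _ hx hy => omega

/-- The Lie subalgebra of the tensor algebra generated by the generators. -/
noncomputable def lieSub (tot : ι →+ ℕ) (deg : Γ → ι) : Submodule ℚ (Tens Γ) :=
  Submodule.span ℚ {x | ∃ i n, LieMon tot deg i n x}

theorem LieMon.mem_lieSub {i : ι} {n : ℕ} {x : Tens Γ} (h : LieMon tot deg i n x) :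
    x ∈ lieSub tot deg := Submodule.subset_span ⟨i, n, h⟩

theorem gen_mem_lieSub (tot : ι →+ ℕ) (deg : Γ → ι) (g : Γ) : wd [g] ∈ lieSub tot deg :=
  (LieMon.gen g).mem_lieSub

theorem lbr_mem_lieSub {x y : Tens Γ} (hx : x ∈ lieSub tot deg) (hy : y ∈ lieSub tot deg) :
    lbr (fun g => tot (deg g)) x y ∈ lieSub tot deg := by
  refine LinearMap.BilinMap.apply_apply_mem_of_mem_span _ _ _ _ ?_ x y hx hy
  rintro x ⟨i, n, hx⟩ y ⟨j, m, hy⟩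
  exact (hx.bracket hy).mem_lieSub

/-- Linear maps agreeing on iterated brackets agree on the Lie subalgebra. -/
theorem eqOn_lieSub {M : Type*} [AddCommGroup M] [Module ℚ M] {f g : Tens Γ →ₗ[ℚ] M}
    (h : ∀ i n x, LieMon tot deg i n x → f x = g x) {x : Tens Γ} (hx : x ∈ lieSub tot deg) :
    f x = g x := by
  have : lieSub tot deg ≤ LinearMap.eqLocus f g := Submodule.span_le.2 (by
    rintro x ⟨i, n, hx⟩; exact h i n x hx)
  exact this hx

theorem mapsTo_lieSub {M : Type*} [AddCommGroup M] [Module ℚ M] {f : Tens Γ →ₗ[ℚ] M}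
    {B : Submodule ℚ M} (h : ∀ i n x, LieMon tot deg i n x → f x ∈ B) {x : Tens Γ}
    (hx : x ∈ lieSub tot deg) : f x ∈ B := by
  have : lieSub tot deg ≤ B.comap f := Submodule.span_le.2 (by
    rintro x ⟨i, n, hx⟩; exact h i n x hx)
  exact this hx

/-- An iterated bracket is homogeneous for the statistic, so a projection either fixes it or kills
it. Degree and word length are the two statistics used. -/
theorem sel_mem_lieSub {κ : Type*} {st : List Γ → κ}
    (h : ∀ i n x, LieMon tot deg i n x → ∃ k, x ∈ sup (fun w => st w = k)) (k : κ) {x : Tens Γ}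
    (hx : x ∈ lieSub tot deg) : sel (fun w => st w = k) x ∈ lieSub tot deg := by
  refine mapsTo_lieSub (fun i n x hx => ?_) hx
  obtain ⟨k', hk'⟩ := h i n x hx
  by_cases hk : k' = k
  · subst hk
    rw [sel_of_mem hk']; exact hx.mem_lieSub
  · rw [sel_of_mem_disjoint (fun w hw hw' => hk (hw.symm.trans hw')) hk']
    exact zero_mem _

theorem sel_deg_mem_lieSub (i : ι) {x : Tens Γ} (hx : x ∈ lieSub tot deg) :
    sel (fun w => wdeg deg w = i) x ∈ lieSub tot deg :=
  sel_mem_lieSub (fun i _ _ h => ⟨i, h.mem_tgr⟩) i hx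

theorem sel_len_mem_lieSub (n : ℕ) {x : Tens Γ} (hx : x ∈ lieSub tot deg) :
    sel (fun w => w.length = n) x ∈ lieSub tot deg :=
  sel_mem_lieSub (st := List.length) (fun _ n _ h => ⟨n, h.mem_tlen⟩) n hx

/-- The bracket of the Lie subalgebra. -/
noncomputable def lieSubBracket (tot : ι →+ ℕ) (deg : Γ → ι) :
    lieSub tot deg →ₗ[ℚ] lieSub tot deg →ₗ[ℚ] lieSub tot deg :=
  LinearMap.mk₂ ℚ (fun x y => ⟨lbr (fun g => tot (deg g)) x.1 y.1, lbr_mem_lieSub x.2 y.2⟩)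
    (fun x x' y => Subtype.ext (LinearMap.map_add₂ _ x.1 x'.1 y.1))
    (fun c x y => Subtype.ext (LinearMap.map_smul₂ _ c x.1 y.1))
    (fun x _ _ => Subtype.ext (map_add (lbr (fun g => tot (deg g)) x.1) _ _))
    (fun c x _ => Subtype.ext (map_smul (lbr (fun g => tot (deg g)) x.1) c _))

theorem lieSub_iSup : ⨆ i, (tgr deg i).comap (lieSub tot deg).subtype = ⊤ := by
  rw [eq_top_iff]
  rintro ⟨x, hx⟩ -
  have : lieSub tot deg ≤ (⨆ i, (tgr deg i).comap (lieSub tot deg).subtype).map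
      (lieSub tot deg).subtype := Submodule.span_le.2 (by
    rintro x ⟨i, n, hx⟩
    exact ⟨⟨x, hx.mem_lieSub⟩, Submodule.mem_iSup_of_mem i hx.mem_tgr, rfl⟩)
  obtain ⟨y, hy, rfl⟩ := this hx
  exact hy

variable [DecidableEq ι]

theorem lieSub_internal :
    DirectSum.IsInternal fun i => (tgr deg i).comap (lieSub tot deg).subtype := by
  refine GrLie.isInternal_of_proj _ (fun i => (sel fun w => wdeg deg w = i).restrict
    (p := lieSub tot deg) fun _ hx => sel_deg_mem_lieSub i hx) lieSub_iSup ?_ ?_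
  · exact fun i x hx => Subtype.ext
      (sel_of_mem (P := fun w => wdeg deg w = i) (x := x.1) (Submodule.mem_comap.1 hx))
  · exact fun i j hij x hx => Subtype.ext
      (sel_of_mem_disjoint (P := fun w => wdeg deg w = i) (Q := fun w => wdeg deg w = j) (x := x.1)
        (fun w hw hw' => hij (hw'.symm.trans hw)) (Submodule.mem_comap.1 hx))

/-- The free graded Lie algebra on a graded set. -/
noncomputable def freeLie (tot : ι →+ ℕ) (deg : Γ → ι) : GrLie.{u} ι tot where
  carrier := lieSub tot deg
  gr i := (tgr deg i).comap (lieSub tot deg).subtype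
  internal := lieSub_internal
  bracket := lieSubBracket tot deg
  bracket_mem {_ _ x y} hx hy := lbr_mem_tgr (x := x.1) (y := y.1) hx hy
  skew {_ _ x y} hx hy := Subtype.ext (lbr_skew (x := x.1) (y := y.1) hx hy)
  jacobi {_ _ _ x y z} hx hy hz :=
    Subtype.ext (lbr_jacobi (x := x.1) (y := y.1) (z := z.1) hx hy hz)

/-- The generators of the free graded Lie algebra. -/
noncomputable def freeLieGen (tot : ι →+ ℕ) (deg : Γ → ι) (g : Γ) : (freeLie tot deg).carrier :=
  (⟨wd [g], gen_mem_lieSub tot deg g⟩ : lieSub tot deg)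

/-- The inclusion of the free Lie algebra in the tensor algebra. -/
noncomputable def freeLieIncl (tot : ι →+ ℕ) (deg : Γ → ι) :
    (freeLie tot deg).carrier →ₗ[ℚ] Tens Γ := (lieSub tot deg).subtype

end GradedTensor

/-- The Jacobi identity in derivation form. -/
theorem GrLie.jacobi_ad {ι : Type} [AddCommMonoid ι] [DecidableEq ι] {tot : ι →+ ℕ}
    (H : GrLie.{u} ι tot) {i j : ι} {x y : H.carrier} (hx : x ∈ H.gr i) (hy : y ∈ H.gr j)
    (z : H.carrier) : H.bracket (H.bracket x y) z =
      H.bracket x (H.bracket y z) - (-1 : ℚ) ^ (tot i * tot j) • H.bracket y (H.bracket x z) := by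
  refine H.induct (p := fun z => H.bracket (H.bracket x y) z =
      H.bracket x (H.bracket y z) - (-1 : ℚ) ^ (tot i * tot j) • H.bracket y (H.bracket x z)) z
    ?_ (by simp) (fun a b ha hb => by
      simp only [map_add, smul_add, ha, hb]; abel)
  intro k z hz
  have h := H.jacobi hx hy hz
  rw [H.skew (H.bracket_mem hy hz) hx, H.skew (H.bracket_mem hz hx) hy, H.skew hz hx] at h
  simp only [map_smul, map_add, add_mul, pow_add, pow_one, smul_smul] at h
  rw [mul_comm (tot j) (tot i), mul_comm (tot k) (tot j), mul_comm (tot k) (tot i)] at h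
  rcases neg_one_pow_eq_or ℚ (tot i * tot j) with h1 | h1 <;>
  rcases neg_one_pow_eq_or ℚ (tot j * tot k) with h2 | h2 <;>
  rcases neg_one_pow_eq_or ℚ (tot i * tot k) with h3 | h3 <;>
  rw [h1, h2, h3] at h <;> rw [h1] <;>
  simp only [one_smul, neg_smul, mul_one, mul_neg, neg_neg] at h ⊢ <;>
  rw [← sub_eq_zero] <;> first
    | (refine Eq.trans ?_ h; abel1)
    | (refine Eq.trans ?_ (neg_eq_zero.2 h); abel1)

/-! ### The Dynkin map and the universal property of the free Lie algebra. -/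

section Dynkin

variable {Γ : Type u} {ι : Type} [AddCommMonoid ι] [DecidableEq ι] {tot : ι →+ ℕ}
  (H : GrLie.{u} ι tot) (f : Γ → H.carrier)

open Tens

/-- The right-normed bracket of a word. -/
def rnorm : List Γ → H.carrier
  | [] => 0
  | [g] => f g
  | g :: g' :: w => H.bracket (f g) (rnorm (g' :: w))

theorem rnorm_cons (g : Γ) {w : List Γ} (hw : w ≠ []) :
    rnorm H f (g :: w) = H.bracket (f g) (rnorm H f w) := by
  cases w with
  | nil => exact absurd rfl hw
  | cons g' w => rfl

/-- The Dynkin map, with the right-normed bracket of a word divided by its length. -/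
noncomputable def dynkin : Tens Γ →ₗ[ℚ] H.carrier :=
  lift fun w => (w.length : ℚ)⁻¹ • rnorm H f w

/-- The action of the tensor algebra by iterated adjoint operators. -/
noncomputable def adAct : Tens Γ →ₐ[ℚ] Module.End ℚ H.carrier := algLift fun g => H.bracket (f g)

theorem rnorm_append (w : List Γ) {w' : List Γ} (hw' : w' ≠ []) :
    rnorm H f (w ++ w') = adAct H f (wd w) (rnorm H f w') := by
  induction w with
  | nil => rw [wd_nil, map_one]; rfl
  | cons g w ih =>
    rw [List.cons_append, rnorm_cons H f g (by simp [hw']), ih, wd_cons, map_mul,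
      Module.End.mul_apply, adAct, algLift_gen]

theorem lift_rnorm_mul {n : ℕ} (hn : 0 < n) (x : Tens Γ) {y : Tens Γ} (hy : y ∈ tlen n) :
    lift (rnorm H f) (x * y) = adAct H f x (lift (rnorm H f) y) := by
  refine bilin_eq_on_sup (P := fun _ => True)
    (f := (LinearMap.mul ℚ (Tens Γ)).compr₂ (lift (rnorm H f)))
    (g := (adAct H f).toLinearMap.compl₂ (lift (rnorm H f)))
    (fun w w' _ hw' => ?_) (mem_sup_top x) hy
  have : w' ≠ [] := by rintro rfl; simp at hw'; omega
  simp [wd_mul, rnorm_append H f w this]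

theorem lift_rnorm_eq {n : ℕ} {y : Tens Γ} (hy : y ∈ tlen n) :
    lift (rnorm H f) y = (n : ℚ) • dynkin H f y := by
  refine eq_on_sup (g := (n : ℚ) • dynkin H f) (fun w hw => ?_) hy
  subst hw
  cases w with
  | nil => simp [rnorm]
  | cons g w =>
    rw [LinearMap.smul_apply, dynkin, lift_wd, lift_wd, smul_smul, mul_inv_cancel₀, one_smul]
    simp; positivity

theorem dynkin_of_mem {n : ℕ} {y : Tens Γ} (hy : y ∈ tlen n) :
    dynkin H f y = (n : ℚ)⁻¹ • lift (rnorm H f) y := by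
  refine eq_on_sup (g := (n : ℚ)⁻¹ • lift (rnorm H f)) (fun w hw => ?_) hy
  subst hw
  simp [dynkin]

variable {H f} {deg : Γ → ι} (hf : ∀ g, f g ∈ H.gr (deg g))
include hf

theorem rnorm_mem (w : List Γ) : rnorm H f w ∈ H.gr (wdeg deg w) := by
  induction w with
  | nil => exact zero_mem _
  | cons g w ih =>
    by_cases hw : w = []
    · subst hw; simpa [rnorm] using hf g
    · rw [rnorm_cons H f g hw, wdeg_cons]
      exact H.bracket_mem (hf g) ih

theorem dynkin_mem {i : ι} {x : Tens Γ} (hx : x ∈ tgr deg i) : dynkin H f x ∈ H.gr i := by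
  refine map_mem_of_sup (fun w hw => ?_) hx
  rw [dynkin, lift_wd, ← hw]
  exact Submodule.smul_mem _ _ (rnorm_mem hf w)

/-- Write D for the Dynkin map. Before normalisation the right-normed bracket of xy is ad(Dx)
applied to that of y, which is m[Dx, Dy], and that of yx is n[Dy, Dx]; the graded commutator
therefore gives (n + m)[Dx, Dy], and dividing by the length removes the factor. The two facts about
`adAct` are hypotheses because `adAct_eq` is proved by an induction that uses this lemma. -/
theorem dynkin_lbr {i j : ι} {n m : ℕ} {x y : Tens Γ} (hx : LieMon tot deg i n x)
    (hy : LieMon tot deg j m y) (hx' : adAct H f x = H.bracket (dynkin H f x))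
    (hy' : adAct H f y = H.bracket (dynkin H f y)) :
    dynkin H f (lbr (fun g => tot (deg g)) x y) = H.bracket (dynkin H f x) (dynkin H f y) := by
  have hnm : ((n + m : ℕ) : ℚ) ≠ 0 := by have := hx.pos; positivity
  rw [dynkin_of_mem H f (lbr_mem_tlen hx.mem_tlen hy.mem_tlen), lbr_homog hx.mem_tgr hy.mem_tgr,
    map_sub, map_smul, lift_rnorm_mul H f hy.pos x hy.mem_tlen,
    lift_rnorm_mul H f hx.pos y hx.mem_tlen, lift_rnorm_eq H f hx.mem_tlen,
    lift_rnorm_eq H f hy.mem_tlen, hx', hy', map_smul, map_smul,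
    H.skew (dynkin_mem hf hy.mem_tgr) (dynkin_mem hf hx.mem_tgr), pow_succ, mul_comm (tot j)]
  rw [inv_smul_eq_iff₀ hnm, smul_smul, smul_smul]
  rcases neg_one_pow_eq_or ℚ (tot i * tot j) with h | h <;> rw [h] <;> push_cast <;>
    simp only [mul_neg, mul_one, neg_smul, sub_neg_eq_add, add_smul, neg_neg, neg_mul, one_mul] <;>
    abel

/-- By the Jacobi identity the adjoint operator of a bracket is the graded commutator of the adjoint
operators, just as `adAct` is on commutators of the tensor algebra. -/
theorem adAct_eq {i : ι} {n : ℕ} {x : Tens Γ} (hx : LieMon tot deg i n x) :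
    adAct H f x = H.bracket (dynkin H f x) := by
  induction hx with
  | gen g => simp [adAct, dynkin, rnorm]
  | @bracket i j n m x y hx hy hx' hy' =>
    rw [dynkin_lbr hf hx hy hx' hy', lbr_homog hx.mem_tgr hy.mem_tgr, map_sub, map_smul, map_mul,
      map_mul, hx', hy']
    refine LinearMap.ext fun z => ?_
    rw [H.jacobi_ad (dynkin_mem hf hx.mem_tgr) (dynkin_mem hf hy.mem_tgr)]
    rfl

theorem dynkin_bracket {x y : Tens Γ} (hx : x ∈ lieSub tot deg) (hy : y ∈ lieSub tot deg) :
    dynkin H f (lbr (fun g => tot (deg g)) x y) = H.bracket (dynkin H f x) (dynkin H f y) := by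
  refine eqOn_lieSub (f := dynkin H f ∘ₗ (lbr fun g => tot (deg g)).flip y)
    (g := H.bracket.flip (dynkin H f y) ∘ₗ dynkin H f) (fun i n x hx => ?_) hx
  refine eqOn_lieSub (f := dynkin H f ∘ₗ (lbr fun g => tot (deg g)) x)
    (g := H.bracket (dynkin H f x) ∘ₗ dynkin H f) (fun j m y hy => ?_) hy
  exact dynkin_lbr hf hx hy (adAct_eq hf hx) (adAct_eq hf hy)

/-- The morphism out of the free Lie algebra given on generators. -/
noncomputable def freeLieLift : freeLie tot deg ⟶ H where
  toLin := dynkin H f ∘ₗ freeLieIncl tot deg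
  map_gr hx := dynkin_mem hf hx
  map_bracket x y := dynkin_bracket hf x.2 y.2

theorem freeLieLift_gen (g : Γ) :
    GrLie.lin (freeLieLift (tot := tot) hf) (freeLieGen tot deg g) = f g := by
  change dynkin H f (wd [g]) = f g
  simp [dynkin, rnorm]

end Dynkin

section Free

variable {Γ : Type u} {ι : Type} [AddCommMonoid ι] [DecidableEq ι] {tot : ι →+ ℕ} {deg : Γ → ι}

open Tens

theorem freeLie_hom_ext {H : GrLie.{u} ι tot} {φ ψ : freeLie tot deg ⟶ H}
    (h : ∀ g, GrLie.lin φ (freeLieGen tot deg g) = GrLie.lin ψ (freeLieGen tot deg g)) : φ = ψ := by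
  have key : ∀ i n x, LieMon tot deg i n x → ∀ hx : x ∈ lieSub tot deg,
      GrLie.lin φ ⟨x, hx⟩ = GrLie.lin ψ ⟨x, hx⟩ := by
    intro i n x hx
    induction hx with
    | gen g => exact fun _ => h g
    | bracket hx hy ihx ihy =>
      intro _
      have h1 := φ.map_bracket ⟨_, hx.mem_lieSub⟩ ⟨_, hy.mem_lieSub⟩
      have h2 := ψ.map_bracket ⟨_, hx.mem_lieSub⟩ ⟨_, hy.mem_lieSub⟩
      exact h1.trans ((congrArg₂ (fun a b => H.bracket a b) (ihx _) (ihy _)).trans h2.symm)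
  refine GrLie.Hom.ext (LinearMap.ext ?_)
  rintro ⟨x, hx⟩
  have : lieSub tot deg ≤ (LinearMap.eqLocus (GrLie.lin φ) (GrLie.lin ψ)).map
      (lieSub tot deg).subtype := Submodule.span_le.2 (by
    rintro x ⟨i, n, hx⟩
    exact ⟨⟨x, hx.mem_lieSub⟩, key i n x hx _, rfl⟩)
  obtain ⟨y, hy, rfl⟩ := this hx
  exact hy

theorem freeLie_isFreeOn (tot : ι →+ ℕ) (deg : Γ → ι) :
    (freeLie tot deg).IsFreeOn deg (freeLieGen tot deg) := by
  refine ⟨fun g => (LieMon.gen (tot := tot) g).mem_tgr, fun H f hf => ?_⟩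
  refine ⟨freeLieLift hf, freeLieLift_gen hf, fun ψ hψ => freeLie_hom_ext fun g => ?_⟩
  rw [hψ, freeLieLift_gen]

/-- The Dynkin map of the free Lie algebra is a retraction of its tensor algebra. -/
theorem dynkin_self {x : Tens Γ} (hx : x ∈ lieSub tot deg) :
    freeLieIncl tot deg (dynkin (freeLie tot deg) (freeLieGen tot deg) x) = x := by
  have hf : ∀ g, freeLieGen tot deg g ∈ (freeLie tot deg).gr (deg g) :=
    (freeLie_isFreeOn tot deg).1
  have : freeLieLift hf = 𝟙 (freeLie tot deg) := freeLie_hom_ext fun g => freeLieLift_gen hf g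
  have := congrArg (fun φ => GrLie.lin φ (⟨x, hx⟩ : lieSub tot deg)) this
  exact congrArg (freeLieIncl tot deg) this

end Free

/-! ### Exterior forms with coefficients in a superalgebra -/

section Shuffle

variable {n m l : ℕ}

/-- The sign of moving the elements of `I` past the smaller elements of `J`. -/
def shSign (I J : Finset (Fin n)) : ℚ := ∏ i ∈ I, ∏ j ∈ J, if j < i then -1 else 1

@[simp] theorem shSign_empty_left (J : Finset (Fin n)) : shSign ∅ J = 1 := by simp [shSign]

@[simp] theorem shSign_empty_right (I : Finset (Fin n)) : shSign I ∅ = 1 := by simp [shSign]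

theorem shSign_union_left {I J : Finset (Fin n)} (h : Disjoint I J) (K : Finset (Fin n)) :
    shSign (I ∪ J) K = shSign I K * shSign J K := by
  simp only [shSign, Finset.prod_union h]

theorem shSign_union_right {J K : Finset (Fin n)} (I : Finset (Fin n)) (h : Disjoint J K) :
    shSign I (J ∪ K) = shSign I J * shSign I K := by
  simp only [shSign, Finset.prod_union h, Finset.prod_mul_distrib]

/-- By disjointness each pair (i, j) is an inversion for exactly one of the two orders of the
factors. -/
theorem shSign_comm {I J : Finset (Fin n)} (h : Disjoint I J) :
    shSign J I = (-1) ^ (I.card * J.card) * shSign I J := by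
  rw [shSign, Finset.prod_comm, shSign, mul_comm I.card, pow_mul, ← Finset.prod_const,
    ← Finset.prod_mul_distrib]
  refine Finset.prod_congr rfl fun i hi => ?_
  rw [← Finset.prod_const, ← Finset.prod_mul_distrib]
  refine Finset.prod_congr rfl fun j hj => ?_
  have : i ≠ j := by rintro rfl; exact Finset.disjoint_left.1 h hi hj
  rcases lt_or_gt_of_ne this with h | h
  · simp [h, h.le]
  · simp [h, h.le]

theorem shSign_mul_self (I J : Finset (Fin n)) : shSign I J * shSign I J = 1 := by
  rw [shSign, ← Finset.prod_mul_distrib]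
  refine Finset.prod_eq_one fun i _ => ?_
  rw [← Finset.prod_mul_distrib]
  refine Finset.prod_eq_one fun j _ => ?_
  split_ifs <;> norm_num

/-- Both sides run over the ordered partitions of K into three parts; this is the reindexing behind
associativity of the exterior product. -/
theorem sum_powerset_assoc {M : Type*} [AddCommMonoid M] (K : Finset (Fin n))
    (f : Finset (Fin n) → Finset (Fin n) → Finset (Fin n) → M) :
    ∑ A ∈ K.powerset, ∑ I ∈ A.powerset, f I (A \ I) (K \ A) =
      ∑ I ∈ K.powerset, ∑ J ∈ (K \ I).powerset, f I J ((K \ I) \ J) := by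
  rw [Finset.sum_sigma', Finset.sum_sigma']
  refine Finset.sum_nbij' (fun x => ⟨x.2, x.1 \ x.2⟩) (fun x => ⟨x.1 ∪ x.2, x.1⟩) ?_ ?_ ?_ ?_ ?_
  · rintro ⟨A, I⟩ h
    simp only [Finset.mem_sigma, Finset.mem_powerset] at h ⊢
    exact ⟨h.2.trans h.1, Finset.sdiff_subset_sdiff h.1 le_rfl⟩
  · rintro ⟨I, J⟩ h
    simp only [Finset.mem_sigma, Finset.mem_powerset] at h ⊢
    exact ⟨Finset.union_subset h.1 (h.2.trans Finset.sdiff_subset), Finset.subset_union_left⟩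
  · rintro ⟨A, I⟩ h
    simp only [Finset.mem_sigma, Finset.mem_powerset] at h ⊢
    simp [Finset.union_eq_right.2 h.2]
  · rintro ⟨I, J⟩ h
    simp only [Finset.mem_sigma, Finset.mem_powerset] at h
    have : Disjoint J I := Finset.disjoint_of_subset_left h.2 Finset.sdiff_disjoint
    simp [Finset.union_sdiff_cancel_left this.symm]
  · rintro ⟨A, I⟩ h
    simp only [Finset.mem_sigma, Finset.mem_powerset] at h ⊢
    rw [Finset.sdiff_sdiff_left', ← Finset.sdiff_union_distrib, Finset.union_sdiff_of_subset h.2]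

end Shuffle

section Form

variable {R : Type*} [Ring R] [Algebra ℚ R]

/-- Exterior forms in `n` odd variables, with coefficients (written on the right) in an algebra
with a parity operator. -/
structure Form (n : ℕ) (_τ : R →ₐ[ℚ] R) where
  toFun : Finset (Fin n) → R

namespace Form

variable {n : ℕ} {τ : R →ₐ[ℚ] R}

instance : FunLike (Form n τ) (Finset (Fin n)) R where
  coe := toFun
  coe_injective := by rintro ⟨u⟩ ⟨v⟩ h; exact congrArg mk h

@[ext] theorem ext {u v : Form n τ} (h : ∀ K, u K = v K) : u = v := DFunLike.ext _ _ h

@[simp] theorem mk_apply (f : Finset (Fin n) → R) (K : Finset (Fin n)) :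
    (⟨f⟩ : Form n τ) K = f K := rfl

instance : Zero (Form n τ) := ⟨⟨fun _ => 0⟩⟩
instance : Add (Form n τ) := ⟨fun u v => ⟨fun K => u K + v K⟩⟩
instance : Neg (Form n τ) := ⟨fun u => ⟨fun K => -u K⟩⟩
instance : Sub (Form n τ) := ⟨fun u v => ⟨fun K => u K - v K⟩⟩
instance {S : Type*} [SMul S R] : SMul S (Form n τ) := ⟨fun c u => ⟨fun K => c • u K⟩⟩

instance : AddCommGroup (Form n τ) := DFunLike.coe_injective.addCommGroup _ rfl (fun _ _ => rfl)
  (fun _ => rfl) (fun _ _ => rfl) (fun _ _ => rfl) (fun _ _ => rfl)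

@[simp] theorem add_apply (u v : Form n τ) (K : Finset (Fin n)) : (u + v) K = u K + v K := rfl
@[simp] theorem zero_apply (K : Finset (Fin n)) : (0 : Form n τ) K = 0 := rfl
@[simp] theorem neg_apply (u : Form n τ) (K : Finset (Fin n)) : (-u) K = -u K := rfl
@[simp] theorem sub_apply (u v : Form n τ) (K : Finset (Fin n)) : (u - v) K = u K - v K := rfl
@[simp] theorem smul_apply (c : ℚ) (u : Form n τ) (K : Finset (Fin n)) : (c • u) K = c • u K := rfl

instance : Module ℚ (Form n τ) := Function.Injective.module ℚ
  (⟨⟨fun u => (u : Finset (Fin n) → R), rfl⟩, fun _ _ => rfl⟩ : Form n τ →+ Finset (Fin n) → R)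
  DFunLike.coe_injective (fun _ _ => rfl)

/-- The coefficient of a form, as a linear map. -/
def coeff (K : Finset (Fin n)) : Form n τ →ₗ[ℚ] R where
  toFun u := u K
  map_add' _ _ := rfl
  map_smul' _ _ := rfl

@[simp] theorem coeff_apply (K : Finset (Fin n)) (u : Form n τ) : coeff K u = u K := rfl

theorem sum_apply {κ : Type*} (s : Finset κ) (f : κ → Form n τ) (K : Finset (Fin n)) :
    (∑ i ∈ s, f i) K = ∑ i ∈ s, f i K := map_sum (coeff K) f s

/-- The exterior product. -/
noncomputable instance : Mul (Form n τ) :=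
  ⟨fun u v => ⟨fun K =>
    ∑ I ∈ K.powerset, shSign I (K \ I) • ((τ ^ (K \ I).card) (u I) * v (K \ I))⟩⟩

theorem mul_apply (u v : Form n τ) (K : Finset (Fin n)) : (u * v) K =
    ∑ I ∈ K.powerset, shSign I (K \ I) • ((τ ^ (K \ I).card) (u I) * v (K \ I)) := rfl

noncomputable instance : One (Form n τ) := ⟨⟨fun K => if K = ∅ then 1 else 0⟩⟩

theorem one_apply (K : Finset (Fin n)) : (1 : Form n τ) K = if K = ∅ then 1 else 0 := rfl

protected theorem mul_assoc (u v w : Form n τ) : u * v * w = u * (v * w) := by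
  ext K
  have key := sum_powerset_assoc K fun I J L => (shSign I J * shSign I L * shSign J L) •
    ((τ ^ (J.card + L.card)) (u I) * (τ ^ L.card) (v J) * w L)
  rw [mul_apply, mul_apply]
  refine Eq.trans ?_ (key.trans ?_)
  · refine Finset.sum_congr rfl fun A hA => ?_
    rw [mul_apply, map_sum, Finset.sum_mul, Finset.smul_sum]
    refine Finset.sum_congr rfl fun I hI => ?_
    have hI' := Finset.mem_powerset.1 hI
    have h1 : shSign A (K \ A) = shSign I (K \ A) * shSign (A \ I) (K \ A) := by
      rw [← shSign_union_left Finset.disjoint_sdiff, Finset.union_sdiff_of_subset hI']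
    rw [map_smul, map_mul, smul_mul_assoc, smul_smul, h1, add_comm (A \ I).card, pow_add,
      AlgHom.mul_apply]
    congr 1
    ring
  · refine Finset.sum_congr rfl fun I hI => ?_
    rw [mul_apply, Finset.mul_sum, Finset.smul_sum]
    refine Finset.sum_congr rfl fun J hJ => ?_
    have hJ' := Finset.mem_powerset.1 hJ
    have h1 : shSign I (K \ I) = shSign I J * shSign I ((K \ I) \ J) := by
      rw [← shSign_union_right _ Finset.disjoint_sdiff, Finset.union_sdiff_of_subset hJ']
    have h2 : (K \ I).card = J.card + ((K \ I) \ J).card := by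
      rw [Finset.card_sdiff_of_subset hJ']
      have := Finset.card_le_card hJ'
      omega
    rw [mul_smul_comm, smul_smul, h1, h2, mul_assoc, mul_assoc]

noncomputable instance : Ring (Form n τ) :=
  { (inferInstance : AddCommGroup (Form n τ)) with
    left_distrib := fun u v w => by
      ext K
      simp only [mul_apply, add_apply, mul_add, smul_add, Finset.sum_add_distrib]
    right_distrib := fun u v w => by
      ext K
      simp only [mul_apply, add_apply, map_add, add_mul, smul_add, Finset.sum_add_distrib]
    zero_mul := fun u => by ext K; simp [mul_apply]
    mul_zero := fun u => by ext K; simp [mul_apply]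
    mul_assoc := Form.mul_assoc
    one_mul := fun u => by
      ext K
      rw [mul_apply, Finset.sum_eq_single ∅]
      · simp [one_apply]
      · intro I _ hI
        simp [one_apply, hI]
      · simp
    mul_one := fun u => by
      ext K
      rw [mul_apply, Finset.sum_eq_single K]
      · simp [one_apply]
      · intro I hI hI'
        have : K \ I ≠ ∅ := fun h => hI' (Finset.Subset.antisymm (Finset.mem_powerset.1 hI)
          (Finset.sdiff_eq_empty_iff_subset.1 h))
        simp [one_apply, this]
      · simp }

noncomputable instance : Algebra ℚ (Form n τ) := Algebra.ofModule
  (fun c u v => by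
    ext K
    simp only [mul_apply, smul_apply, smul_mul_assoc, Finset.smul_sum])
  (fun c u v => by
    ext K
    simp only [mul_apply, smul_apply, mul_smul_comm, Finset.smul_sum])

end Form

end Form

namespace Form

variable {R : Type*} [Ring R] [Algebra ℚ R] {n m l : ℕ} {τ : R →ₐ[ℚ] R}

/-- The `k`-th odd variable. -/
def omega (k : Fin n) : Form n τ := ⟨fun K => if K = {k} then 1 else 0⟩

theorem omega_mul (k : Fin n) (v : Form n τ) (K : Finset (Fin n)) :
    ((omega k : Form n τ) * v) K = if k ∈ K then shSign {k} (K \ {k}) • v (K \ {k}) else 0 := by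
  rw [mul_apply]
  split_ifs with h
  · rw [Finset.sum_eq_single {k}]
    · simp [omega]
    · intro I _ hI
      simp [omega, hI]
    · simp [h]
  · refine Finset.sum_eq_zero fun I hI => ?_
    have : I ≠ {k} := by
      rintro rfl
      exact h (Finset.singleton_subset_iff.1 (Finset.mem_powerset.1 hI))
    simp [omega, this]

theorem mul_omega (k : Fin n) (v : Form n τ) (K : Finset (Fin n)) :
    (v * (omega k : Form n τ)) K = if k ∈ K then shSign (K \ {k}) {k} • τ (v (K \ {k})) else 0 := by
  rw [mul_apply]
  split_ifs with h
  · have hk : K \ (K \ {k}) = {k} := by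
      rw [sdiff_sdiff_right_self]; exact inf_eq_right.2 (by simpa using h)
    rw [Finset.sum_eq_single (K \ {k})]
    · simp [omega, hk]
    · intro I hI hI'
      have : K \ I ≠ {k} := by
        intro h'
        apply hI'
        rw [← h', sdiff_sdiff_right_self]
        exact (inf_eq_right.2 (Finset.mem_powerset.1 hI)).symm
      simp [omega, this]
    · simp
  · refine Finset.sum_eq_zero fun I hI => ?_
    have : K \ I ≠ {k} := by
      intro h'
      have : k ∈ K \ I := by rw [h']; simp
      exact h (Finset.mem_sdiff.1 this).1
    simp [omega, this]

/-- The total parity operator on forms. -/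
def parity : Form n τ →ₗ[ℚ] Form n τ where
  toFun u := ⟨fun K => (-1 : ℚ) ^ K.card • τ (u K)⟩
  map_add' u v := by ext K; simp
  map_smul' c u := by
    ext K
    simp only [smul_apply, mk_apply, map_smul, RingHom.id_apply]
    rw [smul_comm]

theorem parity_apply (u : Form n τ) (K : Finset (Fin n)) :
    parity u K = (-1 : ℚ) ^ K.card • τ (u K) := rfl

/-- Moving ω_k to the front costs one sign for each variable it passes and one application of τ to
the coefficient; together these are the total parity. -/
theorem mul_omega_eq (k : Fin n) (v : Form n τ) : v * (omega k : Form n τ) = omega k * parity v := by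
  ext K
  rw [mul_omega, omega_mul]
  split_ifs with h
  · rw [parity_apply, smul_smul, shSign_comm (I := {k}) (by simp), Finset.card_singleton, one_mul,
      mul_comm]
  · rfl

theorem parity_omega (k : Fin n) : parity (omega k : Form n τ) = -omega k := by
  ext K
  rw [parity_apply, neg_apply]
  by_cases h : K = {k}
  · subst h; simp [omega]
  · simp [omega, h]

/-- The sum of the first `t` odd variables. -/
noncomputable def theta (t : ℕ) : Form n τ := ∑ k ∈ Finset.univ.filter (fun k : Fin n => k.val < t), omega k

theorem mul_theta (t : ℕ) (v : Form n τ) : v * theta t = theta t * parity v := by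
  rw [theta, Finset.mul_sum, Finset.sum_mul]
  exact Finset.sum_congr rfl fun k _ => mul_omega_eq k v

theorem parity_theta (t : ℕ) : parity (theta t : Form n τ) = -theta t := by
  rw [theta, map_sum, ← Finset.sum_neg_distrib]
  exact Finset.sum_congr rfl fun k _ => parity_omega k

/-- θ is odd, so it anticommutes with itself, and 2 is invertible. -/
theorem theta_mul_self (t : ℕ) : (theta t : Form n τ) * theta t = 0 := by
  have h := mul_theta t (theta t : Form n τ)
  rw [parity_theta, mul_neg] at h
  have h2 : (2 : ℚ) • ((theta t : Form n τ) * theta t) = 0 := by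
    rw [two_smul]
    nth_rw 1 [h]
    exact neg_add_cancel _
  exact (smul_eq_zero.1 h2).resolve_left two_ne_zero

@[simp] theorem theta_zero : (theta 0 : Form n τ) = 0 := by simp [theta]

theorem theta_apply (t : ℕ) (K : Finset (Fin n)) :
    (theta t : Form n τ) K = if ∃ k : Fin n, K = {k} ∧ k.val < t then 1 else 0 := by
  rw [theta, sum_apply]
  split_ifs with h
  · obtain ⟨k, rfl, hk⟩ := h
    rw [Finset.sum_eq_single k]
    · simp [omega]
    · intro j _ hj
      have : ({k} : Finset (Fin n)) ≠ {j} := by simpa using hj.symm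
      simp [omega, this]
    · simp [hk]
  · refine Finset.sum_eq_zero fun k hk => ?_
    have : K ≠ {k} := fun h' => h ⟨k, h', (Finset.mem_filter.1 hk).2⟩
    simp [omega, this]

section Map

variable {R' : Type*} [Ring R'] [Algebra ℚ R'] {τ' : R' →ₐ[ℚ] R'}

/-- Applying an algebra map commuting with the parities to the coefficients. -/
noncomputable def map (f : R →ₐ[ℚ] R') (hf : ∀ x, f (τ x) = τ' (f x)) : Form n τ →ₐ[ℚ] Form n τ' :=
  AlgHom.ofLinearMap
    { toFun := fun u => ⟨fun K => f (u K)⟩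
      map_add' := fun u v => by ext K; simp
      map_smul' := fun c u => by ext K; simp }
    (by ext K; simp only [LinearMap.coe_mk, AddHom.coe_mk, mk_apply, one_apply]; split_ifs <;> simp)
    (by
      intro u v
      have hp : ∀ (k : ℕ) (x : R), f ((τ ^ k) x) = (τ' ^ k) (f x) := by
        intro k
        induction k with
        | zero => simp
        | succ k ih => intro x; rw [pow_succ, pow_succ, AlgHom.mul_apply, AlgHom.mul_apply, ih, hf]
      ext K
      simp only [LinearMap.coe_mk, AddHom.coe_mk, mk_apply, mul_apply, map_sum, map_smul, map_mul,
        hp])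

theorem map_apply (f : R →ₐ[ℚ] R') (hf : ∀ x, f (τ x) = τ' (f x)) (u : Form n τ)
    (K : Finset (Fin n)) : map f hf u K = f (u K) := rfl

theorem map_omega (f : R →ₐ[ℚ] R') (hf : ∀ x, f (τ x) = τ' (f x)) (k : Fin n) :
    map f hf (omega k) = omega k := by
  ext K
  rw [map_apply]
  simp only [omega, mk_apply]
  split_ifs <;> simp

theorem map_theta (f : R →ₐ[ℚ] R') (hf : ∀ x, f (τ x) = τ' (f x)) (t : ℕ) :
    map f hf (theta t : Form n τ) = theta t := by
  rw [theta, map_sum]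
  exact Finset.sum_congr rfl fun k _ => map_omega f hf k

end Map

end Form

/-! ### Monotone partial maps between sets of steps. -/

section Shadow

variable {n m l : ℕ}

/-- A partial map is defined and injective on `J`. -/
def Good (b : Fin n → Option (Fin m)) (J : Finset (Fin n)) : Prop :=
  (∀ k ∈ J, ∃ j, b k = some j) ∧ Set.InjOn b J

/-- The image of a set under a partial map. -/
def shadow (b : Fin n → Option (Fin m)) (J : Finset (Fin n)) : Finset (Fin m) :=
  Finset.univ.filter fun j => ∃ k ∈ J, b k = some j

theorem mem_shadow {b : Fin n → Option (Fin m)} {J : Finset (Fin n)} {j : Fin m} :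
    j ∈ shadow b J ↔ ∃ k ∈ J, b k = some j := by simp [shadow]

theorem Good.subset {b : Fin n → Option (Fin m)} {I J : Finset (Fin n)} (h : Good b J)
    (hI : I ⊆ J) : Good b I :=
  ⟨fun k hk => h.1 k (hI hk), h.2.mono (Finset.coe_subset.2 hI)⟩

theorem Good.eq {b : Fin n → Option (Fin m)} {J : Finset (Fin n)} (h : Good b J) {k k' : Fin n}
    {j : Fin m} (hk : k ∈ J) (hk' : k' ∈ J) (h1 : b k = some j) (h2 : b k' = some j) : k = k' :=
  h.2 hk hk' (h1.trans h2.symm)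

theorem Good.prod_shadow {b : Fin n → Option (Fin m)} {J : Finset (Fin n)} (h : Good b J)
    {F : Fin m → ℚ} {G : Fin n → ℚ} (hFG : ∀ k ∈ J, ∀ j, b k = some j → G k = F j) :
    ∏ j ∈ shadow b J, F j = ∏ k ∈ J, G k := by
  symm
  refine Finset.prod_bij (fun k hk => (h.1 k hk).choose) ?_ ?_ ?_ ?_
  · exact fun k hk => mem_shadow.2 ⟨k, hk, (h.1 k hk).choose_spec⟩
  · intro k hk k' hk' hkk'
    exact h.eq hk hk' (h.1 k hk).choose_spec (hkk' ▸ (h.1 k' hk').choose_spec)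
  · intro j hj
    obtain ⟨k, hk, hkj⟩ := mem_shadow.1 hj
    exact ⟨k, hk, Option.some.inj ((h.1 k hk).choose_spec.symm.trans hkj)⟩
  · exact fun k hk => hFG k hk _ (h.1 k hk).choose_spec

theorem Good.card_shadow {b : Fin n → Option (Fin m)} {J : Finset (Fin n)} (h : Good b J) :
    (shadow b J).card = J.card := by
  symm
  refine Finset.card_bij (fun k hk => (h.1 k hk).choose) ?_ ?_ ?_
  · exact fun k hk => mem_shadow.2 ⟨k, hk, (h.1 k hk).choose_spec⟩
  · intro k hk k' hk' hkk'
    exact h.eq hk hk' (h.1 k hk).choose_spec (hkk' ▸ (h.1 k' hk').choose_spec)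
  · intro j hj
    obtain ⟨k, hk, hkj⟩ := mem_shadow.1 hj
    exact ⟨k, hk, Option.some.inj ((h.1 k hk).choose_spec.symm.trans hkj)⟩

theorem Good.shadow_sdiff {b : Fin n → Option (Fin m)} {I J : Finset (Fin n)} (h : Good b J)
    (hI : I ⊆ J) : shadow b (J \ I) = shadow b J \ shadow b I := by
  ext j
  simp only [mem_shadow, Finset.mem_sdiff, not_exists, not_and]
  constructor
  · rintro ⟨k, ⟨hk, hkI⟩, hkj⟩
    refine ⟨⟨k, hk, hkj⟩, fun k' hk' hk'j => hkI ?_⟩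
    rwa [h.eq hk (hI hk') hkj hk'j]
  · rintro ⟨⟨k, hk, hkj⟩, h'⟩
    exact ⟨k, ⟨hk, fun hkI => h' k hkI hkj⟩, hkj⟩

/-- Partial maps that are monotone where defined. -/
def PMono (b : Fin n → Option (Fin m)) : Prop :=
  ∀ k k' j j', b k = some j → b k' = some j' → k ≤ k' → j ≤ j'

/-- A monotone map that is injective on K preserves and reflects strict inequalities there, so
inversions correspond. -/
theorem Good.shSign_shadow {b : Fin n → Option (Fin m)} (hb : PMono b) {I J K : Finset (Fin n)}
    (h : Good b K) (hI : I ⊆ K) (hJ : J ⊆ K) :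
    shSign (shadow b I) (shadow b J) = shSign I J := by
  refine (h.subset hI).prod_shadow fun k hk j hkj => ?_
  refine ((h.subset hJ).prod_shadow fun k' hk' j' hkj' => ?_).symm
  have hiff : k' < k ↔ j' < j := by
    constructor
    · intro hlt
      refine lt_of_le_of_ne (hb _ _ _ _ hkj' hkj hlt.le) ?_
      rintro rfl
      exact hlt.ne (h.eq (hJ hk') (hI hk) hkj' hkj)
    · intro hlt
      by_contra hle
      exact absurd (hb _ _ _ _ hkj hkj' (not_lt.1 hle)) (not_le.2 hlt)
  simp only [hiff]

end Shadow

section Swap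

variable {n m : ℕ}

theorem Good.swap {b : Fin n → Option (Fin m)} {k k' : Fin n} (hkk : b k = b k')
    (I : Finset (Fin n)) : Good b (I.map (Equiv.swap k k').toEmbedding) ↔ Good b I := by
  have hb : ∀ x, b (Equiv.swap k k' x) = b x := by
    intro x
    by_cases h1 : x = k
    · subst h1; rw [Equiv.swap_apply_left, hkk]
    by_cases h2 : x = k'
    · subst h2; rw [Equiv.swap_apply_right, hkk]
    · rw [Equiv.swap_apply_of_ne_of_ne h1 h2]
  constructor
  · rintro ⟨h1, h2⟩
    refine ⟨fun x hx => ?_, fun x hx y hy hxy => ?_⟩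
    · rw [← hb]; exact h1 _ (Finset.mem_map_of_mem _ hx)
    · refine (Equiv.swap k k').injective (h2 ?_ ?_ ?_)
      · exact Finset.mem_coe.2 (Finset.mem_map_of_mem _ (Finset.mem_coe.1 hx))
      · exact Finset.mem_coe.2 (Finset.mem_map_of_mem _ (Finset.mem_coe.1 hy))
      · rw [hb, hb, hxy]
  · rintro ⟨h1, h2⟩
    refine ⟨fun x hx => ?_, fun x hx y hy hxy => ?_⟩
    · obtain ⟨z, hz, rfl⟩ := Finset.mem_map.1 hx
      obtain ⟨j, hj⟩ := h1 z hz
      exact ⟨j, (hb z).trans hj⟩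
    · obtain ⟨z, hz, rfl⟩ := Finset.mem_map.1 (Finset.mem_coe.1 hx)
      obtain ⟨w, hw, rfl⟩ := Finset.mem_map.1 (Finset.mem_coe.1 hy)
      exact congrArg _ (h2 hz hw ((hb z).symm.trans (hxy.trans (hb w))))

theorem shadow_swap {b : Fin n → Option (Fin m)} {k k' : Fin n} (hkk : b k = b k')
    (I : Finset (Fin n)) : shadow b (I.map (Equiv.swap k k').toEmbedding) = shadow b I := by
  have hb : ∀ x, b (Equiv.swap k k' x) = b x := by
    intro x
    by_cases h1 : x = k
    · subst h1; rw [Equiv.swap_apply_left, hkk]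
    by_cases h2 : x = k'
    · subst h2; rw [Equiv.swap_apply_right, hkk]
    · rw [Equiv.swap_apply_of_ne_of_ne h1 h2]
  ext j
  simp only [mem_shadow, Finset.mem_map_equiv]
  constructor
  · rintro ⟨x, hx, hxj⟩
    exact ⟨_, hx, by rw [Equiv.symm_swap, hb]; exact hxj⟩
  · rintro ⟨x, hx, hxj⟩
    exact ⟨Equiv.swap k k' x, by simpa using hx, by rw [hb]; exact hxj⟩

theorem prod_prod_ite_eq_neg_one {I C : Finset (Fin n)} {a₀ c₀ : Fin n} (ha : a₀ ∈ I) (hc : c₀ ∈ C)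
    {P : Fin n → Fin n → Prop} [∀ a c, Decidable (P a c)]
    (hP : ∀ a ∈ I, ∀ c ∈ C, (P a c ↔ a = a₀ ∧ c = c₀)) :
    ∏ a ∈ I, ∏ c ∈ C, (if P a c then (-1 : ℚ) else 1) = -1 := by
  rw [Finset.prod_eq_single a₀, Finset.prod_eq_single c₀]
  · exact if_pos ((hP _ ha _ hc).2 ⟨rfl, rfl⟩)
  · exact fun c hc' hne => if_neg fun h => hne ((hP _ ha _ hc').1 h).2
  · exact fun h => absurd hc h
  · exact fun a ha' hne => Finset.prod_eq_one fun c hc' => if_neg fun h => hne ((hP _ ha' _ hc').1 h).1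
  · exact fun h => absurd ha h

/-- Exchanging two elements of `I ∪ C` adjacent in `I ∪ C`, one in each part, changes the sign. -/
theorem shSign_swap {I C : Finset (Fin n)} {k k' : Fin n} (hkk : k < k')
    (hadj : ∀ x, x ∈ I ∨ x ∈ C → ¬ (k < x ∧ x < k'))
    (hd : ∀ x ∈ I, x ∉ C)
    (h : (k ∈ I ∧ k' ∈ C ∧ k' ∉ I ∧ k ∉ C) ∨ (k' ∈ I ∧ k ∈ C ∧ k ∉ I ∧ k' ∉ C)) :
    shSign (I.map (Equiv.swap k k').toEmbedding) (C.map (Equiv.swap k k').toEmbedding) =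
      -shSign I C := by
  -- Nothing of I ∪ C lies strictly between k and k', so the transposition alters the relative order
  -- of no pair other than {k, k'} itself.
  have hsg : ∀ a ∈ I, ∀ c ∈ C, (if Equiv.swap k k' c < Equiv.swap k k' a then (-1 : ℚ) else 1) =
      (if c < a then -1 else 1) * (if (a = k ∨ a = k') ∧ (c = k ∨ c = k') then -1 else 1) := by
    intro a ha c hc
    have h1 := hadj a (Or.inl ha)
    have h2 := hadj c (Or.inr hc)
    have h3 : a ≠ c := by rintro rfl; exact hd a ha hc
    clear hadj hd h
    by_cases ha1 : a = k
    · subst ha1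
      by_cases hc2 : c = k'
      · subst hc2; simp [hkk, hkk.le]
      · rw [Equiv.swap_apply_left, Equiv.swap_apply_of_ne_of_ne h3.symm hc2]; clear ha hc; grind
    by_cases ha2 : a = k'
    · subst ha2
      by_cases hc1 : c = k
      · subst hc1; simp [hkk, hkk.le]
      · rw [Equiv.swap_apply_right, Equiv.swap_apply_of_ne_of_ne hc1 h3.symm]; clear ha hc; grind
    rw [Equiv.swap_apply_of_ne_of_ne ha1 ha2]
    by_cases hc1 : c = k
    · subst hc1; rw [Equiv.swap_apply_left]; clear ha hc; grind
    by_cases hc2 : c = k'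
    · subst hc2; rw [Equiv.swap_apply_right]; clear ha hc; grind
    rw [Equiv.swap_apply_of_ne_of_ne hc1 hc2]; simp [ha1, ha2]
  simp only [shSign, Finset.prod_map, Equiv.coe_toEmbedding]
  rw [Finset.prod_congr rfl fun a ha => Finset.prod_congr rfl fun c hc => hsg a ha c hc]
  simp only [Finset.prod_mul_distrib]
  rcases h with ⟨h, h', h'', h'''⟩ | ⟨h, h', h'', h'''⟩
  · rw [prod_prod_ite_eq_neg_one
      (P := fun a c => (a = k ∨ a = k') ∧ (c = k ∨ c = k')) h h', mul_neg_one]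
    intro a ha c hc
    have h1 : a ≠ k' := by rintro rfl; exact h'' ha
    have h2 : c ≠ k := by rintro rfl; exact h''' hc
    simp [h1, h2]
  · rw [prod_prod_ite_eq_neg_one
      (P := fun a c => (a = k ∨ a = k') ∧ (c = k ∨ c = k')) h h', mul_neg_one]
    intro a ha c hc
    have h1 : a ≠ k := by rintro rfl; exact h'' ha
    have h2 : c ≠ k' := by rintro rfl; exact h''' hc
    simp [h1, h2]

end Swap

/-! ### Substitution of sums of odd variables, as a map of forms. -/

namespace Form

variable {R : Type*} [Ring R] [Algebra ℚ R] {n m l : ℕ} {τ : R →ₐ[ℚ] R}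

open Classical in
/-- The map of forms sending an odd variable to the sum of the variables over it. -/
noncomputable def push (b : Fin n → Option (Fin m)) (u : Form m τ) : Form n τ :=
  ⟨fun J => if Good b J then u (shadow b J) else 0⟩

theorem push_of_good {b : Fin n → Option (Fin m)} {J : Finset (Fin n)} (h : Good b J)
    (u : Form m τ) : push b u J = u (shadow b J) := if_pos h

theorem push_of_not_good {b : Fin n → Option (Fin m)} {J : Finset (Fin n)} (h : ¬ Good b J)
    (u : Form m τ) : push b u J = 0 := if_neg h

/-- On J the partial map is an order isomorphism onto its shadow, so the splittings of J and of the
shadow correspond, with equal signs and cardinalities. -/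
theorem push_mul_of_good {b : Fin n → Option (Fin m)} (hb : PMono b) {J : Finset (Fin n)}
    (h : Good b J) (u v : Form m τ) : push b (u * v) J = (push b u * push b v) J := by
  rw [push_of_good h, mul_apply, mul_apply]
  symm
  refine Finset.sum_nbij' (fun A => shadow b A)
    (fun B => J.filter fun k => ∃ j ∈ B, b k = some j) ?_ ?_ ?_ ?_ ?_
  · intro A hA
    rw [Finset.mem_powerset] at hA ⊢
    intro j hj
    obtain ⟨k, hk, hkj⟩ := mem_shadow.1 hj
    exact mem_shadow.2 ⟨k, hA hk, hkj⟩
  · intro B _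
    exact Finset.mem_powerset.2 (Finset.filter_subset _ _)
  · intro A hA
    have hA := Finset.mem_powerset.1 hA
    ext k
    simp only [Finset.mem_filter, mem_shadow]
    constructor
    · rintro ⟨hk, j, ⟨k', hk', hk'j⟩, hkj⟩
      rwa [h.eq hk (hA hk') hkj hk'j]
    · intro hk
      obtain ⟨j, hj⟩ := h.1 k (hA hk)
      exact ⟨hA hk, j, ⟨k, hk, hj⟩, hj⟩
  · intro B hB
    have hB := Finset.mem_powerset.1 hB
    ext j
    simp only [mem_shadow, Finset.mem_filter]
    constructor
    · rintro ⟨k, ⟨_, j', hj', hkj'⟩, hkj⟩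
      rwa [Option.some.inj (hkj.symm.trans hkj')]
    · intro hj
      obtain ⟨k, hk, hkj⟩ := mem_shadow.1 (hB hj)
      exact ⟨k, ⟨hk, j, hj, hkj⟩, hkj⟩
  · intro A hA
    have hA := Finset.mem_powerset.1 hA
    rw [push_of_good (h.subset hA), push_of_good (h.subset Finset.sdiff_subset),
      h.shadow_sdiff hA, ← h.shadow_sdiff hA, h.shSign_shadow hb hA Finset.sdiff_subset,
      (h.subset Finset.sdiff_subset).card_shadow]

/-- If some k in J is outside the domain, it lies in one of the two parts and kills each term.
Otherwise two elements of J share a block: terms with both in one part vanish, and the others cancel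
in pairs when the two elements are exchanged. This is the vanishing of the square of a sum of odd
variables. -/
theorem push_mul_of_not_good {b : Fin n → Option (Fin m)} (hb : PMono b) {J : Finset (Fin n)}
    (h : ¬ Good b J) (u v : Form m τ) : (push b u * push b v) J = 0 := by
  rw [mul_apply]
  by_cases hd : ∀ k ∈ J, ∃ j, b k = some j
  -- If x < y share a block, monotonicity puts the successor of x in J into that block too. So the
  -- colliding pair may be taken adjacent in J, as `shSign_swap` requires.
  · obtain ⟨k, k', hk, hk', hkk, hlt, hadj⟩ : ∃ k k', k ∈ J ∧ k' ∈ J ∧ b k = b k' ∧ k < k' ∧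
        ∀ x ∈ J, ¬ (k < x ∧ x < k') := by
      have : ¬ Set.InjOn b J := fun h' => h ⟨hd, h'⟩
      simp only [Set.InjOn, not_forall] at this
      obtain ⟨x, hx, y, hy, hxy, hne⟩ := this
      wlog hlt : x < y generalizing x y
      · exact this y hy x hx hxy.symm (Ne.symm hne)
          (lt_of_le_of_ne (not_lt.1 hlt) (Ne.symm hne))
      have hne : (J.filter fun z => x < z).Nonempty := ⟨y, Finset.mem_filter.2 ⟨hy, hlt⟩⟩
      have hmem := Finset.mem_filter.1 (Finset.min'_mem _ hne)
      refine ⟨x, (J.filter fun z => x < z).min' hne, hx, hmem.1, ?_, hmem.2, ?_⟩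
      · obtain ⟨j, hj⟩ := hd x hx
        obtain ⟨j', hj'⟩ := hd _ hmem.1
        have h1 := hb _ _ _ _ hj hj' hmem.2.le
        have h2 := hb _ _ _ _ hj' (hxy.symm.trans hj)
          (Finset.min'_le _ _ (Finset.mem_filter.2 ⟨hy, hlt⟩))
        rw [hj, hj', le_antisymm h1 h2]
      · rintro z hz ⟨hxz, hzm⟩
        exact absurd (Finset.min'_le _ _ (Finset.mem_filter.2 ⟨hz, hxz⟩)) (not_le.2 hzm)
    have hbad : ∀ A : Finset (Fin n), k ∈ A → k' ∈ A → ∀ w : Form m τ, push b w A = 0 :=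
      fun A h1 h2 w => push_of_not_good (fun hg => hlt.ne (hg.2 h1 h2 hkk)) w
    have hJ : J.map (Equiv.swap k k').toEmbedding = J := by
      refine Finset.eq_of_subset_of_card_le ?_ (by rw [Finset.card_map])
      intro x hx
      obtain ⟨y, hy, rfl⟩ := Finset.mem_map.1 hx
      change Equiv.swap k k' y ∈ J
      rw [Equiv.swap_apply_def]
      split_ifs <;> assumption
    have hpush : ∀ (A : Finset (Fin n)) (w : Form m τ),
        push b w (A.map (Equiv.swap k k').toEmbedding) = push b w A := by
      intro A w
      by_cases hA : Good b A
      · rw [push_of_good hA, push_of_good ((Good.swap hkk A).2 hA), shadow_swap hkk]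
      · rw [push_of_not_good hA, push_of_not_good (fun h' => hA ((Good.swap hkk A).1 h'))]
    have hterm : ∀ A ∈ J.powerset, ¬ (k ∈ A ↔ k' ∉ A) →
        shSign A (J \ A) • ((τ ^ (J \ A).card) (push b u A) * push b v (J \ A)) = 0 := by
      intro A _ hA
      by_cases h1 : k ∈ A
      · have h2 : k' ∈ A := by tauto
        rw [hbad A h1 h2, map_zero, zero_mul, smul_zero]
      · have h2 : k' ∉ A := by tauto
        rw [hbad (J \ A) (Finset.mem_sdiff.2 ⟨hk, h1⟩) (Finset.mem_sdiff.2 ⟨hk', h2⟩), mul_zero,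
          smul_zero]
    refine Finset.sum_involution (fun A _ => A.map (Equiv.swap k k').toEmbedding) ?_ ?_ ?_ ?_
    · intro A hA
      have hA' := Finset.mem_powerset.1 hA
      have hsd : J \ A.map (Equiv.swap k k').toEmbedding =
          (J \ A).map (Equiv.swap k k').toEmbedding := by
        rw [Finset.map_sdiff, hJ]
      by_cases hc : k ∈ A ↔ k' ∉ A
      · rw [hsd, hpush, hpush, Finset.card_map, shSign_swap hlt]
        · rw [neg_smul, add_neg_cancel]
        · rintro x (hx | hx)
          · exact hadj x (hA' hx)
          · exact hadj x (Finset.mem_sdiff.1 hx).1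
        · exact fun x hx hx' => (Finset.mem_sdiff.1 hx').2 hx
        · simp only [Finset.mem_sdiff]
          tauto
      · rw [hterm A hA hc, zero_add, hsd, hpush, hpush, Finset.card_map]
        by_cases h1 : k ∈ A
        · have h2 : k' ∈ A := by tauto
          rw [hbad A h1 h2, map_zero, zero_mul, smul_zero]
        · have h2 : k' ∉ A := by tauto
          rw [hbad (J \ A) (Finset.mem_sdiff.2 ⟨hk, h1⟩) (Finset.mem_sdiff.2 ⟨hk', h2⟩), mul_zero,
            smul_zero]
    · intro A hA hne heq
      apply hne
      refine hterm A hA fun hc => ?_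
      have : k ∈ A ↔ k' ∈ A := by
        constructor
        · intro h1
          rw [← heq]
          exact Finset.mem_map.2 ⟨k, h1, Equiv.swap_apply_left _ _⟩
        · intro h1
          rw [← heq]
          exact Finset.mem_map.2 ⟨k', h1, Equiv.swap_apply_right _ _⟩
      tauto
    · intro A hA
      rw [Finset.mem_powerset] at hA ⊢
      rw [← hJ]
      exact Finset.map_subset_map.2 hA
    · intro A hA
      ext x
      simp
  · push Not at hd
    obtain ⟨k, hk, hkb⟩ := hd
    refine Finset.sum_eq_zero fun A _ => ?_
    by_cases hkA : k ∈ A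
    · rw [push_of_not_good (fun hg => (hg.1 k hkA).elim hkb), map_zero, zero_mul, smul_zero]
    · rw [push_of_not_good (J := J \ A)
        (fun hg => (hg.1 k (Finset.mem_sdiff.2 ⟨hk, hkA⟩)).elim hkb), mul_zero, smul_zero]

/-- The map of forms sending an odd variable to the sum of the variables over it, as an algebra
map. -/
noncomputable def pushHom (b : Fin n → Option (Fin m)) (hb : PMono b) :
    Form m τ →ₐ[ℚ] Form n τ :=
  AlgHom.ofLinearMap
    { toFun := push b
      map_add' := fun u v => by
        ext J
        by_cases h : Good b J
        · simp [push_of_good h]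
        · simp [push_of_not_good h]
      map_smul' := fun c u => by
        ext J
        by_cases h : Good b J
        · simp [push_of_good h]
        · simp [push_of_not_good h] }
    (by
      ext J
      change push b 1 J = _
      by_cases h : Good b J
      · have hJ : shadow b J = ∅ ↔ J = ∅ := by
          rw [← Finset.card_eq_zero, h.card_shadow, Finset.card_eq_zero]
        simp only [push_of_good h, one_apply, hJ]
      · rw [push_of_not_good h, one_apply, if_neg]
        rintro rfl
        exact h ⟨by simp, by simp⟩)
    (by
      intro u v
      ext J
      change push b (u * v) J = (push b u * push b v) J
      by_cases h : Good b J
      · exact push_mul_of_good hb h u v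
      · rw [push_of_not_good h, push_mul_of_not_good hb h])

end Form

/-! ### The blocks of steps determined by a monotone map. -/

section Blocks

variable {n m l : ℕ}

theorem exists_step {f : ℕ → ℕ} {k a b : ℕ} (hab : a ≤ b) (ha : f a ≤ k) (hb : k < f b) :
    ∃ j, a ≤ j ∧ j < b ∧ f j ≤ k ∧ k < f (j + 1) := by
  induction b, hab using Nat.le_induction with
  | base => omega
  | succ b hab ih =>
    by_cases h : k < f b
    · obtain ⟨j, h1, h2, h3⟩ := ih h
      exact ⟨j, h1, by omega, h3⟩
    · exact ⟨b, hab, by omega, by omega, hb⟩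

theorem exists_step_fin {f : Fin (m + 1) → Fin (n + 1)} {k : Fin n} {a b : Fin (m + 1)} (hab : a ≤ b)
    (ha : (f a).val ≤ k) (hb : k < (f b).val) :
    ∃ j : Fin m, a ≤ j.castSucc ∧ j.succ ≤ b ∧ (f j.castSucc).val ≤ k ∧ k < (f j.succ).val := by
  let F : ℕ → ℕ := fun x => if h : x < m + 1 then (f ⟨x, h⟩).val else 0
  have hF : ∀ x : Fin (m + 1), F x = f x := fun x => dif_pos x.isLt
  obtain ⟨j, h1, h2, h3, h4⟩ := exists_step (f := F) (k := k) (a := a) (b := b) hab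
    (by rw [hF]; exact ha) (by rw [hF]; exact hb)
  have hj : j < m := by omega
  refine ⟨⟨j, hj⟩, h1, h2, ?_, ?_⟩
  · rw [← hF]; exact h3
  · rw [← hF]; exact h4

open Classical in
/-- The block of a step of `[n]` under a map `[m] → [n]`. -/
noncomputable def blk (α : Fin (m + 1) →o Fin (n + 1)) (k : Fin n) : Option (Fin m) :=
  if h : ∃ j : Fin m, (α j.castSucc).val ≤ k ∧ k < (α j.succ).val then some h.choose else none

/-- The blocks of a monotone map are disjoint, so the choice made in `blk` does not matter. -/
theorem blk_eq_some {α : Fin (m + 1) →o Fin (n + 1)} {k : Fin n} {j : Fin m} :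
    blk α k = some j ↔ (α j.castSucc).val ≤ k ∧ k < (α j.succ).val := by
  have huniq : ∀ j j' : Fin m, (α j.castSucc).val ≤ k → k < (α j'.succ).val → j ≤ j' := by
    intro j j' h h'
    by_contra hlt
    have : α j'.succ ≤ α j.castSucc := α.monotone (by
      rw [Fin.le_def, Fin.val_succ, Fin.val_castSucc]; rw [Fin.le_def] at hlt; omega)
    rw [Fin.le_def] at this
    omega
  unfold blk
  split_ifs with h
  · rw [Option.some_inj]
    constructor
    · rintro rfl; exact h.choose_spec
    · intro hj
      exact le_antisymm (huniq _ _ h.choose_spec.1 hj.2) (huniq _ _ hj.1 h.choose_spec.2)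
  · refine ⟨fun h' => (by cases h'), fun hj => (h ⟨j, hj⟩).elim⟩

theorem blk_pmono (α : Fin (m + 1) →o Fin (n + 1)) : PMono (blk α) := by
  intro k k' j j' h h' hk
  rw [blk_eq_some] at h h'
  by_contra hlt
  have : α j'.succ ≤ α j.castSucc := α.monotone (by
    rw [Fin.le_def, Fin.val_succ, Fin.val_castSucc]; rw [Fin.le_def] at hlt; omega)
  rw [Fin.le_def] at this hk
  omega

/-- A block of the composite is the disjoint union of the α-blocks over the corresponding β-block;
the α-block containing k is found by a discrete intermediate value argument. -/
theorem blk_comp (α : Fin (m + 1) →o Fin (n + 1)) (β : Fin (l + 1) →o Fin (m + 1)) (k : Fin n) :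
    blk (α.comp β) k = (blk α k).bind (blk β) := by
  ext i
  rw [Option.bind_eq_some_iff]
  simp only [blk_eq_some]
  constructor
  · rintro ⟨h1, h2⟩
    obtain ⟨j, h3, h4, h5, h6⟩ := exists_step_fin (f := α) (β.monotone i.castSucc_lt_succ.le) h1 h2
    exact ⟨j, ⟨h5, h6⟩, h3, h4⟩
  · rintro ⟨j, ⟨h1, h2⟩, h3, h4⟩
    have h5 : α (β i.castSucc) ≤ α j.castSucc := α.monotone (by rw [Fin.le_def]; exact h3)
    have h6 : α j.succ ≤ α (β i.succ) := α.monotone (by rw [Fin.le_def, Fin.val_succ]; exact h4)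
    rw [Fin.le_def] at h5 h6
    exact ⟨h5.trans h1, h2.trans_le h6⟩

theorem blk_id (k : Fin n) : blk (OrderHom.id : Fin (n + 1) →o Fin (n + 1)) k = some k := by
  rw [blk_eq_some]; simp

theorem good_some (J : Finset (Fin n)) : Good (some : Fin n → Option (Fin n)) J :=
  ⟨fun k _ => ⟨k, rfl⟩, fun _ _ _ _ h => Option.some_inj.1 h⟩

theorem shadow_some (J : Finset (Fin n)) : shadow (some : Fin n → Option (Fin n)) J = J := by
  ext j; simp [mem_shadow]

variable {a : Fin n → Option (Fin m)} {b : Fin m → Option (Fin l)}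

theorem good_bind {J : Finset (Fin n)} :
    Good (fun k => (a k).bind b) J ↔ Good a J ∧ Good b (shadow a J) := by
  constructor
  · rintro ⟨h1, h2⟩
    have ha : ∀ k ∈ J, ∃ j, a k = some j := fun k hk => by
      obtain ⟨i, hi⟩ := h1 k hk
      obtain ⟨j, hj, -⟩ := Option.bind_eq_some_iff.1 hi
      exact ⟨j, hj⟩
    refine ⟨⟨ha, fun k hk k' hk' h => h2 hk hk' (by simp only [h])⟩, fun j hj => ?_, ?_⟩
    · obtain ⟨k, hk, hkj⟩ := mem_shadow.1 hj
      obtain ⟨i, hi⟩ := h1 k hk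
      exact ⟨i, by simpa [hkj] using hi⟩
    · intro j hj j' hj' h
      obtain ⟨k, hk, hkj⟩ := mem_shadow.1 hj
      obtain ⟨k', hk', hkj'⟩ := mem_shadow.1 hj'
      have : k = k' := h2 hk hk' (by simp [hkj, hkj', h])
      subst this
      exact Option.some_inj.1 (hkj.symm.trans hkj')
  · rintro ⟨h1, h2⟩
    refine ⟨fun k hk => ?_, fun k hk k' hk' h => ?_⟩
    · obtain ⟨j, hj⟩ := h1.1 k hk
      obtain ⟨i, hi⟩ := h2.1 j (mem_shadow.2 ⟨k, hk, hj⟩)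
      exact ⟨i, by simp [hj, hi]⟩
    · obtain ⟨j, hj⟩ := h1.1 k hk
      obtain ⟨j', hj'⟩ := h1.1 k' hk'
      have : j = j' := h2.2 (mem_shadow.2 ⟨k, hk, hj⟩) (mem_shadow.2 ⟨k', hk', hj'⟩)
        (by simpa [hj, hj'] using h)
      exact h1.2 hk hk' (by rw [hj, hj', this])

theorem shadow_bind (J : Finset (Fin n)) :
    shadow (fun k => (a k).bind b) J = shadow b (shadow a J) := by
  ext i
  simp only [mem_shadow, Option.bind_eq_some_iff]
  constructor
  · rintro ⟨k, hk, j, h1, h2⟩; exact ⟨j, ⟨k, hk, h1⟩, h2⟩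
  · rintro ⟨j, ⟨k, hk, h1⟩, h2⟩; exact ⟨k, hk, j, h1, h2⟩

end Blocks

namespace Form

variable {R : Type*} [Ring R] [Algebra ℚ R] {n m l : ℕ} {τ : R →ₐ[ℚ] R}

/-- Pushing forward along a map `[m] → [n]`. -/
noncomputable def pushBlk (α : Fin (m + 1) →o Fin (n + 1)) : Form m τ →ₐ[ℚ] Form n τ :=
  pushHom (blk α) (blk_pmono α)

theorem pushBlk_of_good {α : Fin (m + 1) →o Fin (n + 1)} {J : Finset (Fin n)} (h : Good (blk α) J)
    (u : Form m τ) : pushBlk α u J = u (shadow (blk α) J) := push_of_good h u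

theorem pushBlk_of_not_good {α : Fin (m + 1) →o Fin (n + 1)} {J : Finset (Fin n)}
    (h : ¬ Good (blk α) J) (u : Form m τ) : pushBlk α u J = 0 := push_of_not_good h u

theorem pushBlk_id (u : Form n τ) : pushBlk OrderHom.id u = u := by
  ext J
  have hb : blk (OrderHom.id : Fin (n + 1) →o Fin (n + 1)) = some := funext blk_id
  have hg : Good (blk (OrderHom.id : Fin (n + 1) →o Fin (n + 1))) J := by rw [hb]; exact good_some J
  rw [pushBlk_of_good hg, hb, shadow_some]

theorem pushBlk_comp (α : Fin (m + 1) →o Fin (n + 1)) (β : Fin (l + 1) →o Fin (m + 1))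
    (u : Form l τ) : pushBlk (α.comp β) u = pushBlk α (pushBlk β u) := by
  ext J
  have hb : blk (α.comp β) = fun k => (blk α k).bind (blk β) := funext (blk_comp α β)
  by_cases h : Good (blk (α.comp β)) J
  · rw [pushBlk_of_good h]
    rw [hb] at h
    rw [pushBlk_of_good (good_bind.1 h).1, pushBlk_of_good (good_bind.1 h).2, hb, shadow_bind]
  · rw [pushBlk_of_not_good h]
    rw [hb, good_bind, not_and] at h
    by_cases h' : Good (blk α) J
    · rw [pushBlk_of_good h', pushBlk_of_not_good (h h')]
    · rw [pushBlk_of_not_good h']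

theorem parity_pushBlk (α : Fin (m + 1) →o Fin (n + 1)) (u : Form m τ) :
    parity (pushBlk α u) = pushBlk α (parity u) := by
  ext J
  rw [parity_apply]
  by_cases h : Good (blk α) J
  · rw [pushBlk_of_good h, pushBlk_of_good h, parity_apply, h.card_shadow]
  · rw [pushBlk_of_not_good h, pushBlk_of_not_good h, map_zero, smul_zero]

theorem map_pushBlk {R' : Type*} [Ring R'] [Algebra ℚ R'] {τ' : R' →ₐ[ℚ] R'} (f : R →ₐ[ℚ] R')
    (hf : ∀ x, f (τ x) = τ' (f x)) (α : Fin (m + 1) →o Fin (n + 1)) (u : Form m τ) :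
    map f hf (pushBlk α u) = pushBlk α (map f hf u) := by
  ext J
  rw [map_apply]
  by_cases h : Good (blk α) J
  · rw [pushBlk_of_good h, pushBlk_of_good h, map_apply]
  · rw [pushBlk_of_not_good h, pushBlk_of_not_good h, map_zero]

/-- The steps below α(β 0) are the steps below α 0 together with the α-blocks of the steps below β
0. This cocycle identity is what makes the twisted operators compose. -/
theorem pushBlk_theta (α : Fin (m + 1) →o Fin (n + 1)) (β : Fin (l + 1) →o Fin (m + 1)) :
    pushBlk α (theta (β 0).val : Form m τ) + theta (α 0).val = theta (α (β 0)).val := by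
  ext J
  rw [add_apply, theta_apply, theta_apply]
  have hα : α 0 ≤ α (β 0) := α.monotone (Fin.zero_le _)
  rw [Fin.le_def] at hα
  by_cases hJ : ∃ k, J = {k}
  · obtain ⟨k, rfl⟩ := hJ
    have h1 : pushBlk α (theta (β 0).val : Form m τ) {k} =
        if (α 0).val ≤ k ∧ k < (α (β 0)).val then 1 else 0 := by
      by_cases h : Good (blk α) {k}
      · obtain ⟨j, hj⟩ := h.1 k (Finset.mem_singleton_self k)
        have hs : shadow (blk α) {k} = {j} := by
          ext i; simp only [mem_shadow, Finset.mem_singleton, exists_eq_left, hj, Option.some_inj]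
          exact eq_comm
        rw [pushBlk_of_good h, theta_apply, hs]
        rw [blk_eq_some] at hj
        have h0 : α 0 ≤ α j.castSucc := α.monotone (Fin.zero_le _)
        rw [Fin.le_def] at h0
        refine if_congr ⟨?_, ?_⟩ rfl rfl
        · rintro ⟨i, hi, hlt⟩
          rw [Finset.singleton_inj] at hi
          subst hi
          have : α j.succ ≤ α (β 0) := α.monotone (by rw [Fin.le_def, Fin.val_succ]; exact hlt)
          rw [Fin.le_def] at this
          omega
        · rintro ⟨h3, h4⟩
          refine ⟨j, rfl, ?_⟩
          by_contra hlt
          have : α (β 0) ≤ α j.castSucc := α.monotone (by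
            rw [Fin.le_def, Fin.val_castSucc]; omega)
          rw [Fin.le_def] at this
          omega
      · rw [pushBlk_of_not_good h, if_neg]
        rintro ⟨h3, h4⟩
        obtain ⟨j, -, -, h5, h6⟩ := exists_step_fin (f := α) (Fin.zero_le (β 0)) h3 h4
        refine h ⟨fun k' hk' => ?_, by simp⟩
        rw [Finset.mem_singleton] at hk'
        subst hk'
        exact ⟨j, blk_eq_some.2 ⟨h5, h6⟩⟩
    rw [h1]
    simp only [Finset.singleton_inj, exists_eq_left']
    by_cases h3 : k.val < (α 0).val
    · rw [if_neg (by omega), if_pos h3, if_pos (by omega), zero_add]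
    · rw [if_neg h3, add_zero]
      exact if_congr (by omega) rfl rfl
  · have h0 : ∀ t : ℕ, ¬ ∃ k : Fin n, J = {k} ∧ k.val < t := fun t ⟨k, hk, _⟩ => hJ ⟨k, hk⟩
    rw [if_neg (h0 _), if_neg (h0 _), add_zero]
    by_cases h : Good (blk α) J
    · rw [pushBlk_of_good h, theta_apply, if_neg]
      rintro ⟨j, hj, -⟩
      apply hJ
      rw [← Finset.card_eq_one, ← h.card_shadow, hj, Finset.card_singleton]
    · rw [pushBlk_of_not_good h]

end Form

/-! ### Parity and graded derivations of the tensor algebra. -/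

namespace Tens

section Parity

variable {Γ : Type*} {ι : Type} [AddCommMonoid ι]

/-- The parity operator of the tensor algebra. -/
noncomputable def par (e : Γ → ℕ) : Tens Γ →ₐ[ℚ] Tens Γ := algLift fun g => (-1 : ℚ) ^ e g • wd [g]

theorem par_gen (e : Γ → ℕ) (g : Γ) : par e (wd [g]) = (-1 : ℚ) ^ e g • wd [g] := algLift_gen _ g

theorem par_wd (e : Γ → ℕ) (w : List Γ) : par e (wd w) = (-1 : ℚ) ^ (w.map e).sum • wd w := by
  induction w with
  | nil => rw [wd_nil, map_one]; simp
  | cons g w ih =>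
    rw [wd_cons, map_mul, ih, par_gen, smul_mul_smul_comm, ← pow_add, List.map_cons, List.sum_cons]

/-- The derivation, in the graded sense, with given values on the generators, on words. -/
noncomputable def derWd (e : Γ → ℕ) (δ : Γ → Tens Γ) : List Γ → Tens Γ
  | [] => 0
  | g :: w => δ g * wd w + (-1 : ℚ) ^ e g • (wd [g] * derWd e δ w)

/-- The derivation, in the graded sense, with given values on the generators. -/
noncomputable def der (e : Γ → ℕ) (δ : Γ → Tens Γ) : Tens Γ →ₗ[ℚ] Tens Γ := lift (derWd e δ)

variable (e : Γ → ℕ) (δ : Γ → Tens Γ)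

theorem der_one : der e δ 1 = 0 := by rw [← wd_nil, der, lift_wd]; rfl

theorem der_cons (g : Γ) (w : List Γ) :
    der e δ (wd (g :: w)) = δ g * wd w + (-1 : ℚ) ^ e g • (wd [g] * der e δ (wd w)) := by
  rw [der, lift_wd, lift_wd]; rfl

theorem der_gen (g : Γ) : der e δ (wd [g]) = δ g := by
  rw [der_cons, wd_nil, der_one]; simp

theorem der_mul (a b : Tens Γ) : der e δ (a * b) = der e δ a * b + par e a * der e δ b := by
  refine LinearMap.congr_fun₂ (f := (LinearMap.mul ℚ (Tens Γ)).compr₂ (der e δ))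
    (g := (LinearMap.mul ℚ (Tens Γ)).comp (der e δ) +
      (LinearMap.mul ℚ (Tens Γ)).compl₁₂ (par e).toLinearMap (der e δ)) (bilin_ext fun w w' => ?_) a b
  change der e δ (wd w * wd w') = der e δ (wd w) * wd w' + par e (wd w) * der e δ (wd w')
  induction w with
  | nil => rw [wd_nil, der_one, map_one]; simp
  | cons g w ih =>
    rw [wd_mul, List.cons_append, der_cons, ← wd_mul, ih, der_cons, wd_cons g w, map_mul, par_gen]
    simp only [mul_add, add_mul, smul_add, smul_mul_assoc, mul_assoc, add_assoc]

end Parity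

end Tens

namespace Form

variable {R : Type*} [Ring R] [Algebra ℚ R] {n m l : ℕ} {τ : R →ₐ[ℚ] R}

theorem parity_one : parity (1 : Form n τ) = 1 := by
  ext K
  rw [parity_apply, one_apply]
  split_ifs with h
  · subst h; simp
  · simp

theorem parity_mul (u v : Form n τ) : parity (u * v) = parity u * parity v := by
  ext K
  rw [parity_apply, mul_apply, mul_apply, map_sum, Finset.smul_sum]
  refine Finset.sum_congr rfl fun I hI => ?_
  rw [parity_apply, parity_apply, map_smul, map_mul, map_smul, smul_mul_smul_comm, smul_smul,
    smul_smul, ← pow_add, add_comm, Finset.card_sdiff_add_card_eq_card (Finset.mem_powerset.1 hI),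
    mul_comm]
  congr 2
  change (τ * τ ^ _) (u I) = (τ ^ _ * τ) (u I)
  rw [← pow_succ, ← pow_succ']

/-- Forms all of whose terms have the same number of odd variables. -/
def IsHom (p : ℕ) (u : Form n τ) : Prop := ∀ K, K.card ≠ p → u K = 0

theorem IsHom.mul {p q : ℕ} {u v : Form n τ} (hu : IsHom p u) (hv : IsHom q v) :
    IsHom (p + q) (u * v) := by
  intro K hK
  rw [mul_apply]
  refine Finset.sum_eq_zero fun I hI => ?_
  have := Finset.card_sdiff_add_card_eq_card (Finset.mem_powerset.1 hI)
  by_cases h : I.card = p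
  · rw [hv _ (by omega), mul_zero, smul_zero]
  · rw [hu _ h, map_zero, zero_mul, smul_zero]

theorem isHom_one : IsHom 0 (1 : Form n τ) := fun K hK => by
  rw [one_apply, if_neg]; rintro rfl; exact hK rfl

theorem isHom_theta (t : ℕ) : IsHom 1 (theta t : Form n τ) := fun K hK => by
  rw [theta_apply, if_neg]; rintro ⟨k, rfl, -⟩; exact hK (Finset.card_singleton k)

theorem IsHom.pushBlk {p : ℕ} {u : Form m τ} (hu : IsHom p u) (α : Fin (m + 1) →o Fin (n + 1)) :
    IsHom p (pushBlk α u) := by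
  intro K hK
  by_cases h : Good (blk α) K
  · rw [pushBlk_of_good h, hu _ (by rwa [h.card_shadow])]
  · rw [pushBlk_of_not_good h]

/-- The forms with coefficients in a subspace. -/
def coeffIn (B : Submodule ℚ R) : Submodule ℚ (Form n τ) where
  carrier := {u | ∀ K, u K ∈ B}
  add_mem' hu hv K := add_mem (hu K) (hv K)
  zero_mem' _ := zero_mem _
  smul_mem' c _ hu K := B.smul_mem c (hu K)

theorem pushBlk_mem_coeffIn {B : Submodule ℚ R} {u : Form m τ} (hu : u ∈ coeffIn B)
    (α : Fin (m + 1) →o Fin (n + 1)) : pushBlk α u ∈ coeffIn B := by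
  intro K
  by_cases h : Good (blk α) K
  · rw [pushBlk_of_good h]; exact hu _
  · rw [pushBlk_of_not_good h]; exact zero_mem _

theorem theta_mul_mem_coeffIn {B : Submodule ℚ R} {u : Form n τ} (hu : u ∈ coeffIn B) (t : ℕ) :
    theta t * u ∈ coeffIn B := by
  rw [theta, Finset.sum_mul]
  refine Submodule.sum_mem _ fun k _ K => ?_
  rw [omega_mul]
  split_ifs
  · exact B.smul_mem _ (hu _)
  · exact zero_mem _

end Form

/-! ### The simplicial operators twisted by a differential. -/

open Tens Form

/-- Quillen data: a differential on the free bigraded Lie algebra, by its values on generators. -/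
structure FreeDiff (X : Type u) where
  dg : X → ℕ × ℕ
  δ : X → Tens X
  mem_lie : ∀ x, δ x ∈ lieSub totalDegree dg
  deg_succ : ∀ x p s, dg x = (p + 1, s) → δ x ∈ tgr dg (p, s)
  deg_zero : ∀ x, (dg x).1 = 0 → δ x = 0
  len : ∀ x, δ x ∈ sup (fun w => 2 ≤ w.length)
  sq_zero : ∀ x, der (fun x => totalDegree (dg x)) δ (δ x) = 0

/-- The generators in simplicial dimension `n`. -/
abbrev SGen {X : Type u} (dg : X → ℕ × ℕ) (n : ℕ) : Type u :=
  {g : X × Finset (Fin n) // g.2.card = (dg g.1).1}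

namespace FreeDiff

variable {X : Type u} (D : FreeDiff X)

/-- The total degree of a generator. -/
abbrev tdeg (x : X) : ℕ := totalDegree (D.dg x)

/-- The differential. -/
noncomputable abbrev d : Tens X →ₗ[ℚ] Tens X := der D.tdeg D.δ

/-- The internal degree of a generator. -/
def ideg (n : ℕ) (g : SGen D.dg n) : ℕ := (D.dg g.1.1).2

/-- The tensor algebra in simplicial dimension `n`. -/
abbrev T (n : ℕ) := Tens (SGen D.dg n)

/-- The parity operator in simplicial dimension `n`. -/
noncomputable abbrev τ (n : ℕ) : D.T n →ₐ[ℚ] D.T n := par (D.ideg n)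

/-- The universal form of a generator. -/
noncomputable def EGen (n : ℕ) (x : X) : Form n (D.τ n) :=
  ⟨fun I => if h : I.card = (D.dg x).1 then wd [⟨(x, I), h⟩] else 0⟩

theorem EGen_of_card {n : ℕ} {x : X} {I : Finset (Fin n)} (h : I.card = (D.dg x).1) :
    D.EGen n x I = wd [⟨(x, I), h⟩] := dif_pos h

/-- The universal form of an element. -/
noncomputable def E (n : ℕ) : Tens X →ₐ[ℚ] Form n (D.τ n) := algLift (D.EGen n)

theorem E_gen (n : ℕ) (x : X) : D.E n (wd [x]) = D.EGen n x := algLift_gen _ x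

theorem isHom_EGen (n : ℕ) (x : X) : IsHom (D.dg x).1 (D.EGen n x) := fun _ hK => dif_neg hK

theorem isHom_E_wd (n : ℕ) (w : List X) : IsHom (wdeg D.dg w).1 (D.E n (wd w)) := by
  induction w with
  | nil => rw [wd_nil, map_one]; exact isHom_one
  | cons x w ih =>
    rw [wd_cons, map_mul, E_gen, wdeg_cons]
    exact (D.isHom_EGen n x).mul ih

theorem isHom_E {n p s : ℕ} {a : Tens X} (ha : a ∈ tgr D.dg (p, s)) : IsHom p (D.E n a) := by
  intro K hK
  refine eq_on_sup (f := coeff K ∘ₗ (D.E n).toLinearMap) (g := 0) (fun w hw => ?_) ha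
  exact D.isHom_E_wd n w K (by rw [hw]; exact hK)

theorem parity_EGen (n : ℕ) (x : X) :
    parity (D.EGen n x) = (-1 : ℚ) ^ D.tdeg x • D.EGen n x := by
  refine Form.ext fun K => ?_
  rw [parity_apply, Form.smul_apply]
  by_cases h : K.card = (D.dg x).1
  · rw [EGen_of_card D h, par_gen, smul_smul, ← pow_add, h]; rfl
  · rw [D.isHom_EGen n x K h, map_zero, smul_zero, smul_zero]

theorem parity_E (n : ℕ) (a : Tens X) : parity (D.E n a) = D.E n (par D.tdeg a) := by
  refine LinearMap.congr_fun (f := parity ∘ₗ (D.E n).toLinearMap)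
    (g := (D.E n).toLinearMap ∘ₗ (par D.tdeg).toLinearMap) (lin_ext fun w => ?_) a
  change parity (D.E n (wd w)) = D.E n (par D.tdeg (wd w))
  induction w with
  | nil => rw [wd_nil, map_one (D.E n), parity_one, map_one (par _), map_one]
  | cons x w ih =>
    rw [wd_cons, map_mul, parity_mul, ih, map_mul, map_mul, E_gen, parity_EGen, par_gen, map_smul,
      E_gen]

/-- The differential lowers the total degree by one, hence reverses parity; in homological degree 0
both sides are zero. -/
theorem par_δ (x : X) : par D.tdeg (D.δ x) = -((-1 : ℚ) ^ D.tdeg x • D.δ x) := by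
  by_cases h : (D.dg x).1 = 0
  · rw [D.deg_zero x h, map_zero, smul_zero, neg_zero]
  · obtain ⟨p, hp⟩ := Nat.exists_eq_succ_of_ne_zero h
    have hx := D.deg_succ x p (D.dg x).2 (Prod.ext hp rfl)
    rw [← neg_smul]
    refine eq_on_sup (f := (par D.tdeg).toLinearMap)
      (g := (-(-1 : ℚ) ^ D.tdeg x) • LinearMap.id) (fun w hw => ?_) hx
    have h1 : (w.map D.tdeg).sum = p + (D.dg x).2 := by
      change wdeg D.tdeg w = _
      rw [wdeg_comp, hw]; rfl
    have h2 : D.tdeg x = (p + (D.dg x).2) + 1 := by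
      change (D.dg x).1 + (D.dg x).2 = _
      omega
    change par D.tdeg (wd w) = (-(-1 : ℚ) ^ D.tdeg x) • wd w
    rw [par_wd, h1, h2, pow_succ]; simp

variable {n m l : ℕ}

/-- The form defining the operator `α` on generators. -/
noncomputable def opForm (α : Fin (m + 1) →o Fin (n + 1)) (a : Tens X) : Form n (D.τ m) :=
  pushBlk α (D.E m a) + theta (α 0).val * pushBlk α (D.E m (D.d a))

/-- The form is the push-forward of E(exp(θd) a). In the product the two terms linear in θ combine
by the graded Leibniz rule, the parity operator arising when θ is moved to the front, and the
quadratic term contains θ² = 0. -/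
theorem opForm_mul (α : Fin (m + 1) →o Fin (n + 1)) (a b : Tens X) :
    D.opForm α (a * b) = D.opForm α a * D.opForm α b := by
  have h := theta_mul_self (R := D.T m) (n := n) (τ := D.τ m) (α 0).val
  simp only [opForm, der_mul, map_mul, map_add, mul_add, add_mul]
  have h1 : pushBlk α (D.E m a) * (theta (α 0).val * pushBlk α (D.E m (D.d b))) =
      theta (α 0).val * (pushBlk α (D.E m (par D.tdeg a)) * pushBlk α (D.E m (D.d b))) := by
    rw [← mul_assoc, mul_theta, parity_pushBlk, parity_E, mul_assoc]
  have h2 : theta (α 0).val * pushBlk α (D.E m (D.d a)) *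
      (theta (α 0).val * pushBlk α (D.E m (D.d b))) = 0 := by
    rw [mul_assoc, ← mul_assoc (pushBlk α (D.E m (D.d a))), mul_theta, ← mul_assoc, ← mul_assoc, h]
    simp
  rw [h1, h2, add_zero, ← mul_assoc (theta _), add_assoc]

theorem opForm_one (α : Fin (m + 1) →o Fin (n + 1)) : D.opForm α 1 = 1 := by
  rw [opForm, der_one]; simp

/-- The operator `α` on the tensor algebras. -/
noncomputable def op (α : Fin (m + 1) →o Fin (n + 1)) : D.T n →ₐ[ℚ] D.T m :=
  algLift fun g => D.opForm α (wd [g.1.1]) g.1.2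

theorem op_gen (α : Fin (m + 1) →o Fin (n + 1)) (g : SGen D.dg n) :
    D.op α (wd [g]) = D.opForm α (wd [g.1.1]) g.1.2 := algLift_gen _ g

theorem isHom_opForm_gen (α : Fin (m + 1) →o Fin (n + 1)) (x : X) :
    IsHom (D.dg x).1 (D.opForm α (wd [x])) := by
  intro K hK
  rw [opForm, Form.add_apply, E_gen, (D.isHom_EGen m x).pushBlk α K hK, zero_add, der_gen]
  by_cases h : (D.dg x).1 = 0
  · rw [D.deg_zero x h]; simp
  · obtain ⟨p, hp⟩ := Nat.exists_eq_succ_of_ne_zero h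
    have hx := D.deg_succ x p (D.dg x).2 (Prod.ext hp rfl)
    exact (isHom_theta _).mul ((D.isHom_E hx).pushBlk α) K (by omega)

theorem parity_opForm_gen (α : Fin (m + 1) →o Fin (n + 1)) (x : X) :
    parity (D.opForm α (wd [x])) = (-1 : ℚ) ^ D.tdeg x • D.opForm α (wd [x]) := by
  rw [opForm, der_gen, map_add, parity_mul, parity_theta, parity_pushBlk, parity_pushBlk, parity_E,
    parity_E, par_gen, par_δ]
  simp

/-- The form of a generator is an eigenvector of the total parity. Compare the coefficients of ω_I:
the sign (-1)^|I| belonging to the variables cancels, and the internal parity remains. -/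
theorem op_τ (α : Fin (m + 1) →o Fin (n + 1)) (y : D.T n) : D.op α (D.τ n y) = D.τ m (D.op α y) := by
  refine AlgHom.congr_fun (φ₁ := (D.op α).comp (D.τ n)) (φ₂ := (D.τ m).comp (D.op α))
    (algHom_ext fun g => ?_) y
  change D.op α (D.τ n (wd [g])) = D.τ m (D.op α (wd [g]))
  rw [par_gen, map_smul, op_gen]
  have h := congrArg (fun u : Form n (D.τ m) => u g.1.2) (D.parity_opForm_gen α g.1.1)
  simp only [parity_apply, Form.smul_apply] at h
  have hs : D.tdeg g.1.1 = g.1.2.card + D.ideg n g := by rw [g.2]; rfl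
  rw [hs, pow_add, mul_smul] at h
  exact (smul_right_injective _ (pow_ne_zero _ (by norm_num : (-1 : ℚ) ≠ 0)) h).symm

/-- On generators this is the definition of `op`, and both sides are multiplicative in a. It is
needed for a = dx, in order to compose operators. -/
theorem map_op_E (α : Fin (m + 1) →o Fin (n + 1)) (a : Tens X) :
    Form.map (D.op α) (D.op_τ α) (D.E n a) = D.opForm α a := by
  have h : ∀ w, Form.map (D.op α) (D.op_τ α) (D.E n (wd w)) = D.opForm α (wd w) := by
    intro w
    induction w with
    | nil => rw [wd_nil, map_one, map_one, opForm_one]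
    | cons x w ih =>
      rw [wd_cons, map_mul, map_mul, ih, opForm_mul, E_gen]
      congr 1
      refine Form.ext fun K => ?_
      rw [Form.map_apply]
      by_cases hK : K.card = (D.dg x).1
      · rw [D.EGen_of_card hK, op_gen]
      · rw [D.isHom_EGen n x K hK, map_zero, D.isHom_opForm_gen α x K hK]
  refine LinearMap.congr_fun (f := (Form.map (D.op α) (D.op_τ α)).toLinearMap ∘ₗ
    (D.E n).toLinearMap) (g := (pushBlk α).toLinearMap ∘ₗ (D.E m).toLinearMap +
    LinearMap.mulLeft ℚ (theta (α 0).val) ∘ₗ (pushBlk α).toLinearMap ∘ₗ (D.E m).toLinearMap ∘ₗ D.d)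
    (lin_ext h) a

theorem op_E (α : Fin (m + 1) →o Fin (n + 1)) (a : Tens X) (K : Finset (Fin n)) :
    D.op α (D.E n a K) = D.opForm α a K :=
  congrArg (fun u : Form n (D.τ m) => u K) (D.map_op_E α a)

theorem op_id (y : D.T n) : D.op OrderHom.id y = y := by
  refine AlgHom.congr_fun (φ₂ := AlgHom.id ℚ (D.T n)) (algHom_ext fun g => ?_) y
  rw [op_gen, opForm]
  simp only [OrderHom.id_coe, id_eq, Fin.val_zero, theta_zero, zero_mul, add_zero, pushBlk_id, E_gen]
  exact D.EGen_of_card g.2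

/-- Composing exp(θd) with exp(θ'd) produces one term containing d², which vanishes, and two terms
linear in d, whose θ's add up by `pushBlk_theta`. -/
theorem map_opForm_gen (α : Fin (m + 1) →o Fin (n + 1)) (β : Fin (l + 1) →o Fin (m + 1)) (x : X) :
    Form.map (D.op β) (D.op_τ β) (D.opForm α (wd [x])) = D.opForm (α.comp β) (wd [x]) := by
  rw [opForm, map_add, map_mul, map_theta, map_pushBlk, map_pushBlk, map_op_E, map_op_E, der_gen,
    opForm, opForm, D.sq_zero, opForm, der_gen]
  simp only [map_zero, mul_zero, add_zero, map_add, map_mul, pushBlk_comp]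
  rw [add_assoc, ← add_mul]
  rw [pushBlk_theta]; rfl

theorem op_comp (α : Fin (m + 1) →o Fin (n + 1)) (β : Fin (l + 1) →o Fin (m + 1)) (y : D.T n) :
    D.op (α.comp β) y = D.op β (D.op α y) := by
  refine AlgHom.congr_fun (φ₂ := (D.op β).comp (D.op α)) (algHom_ext fun g => ?_) y
  rw [op_gen, ← map_opForm_gen, AlgHom.comp_apply, op_gen, Form.map_apply]

/-- The operator `α` on the tensor algebras, for the differential zero. -/
noncomputable def op₀ (α : Fin (m + 1) →o Fin (n + 1)) : D.T n →ₐ[ℚ] D.T m :=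
  algLift fun g => pushBlk α (D.EGen m g.1.1) g.1.2

theorem op₀_gen (α : Fin (m + 1) →o Fin (n + 1)) (g : SGen D.dg n) :
    D.op₀ α (wd [g]) = pushBlk α (D.EGen m g.1.1) g.1.2 := algLift_gen _ g

theorem op₀_τ (α : Fin (m + 1) →o Fin (n + 1)) (y : D.T n) :
    D.op₀ α (D.τ n y) = D.τ m (D.op₀ α y) := by
  refine AlgHom.congr_fun (φ₁ := (D.op₀ α).comp (D.τ n)) (φ₂ := (D.τ m).comp (D.op₀ α))
    (algHom_ext fun g => ?_) y
  change D.op₀ α (D.τ n (wd [g])) = D.τ m (D.op₀ α (wd [g]))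
  rw [par_gen, map_smul, op₀_gen]
  have h := congrArg (fun u : Form n (D.τ m) => u g.1.2) (parity_pushBlk α (D.EGen m g.1.1))
  rw [parity_EGen, map_smul] at h
  simp only [parity_apply, Form.smul_apply] at h
  have hs : D.tdeg g.1.1 = g.1.2.card + D.ideg n g := by rw [g.2]; rfl
  rw [hs, pow_add, mul_smul] at h
  exact (smul_right_injective _ (pow_ne_zero _ (by norm_num : (-1 : ℚ) ≠ 0)) h).symm

theorem map_op₀_E (α : Fin (m + 1) →o Fin (n + 1)) (a : Tens X) :
    Form.map (D.op₀ α) (D.op₀_τ α) (D.E n a) = pushBlk α (D.E m a) := by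
  refine AlgHom.congr_fun (φ₁ := (Form.map (D.op₀ α) (D.op₀_τ α)).comp (D.E n))
    (φ₂ := (pushBlk α).comp (D.E m)) (algHom_ext fun x => Form.ext fun K => ?_) a
  rw [AlgHom.comp_apply, AlgHom.comp_apply, E_gen, E_gen, Form.map_apply]
  by_cases hK : K.card = (D.dg x).1
  · rw [D.EGen_of_card hK, op₀_gen]
  · rw [D.isHom_EGen n x K hK, map_zero, (D.isHom_EGen m x).pushBlk α K hK]

theorem op₀_E (α : Fin (m + 1) →o Fin (n + 1)) (a : Tens X) (K : Finset (Fin n)) :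
    D.op₀ α (D.E n a K) = pushBlk α (D.E m a) K :=
  congrArg (fun u : Form n (D.τ m) => u K) (D.map_op₀_E α a)

theorem op₀_id (y : D.T n) : D.op₀ OrderHom.id y = y := by
  refine AlgHom.congr_fun (φ₂ := AlgHom.id ℚ (D.T n)) (algHom_ext fun g => ?_) y
  rw [op₀_gen, pushBlk_id]
  exact D.EGen_of_card g.2

theorem op₀_comp (α : Fin (m + 1) →o Fin (n + 1)) (β : Fin (l + 1) →o Fin (m + 1)) (y : D.T n) :
    D.op₀ (α.comp β) y = D.op₀ β (D.op₀ α y) := by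
  refine AlgHom.congr_fun (φ₂ := (D.op₀ β).comp (D.op₀ α)) (algHom_ext fun g => ?_) y
  rw [AlgHom.comp_apply, op₀_gen, op₀_gen, pushBlk_comp, ← E_gen, ← E_gen, ← map_op₀_E,
    ← map_pushBlk, Form.map_apply]

end FreeDiff

/-! ### Algebra maps, word length, degree and Lie elements. -/

namespace Tens

variable {Γ Γ' : Type*}

/-- The span of the words of length at least `k`. -/
noncomputable abbrev tge (k : ℕ) : Submodule ℚ (Tens Γ) := sup fun w => k ≤ w.length

theorem tge_anti {k l : ℕ} (h : k ≤ l) : (tge l : Submodule ℚ (Tens Γ)) ≤ tge k :=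
  sup_mono fun _ => h.trans

theorem tge_mul {k l : ℕ} {x y : Tens Γ} (hx : x ∈ tge k) (hy : y ∈ tge l) : x * y ∈ tge (k + l) :=
  mul_mem_sup (fun w w' h h' => by rw [List.length_append]; omega) hx hy

theorem mem_tge_zero (x : Tens Γ) : x ∈ tge 0 := sup_mono (fun _ _ => Nat.zero_le _) (mem_sup_top x)

theorem algHom_mem_tge {f : Tens Γ →ₐ[ℚ] Tens Γ'} (hf : ∀ g, f (wd [g]) ∈ tge 1) {k : ℕ}
    {x : Tens Γ} (hx : x ∈ tge k) : f x ∈ tge k := by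
  have h : ∀ w, f (wd w) ∈ tge w.length := by
    intro w
    induction w with
    | nil => exact mem_tge_zero _
    | cons g w ih =>
      rw [wd_cons, map_mul, List.length_cons, add_comm]
      exact tge_mul (hf g) ih
  exact map_mem_of_sup (f := f.toLinearMap) (fun w hw => tge_anti hw (h w)) hx

/-- Telescoping along the word: f(gw) − f'(gw) = (f(g) − f'(g)) f(w) + f'(g) (f(w) − f'(w)), and
each summand gains one extra letter. -/
theorem algHom_sub_mem_tge {f f' : Tens Γ →ₐ[ℚ] Tens Γ'} (hf : ∀ g, f (wd [g]) ∈ tge 1)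
    (hf' : ∀ g, f' (wd [g]) ∈ tge 1) (hff : ∀ g, f (wd [g]) - f' (wd [g]) ∈ tge 2) {k : ℕ}
    {x : Tens Γ} (hx : x ∈ tge k) : f x - f' x ∈ tge (k + 1) := by
  have h : ∀ w, f (wd w) - f' (wd w) ∈ tge (w.length + 1) := by
    intro w
    induction w with
    | nil => rw [wd_nil, map_one, map_one, sub_self]; exact zero_mem _
    | cons g w ih =>
      rw [wd_cons, map_mul, map_mul, List.length_cons]
      have e : f (wd [g]) * f (wd w) - f' (wd [g]) * f' (wd w) =
          (f (wd [g]) - f' (wd [g])) * f (wd w) + f' (wd [g]) * (f (wd w) - f' (wd w)) := by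
        noncomm_ring
      rw [e]
      refine add_mem (tge_anti (by omega) (tge_mul (hff g) (algHom_mem_tge hf (wd_mem_sup le_rfl))))
        (tge_anti (by omega) (tge_mul (hf' g) ih))
  exact map_mem_of_sup (f := f.toLinearMap - f'.toLinearMap) (fun w hw => tge_anti (by omega) (h w)) hx

theorem algHom_mem_tgr {ι : Type} [AddCommMonoid ι] {e : Γ → ι} {e' : Γ' → ι}
    {f : Tens Γ →ₐ[ℚ] Tens Γ'} (hf : ∀ g, f (wd [g]) ∈ tgr e' (e g)) {i : ι} {x : Tens Γ}
    (hx : x ∈ tgr e i) : f x ∈ tgr e' i := by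
  have h : ∀ w, f (wd w) ∈ tgr e' (wdeg e w) := by
    intro w
    induction w with
    | nil => rw [wd_nil, map_one, ← wd_nil]; exact wd_mem_sup rfl
    | cons g w ih =>
      rw [wd_cons, map_mul, wdeg_cons]
      exact mul_mem_tgr (hf g) ih
  exact map_mem_of_sup (f := f.toLinearMap) (fun w hw => hw ▸ h w) hx

theorem algHom_mem_tlen {f : Tens Γ →ₐ[ℚ] Tens Γ'} (hf : ∀ g, f (wd [g]) ∈ tlen 1) {k : ℕ}
    {x : Tens Γ} (hx : x ∈ tlen k) : f x ∈ tlen k := by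
  have h : ∀ w, f (wd w) ∈ tlen w.length := by
    intro w
    induction w with
    | nil => rw [wd_nil, map_one, ← wd_nil]; exact wd_mem_sup rfl
    | cons g w ih =>
      rw [wd_cons, map_mul, List.length_cons, add_comm]
      exact mul_mem_tlen (hf g) ih
  exact map_mem_of_sup (f := f.toLinearMap) (fun w hw => hw ▸ h w) hx

end Tens

theorem lieSub_tge {Γ : Type u} {ι : Type} [AddCommMonoid ι] {tot : ι →+ ℕ} {deg : Γ → ι} {x : Tens Γ}
    (hx : x ∈ lieSub tot deg) : x ∈ tge 1 :=
  mapsTo_lieSub (f := LinearMap.id)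
    (fun _ _ _ h => sup_mono (fun w hw => by have := h.pos; omega) h.mem_tlen) hx

theorem algHom_lbr {Γ Γ' : Type u} {ι : Type} [AddCommMonoid ι] {tot : ι →+ ℕ} {deg : Γ → ι}
    {deg' : Γ' → ι} {f : Tens Γ →ₐ[ℚ] Tens Γ'} (hf : ∀ g, f (wd [g]) ∈ tgr deg' (deg g)) (x y : Tens Γ) :
    f (lbr (fun g => tot (deg g)) x y) = lbr (fun g => tot (deg' g)) (f x) (f y) := by
  refine LinearMap.congr_fun₂ (f := (lbr fun g => tot (deg g)).compr₂ f.toLinearMap)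
    (g := (lbr fun g => tot (deg' g)).compl₁₂ f.toLinearMap f.toLinearMap)
    (bilin_ext fun w w' => ?_) x y
  have h : ∀ w, wd w ∈ tgr deg (wdeg deg w) := fun w => wd_mem_sup rfl
  change f (lbr _ (wd w) (wd w')) = lbr _ (f (wd w)) (f (wd w'))
  rw [lbr_homog (h w) (h w'), lbr_homog (algHom_mem_tgr hf (h w)) (algHom_mem_tgr hf (h w')), map_sub,
    map_smul, map_mul, map_mul]

theorem algHom_mem_lieSub {Γ Γ' : Type u} {ι : Type} [AddCommMonoid ι] {tot : ι →+ ℕ} {deg : Γ → ι}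
    {deg' : Γ' → ι} {f : Tens Γ →ₐ[ℚ] Tens Γ'} (hf : ∀ g, f (wd [g]) ∈ tgr deg' (deg g))
    (hf' : ∀ g, f (wd [g]) ∈ lieSub tot deg') {x : Tens Γ} (hx : x ∈ lieSub tot deg) :
    f x ∈ lieSub tot deg' := by
  refine mapsTo_lieSub (f := f.toLinearMap) (fun i n x hx => ?_) hx
  change f x ∈ _
  induction hx with
  | gen g => exact hf' g
  | bracket _ _ h h' => rw [algHom_lbr hf]; exact lbr_mem_lieSub h h'

theorem par_pow_apply {Γ : Type*} (e : Γ → ℕ) {s : ℕ} {x : Tens Γ} (hx : x ∈ tgr e s) (k : ℕ) :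
    (par e ^ k) x = (-1 : ℚ) ^ (s * k) • x := by
  have h1 : par e x = (-1 : ℚ) ^ s • x := by
    refine eq_on_sup (f := (par e).toLinearMap) (g := (-1 : ℚ) ^ s • LinearMap.id) (fun w hw => ?_) hx
    change par e (wd w) = (-1 : ℚ) ^ s • wd w
    rw [par_wd, ← hw]; rfl
  induction k with
  | zero => simp
  | succ k ih =>
    rw [pow_succ', AlgHom.mul_apply, ih, map_smul, h1, smul_smul, ← pow_add, mul_add, mul_one]

theorem par_pow_mem_sup {Γ : Type*} (e : Γ → ℕ) {P : List Γ → Prop} {x : Tens Γ} (hx : x ∈ sup P)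
    (k : ℕ) : (par e ^ k) x ∈ sup P := by
  induction k with
  | zero => exact hx
  | succ k ih =>
    rw [pow_succ', AlgHom.mul_apply]
    refine map_mem_of_sup (f := (par e).toLinearMap) (fun w hw => ?_) ih
    change par e (wd w) ∈ _
    rw [par_wd]
    exact Submodule.smul_mem _ _ (wd_mem_sup hw)

namespace Form

variable {Γ : Type u} {e : Γ → ℕ} {n : ℕ}

theorem mul_mem_coeffIn_sup {P Q R : List Γ → Prop} (h : ∀ w w', P w → Q w' → R (w ++ w'))
    {u v : Form n (par e)} (hu : u ∈ coeffIn (sup P)) (hv : v ∈ coeffIn (sup Q)) :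
    u * v ∈ coeffIn (sup R) := by
  intro K
  rw [mul_apply]
  exact Submodule.sum_mem _ fun I _ => Submodule.smul_mem _ _
    (mul_mem_sup h (par_pow_mem_sup e (hu I) _) (hv _))

/-- The graded commutator of homogeneous forms. -/
theorem commutator_apply {p q s t : ℕ} {u v : Form n (par e)} (hu : IsHom p u) (hv : IsHom q v)
    (hu' : u ∈ coeffIn (tgr e s)) (hv' : v ∈ coeffIn (tgr e t)) (K : Finset (Fin n)) :
    (u * v - (-1 : ℚ) ^ ((p + s) * (q + t)) • (v * u)) K =
      ∑ I ∈ K.powerset, (shSign I (K \ I) * (-1) ^ (s * q)) • lbr e (u I) (v (K \ I)) := by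
  -- Passing to complements in K puts v * u over the same index set as u * v, so the two sums can be
  -- compared term by term.
  have hs : (v * u) K = ∑ I ∈ K.powerset,
      shSign (K \ I) I • ((par e ^ I.card) (v (K \ I)) * u I) := by
    rw [mul_apply]
    refine Finset.sum_nbij' (fun I => K \ I) (fun I => K \ I) ?_ ?_ ?_ ?_ ?_
    · exact fun I _ => Finset.mem_powerset.2 Finset.sdiff_subset
    · exact fun I _ => Finset.mem_powerset.2 Finset.sdiff_subset
    · exact fun I hI => Finset.sdiff_sdiff_eq_self (Finset.mem_powerset.1 hI)
    · exact fun I hI => Finset.sdiff_sdiff_eq_self (Finset.mem_powerset.1 hI)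
    · intro I hI
      rw [Finset.sdiff_sdiff_eq_self (Finset.mem_powerset.1 hI)]
  rw [sub_apply, Form.smul_apply, hs, mul_apply, Finset.smul_sum, ← Finset.sum_sub_distrib]
  refine Finset.sum_congr rfl fun I hI => ?_
  rw [par_pow_apply e (hu' I), par_pow_apply e (hv' _)]
  by_cases h1 : I.card = p
  swap
  · rw [hu I h1]; simp
  by_cases h2 : (K \ I).card = q
  swap
  · rw [hv _ h2]; simp
  rw [lbr_of_mem (hu' I) (hv' _), h1, h2, shSign_comm (I := I) (J := K \ I) Finset.disjoint_sdiff,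
    h1, h2]
  simp only [smul_sub, smul_mul_assoc, smul_smul]
  congr 2
  have h3 : ∀ k : ℕ, (-1 : ℚ) ^ k * (-1) ^ k = 1 := fun k => by rw [← mul_pow]; simp
  -- Of the four factors, pq is cancelled by reversing the shuffle sign and tp by the parities
  -- applied to the coefficient of v. What remains is sq, common to both products, and st, the
  -- internal commutator sign.
  have : ((-1 : ℚ) ^ ((p + s) * (q + t))) =
      (-1) ^ (p * q) * (-1) ^ (t * p) * (-1) ^ (s * q) * (-1) ^ (s * t) := by
    rw [← pow_add, ← pow_add, ← pow_add]; congr 1; ring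
  rw [this]
  linear_combination ((-1) ^ (s * q) * (-1) ^ (s * t) * shSign I (K \ I)) *
    ((-1) ^ (t * p) * (-1) ^ (t * p) * h3 (p * q) + h3 (t * p))

end Form

namespace FreeDiff

variable {X : Type u} (D : FreeDiff X) {n m l : ℕ}

/-- Every word in a coefficient of E(w) becomes w when the sets of steps are forgotten. The
statements on length and internal degree follow from this one. -/
theorem E_wd_mem (n : ℕ) (w : List X) :
    D.E n (wd w) ∈ coeffIn (sup fun w' => w'.map (fun g => g.1.1) = w) := by
  induction w with
  | nil =>
    rw [wd_nil, map_one]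
    intro K
    rw [one_apply]
    split_ifs
    · rw [← wd_nil]; exact wd_mem_sup rfl
    · exact zero_mem _
  | cons x w ih =>
    rw [wd_cons, map_mul, E_gen]
    refine mul_mem_coeffIn_sup (P := fun w' => w'.map (fun g => g.1.1) = [x]) ?_ ?_ ih
    · intro w1 w2 h1 h2
      rw [List.map_append, h1, h2]; rfl
    · intro K
      by_cases h : K.card = (D.dg x).1
      · rw [D.EGen_of_card h]; exact wd_mem_sup rfl
      · rw [D.isHom_EGen n x K h]; exact zero_mem _

theorem E_mem_sup {P : List X → Prop} {Q : List (SGen D.dg n) → Prop}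
    (h : ∀ w, P (w.map fun g => g.1.1) → Q w) {a : Tens X} (ha : a ∈ sup P) :
    D.E n a ∈ coeffIn (sup Q) := by
  intro K
  refine map_mem_of_sup (f := coeff K ∘ₗ (D.E n).toLinearMap) (fun w hw => ?_) ha
  exact sup_mono (fun w' hw' => h w' (by rw [hw']; exact hw)) (D.E_wd_mem n w K)

theorem E_mem_tgr {p s : ℕ} {a : Tens X} (ha : a ∈ tgr D.dg (p, s)) :
    D.E n a ∈ coeffIn (tgr (D.ideg n) s) := by
  refine D.E_mem_sup (fun w hw => ?_) ha
  have : ∀ w : List (SGen D.dg n), wdeg (D.ideg n) w = (wdeg D.dg (w.map fun g => g.1.1)).2 := by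
    intro w
    induction w with
    | nil => rfl
    | cons g w ih => rw [wdeg_cons, List.map_cons, wdeg_cons, ih]; rfl
  rw [this, hw]

theorem E_mem_tge {k : ℕ} {a : Tens X} (ha : a ∈ tge k) : D.E n a ∈ coeffIn (tge k) :=
  D.E_mem_sup (fun w hw => by rwa [List.length_map] at hw) ha

theorem E_mem_tlen {k : ℕ} {a : Tens X} (ha : a ∈ tlen k) : D.E n a ∈ coeffIn (tlen k) :=
  D.E_mem_sup (fun w hw => by rwa [List.length_map] at hw) ha

/-- The Lie subalgebra in simplicial dimension `n`. -/
noncomputable abbrev lieT (n : ℕ) : Submodule ℚ (D.T n) := lieSub (AddMonoidHom.id ℕ) (D.ideg n)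

/-- Total degree is homological plus internal degree, so a graded commutator upstairs becomes a
graded commutator of forms, whose coefficients are sums of graded commutators of coefficients by
`commutator_apply`. -/
theorem E_mem_lie {a : Tens X} (ha : a ∈ lieSub totalDegree D.dg) :
    D.E n a ∈ coeffIn (D.lieT n) := by
  intro K
  refine mapsTo_lieSub (f := coeff K ∘ₗ (D.E n).toLinearMap) (fun i k x hx => ?_) ha
  change D.E n x K ∈ D.lieT n
  induction hx generalizing K with
  | gen x =>
    rw [E_gen]
    by_cases h : K.card = (D.dg x).1
    · rw [D.EGen_of_card h]; exact gen_mem_lieSub _ _ _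
    · rw [D.isHom_EGen n x K h]; exact zero_mem _
  | @bracket i j _ _ x y hx hy h h' =>
    rw [lbr_homog hx.mem_tgr hy.mem_tgr, map_sub, map_smul, map_mul, map_mul]
    rw [show totalDegree i = i.1 + i.2 from rfl, show totalDegree j = j.1 + j.2 from rfl,
      commutator_apply (D.isHom_E hx.mem_tgr) (D.isHom_E hy.mem_tgr) (D.E_mem_tgr hx.mem_tgr)
      (D.E_mem_tgr hy.mem_tgr)]
    exact Submodule.sum_mem _ fun I _ => Submodule.smul_mem _ _ (lbr_mem_lieSub (h I) (h' _))

theorem opForm_gen_mem (α : Fin (m + 1) →o Fin (n + 1)) (x : X) {B : Submodule ℚ (D.T m)}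
    (h1 : D.E m (wd [x]) ∈ coeffIn B) (h2 : D.E m (D.δ x) ∈ coeffIn B) :
    D.opForm α (wd [x]) ∈ coeffIn B := by
  rw [opForm, der_gen]
  exact add_mem (pushBlk_mem_coeffIn h1 α) (theta_mul_mem_coeffIn (pushBlk_mem_coeffIn h2 α) _)

theorem op_gen_mem_tgr (α : Fin (m + 1) →o Fin (n + 1)) (g : SGen D.dg n) :
    D.op α (wd [g]) ∈ tgr (D.ideg m) (D.ideg n g) := by
  rw [op_gen]
  refine D.opForm_gen_mem α g.1.1 (B := tgr (D.ideg m) (D.ideg n g)) ?_ ?_ g.1.2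
  · exact D.E_mem_tgr (p := (D.dg g.1.1).1) (wd_mem_sup (by simp [ideg]))
  · by_cases h : (D.dg g.1.1).1 = 0
    · rw [D.deg_zero _ h, map_zero]; exact zero_mem _
    · obtain ⟨p, hp⟩ := Nat.exists_eq_succ_of_ne_zero h
      exact D.E_mem_tgr (D.deg_succ _ p _ (Prod.ext hp rfl))

theorem op_mem_tgr (α : Fin (m + 1) →o Fin (n + 1)) {s : ℕ} {y : D.T n}
    (hy : y ∈ tgr (D.ideg n) s) : D.op α y ∈ tgr (D.ideg m) s :=
  algHom_mem_tgr (D.op_gen_mem_tgr α) hy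

theorem op_mem_lie (α : Fin (m + 1) →o Fin (n + 1)) {y : D.T n} (hy : y ∈ D.lieT n) :
    D.op α y ∈ D.lieT m := by
  refine algHom_mem_lieSub (D.op_gen_mem_tgr α) (fun g => ?_) hy
  rw [op_gen]
  exact D.opForm_gen_mem α g.1.1 (D.E_mem_lie (gen_mem_lieSub _ _ _)) (D.E_mem_lie (D.mem_lie _)) g.1.2

theorem op_lbr (α : Fin (m + 1) →o Fin (n + 1)) (x y : D.T n) :
    D.op α (lbr (fun g => AddMonoidHom.id ℕ (D.ideg n g)) x y) =
      lbr (fun g => AddMonoidHom.id ℕ (D.ideg m g)) (D.op α x) (D.op α y) :=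
  algHom_lbr (tot := AddMonoidHom.id ℕ) (D.op_gen_mem_tgr α) x y

theorem op_gen_mem_tge (α : Fin (m + 1) →o Fin (n + 1)) (g : SGen D.dg n) :
    D.op α (wd [g]) ∈ tge 1 := by
  rw [op_gen]
  refine D.opForm_gen_mem α g.1.1 (D.E_mem_tge (wd_mem_sup le_rfl)) ?_ g.1.2
  exact D.E_mem_tge (tge_anti one_le_two (D.len _))

theorem op₀_gen_mem_tgr (α : Fin (m + 1) →o Fin (n + 1)) (g : SGen D.dg n) :
    D.op₀ α (wd [g]) ∈ tgr (D.ideg m) (D.ideg n g) := by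
  rw [op₀_gen, ← E_gen]
  exact pushBlk_mem_coeffIn (D.E_mem_tgr (p := (D.dg g.1.1).1) (wd_mem_sup (by simp [ideg]))) α _

theorem op₀_mem_tgr (α : Fin (m + 1) →o Fin (n + 1)) {s : ℕ} {y : D.T n}
    (hy : y ∈ tgr (D.ideg n) s) : D.op₀ α y ∈ tgr (D.ideg m) s :=
  algHom_mem_tgr (D.op₀_gen_mem_tgr α) hy

theorem op₀_gen_mem_tlen (α : Fin (m + 1) →o Fin (n + 1)) (g : SGen D.dg n) :
    D.op₀ α (wd [g]) ∈ tlen 1 := by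
  rw [op₀_gen, ← E_gen]
  have h : (wd [g.1.1] : Tens X) ∈ tlen 1 := wd_mem_sup (P := fun w => w.length = 1) rfl
  exact pushBlk_mem_coeffIn (D.E_mem_tlen h) α _

theorem op₀_mem_tlen (α : Fin (m + 1) →o Fin (n + 1)) {k : ℕ} {y : D.T n} (hy : y ∈ tlen k) :
    D.op₀ α y ∈ tlen k := algHom_mem_tlen (D.op₀_gen_mem_tlen α) hy

theorem op₀_mem_lie (α : Fin (m + 1) →o Fin (n + 1)) {y : D.T n} (hy : y ∈ D.lieT n) :
    D.op₀ α y ∈ D.lieT m := by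
  refine algHom_mem_lieSub (D.op₀_gen_mem_tgr α) (fun g => ?_) hy
  rw [op₀_gen, ← E_gen]
  exact pushBlk_mem_coeffIn (D.E_mem_lie (gen_mem_lieSub _ _ _)) α _

theorem op₀_gen_mem_tge (α : Fin (m + 1) →o Fin (n + 1)) (g : SGen D.dg n) :
    D.op₀ α (wd [g]) ∈ tge 1 :=
  (sup_mono fun _ hw => le_of_eq (Eq.symm hw) : (tlen 1 : Submodule ℚ (D.T m)) ≤ tge 1)
    (D.op₀_gen_mem_tlen α g)

/-- On a generator over x the correction is a combination of coefficients of E(δx), and δx contains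
only words of length at least two. Thus `op₀` is the associated graded of `op` for the word-length
filtration. -/
theorem op_sub_mem_tge (α : Fin (m + 1) →o Fin (n + 1)) {k : ℕ} {y : D.T n} (hy : y ∈ tge k) :
    D.op α y - D.op₀ α y ∈ tge (k + 1) := by
  refine algHom_sub_mem_tge (D.op_gen_mem_tge α)
    (D.op₀_gen_mem_tge α) (fun g => ?_) hy
  have h : D.op α (wd [g]) - D.op₀ α (wd [g]) =
      (theta (α 0).val * pushBlk α (D.E m (D.δ g.1.1)) : Form n (D.τ m)) g.1.2 := by
    rw [op₀_gen, op_gen, opForm, der_gen, Form.add_apply, E_gen, add_sub_cancel_left]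
  rw [h]
  exact theta_mul_mem_coeffIn (pushBlk_mem_coeffIn (D.E_mem_tge (D.len g.1.1)) α) _ _

/-- There is no step below vertex 0, so θ = 0. This covers the degeneracies and all faces other than
d_0. -/
theorem op_eq_op₀ (α : Fin (m + 1) →o Fin (n + 1)) (hα : (α 0).val = 0) (y : D.T n) :
    D.op α y = D.op₀ α y := by
  refine AlgHom.congr_fun (φ₁ := D.op α) (φ₂ := D.op₀ α) (algHom_ext fun g => ?_) y
  rw [op₀_gen, op_gen, opForm, hα, theta_zero, zero_mul, add_zero, E_gen]

end FreeDiff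

namespace Tens

/-- Compositions of algebra maps agreeing on generators agree. -/
theorem comp_eq_of_gen {Γ Γ' Γ'' : Type*} {A : Type*} [Ring A] [Algebra ℚ A] {f : Tens Γ' →ₐ[ℚ] A}
    {g : Tens Γ →ₐ[ℚ] Tens Γ'} {f' : Tens Γ'' →ₐ[ℚ] A} {g' : Tens Γ →ₐ[ℚ] Tens Γ''}
    (h : ∀ t, f (g (wd [t])) = f' (g' (wd [t]))) (x : Tens Γ) : f (g x) = f' (g' x) := by
  have : f.comp g = f'.comp g' := algHom_ext h
  exact AlgHom.congr_fun this x

end Tens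

/-! ### A combinatorial model of the case of zero differential, with steps in ℕ. -/

namespace Multi

variable {Y : Type*}

/-- The effect of the `k`-th face on steps. -/
def fs (k x : ℕ) : ℕ := if x < k then x else x - 1

/-- The effect of the `j`-th degeneracy on steps. -/
def gs (j x : ℕ) : ℕ := if x < j then x else x + 1

/-- The `k`-th face is zero on letters containing the set of steps `I`. -/
def Bad (k : ℕ) (I : Finset ℕ) : Prop := k ∈ I ∧ (k = 0 ∨ k - 1 ∈ I)

instance (k : ℕ) (I : Finset ℕ) : Decidable (Bad k I) := inferInstanceAs (Decidable (_ ∧ _))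

/-- The `k`-th face, not the last one. -/
noncomputable def fc (k : ℕ) : Tens (Y × Finset ℕ) →ₐ[ℚ] Tens (Y × Finset ℕ) :=
  algLift fun g => if Bad k g.2 then 0 else wd [(g.1, g.2.image (fs k))]

/-- The last face, the last step being `n`. -/
noncomputable def lf (n : ℕ) : Tens (Y × Finset ℕ) →ₐ[ℚ] Tens (Y × Finset ℕ) :=
  algLift fun g => if n ∈ g.2 then 0 else wd [g]

/-- The degeneracies. -/
noncomputable def dg (j : ℕ) : Tens (Y × Finset ℕ) →ₐ[ℚ] Tens (Y × Finset ℕ) :=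
  algLift fun g => wd [(g.1, g.2.image (gs j))]

theorem fc_gen (k : ℕ) (y : Y) (I : Finset ℕ) :
    fc k (wd [(y, I)]) = if Bad k I then 0 else wd [(y, I.image (fs k))] := algLift_gen _ _

theorem lf_gen (n : ℕ) (y : Y) (I : Finset ℕ) :
    lf n (wd [(y, I)]) = if n ∈ I then 0 else wd [(y, I)] := algLift_gen _ _

theorem dg_gen (j : ℕ) (y : Y) (I : Finset ℕ) :
    dg j (wd [(y, I)]) = wd [(y, I.image (gs j))] := algLift_gen _ _

/-- This and the next three lemmas are the simplicial identities that the homotopy needs. The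
composite of face i with degeneracy i is not among them, since it only enters an error term. -/
theorem fc_dg_lt {k i : ℕ} (h : k ≤ i) (x : Tens (Y × Finset ℕ)) :
    fc k (dg (i + 1) x) = dg i (fc k x) := by
  refine comp_eq_of_gen (fun ⟨y, I⟩ => ?_) x
  rw [dg_gen, fc_gen, fc_gen]
  have hb : Bad k (I.image (gs (i + 1))) ↔ Bad k I := by
    have h1 : ∀ a, a ≤ i → (a ∈ I.image (gs (i + 1)) ↔ a ∈ I) := by
      intro a ha
      rw [Finset.mem_image]
      constructor
      · rintro ⟨x, hx, rfl⟩; unfold gs at ha ⊢; split_ifs at ha ⊢ <;> first | exact hx | omega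
      · exact fun hx => ⟨a, hx, if_pos (by omega)⟩
    unfold Bad
    rw [h1 _ h, h1 _ (by omega)]
  simp only [hb]
  split_ifs with hB
  · simp
  · rw [dg_gen, Finset.image_image, Finset.image_image]
    congr 3
    refine Finset.image_congr fun a ha => ?_
    -- The truncated subtraction in `fs` gives a wrong value at step 0 for face 0, but a letter with
    -- that step is annihilated by that face.
    have : k = 0 → a ≠ 0 := by rintro rfl rfl; exact hB ⟨ha, Or.inl rfl⟩
    simp only [Function.comp, fs, gs]; split_ifs <;> omega

theorem fc_dg_succ (i : ℕ) (x : Tens (Y × Finset ℕ)) : fc (i + 1) (dg i x) = x := by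
  refine comp_eq_of_gen (f' := AlgHom.id ℚ _) (g' := AlgHom.id ℚ _) (fun ⟨y, I⟩ => ?_) x
  rw [AlgHom.id_apply, AlgHom.id_apply, dg_gen, fc_gen, if_neg]
  · rw [Finset.image_image, Finset.image_congr (g := id), Finset.image_id]
    intro a _; simp only [Function.comp, fs, gs, id]; split_ifs <;> omega
  · rintro ⟨-, h | h⟩
    · omega
    · obtain ⟨a, -, ha⟩ := Finset.mem_image.1 h
      unfold gs at ha; split_ifs at ha <;> omega

theorem fc_dg_gt {k i : ℕ} (h : i < k) (x : Tens (Y × Finset ℕ)) :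
    fc (k + 1) (dg i x) = dg i (fc k x) := by
  refine comp_eq_of_gen (fun ⟨y, I⟩ => ?_) x
  rw [dg_gen, fc_gen, fc_gen]
  have hb : Bad (k + 1) (I.image (gs i)) ↔ Bad k I := by
    have h1 : ∀ a, i ≤ a → (a + 1 ∈ I.image (gs i) ↔ a ∈ I) := by
      intro a ha
      rw [Finset.mem_image]
      constructor
      · rintro ⟨x, hx, hxa⟩
        unfold gs at hxa
        split_ifs at hxa
        · omega
        · rwa [← Nat.succ_injective hxa]
      · exact fun hx => ⟨a, hx, if_neg (by omega)⟩
    have h2 := h1 (k - 1) (by omega)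
    rw [Nat.sub_add_cancel (by omega)] at h2
    unfold Bad
    rw [h1 _ h.le, Nat.add_sub_cancel, h2]
    simp [show k ≠ 0 by omega]
  simp only [hb]
  split_ifs
  · simp
  · rw [dg_gen, Finset.image_image, Finset.image_image]
    congr 4
    ext a; simp only [Function.comp, fs, gs]; split_ifs <;> omega

theorem lf_dg {n i : ℕ} (h : i ≤ n) (x : Tens (Y × Finset ℕ)) :
    lf (n + 1) (dg i x) = dg i (lf n x) := by
  refine comp_eq_of_gen (fun ⟨y, I⟩ => ?_) x
  rw [dg_gen, lf_gen, lf_gen]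
  have hb : n + 1 ∈ I.image (gs i) ↔ n ∈ I := by
    rw [Finset.mem_image]
    constructor
    · rintro ⟨x, hx, hxa⟩
      unfold gs at hxa
      split_ifs at hxa
      · omega
      · rwa [← Nat.succ_injective hxa]
    · exact fun hx => ⟨n, hx, if_neg (by omega)⟩
  simp only [hb]
  split_ifs
  · simp
  · rw [dg_gen]

/-- The words of level `n`. -/
def Lev (n : ℕ) (w : List (Y × Finset ℕ)) : Prop := ∀ g ∈ w, ∀ a ∈ g.2, a < n

/-- The number of letters plus the sum of their sizes. -/
def wt (w : List (Y × Finset ℕ)) : ℕ := (w.map fun g => g.2.card + 1).sum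

@[simp] theorem wt_nil : wt ([] : List (Y × Finset ℕ)) = 0 := rfl

@[simp] theorem wt_cons (g : Y × Finset ℕ) (w : List (Y × Finset ℕ)) :
    wt (g :: w) = g.2.card + 1 + wt w := by simp [wt]

theorem lev_cons {n : ℕ} {g : Y × Finset ℕ} {w : List (Y × Finset ℕ)} :
    Lev n (g :: w) ↔ (∀ a ∈ g.2, a < n) ∧ Lev n w := by simp [Lev]

/-- The words of level `n` and weight `k`. -/
def LW (n k : ℕ) (w : List (Y × Finset ℕ)) : Prop := Lev n w ∧ wt w = k

theorem algHom_mem_LW {f : Tens (Y × Finset ℕ) →ₐ[ℚ] Tens (Y × Finset ℕ)} {n n' : ℕ}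
    (hf : ∀ y I, (∀ a ∈ I, a < n) → f (wd [(y, I)]) ∈ sup (LW n' (I.card + 1)))
    {w : List (Y × Finset ℕ)} (hw : Lev n w) : f (wd w) ∈ sup (LW n' (wt w)) := by
  induction w with
  | nil => rw [wd_nil, map_one, ← wd_nil]; exact wd_mem_sup ⟨by simp [Lev], rfl⟩
  | cons g w ih =>
    rw [lev_cons] at hw
    rw [wd_cons, map_mul]
    refine mul_mem_sup ?_ (hf g.1 g.2 hw.1) (ih hw.2)
    rintro w1 w2 ⟨h1, h2⟩ ⟨h3, h4⟩
    refine ⟨fun g hg => (List.mem_append.1 hg).elim (h1 g) (h3 g), ?_⟩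
    rw [wt_cons, ← h2, ← h4, wt, wt, wt, List.map_append, List.sum_append]

/-- For k > 0 only the steps k − 1 and k are identified. For k = 0 truncation identifies 0 and 1,
but then 0 is not in I. -/
theorem fs_injOn {k : ℕ} {I : Finset ℕ} (h : ¬ Bad k I) : Set.InjOn (fs k) I := by
  intro a ha b hb hab
  rw [Finset.mem_coe] at ha hb
  unfold fs at hab
  unfold Bad at h
  by_contra hne
  split_ifs at hab
  · exact hne hab
  · have : b = k := by omega
    subst this
    exact h ⟨hb, Or.inr (by rwa [← hab])⟩
  · have : a = k := by omega
    subst this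
    exact h ⟨ha, Or.inr (by rwa [hab])⟩
  · have : k = 0 := by omega
    subst this
    rcases Nat.eq_zero_or_pos a with rfl | h1
    · exact h ⟨ha, Or.inl rfl⟩
    · rcases Nat.eq_zero_or_pos b with rfl | h2
      · exact h ⟨hb, Or.inl rfl⟩
      · omega

theorem fc_gen_mem {n k : ℕ} (hk : k ≤ n) (y : Y) (I : Finset ℕ) (hI : ∀ a ∈ I, a < n + 1) :
    fc k (wd [(y, I)]) ∈ sup (LW n (I.card + 1)) := by
  rw [fc_gen]
  split_ifs with h
  · exact zero_mem _
  · refine wd_mem_sup ⟨?_, ?_⟩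
    · simp only [Lev, List.mem_singleton, forall_eq, Finset.mem_image]
      rintro _ ⟨a, ha, rfl⟩
      have := hI a ha
      unfold Bad at h
      unfold fs
      split_ifs with h1
      · omega
      · rcases Nat.eq_zero_or_pos a with rfl | h2
        · exact absurd ⟨by rwa [show k = 0 by omega], Or.inl (by omega)⟩ h
        · omega
    · simp [Finset.card_image_of_injOn (fs_injOn h)]

theorem lf_gen_mem {n : ℕ} (y : Y) (I : Finset ℕ) (hI : ∀ a ∈ I, a < n + 1) :
    lf n (wd [(y, I)]) ∈ sup (LW n (I.card + 1)) := by
  rw [lf_gen]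
  split_ifs with h
  · exact zero_mem _
  · refine wd_mem_sup ⟨?_, by simp⟩
    simp only [Lev, List.mem_singleton, forall_eq]
    intro a ha
    have := hI a ha
    have : a ≠ n := by rintro rfl; exact h ha
    omega

theorem gs_injective (j : ℕ) : Function.Injective (gs j) := by
  intro a b hab
  unfold gs at hab
  split_ifs at hab <;> omega

theorem dg_gen_mem {n j : ℕ} (y : Y) (I : Finset ℕ) (hI : ∀ a ∈ I, a < n) :
    dg j (wd [(y, I)]) ∈ sup (LW (n + 1) (I.card + 1)) := by
  rw [dg_gen]
  refine wd_mem_sup ⟨?_, ?_⟩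
  · simp only [Lev, List.mem_singleton, forall_eq, Finset.mem_image]
    rintro _ ⟨a, ha, rfl⟩
    have := hI a ha
    unfold gs
    split_ifs <;> omega
  · simp [Finset.card_image_of_injective _ (gs_injective j)]

theorem fc_mem {n k l : ℕ} (hk : k ≤ n) {x : Tens (Y × Finset ℕ)} (hx : x ∈ sup (LW (n + 1) l)) :
    fc k x ∈ sup (LW n l) :=
  map_mem_of_sup (f := (fc k).toLinearMap)
    (fun _ hw => hw.2 ▸ algHom_mem_LW (fc_gen_mem hk) hw.1) hx

theorem lf_mem {n l : ℕ} {x : Tens (Y × Finset ℕ)} (hx : x ∈ sup (LW (n + 1) l)) :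
    lf n x ∈ sup (LW n l) :=
  map_mem_of_sup (f := (lf n).toLinearMap)
    (fun _ hw => hw.2 ▸ algHom_mem_LW lf_gen_mem hw.1) hx

/-- The boundary. -/
noncomputable def bd : ℕ → (Tens (Y × Finset ℕ) →ₗ[ℚ] Tens (Y × Finset ℕ))
  | 0 => 0
  | n + 1 => ∑ k ∈ Finset.range (n + 1), (-1 : ℚ) ^ k • (fc k).toLinearMap +
      (-1 : ℚ) ^ (n + 1) • (lf n).toLinearMap

theorem bd_succ (n : ℕ) (x : Tens (Y × Finset ℕ)) : bd (n + 1) x =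
    ∑ k ∈ Finset.range (n + 1), (-1 : ℚ) ^ k • fc k x + (-1 : ℚ) ^ (n + 1) • lf n x := by
  simp [bd]

theorem bd_mem {n l : ℕ} {x : Tens (Y × Finset ℕ)} (hx : x ∈ sup (LW (n + 1) l)) :
    bd (n + 1) x ∈ sup (LW n l) := by
  rw [bd_succ]
  refine add_mem (Submodule.sum_mem _ fun k hk => Submodule.smul_mem _ _ (fc_mem ?_ hx))
    (Submodule.smul_mem _ _ (lf_mem hx))
  exact Nat.lt_succ_iff.1 (Finset.mem_range.1 hk)

end Multi

/-! ### The contracting homotopy. -/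

namespace Multi

variable {Y : Type*}

/-- The contracting homotopy, on words. -/
noncomputable def hmWd : List (Y × Finset ℕ) → Tens (Y × Finset ℕ)
  | [] => 0
  | (y, I) :: w =>
    if I = ∅ then 0 else (-1 : ℚ) ^ (I.sup id + 1) • (wd [(y, I)] * dg (I.sup id) (wd w))

/-- The contracting homotopy. -/
noncomputable def hm : Tens (Y × Finset ℕ) →ₗ[ℚ] Tens (Y × Finset ℕ) := lift hmWd

/-- With i the last step of the first letter, the homotopy degenerates the tail at i and leaves the
first letter unchanged; seen one level up, the first letter does not use step i + 1 and the tail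
does not use step i. -/
theorem hm_mul {y : Y} {I : Finset ℕ} {i : ℕ} (hi : i ∈ I) (hI : ∀ a ∈ I, a ≤ i)
    (x : Tens (Y × Finset ℕ)) :
    hm (wd [(y, I)] * x) = (-1 : ℚ) ^ (i + 1) • (wd [(y, I)] * dg i x) := by
  have hs : I.sup id = i := le_antisymm (Finset.sup_le hI) (Finset.le_sup (f := id) hi)
  refine LinearMap.congr_fun (f := hm ∘ₗ LinearMap.mulLeft ℚ (wd [(y, I)]))
    (g := (-1 : ℚ) ^ (i + 1) • (LinearMap.mulLeft ℚ (wd [(y, I)]) ∘ₗ (dg i).toLinearMap))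
    (lin_ext fun w => ?_) x
  change hm (wd [(y, I)] * wd w) = (-1 : ℚ) ^ (i + 1) • (wd [(y, I)] * dg i (wd w))
  rw [← wd_cons, hm, lift_wd, hmWd, if_neg (Finset.ne_empty_of_mem hi), hs]

theorem hm_mul_empty (y : Y) (x : Tens (Y × Finset ℕ)) : hm (wd [(y, ∅)] * x) = 0 := by
  have h : hm ∘ₗ LinearMap.mulLeft ℚ (wd [(y, ∅)]) = 0 := lin_ext fun w => by
    rw [LinearMap.comp_apply, LinearMap.mulLeft_apply, ← wd_cons, hm, lift_wd, hmWd, if_pos rfl,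
      LinearMap.zero_apply]
  exact LinearMap.congr_fun h x

theorem dg_mem {n j l : ℕ} {x : Tens (Y × Finset ℕ)} (hx : x ∈ sup (LW n l)) :
    dg j x ∈ sup (LW (n + 1) l) :=
  map_mem_of_sup (f := (dg j).toLinearMap)
    (fun _ hw => hw.2 ▸ algHom_mem_LW dg_gen_mem hw.1) hx

theorem dg_of_lev {n l : ℕ} {x : Tens (Y × Finset ℕ)} (hx : x ∈ sup (LW n l)) : dg n x = x := by
  refine eq_on_sup (f := (dg n).toLinearMap) (g := LinearMap.id) (fun w hw => ?_) hx
  replace hw := hw.1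
  change dg n (wd w) = wd w
  induction w with
  | nil => rw [wd_nil, map_one]
  | cons g w ih =>
    rw [lev_cons] at hw
    rw [wd_cons, map_mul, ih hw.2, dg_gen, Finset.image_congr (g := id), Finset.image_id]
    exact fun a ha => if_pos (hw.1 a ha)

/-- The words of level `n` and weight `k` whose first letter has all its steps less than `i`. -/
def Fi (n k i : ℕ) (w : List (Y × Finset ℕ)) : Prop :=
  LW n k w ∧ ∃ y I w', w = (y, I) :: w' ∧ ∀ a ∈ I, a < i

theorem mul_mem_Fi {n k l i : ℕ} {y : Y} {I : Finset ℕ} (hI : ∀ a ∈ I, a < i) (hn : ∀ a ∈ I, a < n)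
    {x : Tens (Y × Finset ℕ)} (hx : x ∈ sup (LW n l)) (hk : k = I.card + 1 + l) :
    wd [(y, I)] * x ∈ sup (Fi n k i) := by
  refine map_mem_of_sup (f := LinearMap.mulLeft ℚ (wd [(y, I)])) (fun w hw => ?_) hx
  rw [LinearMap.mulLeft_apply, ← wd_cons]
  exact wd_mem_sup ⟨⟨lev_cons.2 ⟨hn, hw.1⟩, by rw [wt_cons, hw.2, hk]⟩, y, I, w, rfl, hI⟩

theorem image_fs_of_lt {k : ℕ} {I : Finset ℕ} (h : ∀ a ∈ I, a < k) : I.image (fs k) = I := by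
  rw [Finset.image_congr (g := id), Finset.image_id]
  exact fun a ha => if_pos (h a ha)

theorem fc_gen_of_lt {k : ℕ} {I : Finset ℕ} (h : ∀ a ∈ I, a < k) (y : Y) :
    fc k (wd [(y, I)]) = wd [(y, I)] := by
  rw [fc_gen, if_neg, image_fs_of_lt h]
  exact fun hB => absurd (h k hB.1) (lt_irrefl k)

section Homotopy

variable {y : Y} {I : Finset ℕ} {i : ℕ} (hi : i ∈ I) (hI : ∀ a ∈ I, a ≤ i)

/-- A face below i lowers the last step of the first letter by one, which is the source of the sign.
-/
theorem fc_hm_lt (hi : i ∈ I) (hI : ∀ a ∈ I, a ≤ i) {k : ℕ} (hk : k < i) (x : Tens (Y × Finset ℕ)) :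
    fc k (hm (wd [(y, I)] * x)) = -hm (fc k (wd [(y, I)] * x)) := by
  obtain ⟨i, rfl⟩ := Nat.exists_eq_add_of_lt hk
  rw [hm_mul hi hI, map_smul, map_mul, map_mul, fc_dg_lt (by omega), fc_gen]
  split_ifs with hB
  · simp
  · have h1 : k + i ∈ I.image (fs k) :=
      Finset.mem_image.2 ⟨_, hi, by rw [fs, if_neg (by omega)]; omega⟩
    have h2 : ∀ a ∈ I.image (fs k), a ≤ k + i := by
      intro a ha
      obtain ⟨b, hb, rfl⟩ := Finset.mem_image.1 ha
      have := hI b hb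
      unfold fs; split_ifs <;> omega
    rw [hm_mul h1 h2, ← neg_smul, pow_succ]
    congr 1
    ring

/-- This face undoes the degeneracy of the tail and fixes the first letter, which has no step above
i. It is the face that contributes the identity to the homotopy formula. -/
theorem fc_hm_succ (hi : i ∈ I) (hI : ∀ a ∈ I, a ≤ i) (x : Tens (Y × Finset ℕ)) :
    fc (i + 1) (hm (wd [(y, I)] * x)) = (-1 : ℚ) ^ (i + 1) • (wd [(y, I)] * x) := by
  rw [hm_mul hi hI, map_smul, map_mul, fc_dg_succ,
    fc_gen_of_lt fun a ha => Nat.lt_succ_of_le (hI a ha)]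

theorem fc_hm_gt (hi : i ∈ I) (hI : ∀ a ∈ I, a ≤ i) {k : ℕ} (hk : i < k) (x : Tens (Y × Finset ℕ)) :
    fc (k + 1) (hm (wd [(y, I)] * x)) = hm (fc k (wd [(y, I)] * x)) := by
  rw [hm_mul hi hI, map_smul, map_mul, fc_dg_gt hk, map_mul,
    fc_gen_of_lt fun a ha => (hI a ha).trans_lt (by omega),
    fc_gen_of_lt fun a ha => (hI a ha).trans_lt hk, hm_mul hi hI]

variable {m l : ℕ} {x : Tens (Y × Finset ℕ)}

/-- If face i does not annihilate the first letter, it pushes its last step below i. Such terms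
count as errors, to be removed by later reductions. -/
theorem fc_self_hm (hi : i ∈ I) (hI : ∀ a ∈ I, a ≤ i) (him : i ≤ m) (hx : x ∈ sup (LW (m + 1) l)) :
    fc i (hm (wd [(y, I)] * x)) ∈ sup (Fi (m + 1) (I.card + 1 + l) i) := by
  rw [hm_mul hi hI, map_smul, map_mul, fc_gen]
  refine Submodule.smul_mem _ _ ?_
  split_ifs with hB
  · rw [zero_mul]; exact zero_mem _
  · have h1 : ∀ a ∈ I.image (fs i), a < i := by
      intro a ha
      obtain ⟨b, hb, rfl⟩ := Finset.mem_image.1 ha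
      have := hI b hb
      have : i ≠ 0 := by rintro rfl; exact hB ⟨hi, Or.inl rfl⟩
      unfold fs; split_ifs <;> omega
    exact mul_mem_Fi h1 (fun a ha => (h1 a ha).trans_le (by omega))
      (fc_mem (by omega) (dg_mem hx)) (by rw [Finset.card_image_of_injOn (fs_injOn hB)])

theorem hm_fc_self (hi : i ∈ I) (hI : ∀ a ∈ I, a ≤ i) (him : i ≤ m) (hx : x ∈ sup (LW (m + 1) l)) :
    hm (fc i (wd [(y, I)] * x)) ∈ sup (Fi (m + 1) (I.card + 1 + l) i) := by
  rw [map_mul, fc_gen]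
  split_ifs with hB
  · rw [zero_mul, map_zero]; exact zero_mem _
  · have h1 : ∀ a ∈ I.image (fs i), a < i := by
      intro a ha
      obtain ⟨b, hb, rfl⟩ := Finset.mem_image.1 ha
      have := hI b hb
      have : i ≠ 0 := by rintro rfl; exact hB ⟨hi, Or.inl rfl⟩
      unfold fs; split_ifs <;> omega
    have hne : (I.image (fs i)).Nonempty := ⟨_, Finset.mem_image_of_mem _ hi⟩
    rw [hm_mul (Finset.max'_mem _ hne) (fun a ha => Finset.le_max' _ a ha)]
    exact Submodule.smul_mem _ _ (mul_mem_Fi h1 (fun a ha => (h1 a ha).trans_le (by omega))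
      (dg_mem (fc_mem (by omega) hx)) (by rw [Finset.card_image_of_injOn (fs_injOn hB)]))

theorem lf_hm (hi : i ∈ I) (hI : ∀ a ∈ I, a ≤ i) (him : i ≤ m) (x : Tens (Y × Finset ℕ)) :
    lf (m + 1) (hm (wd [(y, I)] * x)) = (-1 : ℚ) ^ (i + 1) • (wd [(y, I)] * dg i (lf m x)) := by
  rw [hm_mul hi hI, map_smul, map_mul, lf_dg him, lf_gen, if_neg]
  intro h
  have := hI _ h
  omega

theorem hm_lf_lt (hi : i ∈ I) (hI : ∀ a ∈ I, a ≤ i) (him : i < m) (x : Tens (Y × Finset ℕ)) :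
    hm (lf m (wd [(y, I)] * x)) = (-1 : ℚ) ^ (i + 1) • (wd [(y, I)] * dg i (lf m x)) := by
  rw [map_mul, lf_gen, if_neg, hm_mul hi hI]
  intro h
  have := hI _ h
  omega

/-- The homotopy formula. -/
theorem homotopy (hi : i ∈ I) (hI : ∀ a ∈ I, a ≤ i) (him : i ≤ m) (hx : x ∈ sup (LW (m + 1) l)) :
    wd [(y, I)] * x - bd (m + 2) (hm (wd [(y, I)] * x)) - hm (bd (m + 1) (wd [(y, I)] * x)) -
      (if i = m then wd [(y, I)] * lf m x else 0) ∈ sup (Fi (m + 1) (I.card + 1 + l) i) := by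
  obtain ⟨r, rfl⟩ := Nat.exists_eq_add_of_le him
  rw [bd_succ, bd_succ, map_add, map_smul, map_sum]
  simp only [map_smul]
  have hs : ∀ f : ℕ → Tens (Y × Finset ℕ), ∑ k ∈ Finset.range (i + r + 1), f k =
      ∑ k ∈ Finset.range i, f k + (∑ k ∈ Finset.range r, f (i + k + 1) + f i) := by
    intro f
    rw [add_assoc i, Finset.sum_range_add, Finset.sum_range_succ']
    simp only [add_zero, ← add_assoc]
  have hs' : ∀ f : ℕ → Tens (Y × Finset ℕ), ∑ k ∈ Finset.range (i + r + 1 + 1), f k =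
      ∑ k ∈ Finset.range i, f k + (∑ k ∈ Finset.range r, f (i + k + 1 + 1) + f (i + 1) + f i) := by
    intro f
    rw [add_assoc i, add_assoc i, Finset.sum_range_add, Finset.sum_range_succ',
      Finset.sum_range_succ']
    simp only [add_zero, zero_add, ← add_assoc]
  rw [hs, hs']
  have h1 : ∑ k ∈ Finset.range i, (-1 : ℚ) ^ k • fc k (hm (wd [(y, I)] * x)) =
      -∑ k ∈ Finset.range i, (-1 : ℚ) ^ k • hm (fc k (wd [(y, I)] * x)) := by
    rw [← Finset.sum_neg_distrib]
    refine Finset.sum_congr rfl fun k hk => ?_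
    rw [fc_hm_lt hi hI (Finset.mem_range.1 hk), smul_neg]
  have h2 : ∑ k ∈ Finset.range r, (-1 : ℚ) ^ (i + k + 1 + 1) • fc (i + k + 1 + 1) (hm (wd [(y, I)] * x)) =
      -∑ k ∈ Finset.range r, (-1 : ℚ) ^ (i + k + 1) • hm (fc (i + k + 1) (wd [(y, I)] * x)) := by
    rw [← Finset.sum_neg_distrib]
    refine Finset.sum_congr rfl fun k hk => ?_
    rw [fc_hm_gt hi hI (by omega), pow_succ]
    simp
  have h3 : (-1 : ℚ) ^ (i + 1) • fc (i + 1) (hm (wd [(y, I)] * x)) = wd [(y, I)] * x := by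
    rw [fc_hm_succ hi hI, smul_smul, ← mul_pow]; simp
  -- The two last-face terms cancel unless i is the top step. In that case the last face annihilates
  -- the first letter before the homotopy is applied, so one of the terms survives.
  have h4 : (-1 : ℚ) ^ (i + r + 1 + 1) • lf (i + r + 1) (hm (wd [(y, I)] * x)) +
      (-1 : ℚ) ^ (i + r + 1) • hm (lf (i + r) (wd [(y, I)] * x)) =
      -(if i = i + r then wd [(y, I)] * lf (i + r) x else 0) := by
    rw [lf_hm hi hI him]
    split_ifs with h
    · have hr : r = 0 := by omega
      subst hr
      have h0 : lf (i + 0) (wd [(y, I)] * x) = 0 := by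
        rw [map_mul, lf_gen, if_pos (by simpa using hi), zero_mul]
      rw [h0, map_zero, smul_zero, add_zero, add_zero, dg_of_lev (lf_mem hx), smul_smul, ← pow_add,
        show i + 1 + 1 + (i + 1) = 2 * (i + 1) + 1 by ring, pow_succ, pow_mul]
      simp
    · rw [hm_lf_lt hi hI (by omega), pow_succ]
      simp
  have h5 := fc_self_hm (y := y) hi hI him hx
  have h6 := hm_fc_self (y := y) hi hI him hx
  have h7 := neg_mem (add_mem (Submodule.smul_mem _ ((-1 : ℚ) ^ i) h5)
    (Submodule.smul_mem _ ((-1 : ℚ) ^ i) h6))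
  convert h7 using 1
  rw [h1, h2, h3, ← neg_eq_iff_eq_neg.2 h4]
  abel

end Homotopy

end Multi

/-! ### The top step of the first letter, and reduction of its last step. -/

namespace Multi

variable {Y : Type*}

/-- Adding the step `m` to the first letter, on words. -/
noncomputable def addTopWd (m : ℕ) : List (Y × Finset ℕ) → Tens (Y × Finset ℕ)
  | [] => 0
  | (y, I) :: w => wd [(y, insert m I)] * wd w

/-- Adding the step `m` to the first letter. -/
noncomputable def addTop (m : ℕ) : Tens (Y × Finset ℕ) →ₗ[ℚ] Tens (Y × Finset ℕ) :=
  lift (addTopWd m)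

/-- Removing the step `m` from the first letter, on words. -/
noncomputable def delTopWd (m : ℕ) : List (Y × Finset ℕ) → Tens (Y × Finset ℕ)
  | [] => 0
  | (y, I) :: w => if m ∈ I then wd [(y, I.erase m)] * lf m (wd w) else 0

/-- Removing the step `m` from the first letter. -/
noncomputable def delTop (m : ℕ) : Tens (Y × Finset ℕ) →ₗ[ℚ] Tens (Y × Finset ℕ) :=
  lift (delTopWd m)

theorem addTop_mul (m : ℕ) (y : Y) (I : Finset ℕ) (x : Tens (Y × Finset ℕ)) :
    addTop m (wd [(y, I)] * x) = wd [(y, insert m I)] * x := by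
  have h : addTop m ∘ₗ LinearMap.mulLeft ℚ (wd [(y, I)]) =
      LinearMap.mulLeft ℚ (wd [(y, insert m I)]) := lin_ext fun w => by
    rw [LinearMap.comp_apply, LinearMap.mulLeft_apply, ← wd_cons, addTop, lift_wd, addTopWd,
      LinearMap.mulLeft_apply]
  exact LinearMap.congr_fun h x

theorem delTop_mul {m : ℕ} {I : Finset ℕ} (hm : m ∈ I) (y : Y) (x : Tens (Y × Finset ℕ)) :
    delTop m (wd [(y, I)] * x) = wd [(y, I.erase m)] * lf m x := by
  have h : delTop m ∘ₗ LinearMap.mulLeft ℚ (wd [(y, I)]) =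
      LinearMap.mulLeft ℚ (wd [(y, I.erase m)]) ∘ₗ (lf m).toLinearMap := lin_ext fun w => by
    rw [LinearMap.comp_apply, LinearMap.mulLeft_apply, ← wd_cons, delTop, lift_wd, delTopWd,
      if_pos hm]; rfl
  exact LinearMap.congr_fun h x

theorem delTop_mul_of_notMem {m : ℕ} {I : Finset ℕ} (hm : m ∉ I) (y : Y) (x : Tens (Y × Finset ℕ)) :
    delTop m (wd [(y, I)] * x) = 0 := by
  have h : delTop m ∘ₗ LinearMap.mulLeft ℚ (wd [(y, I)]) = 0 := lin_ext fun w => by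
    rw [LinearMap.comp_apply, LinearMap.mulLeft_apply, ← wd_cons, delTop, lift_wd, delTopWd,
      if_neg hm, LinearMap.zero_apply]
  exact LinearMap.congr_fun h x

theorem lf_fc {k q : ℕ} (hk : k ≤ q) (x : Tens (Y × Finset ℕ)) :
    lf q (fc k x) = fc k (lf (q + 1) x) := by
  refine comp_eq_of_gen (fun ⟨y, I⟩ => ?_) x
  rw [fc_gen, lf_gen]
  by_cases hB : Bad k I
  · rw [if_pos hB, map_zero]
    split_ifs
    · rw [map_zero]
    · rw [fc_gen, if_pos hB]
  · have h : q ∈ I.image (fs k) ↔ q + 1 ∈ I := by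
      rw [Finset.mem_image]
      constructor
      · rintro ⟨a, ha, haq⟩
        unfold fs at haq
        split_ifs at haq
        · omega
        · rcases Nat.eq_zero_or_pos a with rfl | h0
          · exact absurd ⟨by rwa [show k = 0 by omega], Or.inl (by omega)⟩ hB
          · rwa [show q + 1 = a by omega]
      · exact fun ha => ⟨_, ha, if_neg (by omega)⟩
    rw [if_neg hB, lf_gen]
    simp only [h]
    split_ifs
    · rw [map_zero]
    · rw [fc_gen, if_neg hB]

theorem lf_fc_succ {q l : ℕ} {x : Tens (Y × Finset ℕ)} (hx : x ∈ sup (LW (q + 2) l)) :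
    lf q (fc (q + 1) x) = lf q (lf (q + 1) x) := by
  refine eq_on_sup (f := (lf q).toLinearMap ∘ₗ (fc (q + 1)).toLinearMap)
    (g := (lf q).toLinearMap ∘ₗ (lf (q + 1)).toLinearMap) (fun w hw => ?_) hx
  replace hw := hw.1
  change lf q (fc (q + 1) (wd w)) = lf q (lf (q + 1) (wd w))
  induction w with
  | nil => rw [wd_nil]; simp only [map_one]
  | cons g w ih =>
    rw [lev_cons] at hw
    rw [wd_cons]
    simp only [map_mul]
    rw [ih hw.2]
    congr 1
    obtain ⟨y, I⟩ := g
    by_cases h1 : q + 1 ∈ I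
    · rw [fc_gen, lf_gen, if_pos h1, map_zero]
      split_ifs with hB
      · rw [map_zero]
      · rw [lf_gen, if_pos]
        exact Finset.mem_image.2 ⟨_, h1, if_neg (by omega)⟩
    · rw [fc_gen_of_lt, lf_gen (q + 1), if_neg h1]
      intro a ha
      have := hw.1 a ha
      have : a ≠ q + 1 := by rintro rfl; exact h1 ha
      omega

theorem delTop_fc_of_mem {q k : ℕ} {I : Finset ℕ} (hk : k ≤ q) (hI : q + 1 ∈ I) (y : Y)
    (x : Tens (Y × Finset ℕ)) :
    delTop q (fc k (wd [(y, I)] * x)) = fc k (delTop (q + 1) (wd [(y, I)] * x)) := by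
  have hb : Bad k (I.erase (q + 1)) ↔ Bad k I := by
    unfold Bad
    rw [Finset.mem_erase, Finset.mem_erase]
    simp only [show k ≠ q + 1 by omega, show k - 1 ≠ q + 1 by omega, ne_eq, not_false_eq_true,
      true_and]
  rw [delTop_mul hI, map_mul (fc k), map_mul (fc k), fc_gen, fc_gen]
  simp only [hb]
  split_ifs with hB
  · rw [zero_mul, zero_mul, map_zero]
  · have h1 : fs k (q + 1) = q := if_neg (by omega)
    have h2 : q ∈ I.image (fs k) := Finset.mem_image.2 ⟨_, hI, h1⟩
    have h3 : (I.image (fs k)).erase q = (I.erase (q + 1)).image (fs k) := by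
      ext a
      simp only [Finset.mem_erase, Finset.mem_image]
      constructor
      · rintro ⟨hne, b, hb, rfl⟩
        exact ⟨b, ⟨by rintro rfl; exact hne h1, hb⟩, rfl⟩
      · rintro ⟨b, ⟨hne, hb⟩, rfl⟩
        exact ⟨fun h => hne (fs_injOn hB hb hI (h.trans h1.symm)), b, hb, rfl⟩
    rw [delTop_mul h2, h3, lf_fc hk]

theorem delTop_fc_of_notMem {q k : ℕ} {I : Finset ℕ} (hk : k ≤ q) (hI : q + 1 ∉ I) (y : Y)
    (x : Tens (Y × Finset ℕ)) : delTop q (fc k (wd [(y, I)] * x)) = 0 := by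
  rw [map_mul, fc_gen]
  split_ifs with hB
  · rw [zero_mul, map_zero]
  · refine delTop_mul_of_notMem (fun h => ?_) _ _
    obtain ⟨a, ha, haq⟩ := Finset.mem_image.1 h
    unfold fs at haq
    split_ifs at haq
    · omega
    · rcases Nat.eq_zero_or_pos a with rfl | h0
      · exact absurd ⟨by rwa [show k = 0 by omega], Or.inl (by omega)⟩ hB
      · exact hI (by rwa [show q + 1 = a by omega])

/-- Removing the last step is a chain map. -/
theorem delTop_bd_mul {q l : ℕ} {y : Y} {I : Finset ℕ} (hI : ∀ a ∈ I, a < q + 2)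
    {x : Tens (Y × Finset ℕ)} (hx : x ∈ sup (LW (q + 2) l)) :
    delTop q (bd (q + 2) (wd [(y, I)] * x)) = bd (q + 1) (delTop (q + 1) (wd [(y, I)] * x)) := by
  rw [bd_succ, bd_succ, Finset.sum_range_succ, map_add, map_add, map_sum]
  simp only [map_smul]
  by_cases h1 : q + 1 ∈ I
  · rw [Finset.sum_congr rfl fun k hk => by
      rw [delTop_fc_of_mem (Nat.lt_succ_iff.1 (Finset.mem_range.1 hk)) h1]]
    rw [map_mul (lf (q + 1)), lf_gen, if_pos h1, zero_mul, map_zero, smul_zero, add_zero,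
      delTop_mul h1]
    congr 2
    -- Face q + 1 merges the steps q and q + 1. If the first letter has both, both sides vanish;
    -- otherwise q takes the place of q + 1, and removing it leaves what the last face gives after q
    -- + 1 has been removed.
    rw [map_mul (fc _), map_mul (lf _), fc_gen, lf_gen]
    by_cases h2 : q ∈ I
    · rw [if_pos ⟨h1, Or.inr h2⟩, if_pos (Finset.mem_erase.2 ⟨by omega, h2⟩)]
      simp
    · rw [if_neg fun hB => hB.2.elim (by omega) (by simpa using h2),
        if_neg fun h => h2 (Finset.mem_of_mem_erase h)]
      have h3 : I.image (fs (q + 1)) = insert q (I.erase (q + 1)) := by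
        ext a
        simp only [Finset.mem_image, Finset.mem_insert, Finset.mem_erase]
        constructor
        · rintro ⟨b, hb, rfl⟩
          have := hI b hb
          by_cases hbq : b = q + 1
          · subst hbq; left; exact if_neg (by omega)
          · right; rw [fs, if_pos (by omega)]; exact ⟨hbq, hb⟩
        · rintro (rfl | ⟨hne, ha⟩)
          · exact ⟨_, h1, if_neg (by omega)⟩
          · have := hI a ha
            exact ⟨a, ha, if_pos (by omega)⟩
      rw [h3, delTop_mul (Finset.mem_insert_self _ _), Finset.erase_insert, lf_fc_succ hx]
      exact fun h => h2 (Finset.mem_of_mem_erase h)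
  · rw [Finset.sum_eq_zero fun k hk => by
      rw [delTop_fc_of_notMem (Nat.lt_succ_iff.1 (Finset.mem_range.1 hk)) h1, smul_zero],
      delTop_mul_of_notMem h1]
    simp only [map_zero, smul_zero, Finset.sum_const_zero, zero_add]
    have h3 : ∀ a ∈ I, a < q + 1 := fun a ha => by
      have := hI a ha
      have : a ≠ q + 1 := by rintro rfl; exact h1 ha
      omega
    rw [map_mul (fc _), map_mul (lf _), fc_gen_of_lt h3, lf_gen, if_neg h1]
    -- Without step q + 1 in the first letter, face q + 1 and the last face agree after `delTop` and
    -- carry opposite signs.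
    by_cases h2 : q ∈ I
    · rw [delTop_mul h2, delTop_mul h2, lf_fc_succ hx, pow_succ _ (q + 1)]
      simp
    · rw [delTop_mul_of_notMem h2, delTop_mul_of_notMem h2]; simp

/-- Nonempty words of level `n` and weight `k`. -/
def LN (n k : ℕ) (w : List (Y × Finset ℕ)) : Prop := LW n k w ∧ w ≠ []

/-- Checking statements on nonempty words. -/
theorem eq_on_LN {M : Type*} [AddCommGroup M] [Module ℚ M] {n k : ℕ}
    {f g : Tens (Y × Finset ℕ) →ₗ[ℚ] M}
    (h : ∀ y I l x, (∀ a ∈ I, a < n) → x ∈ sup (LW n l) → k = I.card + 1 + l →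
      f (wd [(y, I)] * x) = g (wd [(y, I)] * x)) {z : Tens (Y × Finset ℕ)} (hz : z ∈ sup (LN n k)) :
    f z = g z := by
  refine eq_on_sup (fun w hw => ?_) hz
  obtain ⟨⟨h1, h2⟩, h3⟩ := hw
  cases w with
  | nil => exact absurd rfl h3
  | cons g w =>
    rw [lev_cons] at h1
    rw [wd_cons]
    exact h g.1 g.2 (wt w) _ h1.1 (wd_mem_sup ⟨h1.2, rfl⟩) (by rw [← h2, wt_cons])

theorem map_mem_of_LN {M : Type*} [AddCommGroup M] [Module ℚ M] {n k : ℕ}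
    {f : Tens (Y × Finset ℕ) →ₗ[ℚ] M} {B : Submodule ℚ M}
    (h : ∀ y I l x, (∀ a ∈ I, a < n) → x ∈ sup (LW n l) → k = I.card + 1 + l →
      f (wd [(y, I)] * x) ∈ B) {z : Tens (Y × Finset ℕ)} (hz : z ∈ sup (LN n k)) : f z ∈ B := by
  refine map_mem_of_sup (fun w hw => ?_) hz
  obtain ⟨⟨h1, h2⟩, h3⟩ := hw
  cases w with
  | nil => exact absurd rfl h3
  | cons g w =>
    rw [lev_cons] at h1
    rw [wd_cons]
    exact h g.1 g.2 (wt w) _ h1.1 (wd_mem_sup ⟨h1.2, rfl⟩) (by rw [← h2, wt_cons])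

theorem mem_LN_of_LW {n k : ℕ} (hk : 0 < k) {z : Tens (Y × Finset ℕ)} (hz : z ∈ sup (LW n k)) :
    z ∈ sup (LN n k) :=
  sup_mono (fun w hw => ⟨hw, by rintro rfl; simp [LW] at hw; omega⟩) hz

theorem delTop_bd {q k : ℕ} {z : Tens (Y × Finset ℕ)} (hz : z ∈ sup (LN (q + 2) k)) :
    delTop q (bd (q + 2) z) = bd (q + 1) (delTop (q + 1) z) := by
  rw [← LinearMap.comp_apply, ← LinearMap.comp_apply]
  refine eq_on_LN (fun y I l x hI hx _ => ?_) hz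
  rw [LinearMap.comp_apply, LinearMap.comp_apply]
  exact delTop_bd_mul hI hx

theorem lf_of_lev {n l : ℕ} {x : Tens (Y × Finset ℕ)} (hx : x ∈ sup (LW n l)) : lf n x = x := by
  refine eq_on_sup (f := (lf n).toLinearMap) (g := LinearMap.id) (fun w hw => ?_) hx
  replace hw := hw.1
  change lf n (wd w) = wd w
  induction w with
  | nil => rw [wd_nil, map_one]
  | cons g w ih =>
    rw [lev_cons] at hw
    rw [wd_cons, map_mul, ih hw.2, lf_gen, if_neg]
    exact fun h => absurd (hw.1 _ h) (lt_irrefl _)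

theorem delTop_addTop {n k : ℕ} {z : Tens (Y × Finset ℕ)} (hz : z ∈ sup (LN n k)) :
    delTop n (addTop n z) = z := by
  refine eq_on_LN (f := delTop n ∘ₗ addTop n) (g := LinearMap.id) (fun y I l x hI hx _ => ?_) hz
  rw [LinearMap.comp_apply, addTop_mul, delTop_mul (Finset.mem_insert_self _ _),
    Finset.erase_insert fun h => absurd (hI _ h) (lt_irrefl _), lf_of_lev hx]; rfl

theorem addTop_mem {n k : ℕ} {z : Tens (Y × Finset ℕ)} (hz : z ∈ sup (LN n k)) :
    addTop n z ∈ sup (LN (n + 1) (k + 1)) := by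
  refine map_mem_of_LN (fun y I l x hI hx hk => ?_) hz
  rw [addTop_mul]
  refine map_mem_of_sup (f := LinearMap.mulLeft ℚ (wd [(y, insert n I)])) (fun w hw => ?_) hx
  rw [LinearMap.mulLeft_apply, ← wd_cons]
  refine wd_mem_sup ⟨⟨lev_cons.2 ⟨?_, fun g hg a ha => (hw.1 g hg a ha).trans (by omega)⟩, ?_⟩, by simp⟩
  · intro a ha
    rcases Finset.mem_insert.1 ha with rfl | ha
    · omega
    · exact (hI a ha).trans (by omega)
  · rw [wt_cons, hw.2, hk, Finset.card_insert_of_notMem fun h => absurd (hI _ h) (lt_irrefl _)]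
    ring

theorem mul_mem_LN {n l : ℕ} {y : Y} {I : Finset ℕ} (hI : ∀ a ∈ I, a < n)
    {x : Tens (Y × Finset ℕ)} (hx : x ∈ sup (LW n l)) :
    wd [(y, I)] * x ∈ sup (LN n (I.card + 1 + l)) := by
  refine map_mem_of_sup (f := LinearMap.mulLeft ℚ (wd [(y, I)])) (fun w hw => ?_) hx
  rw [LinearMap.mulLeft_apply, ← wd_cons]
  exact wd_mem_sup ⟨⟨lev_cons.2 ⟨hI, hw.1⟩, by rw [wt_cons, hw.2]⟩, by simp⟩

theorem delTop_mem {n k : ℕ} {z : Tens (Y × Finset ℕ)} (hz : z ∈ sup (LN (n + 1) k)) :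
    delTop n z ∈ sup (LN n (k - 1)) := by
  refine map_mem_of_LN (fun y I l x hI hx hk => ?_) hz
  by_cases h : n ∈ I
  · rw [delTop_mul h]
    have h1 : k - 1 = (I.erase n).card + 1 + l := by
      rw [hk, Finset.card_erase_add_one h]
      omega
    rw [h1]
    refine mul_mem_LN (fun a ha => ?_) (lf_mem hx)
    have := hI a (Finset.mem_of_mem_erase ha)
    have := Finset.ne_of_mem_erase ha
    omega
  · rw [delTop_mul_of_notMem h]; exact zero_mem _

/-- One step of the reduction. -/
noncomputable def red (n : ℕ) : Tens (Y × Finset ℕ) →ₗ[ℚ] Tens (Y × Finset ℕ) :=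
  LinearMap.id - bd (n + 1) ∘ₗ hm - hm ∘ₗ bd n

theorem bd_mul_empty (n : ℕ) (y : Y) (x : Tens (Y × Finset ℕ)) :
    bd n (wd [(y, ∅)] * x) = wd [(y, ∅)] * bd n x := by
  cases n with
  | zero => simp [bd]
  | succ n =>
    rw [bd_succ, bd_succ, mul_add, Finset.mul_sum]
    have h1 : ∀ k, fc k (wd [(y, ∅)]) = wd [(y, ∅)] := fun k => fc_gen_of_lt (by simp) y
    have h2 : lf n (wd [(y, ∅)]) = wd [(y, ∅)] := by rw [lf_gen, if_neg (by simp)]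
    simp only [map_mul, h1, h2, mul_smul_comm]

theorem red_mul_empty (n : ℕ) (y : Y) (x : Tens (Y × Finset ℕ)) :
    red n (wd [(y, ∅)] * x) = wd [(y, ∅)] * x := by
  simp [red, bd_mul_empty, hm_mul_empty]

theorem Fi_mono {n k i j : ℕ} (h : i ≤ j) : (sup (Fi n k i) : Submodule ℚ (Tens (Y × Finset ℕ))) ≤
    sup (Fi n k j) :=
  sup_mono fun _ ⟨h1, y, I, w', h2, h3⟩ => ⟨h1, y, I, w', h2, fun a ha => (h3 a ha).trans_le h⟩

/-- The exceptional term of the homotopy formula occurs when the first letter contains the top step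
m. It is the word with m stripped from its tail, which is what removing m and putting it back
produces. All other terms have a first letter below m. -/
theorem red_sub_mem {m k : ℕ} {z : Tens (Y × Finset ℕ)} (hz : z ∈ sup (LN (m + 1) k)) :
    red (m + 1) z - addTop m (delTop m z) ∈ sup (Fi (m + 1) k m) := by
  refine map_mem_of_LN (f := red (m + 1) - addTop m ∘ₗ delTop m) (fun y I l x hI hx hk => ?_) hz
  rw [LinearMap.sub_apply, LinearMap.comp_apply]
  rcases Finset.eq_empty_or_nonempty I with rfl | hne
  · rw [red_mul_empty, delTop_mul_of_notMem (by simp), map_zero, sub_zero]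
    exact mul_mem_Fi (by simp) (by simp) hx hk
  · have h1 := homotopy (y := y) (m := m) (Finset.max'_mem I hne) (fun a ha => Finset.le_max' I a ha)
      (Nat.lt_succ_iff.1 (hI _ (Finset.max'_mem I hne))) hx
    rw [← hk] at h1
    have h2 := Fi_mono (Nat.lt_succ_iff.1 (hI _ (Finset.max'_mem I hne))) h1
    have h3 : addTop m (delTop m (wd [(y, I)] * x)) =
        if I.max' hne = m then wd [(y, I)] * lf m x else 0 := by
      split_ifs with h
      · have hm : m ∈ I := by rw [← h]; exact Finset.max'_mem I hne
        rw [delTop_mul hm, addTop_mul, Finset.insert_erase hm]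
      rw [delTop_mul_of_notMem, map_zero]
      intro hm
      have := Finset.le_max' I m hm
      have := hI _ (Finset.max'_mem I hne)
      omega
    rw [h3]
    exact h2

/-- Here the first letter lies below the top step, so the exceptional term of the homotopy formula
is absent and the last step strictly decreases. -/
theorem red_mem_Fi {m k i : ℕ} (him : i < m) {z : Tens (Y × Finset ℕ)}
    (hz : z ∈ sup (Fi (m + 1) k (i + 1))) : red (m + 1) z ∈ sup (Fi (m + 1) k i) := by
  refine map_mem_of_sup (fun w hw => ?_) hz
  obtain ⟨⟨h1, h2⟩, y, I, w', rfl, hI⟩ := hw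
  rw [lev_cons] at h1
  rw [wt_cons] at h2
  have hx : wd w' ∈ sup (LW (m + 1) (wt w')) := wd_mem_sup ⟨h1.2, rfl⟩
  rw [wd_cons]
  rcases Finset.eq_empty_or_nonempty I with rfl | hne
  · rw [red_mul_empty]
    exact mul_mem_Fi (by simp) (by simp) hx h2.symm
  · have hlt := hI _ (Finset.max'_mem I hne)
    have h3 := homotopy (y := y) (m := m) (Finset.max'_mem I hne) (fun a ha => Finset.le_max' I a ha)
      (by omega) hx
    rw [if_neg (by omega), sub_zero, h2] at h3
    exact Fi_mono (Nat.lt_succ_iff.1 hlt) h3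

end Multi

/-! ### Sorted coefficients, and the homology of the combinatorial complex. -/

namespace Multi

variable {Y : Type*}

/-- The words whose letters are consecutive intervals of steps, in decreasing order, exhausting the
steps less than `n`. -/
def Srt : ℕ → List (Y × Finset ℕ) → Prop
  | n, [] => n = 0
  | n, g :: w => ∃ n', n' + g.2.card = n ∧ g.2 = Finset.Ico n' n ∧ Srt n' w

/-- The elements with vanishing sorted coefficients. -/
def NS (n : ℕ) (z : Tens (Y × Finset ℕ)) : Prop := ∀ u, Srt n u → cf u z = 0

theorem Srt.lev {n : ℕ} {u : List (Y × Finset ℕ)} (h : Srt n u) : Lev n u := by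
  induction u generalizing n with
  | nil => simp [Lev]
  | cons g u ih =>
    obtain ⟨n', h1, h2, h3⟩ := h
    refine lev_cons.2 ⟨fun a ha => ?_, fun g hg a ha => (ih h3 g hg a ha).trans_le (by omega)⟩
    rw [h2, Finset.mem_Ico] at ha
    exact ha.2

theorem Srt.cover {n : ℕ} {u : List (Y × Finset ℕ)} (h : Srt n u) {j : ℕ} (hj : j < n) :
    ∃ g ∈ u, j ∈ g.2 := by
  induction u generalizing n with
  | nil => have : n = 0 := h; omega
  | cons g u ih =>
    obtain ⟨n', h1, h2, h3⟩ := h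
    by_cases hjn : j < n'
    · obtain ⟨g', hg', hj'⟩ := ih h3 hjn
      exact ⟨g', List.mem_cons_of_mem _ hg', hj'⟩
    · exact ⟨g, List.mem_cons_self, by rw [h2, Finset.mem_Ico]; omega⟩

/-- The sum of the sizes of the letters. -/
def sz (w : List (Y × Finset ℕ)) : ℕ := (w.map fun g => g.2.card).sum

theorem Srt.sz_eq {n : ℕ} {u : List (Y × Finset ℕ)} (h : Srt n u) : sz u = n := by
  induction u generalizing n with
  | nil => exact Eq.symm h
  | cons g u ih =>
    obtain ⟨n', h1, -, h3⟩ := h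
    have := ih h3
    simp only [sz, List.map_cons, List.sum_cons] at this ⊢
    omega

theorem exists_missing {n : ℕ} {w : List (Y × Finset ℕ)} (h : sz w < n) :
    ∃ j < n, ∀ g ∈ w, j ∉ g.2 := by
  have hc : ∀ w : List (Y × Finset ℕ), ∃ S : Finset ℕ, S.card ≤ sz w ∧ ∀ g ∈ w, g.2 ⊆ S := by
    intro w
    induction w with
    | nil => exact ⟨∅, by simp [sz], by simp⟩
    | cons g w ih =>
      obtain ⟨S, h1, h2⟩ := ih
      refine ⟨g.2 ∪ S, (Finset.card_union_le _ _).trans ?_, ?_⟩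
      · simp only [sz, List.map_cons, List.sum_cons] at h1 ⊢; omega
      · intro g' hg'
        rcases List.mem_cons.1 hg' with rfl | hg'
        · exact Finset.subset_union_left
        · exact (h2 g' hg').trans Finset.subset_union_right
  obtain ⟨S, h1, h2⟩ := hc w
  have : ∃ j ∈ Finset.range n, j ∉ S := by
    by_contra hcon
    push Not at hcon
    have := Finset.card_le_card (fun j hj => hcon j hj : Finset.range n ⊆ S)
    rw [Finset.card_range] at this
    omega
  obtain ⟨j, hj, hjS⟩ := this
  exact ⟨j, Finset.mem_range.1 hj, fun g hg hjg => hjS (h2 g hg hjg)⟩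

theorem fc_wd {k : ℕ} {w : List (Y × Finset ℕ)} (h : ∀ g ∈ w, ¬ Bad k g.2) :
    fc k (wd w) = wd (w.map fun g => (g.1, g.2.image (fs k))) := by
  induction w with
  | nil => rw [wd_nil, map_one]; rfl
  | cons g w ih =>
    rw [List.map_cons, wd_cons g w, map_mul, ih fun g hg => h g (List.mem_cons_of_mem _ hg), fc_gen,
      if_neg (h g List.mem_cons_self), ← wd_cons]

theorem fc_wd_bad {k : ℕ} {w : List (Y × Finset ℕ)} {g : Y × Finset ℕ} (hg : g ∈ w)
    (h : Bad k g.2) : fc k (wd w) = 0 := by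
  induction w with
  | nil => simp at hg
  | cons g' w ih =>
    rw [wd_cons, map_mul]
    rcases List.mem_cons.1 hg with rfl | hg
    · rw [fc_gen, if_pos h, zero_mul]
    · rw [ih hg, mul_zero]

theorem lf_wd {n : ℕ} {w : List (Y × Finset ℕ)} (h : ∀ g ∈ w, n ∉ g.2) : lf n (wd w) = wd w := by
  induction w with
  | nil => rw [wd_nil, map_one]
  | cons g w ih =>
    rw [wd_cons, map_mul, ih fun g hg => h g (List.mem_cons_of_mem _ hg), lf_gen,
      if_neg (h g List.mem_cons_self)]

theorem lf_wd_bad {n : ℕ} {w : List (Y × Finset ℕ)} {g : Y × Finset ℕ} (hg : g ∈ w)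
    (h : n ∈ g.2) : lf n (wd w) = 0 := by
  induction w with
  | nil => simp at hg
  | cons g' w ih =>
    rw [wd_cons, map_mul]
    rcases List.mem_cons.1 hg with rfl | hg
    · rw [lf_gen, if_pos h, zero_mul]
    · rw [ih hg, mul_zero]

theorem sz_map_fs {k : ℕ} {w : List (Y × Finset ℕ)} (h : ∀ g ∈ w, ¬ Bad k g.2) :
    sz (w.map fun g => (g.1, g.2.image (fs k))) = sz w := by
  rw [sz, List.map_map, sz]
  congr 1
  refine List.map_congr_left fun g hg => ?_
  exact Finset.card_image_of_injOn (fs_injOn (h g hg))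

/-- A nonzero face keeps the sum of the sizes of the letters, which for u is n. If w has size at
least n + 1, no face can equal u. Otherwise w misses some step j; only the faces j and j + 1 can use
all n steps, and these two coincide and cancel. -/
theorem cf_bd_wd {n : ℕ} {w u : List (Y × Finset ℕ)} (hw : Lev (n + 1) w) (hu : Srt n u) :
    cf u (bd (n + 1) (wd w)) = 0 := by
  let c : ℕ → ℚ := fun k => if k ≤ n then cf u (fc k (wd w)) else cf u (lf n (wd w))
  have hc : cf u (bd (n + 1) (wd w)) = ∑ k ∈ Finset.range (n + 2), (-1 : ℚ) ^ k * c k := by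
    rw [bd_succ, map_add, map_sum, Finset.sum_range_succ (fun k => (-1 : ℚ) ^ k * c k), map_smul,
      smul_eq_mul]
    congr 1
    · refine Finset.sum_congr rfl fun k hk => ?_
      rw [map_smul, smul_eq_mul]
      simp only [c, if_pos (Nat.lt_succ_iff.1 (Finset.mem_range.1 hk))]
    · simp only [c, if_neg (Nat.not_succ_le_self n)]
  by_cases hs : sz w < n + 1
  · obtain ⟨j, hj, hjw⟩ := exists_missing hs
    have hcase : ∀ k, k ≤ n → k ≠ j → k ≠ j + 1 → c k = 0 := by
      intro k hk h1 h2
      simp only [c, if_pos hk]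
      by_cases hB : ∃ g ∈ w, Bad k g.2
      · obtain ⟨g, hg, hB⟩ := hB
        rw [fc_wd_bad hg hB, map_zero]
      · push Not at hB
        rw [fc_wd hB, cf_wd_ne]
        rintro rfl
        -- The missing step j remains missing under its new name i, while a sorted word uses every
        -- step. The case a = k = 0 is the truncation artefact and is excluded because the face does
        -- not annihilate w.
        obtain ⟨i, hi, hi'⟩ : ∃ i < n, ∀ a, fs k a = i → a = j ∨ (a = 0 ∧ k = 0) := by
          by_cases hjk : j < k
          · refine ⟨j, by omega, fun a ha => ?_⟩
            unfold fs at ha; split_ifs at ha <;> omega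
          · refine ⟨j - 1, by omega, fun a ha => ?_⟩
            unfold fs at ha; split_ifs at ha <;> omega
        obtain ⟨g, hg, hig⟩ := hu.cover hi
        obtain ⟨g', hg', rfl⟩ := List.mem_map.1 hg
        obtain ⟨a, ha, hai⟩ := Finset.mem_image.1 hig
        rcases hi' a hai with rfl | ⟨rfl, rfl⟩
        · exact hjw g' hg' ha
        · exact hB g' hg' ⟨ha, Or.inl rfl⟩
    have hlast : j ≠ n → c (n + 1) = 0 := by
      intro hjn
      simp only [c, if_neg (Nat.not_succ_le_self n)]
      by_cases hB : ∃ g ∈ w, n ∈ g.2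
      · obtain ⟨g, hg, hB⟩ := hB
        rw [lf_wd_bad hg hB, map_zero]
      · push Not at hB
        rw [lf_wd hB, cf_wd_ne]
        rintro rfl
        obtain ⟨g, hg, hjg⟩ := hu.cover (show j < n by omega)
        exact hjw g hg hjg
    have hjj : c j = c (j + 1) := by
      have hBj : ∀ g ∈ w, ¬ Bad j g.2 := fun g hg hB => hjw g hg hB.1
      by_cases hjn : j < n
      · simp only [c, if_pos (show j ≤ n by omega), if_pos (show j + 1 ≤ n by omega)]
        rw [fc_wd hBj, fc_wd]
        · congr 2
          refine List.map_congr_left fun g hg => ?_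
          congr 1
          refine Finset.image_congr fun a ha => ?_
          have : a ≠ j := by rintro rfl; exact hjw g hg ha
          unfold fs; split_ifs <;> omega
        · exact fun g hg hB => hB.2.elim (by omega) (by simpa using hjw g hg)
      · obtain rfl : j = n := by omega
        simp only [c, if_pos le_rfl, if_neg (Nat.not_succ_le_self j)]
        rw [fc_wd hBj, lf_wd hjw]
        congr 2
        conv_rhs => rw [← List.map_id w]
        refine List.map_congr_left fun g hg => ?_
        rw [image_fs_of_lt]; · rfl
        intro a ha
        have := hw g hg a ha
        have : a ≠ j := by rintro rfl; exact hjw g hg ha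
        omega
    rw [hc, Finset.sum_eq_add j (j + 1) (by omega), hjj, pow_succ]
    · ring
    · intro k hk hne
      rw [Finset.mem_range] at hk
      by_cases hkn : k ≤ n
      · rw [hcase k hkn hne.1 hne.2, mul_zero]
      · obtain rfl : k = n + 1 := by omega
        rw [hlast (by omega), mul_zero]
    · intro h; exact absurd (Finset.mem_range.2 (by omega)) h
    · intro h; exact absurd (Finset.mem_range.2 (by omega)) h
  · rw [hc]
    refine Finset.sum_eq_zero fun k _ => ?_
    have hsu := hu.sz_eq
    have : c k = 0 := by
      simp only [c]
      split_ifs with hk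
      · by_cases hB : ∃ g ∈ w, Bad k g.2
        · obtain ⟨g, hg, hB⟩ := hB
          rw [fc_wd_bad hg hB, map_zero]
        · push Not at hB
          rw [fc_wd hB, cf_wd_ne]
          rintro rfl
          rw [sz_map_fs hB] at hsu
          omega
      · by_cases hB : ∃ g ∈ w, n ∈ g.2
        · obtain ⟨g, hg, hB⟩ := hB
          rw [lf_wd_bad hg hB, map_zero]
        · push Not at hB
          rw [lf_wd hB, cf_wd_ne]
          rintro rfl
          omega
    rw [this, mul_zero]

theorem NS_bd {n : ℕ} {z : Tens (Y × Finset ℕ)} (hz : z ∈ sup (Lev (n + 1))) :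
    NS n (bd (n + 1) z) := by
  intro u hu
  refine eq_on_sup (f := cf u ∘ₗ bd (n + 1)) (g := 0) (fun w hw => ?_) hz
  rw [LinearMap.comp_apply, cf_bd_wd hw hu, LinearMap.zero_apply]

theorem cf_cons {Γ : Type*} (g g' : Γ) (u : List Γ) (x : Tens Γ)
    [Decidable (g = g')] : cf (g :: u) (wd [g'] * x) = if g = g' then cf u x else 0 := by
  split_ifs with h
  · subst h
    have : cf (g :: u) ∘ₗ LinearMap.mulLeft ℚ (wd [g]) = cf u := lin_ext fun w => by
      rw [LinearMap.comp_apply, LinearMap.mulLeft_apply, ← wd_cons]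
      by_cases hw : u = w
      · subst hw; rw [cf_wd_self, cf_wd_self]
      · rw [cf_wd_ne hw, cf_wd_ne (by simpa using hw)]
    exact LinearMap.congr_fun this x
  · have : cf (g :: u) ∘ₗ LinearMap.mulLeft ℚ (wd [g']) = 0 := lin_ext fun w => by
      rw [LinearMap.comp_apply, LinearMap.mulLeft_apply, ← wd_cons, cf_wd_ne (by simp [h]),
        LinearMap.zero_apply]
    exact LinearMap.congr_fun this x

theorem cf_lf {n : ℕ} {u : List (Y × Finset ℕ)} (hu : ∀ g ∈ u, n ∉ g.2) (x : Tens (Y × Finset ℕ)) :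
    cf u (lf n x) = cf u x := by
  have : cf u ∘ₗ (lf n).toLinearMap = cf u := lin_ext fun w => by
    change cf u (lf n (wd w)) = cf u (wd w)
    by_cases hB : ∃ g ∈ w, n ∈ g.2
    · obtain ⟨g, hg, hB⟩ := hB
      rw [lf_wd_bad hg hB, map_zero, cf_wd_ne]
      rintro rfl
      exact hu g hg hB
    · push Not at hB
      rw [lf_wd hB]
  exact LinearMap.congr_fun this x

/-- Adding m to the first interval of a nonempty sorted word of level m gives a sorted word of level
m + 1, and the coefficient of `delTop` can be read off there. The empty word never occurs in
`delTop`. -/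
theorem NS_delTop {m k : ℕ} {z : Tens (Y × Finset ℕ)} (hz : z ∈ sup (LN (m + 1) k))
    (h : NS (m + 1) z) : NS m (delTop m z) := by
  classical
  intro u hu
  cases u with
  | nil =>
    refine eq_on_LN (f := cf [] ∘ₗ delTop m) (g := 0) (fun y I l x hI hx _ => ?_) hz
    rw [LinearMap.comp_apply, LinearMap.zero_apply]
    by_cases hm : m ∈ I
    · rw [delTop_mul hm]
      have : cf [] ∘ₗ LinearMap.mulLeft ℚ (wd [(y, I.erase m)]) = 0 := lin_ext fun w => by
        rw [LinearMap.comp_apply, LinearMap.mulLeft_apply, ← wd_cons, cf_wd_ne (by simp),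
          LinearMap.zero_apply]
      exact LinearMap.congr_fun this _
    · rw [delTop_mul_of_notMem hm, map_zero]
  | cons g u =>
    obtain ⟨n', h1, h2, h3⟩ := hu
    have hs : Srt (m + 1) ((g.1, insert m g.2) :: u) := by
      have hmg : m ∉ g.2 := by rw [h2]; simp
      refine ⟨n', ?_, ?_, h3⟩
      · rw [Finset.card_insert_of_notMem hmg]; omega
      · change insert m g.2 = _
        rw [h2]
        ext a
        simp only [Finset.mem_insert, Finset.mem_Ico]
        omega
    have hmu : ∀ g ∈ u, m ∉ g.2 := fun g hg hm => by
      have := h3.lev g hg m hm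
      omega
    rw [← h _ hs]
    refine eq_on_LN (f := cf (g :: u) ∘ₗ delTop m) (g := cf ((g.1, insert m g.2) :: u))
      (fun y I l x hI hx _ => ?_) hz
    have hmg : m ∉ g.2 := by rw [h2]; simp
    rw [LinearMap.comp_apply, cf_cons]
    by_cases hm : m ∈ I
    · rw [delTop_mul hm, cf_cons, cf_lf hmu]
      refine if_congr ?_ rfl rfl
      rw [Prod.ext_iff, Prod.ext_iff]
      refine and_congr Iff.rfl ⟨fun h => ?_, fun h => ?_⟩
      · change g.2 = I.erase m at h
        change insert m g.2 = I
        rw [h, Finset.insert_erase hm]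
      · change insert m g.2 = I at h
        change g.2 = I.erase m
        rw [← h, Finset.erase_insert hmg]
    · rw [delTop_mul_of_notMem hm, map_zero, if_neg]
      intro h
      have : insert m g.2 = I := congrArg Prod.snd h
      exact hm (this ▸ Finset.mem_insert_self _ _)

open Classical in
/-- Stripping a first letter over `y`. -/
noncomputable def strip (y : Y) : Tens (Y × Finset ℕ) →ₗ[ℚ] Tens (Y × Finset ℕ) :=
  lift fun w => match w with
    | [] => 0
    | g :: w => if g.1 = y then wd w else 0

theorem strip_self (y : Y) (I : Finset ℕ) (x : Tens (Y × Finset ℕ)) :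
    strip y (wd [(y, I)] * x) = x := by
  have : strip y ∘ₗ LinearMap.mulLeft ℚ (wd [(y, I)]) = LinearMap.id := lin_ext fun w => by
    rw [LinearMap.comp_apply, LinearMap.mulLeft_apply, ← wd_cons, strip, lift_wd]
    simp
  exact LinearMap.congr_fun this x

theorem strip_ne {y y' : Y} (h : y' ≠ y) (I : Finset ℕ) (x : Tens (Y × Finset ℕ)) :
    strip y (wd [(y', I)] * x) = 0 := by
  have : strip y ∘ₗ LinearMap.mulLeft ℚ (wd [(y', I)]) = 0 := lin_ext fun w => by
    rw [LinearMap.comp_apply, LinearMap.mulLeft_apply, ← wd_cons, strip, lift_wd]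
    simp [h]
  exact LinearMap.congr_fun this x

/-- Checking statements on words beginning with an empty letter. -/
theorem eq_on_Fi_zero {M : Type*} [AddCommGroup M] [Module ℚ M] {n k : ℕ}
    {f g : Tens (Y × Finset ℕ) →ₗ[ℚ] M}
    (h : ∀ y w, LW n (k - 1) w → f (wd [(y, ∅)] * wd w) = g (wd [(y, ∅)] * wd w))
    {z : Tens (Y × Finset ℕ)} (hz : z ∈ sup (Fi n k 0)) : f z = g z := by
  refine eq_on_sup (fun w hw => ?_) hz
  obtain ⟨⟨h1, h2⟩, y, I, w', rfl, h3⟩ := hw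
  obtain rfl : I = ∅ := Finset.eq_empty_of_forall_notMem fun a ha => absurd (h3 a ha) (by omega)
  rw [wd_cons]
  rw [lev_cons] at h1
  exact h y w' ⟨h1.2, by rw [← h2, wt_cons]; simp⟩

theorem strip_mem {n k : ℕ} (y : Y) {z : Tens (Y × Finset ℕ)} (hz : z ∈ sup (Fi n k 0)) :
    strip y z ∈ sup (LW n (k - 1)) := by
  rw [← Submodule.Quotient.mk_eq_zero]
  refine eq_on_Fi_zero (f := (sup (LW n (k - 1))).mkQ ∘ₗ strip y) (g := 0) (fun y' w hw => ?_) hz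
  rw [LinearMap.comp_apply, LinearMap.zero_apply, Submodule.mkQ_apply, Submodule.Quotient.mk_eq_zero]
  by_cases h : y' = y
  · subst h; rw [strip_self]; exact wd_mem_sup hw
  · rw [strip_ne h]; exact zero_mem _

theorem strip_bd {n k : ℕ} (y : Y) {z : Tens (Y × Finset ℕ)} (hz : z ∈ sup (Fi n k 0)) :
    strip y (bd n z) = bd n (strip y z) := by
  rw [← LinearMap.comp_apply, ← LinearMap.comp_apply]
  refine eq_on_Fi_zero (fun y' w hw => ?_) hz
  rw [LinearMap.comp_apply, LinearMap.comp_apply, bd_mul_empty]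
  by_cases h : y' = y
  · subst h; rw [strip_self, strip_self]
  · rw [strip_ne h, strip_ne h, map_zero]

/-- An empty letter is an empty interval, so putting it in front of a sorted word leaves the word
sorted. -/
theorem NS_strip {n k : ℕ} (y : Y) {z : Tens (Y × Finset ℕ)} (hz : z ∈ sup (Fi n k 0))
    (h : NS n z) : NS n (strip y z) := by
  classical
  intro u hu
  have hs : Srt n ((y, ∅) :: u) := ⟨n, by simp, by simp, hu⟩
  rw [← h _ hs, ← LinearMap.comp_apply]
  refine eq_on_Fi_zero (fun y' w hw => ?_) hz
  rw [LinearMap.comp_apply, cf_cons]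
  by_cases h : y' = y
  · subst h; rw [strip_self, if_pos rfl]
  · rw [strip_ne h, map_zero, if_neg]
    exact fun h' => h (congrArg Prod.fst h').symm

theorem exists_sum_strip {n k : ℕ} {z : Tens (Y × Finset ℕ)} (hz : z ∈ sup (Fi n k 0)) :
    ∃ S : Finset Y, z = ∑ y ∈ S, wd [(y, ∅)] * strip y z := by
  classical
  refine ⟨(support z).biUnion fun w => (w.map Prod.fst).toFinset, ?_⟩
  set S := (support z).biUnion fun w => (w.map Prod.fst).toFinset with hS
  have key : ∀ w ∈ support z, wd w = ∑ y ∈ S, wd [(y, ∅)] * strip y (wd w) := by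
    intro w hw
    obtain ⟨-, y, I, w', rfl, h3⟩ := mem_sup_iff.1 hz w (mem_support.1 hw)
    obtain rfl : I = ∅ := Finset.eq_empty_of_forall_notMem fun a ha => absurd (h3 a ha) (by omega)
    have hy : y ∈ S := Finset.mem_biUnion.2 ⟨_, hw, by simp⟩
    rw [wd_cons, Finset.sum_eq_single y, strip_self]
    · intro y' _ hne
      rw [strip_ne hne.symm, mul_zero]
    · exact fun h => absurd hy h
  conv_lhs => rw [← sum_support z]
  rw [Finset.sum_congr rfl fun w hw => by rw [key w hw]]
  simp only [Finset.smul_sum]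
  rw [Finset.sum_comm]
  refine Finset.sum_congr rfl fun y _ => ?_
  conv_rhs => rw [← sum_support z]
  rw [map_sum, Finset.mul_sum]
  refine Finset.sum_congr rfl fun w _ => ?_
  rw [map_smul, mul_smul_comm]

theorem LN_le_LW {n k : ℕ} : (sup (LN n k) : Submodule ℚ (Tens (Y × Finset ℕ))) ≤ sup (LW n k) :=
  sup_mono fun _ h => h.1

theorem Fi_le_LN {n k i : ℕ} : (sup (Fi n k i) : Submodule ℚ (Tens (Y × Finset ℕ))) ≤ sup (LN n k) :=
  sup_mono fun _ ⟨h, y, I, w', h2, _⟩ => ⟨h, by rw [h2]; simp⟩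

theorem LW_le_Lev {n k : ℕ} : (sup (LW n k) : Submodule ℚ (Tens (Y × Finset ℕ))) ≤ sup (Lev n) :=
  sup_mono fun _ h => h.1

theorem hm_mem {m k : ℕ} {z : Tens (Y × Finset ℕ)} (hz : z ∈ sup (LN m k)) :
    hm z ∈ sup (LN (m + 1) k) := by
  refine map_mem_of_LN (fun y I l x hI hx hk => ?_) hz
  rcases Finset.eq_empty_or_nonempty I with rfl | hne
  · rw [hm_mul_empty]; exact zero_mem _
  · rw [hm_mul (Finset.max'_mem I hne) (fun a ha => Finset.le_max' I a ha), hk]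
    exact Submodule.smul_mem _ _ (mul_mem_LN (fun a ha => (hI a ha).trans (by omega)) (dg_mem hx))

theorem bd_one (n : ℕ) : bd (n + 1) (1 : Tens (Y × Finset ℕ)) = if Even n then 0 else 1 := by
  rw [bd_succ]
  simp only [map_one]
  rw [← Finset.sum_smul, ← add_smul, ← Finset.sum_range_succ, neg_one_geom_sum]
  have : Even (n + 1 + 1) ↔ Even n := by simp [Nat.even_add_one]
  simp only [this]
  split_ifs <;> simp

theorem mem_image_fs {k x : ℕ} {I : Finset ℕ} : x ∈ I.image (fs k) ↔
    (x < k ∧ x ∈ I) ∨ (k ≤ x + 1 ∧ x + 1 ∈ I) ∨ (k = 0 ∧ x = 0 ∧ 0 ∈ I) := by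
  rw [Finset.mem_image]
  constructor
  · rintro ⟨a, ha, rfl⟩
    unfold fs
    split_ifs with h
    · exact Or.inl ⟨h, ha⟩
    · rcases Nat.eq_zero_or_pos a with rfl | h0
      · exact Or.inr (Or.inr ⟨by omega, rfl, ha⟩)
      · refine Or.inr (Or.inl ⟨by omega, ?_⟩)
        rwa [Nat.sub_add_cancel h0]
  · rintro (⟨h, hx⟩ | ⟨h, hx⟩ | ⟨rfl, rfl, h⟩)
    · exact ⟨x, hx, if_pos h⟩
    · exact ⟨x + 1, hx, by rw [fs, if_neg (by omega)]; rfl⟩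
    · exact ⟨0, h, rfl⟩

theorem fc_fc {i j : ℕ} (h : i ≤ j) (x : Tens (Y × Finset ℕ)) :
    fc i (fc (j + 1) x) = fc j (fc i x) := by
  refine comp_eq_of_gen (fun ⟨y, I⟩ => ?_) x
  rw [fc_gen, fc_gen]
  have key : Bad (j + 1) I ∨ Bad i (I.image (fs (j + 1))) ↔ Bad i I ∨ Bad j (I.image (fs i)) := by
    unfold Bad
    simp only [mem_image_fs]
    rcases Nat.eq_zero_or_pos i with rfl | hi
    · rcases Nat.eq_zero_or_pos j with rfl | hj
      · grind
      · obtain ⟨j, rfl⟩ : ∃ j', j = j' + 1 := ⟨j - 1, by omega⟩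
        grind
    · obtain ⟨i, rfl⟩ : ∃ j', i = j' + 1 := ⟨i - 1, by omega⟩
      obtain ⟨j, rfl⟩ : ∃ j', j = j' + 1 := ⟨j - 1, by omega⟩
      rcases h.lt_or_eq with h | h
      · have : ¬ (j + 1 + 1 ≤ i + 1 + 1) := by omega
        grind
      · grind
  by_cases h1 : Bad (j + 1) I ∨ Bad i (I.image (fs (j + 1)))
  · have h2 := key.1 h1
    have e1 : fc i (if Bad (j + 1) I then (0 : Tens (Y × Finset ℕ))
        else wd [(y, I.image (fs (j + 1)))]) = 0 := by
      split_ifs with hB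
      · rw [map_zero]
      · rw [fc_gen, if_pos (h1.resolve_left hB)]
    have e2 : fc j (if Bad i I then (0 : Tens (Y × Finset ℕ)) else wd [(y, I.image (fs i))]) = 0 := by
      split_ifs with hB
      · rw [map_zero]
      · rw [fc_gen, if_pos (h2.resolve_left hB)]
    rw [e1, e2]
  · have h2 := mt key.2 h1
    rw [not_or] at h1 h2
    rw [if_neg h1.1, if_neg h2.1, fc_gen, fc_gen, if_neg h1.2, if_neg h2.2, Finset.image_image,
      Finset.image_image]
    congr 3
    refine Finset.image_congr fun a ha => ?_
    -- Step 0 must be excluded for face 0, where truncated subtraction would spoil the identity.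
    have : i = 0 → a ≠ 0 := by rintro rfl rfl; exact h2.1 ⟨ha, Or.inl rfl⟩
    simp only [Function.comp, fs]; split_ifs <;> omega

theorem bd_bd {n k : ℕ} {x : Tens (Y × Finset ℕ)} (hx : x ∈ sup (LW (n + 2) k)) :
    bd (n + 1) (bd (n + 2) x) = 0 := by
  let F : ℕ → ℕ → Tens (Y × Finset ℕ) → Tens (Y × Finset ℕ) := fun n k x =>
    if k ≤ n then fc k x else lf n x
  have hF : ∀ n (x : Tens (Y × Finset ℕ)),
      bd (n + 1) x = ∑ k ∈ Finset.range (n + 2), (-1 : ℚ) ^ k • F n k x := by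
    intro n x
    rw [bd_succ, Finset.sum_range_succ _ (n + 1)]
    simp only [F, if_neg (Nat.not_succ_le_self n)]
    congr 1
    exact Finset.sum_congr rfl fun k hk => by
      rw [if_pos (Nat.lt_succ_iff.1 (Finset.mem_range.1 hk))]
  have hFF : ∀ i j, i ≤ j → j ≤ n + 1 → F n i (F (n + 1) (j + 1) x) = F n j (F (n + 1) i x) := by
    intro i j hij hj
    by_cases hjn : j ≤ n
    · simp only [F, if_pos hjn, if_pos (hij.trans hjn), if_pos (show j + 1 ≤ n + 1 by omega),
        if_pos (show i ≤ n + 1 by omega)]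
      exact fc_fc hij x
    · obtain rfl : j = n + 1 := by omega
      by_cases hin : i ≤ n
      · simp only [F, if_pos hin, if_neg (Nat.not_succ_le_self _), if_pos hij]
        exact (lf_fc hin x).symm
      · obtain rfl : i = n + 1 := by omega
        simp only [F, if_neg (Nat.not_succ_le_self _), if_pos le_rfl]
        exact (lf_fc_succ hx).symm
  have hbd : bd (n + 1) (bd (n + 2) x) = ∑ p ∈ Finset.range (n + 2) ×ˢ Finset.range (n + 3),
      (-1 : ℚ) ^ (p.1 + p.2) • F n p.1 (F (n + 1) p.2 x) := by
    rw [hF (n + 1), map_sum, Finset.sum_product_right]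
    refine Finset.sum_congr rfl fun j _ => ?_
    rw [map_smul, hF, Finset.smul_sum]
    refine Finset.sum_congr rfl fun i _ => ?_
    rw [smul_smul, ← pow_add, add_comm]
  rw [hbd]
  refine Finset.sum_involution
    (fun p _ => if p.1 < p.2 then (p.2 - 1, p.1) else (p.2, p.1 + 1)) ?_ ?_ ?_ ?_
  · rintro ⟨i, j⟩ hp
    rw [Finset.mem_product, Finset.mem_range, Finset.mem_range] at hp
    dsimp only at hp ⊢
    split_ifs with h
    · obtain ⟨j, rfl⟩ : ∃ j', j = j' + 1 := ⟨j - 1, by omega⟩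
      dsimp only
      rw [hFF i j (by omega) (by omega), Nat.add_sub_cancel, ← add_assoc, pow_succ, add_comm j i]
      simp
    · dsimp only
      rw [hFF j i (by omega) (by omega), ← add_assoc, pow_succ, add_comm j i]
      simp
  · rintro ⟨i, j⟩ _ _
    dsimp only
    split_ifs with h
    · intro h'; rw [Prod.mk.injEq] at h'; omega
    · intro h'; rw [Prod.mk.injEq] at h'; omega
  · rintro ⟨i, j⟩ hp
    rw [Finset.mem_product, Finset.mem_range, Finset.mem_range] at hp
    dsimp only at hp ⊢
    split_ifs with h <;> rw [Finset.mem_product, Finset.mem_range, Finset.mem_range] <;>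
      dsimp only <;> omega
  · rintro ⟨i, j⟩ _
    dsimp only
    by_cases h : i < j
    · simp only [if_pos h]
      rw [if_neg (by omega)]
      exact Prod.ext rfl (by dsimp only; omega)
    · simp only [if_neg h]
      rw [if_pos (by omega)]
      exact Prod.ext (by dsimp only; omega) rfl

/-- Cycles with vanishing sorted coefficients are boundaries. -/
theorem exists_bd_eq (k : ℕ) : ∀ (n : ℕ) {z : Tens (Y × Finset ℕ)}, z ∈ sup (LW n k) → bd n z = 0 →
    NS n z → ∃ w ∈ sup (LW (n + 1) k), bd (n + 1) w = z := by
  induction k using Nat.strong_induction_on with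
  | _ k ih =>
  intro n z hz hc hns
  -- Weight zero leaves only the empty word, so the complex is that of a point, with boundary maps
  -- alternately 0 and 1. In level 0 the empty word is sorted, so its coefficient vanishes by
  -- assumption.
  rcases Nat.eq_zero_or_pos k with rfl | hk
  · have hz1 : z = cf [] z • 1 := by
      refine eq_on_sup (f := LinearMap.id) (g := (cf []).smulRight 1) (fun w hw => ?_) hz
      have : w = [] := by
        cases w with
        | nil => rfl
        | cons g w => have := hw.2; rw [wt_cons] at this; omega
      subst this
      rw [LinearMap.smulRight_apply, cf_wd_self, one_smul, ← wd_nil]; rfl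
    cases n with
    | zero =>
      have : cf [] z = 0 := hns [] rfl
      refine ⟨0, zero_mem _, ?_⟩
      rw [hz1, this, zero_smul, map_zero]
    | succ m =>
      by_cases hm : Even m
      · refine ⟨z, ?_, ?_⟩
        · exact sup_mono (fun w hw => ⟨fun g hg a ha => (hw.1 g hg a ha).trans (by omega), hw.2⟩) hz
        · rw [hz1, map_smul, bd_one, if_neg (by simpa [Nat.even_add_one] using hm)]
      · rw [hz1, map_smul, bd_one, if_neg hm] at hc
        exact ⟨0, zero_mem _, by rw [map_zero, hz1, hc]⟩
  -- An empty first letter is fixed by all faces; removing it commutes with the boundary and lowers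
  -- the weight, so the induction hypothesis applies to each y separately.
  have hstrip : ∀ z' : Tens (Y × Finset ℕ), z' ∈ sup (Fi n k 0) → bd n z' = 0 → NS n z' →
      ∃ w ∈ sup (LW (n + 1) k), bd (n + 1) w = z' := by
    intro z' hz' hc' hns'
    obtain ⟨S, hS⟩ := exists_sum_strip hz'
    have hy : ∀ y, ∃ w ∈ sup (LW (n + 1) (k - 1)), bd (n + 1) w = strip y z' := fun y =>
      ih (k - 1) (by omega) n (strip_mem y hz') (by rw [← strip_bd y hz', hc', map_zero])
        (NS_strip y hz' hns')
    choose f hf1 hf2 using hy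
    refine ⟨∑ y ∈ S, wd [(y, ∅)] * f y, Submodule.sum_mem _ fun y _ => ?_, ?_⟩
    · have := LN_le_LW (mul_mem_LN (y := y) (I := ∅) (by simp) (hf1 y))
      rwa [Finset.card_empty, zero_add, Nat.add_sub_cancel' hk] at this
    · rw [map_sum]
      conv_rhs => rw [hS]
      refine Finset.sum_congr rfl fun y _ => ?_
      rw [bd_mul_empty, hf2]
  cases n with
  | zero =>
    refine hstrip z (sup_mono (fun w hw => ⟨hw, ?_⟩) hz) hc hns
    obtain ⟨h1, h2⟩ := hw
    cases w with
    | nil => simp at h2; omega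
    | cons g w => exact ⟨g.1, g.2, w, rfl, (lev_cons.1 h1).1⟩
  | succ m =>
    have hLN := mem_LN_of_LW hk hz
    have step : ∀ z' x : Tens (Y × Finset ℕ), x ∈ sup (LN (m + 2) k) → bd (m + 1) z' = 0 →
        NS (m + 1) z' → bd (m + 1) (z' - bd (m + 2) x) = 0 ∧ NS (m + 1) (z' - bd (m + 2) x) := by
      intro z' x hx hc' hn'
      refine ⟨by rw [map_sub, hc', bd_bd (LN_le_LW hx), sub_zero], fun u hu => ?_⟩
      rw [map_sub, hn' u hu, NS_bd (LW_le_Lev (LN_le_LW hx)) u hu, sub_zero]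
    have hredeq : ∀ z' : Tens (Y × Finset ℕ), bd (m + 1) z' = 0 →
        red (m + 1) z' = z' - bd (m + 2) (hm z') := by
      intro z' hc'
      simp only [red, LinearMap.sub_apply, LinearMap.comp_apply, LinearMap.id_apply, hc', map_zero,
        sub_zero]
    -- On cycles a reduction changes z' by a boundary only. Repeating it drives the last step of the
    -- first letter down until that letter is empty.
    have hred : ∀ i ≤ m, ∀ z' : Tens (Y × Finset ℕ), z' ∈ sup (Fi (m + 1) k i) → bd (m + 1) z' = 0 →
        NS (m + 1) z' → ∃ w ∈ sup (LW (m + 2) k), bd (m + 2) w = z' := by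
      intro i
      induction i with
      | zero => exact fun _ => hstrip
      | succ i ihi =>
        intro him z' hz' hc' hn'
        have hh := hm_mem (Fi_le_LN hz')
        obtain ⟨hc2, hn2⟩ := step z' _ hh hc' hn'
        have hm2 := red_mem_Fi (by omega) hz'
        rw [hredeq z' hc'] at hm2
        obtain ⟨w, hw, hw'⟩ := ihi (by omega) _ hm2 hc2 hn2
        exact ⟨w + hm z', add_mem hw (LN_le_LW hh), by rw [map_add, hw', sub_add_cancel]⟩
    have hh := hm_mem hLN
    obtain ⟨hc1, hn1⟩ := step z _ hh hc hns
    set z1 := z - bd (m + 2) (hm z) with hz1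
    have hb2 : ∀ x : Tens (Y × Finset ℕ), x ∈ sup (LN (m + 2) k) → bd (m + 2) x ∈ sup (LN (m + 1) k) :=
      fun x hx => mem_LN_of_LW hk (bd_mem (LN_le_LW hx))
    have hz1m : z1 ∈ sup (LN (m + 1) k) := sub_mem hLN (hb2 _ hh)
    have hvm := delTop_mem hz1m
    have hvc : bd m (delTop m z1) = 0 := by
      cases m with
      | zero => rfl
      | succ q => rw [← delTop_bd hz1m, hc1, map_zero]
    -- The terms whose first letter contains the top step m give, after its removal, a cycle of
    -- smaller weight with zero sorted coefficients. A primitive v1 of it, lifted by `addTop`,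
    -- clears those terms up to a boundary. In weight zero there are no nonempty words, so the cycle
    -- is already 0.
    obtain ⟨v1, hv1, hv1'⟩ : ∃ v1 ∈ sup (LN (m + 1) (k - 1)), bd (m + 1) v1 = delTop m z1 := by
      rcases Nat.eq_zero_or_pos (k - 1) with h0 | h0
      · refine ⟨0, zero_mem _, ?_⟩
        rw [map_zero]
        rw [h0] at hvm
        refine (eq_on_LN (f := LinearMap.id) (g := 0) (fun _ _ _ _ _ _ h => ?_) hvm).symm
        omega
      · obtain ⟨v1, h1, h2⟩ := ih (k - 1) (by omega) m (LN_le_LW hvm) hvc (NS_delTop hz1m hn1)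
        exact ⟨v1, mem_LN_of_LW h0 h1, h2⟩
    have ha := addTop_mem hv1
    rw [Nat.sub_add_cancel hk] at ha
    obtain ⟨hc2, hn2⟩ := step z1 _ ha hc1 hn1
    set z2 := z1 - bd (m + 2) (addTop (m + 1) v1) with hz2
    have hz2m : z2 ∈ sup (LN (m + 1) k) := sub_mem hz1m (hb2 _ ha)
    have hd : delTop m z2 = 0 := by
      rw [hz2, map_sub, delTop_bd ha, delTop_addTop hv1, hv1', sub_self]
    -- Since `delTop m z2` is zero, the exceptional term disappears and one reduction places the
    -- first letter below m, where the descent applies.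
    have hm3 := red_sub_mem hz2m
    have hh2 := hm_mem hz2m
    obtain ⟨hc3, hn3⟩ := step z2 _ hh2 hc2 hn2
    rw [hd, map_zero, sub_zero, hredeq z2 hc2] at hm3
    obtain ⟨w, hw, hw'⟩ := hred m le_rfl _ hm3 hc3 hn3
    refine ⟨w + hm z2 + addTop (m + 1) v1 + hm z, add_mem (add_mem (add_mem hw (LN_le_LW hh2))
      (LN_le_LW ha)) (LN_le_LW hh), ?_⟩
    rw [map_add, map_add, map_add, hw', hz2, hz1]
    abel

end Multi

namespace Multi

variable {Y : Type*}

theorem wt_eq_sz (w : List (Y × Finset ℕ)) : wt w = sz w + w.length := by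
  induction w with
  | nil => rfl
  | cons g w ih =>
    rw [wt_cons, ih]
    simp only [sz, List.map_cons, List.sum_cons, List.length_cons]
    ring

theorem bd_wd_mem_wt (n : ℕ) (w : List (Y × Finset ℕ)) :
    bd n (wd w) ∈ sup fun w' => wt w' = wt w := by
  cases n with
  | zero => exact zero_mem _
  | succ n =>
    rw [bd_succ]
    refine add_mem (Submodule.sum_mem _ fun k _ => Submodule.smul_mem _ _ ?_)
      (Submodule.smul_mem _ _ ?_)
    · by_cases hB : ∃ g ∈ w, Bad k g.2
      · obtain ⟨g, hg, hB⟩ := hB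
        rw [fc_wd_bad hg hB]; exact zero_mem _
      · push Not at hB
        rw [fc_wd hB]
        refine wd_mem_sup ?_
        rw [wt_eq_sz, wt_eq_sz, sz_map_fs hB, List.length_map]
    · by_cases hB : ∃ g ∈ w, n ∈ g.2
      · obtain ⟨g, hg, hB⟩ := hB
        rw [lf_wd_bad hg hB]; exact zero_mem _
      · push Not at hB
        rw [lf_wd hB]
        exact wd_mem_sup rfl

theorem exists_bd_eq_of_lev {n : ℕ} {z : Tens (Y × Finset ℕ)} (hz : z ∈ sup (Lev n))
    (hc : bd n z = 0) (hns : NS n z) : ∃ w ∈ sup (Lev (n + 1)), bd (n + 1) w = z := by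
  change z ∈ (sup (Lev (n + 1))).map (bd (n + 1))
  refine mem_of_sel_mem wt z _ fun k => ?_
  have h1 : sel (fun w => wt w = k) z ∈ sup (LW n k) := by
    refine mem_sup_iff.2 fun w hw => ?_
    refine ⟨mem_sup_iff.1 (sel_mem_sup hz) w hw, mem_sup_iff.1 (sel_mem _ z) w hw⟩
  have h2 : bd n (sel (fun w => wt w = k) z) = 0 := by
    rw [← sel_comm (bd_wd_mem_wt n), hc, map_zero]
  have h3 : NS n (sel (fun w => wt w = k) z) := by
    intro u hu
    by_cases h : wt u = k
    · rw [cf_sel_pos (P := fun w => wt w = k) h, hns u hu]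
    · exact cf_of_mem (P := fun w => wt w = k) h (sel_mem _ z)
  obtain ⟨w, hw, hw'⟩ := exists_bd_eq k n h1 h2 h3
  exact ⟨w, LW_le_Lev hw, hw'⟩

end Multi

open Multi

/-! ### Comparison of the combinatorial model with the simplicial operators. -/

section Faces

variable {n : ℕ}

/-- The `i`-th coface map. -/
abbrev face (i : Fin (n + 2)) : Fin (n + 1) →o Fin (n + 2) := (Fin.succAboveOrderEmb i).toOrderHom

/-- The `j`-th codegeneracy map. -/
abbrev degen (j : Fin (n + 1)) : Fin (n + 2) →o Fin (n + 1) := ⟨j.predAbove, Fin.predAbove_right_monotone j⟩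

theorem blk_face (i : Fin (n + 2)) (k : Fin (n + 1)) (j : Fin n) :
    blk (face i) k = some j ↔ ¬ (i.val = 0 ∧ k.val = 0) ∧ j.val = fs i k := by
  rw [blk_eq_some]
  simp only [face, OrderEmbedding.toOrderHom_coe, Fin.succAboveOrderEmb_apply, Fin.succAbove, fs,
    Fin.lt_def, Fin.val_castSucc, Fin.val_succ]
  split_ifs <;> simp only [Fin.val_castSucc, Fin.val_succ] <;> omega

theorem mem_map_val {J : Finset (Fin n)} {a : ℕ} :
    a ∈ J.map Fin.valEmbedding ↔ ∃ h : a < n, (⟨a, h⟩ : Fin n) ∈ J := by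
  rw [Finset.mem_map]
  constructor
  · rintro ⟨b, hb, rfl⟩; exact ⟨b.2, hb⟩
  · rintro ⟨h, ha⟩; exact ⟨_, ha, rfl⟩

theorem val_mem_map_val {J : Finset (Fin n)} {a : Fin n} : a.val ∈ J.map Fin.valEmbedding ↔ a ∈ J :=
  mem_map_val.trans ⟨fun ⟨_, h⟩ => h, fun h => ⟨a.2, h⟩⟩

/-- For i = 0 step 0 lies in no block. For 0 < i ≤ n every step has a block, and only the steps i −
1 and i share one. -/
theorem good_face {i : Fin (n + 2)} (hi : i.val ≤ n) (J : Finset (Fin (n + 1))) :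
    Good (blk (face i)) J ↔ ¬ Bad i.val (J.map Fin.valEmbedding) := by
  constructor
  · rintro hg ⟨h1, h2⟩
    obtain ⟨h1', h1⟩ := mem_map_val.1 h1
    obtain ⟨j, hj⟩ := hg.1 _ h1
    have hj' := (blk_face i _ j).1 hj
    rcases h2 with h2 | h2
    · exact hj'.1 ⟨h2, h2⟩
    · obtain ⟨h2', h2⟩ := mem_map_val.1 h2
      have h0 : i.val ≠ 0 := fun h => hj'.1 ⟨h, h⟩
      have : blk (face i) ⟨i.val - 1, h2'⟩ = some j := by
        rw [blk_face]
        refine ⟨fun h => h0 h.1, ?_⟩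
        rw [hj'.2]
        simp only [fs]
        split_ifs <;> omega
      have := hg.eq h1 h2 hj this
      rw [Fin.mk.injEq] at this
      omega
  · intro hB
    have hz : ∀ k ∈ J, ¬ (i.val = 0 ∧ k.val = 0) := by
      rintro k hk ⟨h1, h2⟩
      refine hB ⟨?_, Or.inl h1⟩
      rw [h1, ← h2]
      exact val_mem_map_val.2 hk
    refine ⟨fun k hk => ?_, fun k hk k' hk' h => ?_⟩
    · have hlt : fs i.val k.val < n := by
        have := hz k hk
        unfold fs; split_ifs <;> omega
      exact ⟨⟨_, hlt⟩, (blk_face i k _).2 ⟨hz k hk, rfl⟩⟩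
    · have hlt : fs i.val k.val < n := by
        have := hz k hk
        unfold fs; split_ifs <;> omega
      have h1 : blk (face i) k = some ⟨_, hlt⟩ := (blk_face i k _).2 ⟨hz k hk, rfl⟩
      rw [h1] at h
      have h2 := ((blk_face i k' _).1 h.symm).2
      exact Fin.ext (fs_injOn hB (Finset.mem_coe.2 (val_mem_map_val.2 hk))
        (Finset.mem_coe.2 (val_mem_map_val.2 hk')) h2)

theorem good_face_last {i : Fin (n + 2)} (hi : n < i.val) (J : Finset (Fin (n + 1))) :
    Good (blk (face i)) J ↔ n ∉ J.map Fin.valEmbedding := by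
  have hfs : ∀ k : Fin (n + 1), fs i.val k.val = k.val := fun k => if_pos (by omega)
  constructor
  · rintro hg h1
    obtain ⟨h1', h1⟩ := mem_map_val.1 h1
    obtain ⟨j, hj⟩ := hg.1 _ h1
    have hj' := ((blk_face i _ j).1 hj).2
    rw [hfs] at hj'
    have := j.2
    simp only at hj'
    omega
  · intro hB
    have hlt : ∀ k ∈ J, k.val < n := by
      intro k hk
      have : k.val ≠ n := fun h => hB (by have := val_mem_map_val.2 hk; rwa [h] at this)
      omega
    have hb : ∀ k, ∀ hk : k ∈ J, blk (face i) k = some ⟨k.val, hlt k hk⟩ := fun k hk =>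
      (blk_face i k _).2 ⟨by omega, (hfs k).symm⟩
    refine ⟨fun k hk => ⟨_, hb k hk⟩, fun k hk k' hk' h => ?_⟩
    rw [hb k hk, hb k' hk', Option.some_inj, Fin.mk.injEq] at h
    exact Fin.ext h

theorem shadow_face (i : Fin (n + 2)) {J : Finset (Fin (n + 1))} (hg : Good (blk (face i)) J) :
    (shadow (blk (face i)) J).map Fin.valEmbedding =
      (J.map Fin.valEmbedding).image (fs i) := by
  ext a
  rw [mem_map_val, Finset.mem_image]
  constructor
  · rintro ⟨h, ha⟩
    obtain ⟨k, hk, hka⟩ := mem_shadow.1 ha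
    exact ⟨k.val, val_mem_map_val.2 hk, ((blk_face i k _).1 hka).2.symm⟩
  · rintro ⟨b, hb, rfl⟩
    obtain ⟨h, hb⟩ := mem_map_val.1 hb
    obtain ⟨j, hj⟩ := hg.1 _ hb
    have := ((blk_face i _ j).1 hj).2
    have hlt : fs i.val b < n := by rw [← this]; exact j.2
    refine ⟨hlt, mem_shadow.2 ⟨_, hb, ?_⟩⟩
    rw [hj, Option.some_inj]
    exact Fin.ext this

end Faces

namespace FreeDiff

variable {X : Type u} (D : FreeDiff X) {n : ℕ}

/-- The letter of a generator. -/
def letter (g : SGen D.dg n) : X × Finset ℕ := (g.1.1, g.1.2.map Fin.valEmbedding)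

theorem letter_injective : Function.Injective (D.letter (n := n)) := by
  rintro ⟨⟨x, I⟩, h⟩ ⟨⟨y, J⟩, h'⟩ hxy
  simp only [letter, Prod.mk.injEq, Finset.map_inj] at hxy
  obtain ⟨rfl, rfl⟩ := hxy
  rfl

/-- The comparison with words in sets of natural numbers. -/
noncomputable def emb (n : ℕ) : D.T n →ₐ[ℚ] Tens (X × Finset ℕ) := algLift fun g => wd [D.letter g]

theorem emb_gen (g : SGen D.dg n) : D.emb n (wd [g]) = wd [D.letter g] := algLift_gen _ g

theorem emb_wd (w : List (SGen D.dg n)) : D.emb n (wd w) = wd (w.map D.letter) := by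
  induction w with
  | nil => rw [wd_nil, map_one]; rfl
  | cons g w ih => rw [wd_cons, map_mul, ih, emb_gen, ← wd_cons]; rfl

theorem op₀_gen_of_good {m n : ℕ} {α : Fin (m + 1) →o Fin (n + 1)} {g : SGen D.dg n}
    (h : Good (blk α) g.1.2) :
    D.op₀ α (wd [g]) = wd [⟨(g.1.1, shadow (blk α) g.1.2), h.card_shadow.trans g.2⟩] := by
  rw [op₀_gen, pushBlk_of_good h, EGen_of_card]

theorem op₀_gen_of_not_good {m n : ℕ} {α : Fin (m + 1) →o Fin (n + 1)} {g : SGen D.dg n}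
    (h : ¬ Good (blk α) g.1.2) : D.op₀ α (wd [g]) = 0 := by
  rw [op₀_gen, pushBlk_of_not_good h]

theorem emb_op₀_face {i : Fin (n + 2)} (hi : i.val ≤ n) (y : D.T (n + 1)) :
    D.emb n (D.op₀ (face i) y) = fc i.val (D.emb (n + 1) y) := by
  refine comp_eq_of_gen (fun g => ?_) y
  rw [emb_gen, letter, fc_gen]
  by_cases h : Good (blk (face i)) g.1.2
  · rw [D.op₀_gen_of_good h, if_neg ((good_face hi _).1 h), emb_gen, letter, shadow_face i h]
  · rw [D.op₀_gen_of_not_good h, map_zero, if_pos]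
    rwa [good_face hi, not_not] at h

theorem emb_op₀_face_last {i : Fin (n + 2)} (hi : n < i.val) (y : D.T (n + 1)) :
    D.emb n (D.op₀ (face i) y) = lf n (D.emb (n + 1) y) := by
  refine comp_eq_of_gen (fun g => ?_) y
  rw [emb_gen, letter, lf_gen]
  by_cases h : Good (blk (face i)) g.1.2
  · rw [D.op₀_gen_of_good h, if_neg ((good_face_last hi _).1 h), emb_gen, letter, shadow_face i h,
      image_fs_of_lt]
    intro a ha
    obtain ⟨ha, -⟩ := mem_map_val.1 ha
    omega
  · rw [D.op₀_gen_of_not_good h, map_zero, if_pos]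
    rwa [good_face_last hi, not_not] at h

open Classical in
/-- The retraction of words in sets of natural numbers. -/
noncomputable def ret (n : ℕ) : Tens (X × Finset ℕ) →ₐ[ℚ] D.T n :=
  algLift fun l => if h : ∃ g : SGen D.dg n, D.letter g = l then wd [h.choose] else 0

theorem ret_letter (g : SGen D.dg n) : D.ret n (wd [D.letter g]) = wd [g] := by
  rw [ret, algLift_gen, dif_pos ⟨g, rfl⟩]
  congr 2
  exact D.letter_injective (⟨g, rfl⟩ : ∃ g' : SGen D.dg n, D.letter g' = D.letter g).choose_spec

theorem ret_gen_of_card {l : X × Finset ℕ} (h : l.2.card ≠ (D.dg l.1).1) : D.ret n (wd [l]) = 0 := by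
  rw [ret, algLift_gen, dif_neg]
  rintro ⟨g, rfl⟩
  exact h (by rw [letter, Finset.card_map]; exact g.2)

theorem ret_emb (y : D.T n) : D.ret n (D.emb n y) = y := by
  refine comp_eq_of_gen (f' := AlgHom.id ℚ _) (g' := AlgHom.id ℚ _) (fun g => ?_) y
  rw [emb_gen, ret_letter]; rfl

theorem exists_letter {l : X × Finset ℕ} (h : l.2.card = (D.dg l.1).1) (hl : ∀ a ∈ l.2, a < n) :
    ∃ g : SGen D.dg n, D.letter g = l := by
  have : (l.2.attachFin hl).map Fin.valEmbedding = l.2 := by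
    ext a
    rw [mem_map_val]
    simp only [Finset.mem_attachFin]
    exact ⟨fun ⟨_, h⟩ => h, fun h => ⟨hl a h, h⟩⟩
  refine ⟨⟨(l.1, l.2.attachFin hl), ?_⟩, Prod.ext rfl this⟩
  rw [Finset.card_attachFin]
  exact h

/-- A face that does not annihilate a letter keeps its cardinality, so letters of the wrong size are
killed on both sides, and at this level all the others come from generators. -/
theorem ret_fc {i : Fin (n + 2)} (hi : i.val ≤ n) {w : List (X × Finset ℕ)} (hw : Lev (n + 1) w) :
    D.ret n (fc i.val (wd w)) = D.op₀ (face i) (D.ret (n + 1) (wd w)) := by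
  induction w with
  | nil => rw [wd_nil]; simp only [map_one]
  | cons l w ih =>
    rw [lev_cons] at hw
    rw [wd_cons]
    simp only [map_mul]
    rw [ih hw.2]
    congr 1
    by_cases h : l.2.card = (D.dg l.1).1
    · obtain ⟨g, rfl⟩ := D.exists_letter h hw.1
      rw [ret_letter, ← emb_gen, ← D.emb_op₀_face hi, ret_emb]
    · rw [D.ret_gen_of_card h, map_zero]
      obtain ⟨x, I⟩ := l
      rw [fc_gen]
      split_ifs with hB
      · rw [map_zero]
      · exact D.ret_gen_of_card (by rwa [Finset.card_image_of_injOn (fs_injOn hB)])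

theorem ret_lf {i : Fin (n + 2)} (hi : n < i.val) {w : List (X × Finset ℕ)} (hw : Lev (n + 1) w) :
    D.ret n (lf n (wd w)) = D.op₀ (face i) (D.ret (n + 1) (wd w)) := by
  induction w with
  | nil => rw [wd_nil]; simp only [map_one]
  | cons l w ih =>
    rw [lev_cons] at hw
    rw [wd_cons]
    simp only [map_mul]
    rw [ih hw.2]
    congr 1
    by_cases h : l.2.card = (D.dg l.1).1
    · obtain ⟨g, rfl⟩ := D.exists_letter h hw.1
      rw [ret_letter, ← emb_gen, ← D.emb_op₀_face_last hi, ret_emb]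
    · rw [D.ret_gen_of_card h, map_zero]
      obtain ⟨x, I⟩ := l
      rw [lf_gen]
      split_ifs with hB
      · rw [map_zero]
      · exact D.ret_gen_of_card h

/-- The alternating sum of the faces, for the differential zero. -/
noncomputable def bdT (n : ℕ) : D.T (n + 1) →ₗ[ℚ] D.T n :=
  ∑ i : Fin (n + 2), (-1 : ℚ) ^ i.val • (D.op₀ (face i)).toLinearMap

theorem bdT_apply (y : D.T (n + 1)) :
    D.bdT n y = ∑ i : Fin (n + 2), (-1 : ℚ) ^ i.val • D.op₀ (face i) y := by
  simp [bdT]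

theorem emb_bdT (y : D.T (n + 1)) : D.emb n (D.bdT n y) = bd (n + 1) (D.emb (n + 1) y) := by
  rw [bdT_apply, bd_succ, map_sum, Fin.sum_univ_castSucc, ← Fin.sum_univ_eq_sum_range
    (fun k => (-1 : ℚ) ^ k • fc k (D.emb (n + 1) y))]
  congr 1
  · refine Finset.sum_congr rfl fun i _ => ?_
    rw [map_smul, D.emb_op₀_face (by rw [Fin.val_castSucc]; omega)]; rfl
  · rw [map_smul, D.emb_op₀_face_last (by simp)]; rfl

theorem ret_bd {w : Tens (X × Finset ℕ)} (hw : w ∈ sup (Lev (n + 1))) :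
    D.ret n (bd (n + 1) w) = D.bdT n (D.ret (n + 1) w) := by
  refine eq_on_sup (f := (D.ret n).toLinearMap ∘ₗ bd (n + 1))
    (g := D.bdT n ∘ₗ (D.ret (n + 1)).toLinearMap) (fun w hw => ?_) hw
  change D.ret n (bd (n + 1) (wd w)) = D.bdT n (D.ret (n + 1) (wd w))
  rw [bdT_apply, bd_succ, map_add, map_sum, Fin.sum_univ_castSucc, ← Fin.sum_univ_eq_sum_range
    (fun k => D.ret n ((-1 : ℚ) ^ k • fc k (wd w)))]
  congr 1
  · refine Finset.sum_congr rfl fun i _ => ?_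
    rw [map_smul, ← D.ret_fc (by rw [Fin.val_castSucc]; omega) hw]; rfl
  · rw [map_smul, ← D.ret_lf (by simp) hw]; rfl

/-- The words whose letters are consecutive intervals of steps. -/
def Sorted (n : ℕ) (u : List (SGen D.dg n)) : Prop := Srt n (u.map D.letter)

theorem cf_emb (u : List (SGen D.dg n)) (z : D.T n) : cf (u.map D.letter) (D.emb n z) = cf u z := by
  have : cf (u.map D.letter) ∘ₗ (D.emb n).toLinearMap = cf u := lin_ext fun w => by
    change cf (u.map D.letter) (D.emb n (wd w)) = cf u (wd w)
    rw [emb_wd]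
    by_cases h : u = w
    · subst h; rw [cf_wd_self, cf_wd_self]
    · rw [cf_wd_ne h, cf_wd_ne fun h' => h (List.map_injective_iff.2 D.letter_injective h')]
  exact LinearMap.congr_fun this z

theorem emb_mem_Lev (z : D.T n) : D.emb n z ∈ sup (Lev n) := by
  refine map_mem_of_sup (f := (D.emb n).toLinearMap) (fun w _ => ?_) (mem_sup_top z)
  change D.emb n (wd w) ∈ _
  rw [emb_wd]
  refine wd_mem_sup fun l hl a ha => ?_
  obtain ⟨g, -, rfl⟩ := List.mem_map.1 hl
  exact (mem_map_val.1 ha).1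

theorem NS_emb {z : D.T n} (h : ∀ u, D.Sorted n u → cf u z = 0) : NS n (D.emb n z) := by
  intro U hU
  by_cases hu : ∃ u : List (SGen D.dg n), u.map D.letter = U
  · obtain ⟨u, rfl⟩ := hu
    rw [cf_emb, h u hU]
  · refine cf_of_mem (P := fun U => ∃ u : List (SGen D.dg n), u.map D.letter = U) hu ?_
    refine map_mem_of_sup (f := (D.emb n).toLinearMap) (fun w _ => ?_) (mem_sup_top z)
    change D.emb n (wd w) ∈ _
    rw [emb_wd]
    exact wd_mem_sup ⟨w, rfl⟩

/-- Boundaries have vanishing sorted coefficients. -/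
theorem cf_bdT {u : List (SGen D.dg n)} (hu : D.Sorted n u) (y : D.T (n + 1)) :
    cf u (D.bdT n y) = 0 := by
  rw [← cf_emb, emb_bdT]
  exact NS_bd (D.emb_mem_Lev y) _ hu

/-- Cycles with vanishing sorted coefficients are boundaries. -/
theorem exists_bdT_eq {z : D.T n} (hc : bd n (D.emb n z) = 0)
    (h : ∀ u, D.Sorted n u → cf u z = 0) : ∃ w, D.bdT n w = z := by
  obtain ⟨w, hw, hw'⟩ := exists_bd_eq_of_lev (D.emb_mem_Lev z) hc (D.NS_emb h)
  exact ⟨D.ret (n + 1) w, by rw [← D.ret_bd hw, hw', ret_emb]⟩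

end FreeDiff

/-! ### From primitives for the alternating sum of faces to Moore chains. -/

section DoldKan

open AlgebraicTopology AlgebraicTopology.DoldKan CategoryTheory.SimplicialObject

variable (F : SimplicialObject (ModuleCat.{u} ℚ)) {n : ℕ}

/-- The elements annihilated by all faces but the first. -/
noncomputable def mooreSub (n : ℕ) : Submodule ℚ (F.obj (Opposite.op (SimplexCategory.mk (n + 1)))) :=
  ⨅ i : Fin (n + 1), LinearMap.ker (F.δ i.succ).hom

theorem P_f_apply_of_mem (q : ℕ) {z : F.obj (Opposite.op (SimplexCategory.mk (n + 1)))}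
    (hz : z ∈ mooreSub F n) : ((P q : AlternatingFaceMapComplex.obj F ⟶ _).f (n + 1)).hom z = z := by
  have hv : HigherFacesVanish q (ModuleCat.ofHom (mooreSub F n).subtype :
      ModuleCat.of ℚ (mooreSub F n) ⟶ F.obj (Opposite.op (SimplexCategory.mk (n + 1)))) := by
    intro j _
    ext x
    exact (Submodule.mem_iInf _).1 x.2 j
  exact LinearMap.congr_fun (congrArg ModuleCat.Hom.hom hv.comp_P_eq_self) (⟨z, hz⟩ : mooreSub F n)

theorem exists_moore_of_boundary {z : F.obj (Opposite.op (SimplexCategory.mk n))}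
    (hz : ∀ q, ((P q : AlternatingFaceMapComplex.obj F ⟶ _).f n).hom z = z)
    {w : F.obj (Opposite.op (SimplexCategory.mk (n + 1)))}
    (hw : ∑ i : Fin (n + 2), (-1 : ℚ) ^ i.val • (F.δ i).hom w = z) :
    ∃ w' ∈ mooreSub F n, (F.δ 0).hom w' = z := by
  have hd : ((AlternatingFaceMapComplex.obj F).d (n + 1) n).hom w = z := by
    rw [AlternatingFaceMapComplex.obj_d_eq, ModuleCat.hom_sum, LinearMap.sum_apply, ← hw]
    refine Finset.sum_congr rfl fun i _ => ?_
    rw [ModuleCat.hom_zsmul, LinearMap.smul_apply]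
    rcases Nat.even_or_odd i.val with h | h
    · rw [h.neg_one_pow, h.neg_one_pow, one_smul, one_smul]
    · rw [h.neg_one_pow, h.neg_one_pow, neg_one_smul, neg_one_smul]
  -- The Dold–Kan projector is a chain map with values in Moore chains and fixes z, so it replaces
  -- the primitive w by a Moore chain, on which the alternating sum reduces to the face d_0.
  set Pw := ((P (n + 1) : AlternatingFaceMapComplex.obj F ⟶ _).f (n + 1)).hom w with hPw
  have hm : Pw ∈ mooreSub F n := (Submodule.mem_iInf _).2 fun i =>
    LinearMap.congr_fun (congrArg ModuleCat.Hom.hom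
      (HigherFacesVanish.of_P (X := F) (n + 1) n i (by omega))) w
  refine ⟨Pw, hm, ?_⟩
  have hc := LinearMap.congr_fun (congrArg ModuleCat.Hom.hom
    ((P (n + 1) : AlternatingFaceMapComplex.obj F ⟶ _).comm (n + 1) n)) w
  change ((AlternatingFaceMapComplex.obj F).d (n + 1) n).hom Pw =
    ((P (n + 1) : AlternatingFaceMapComplex.obj F ⟶ _).f n).hom (((AlternatingFaceMapComplex.obj F).d (n + 1) n).hom w) at hc
  rw [hd, hz] at hc
  rw [← hc, AlternatingFaceMapComplex.obj_d_eq, ModuleCat.hom_sum, LinearMap.sum_apply,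
    Fin.sum_univ_succ, Finset.sum_eq_zero, add_zero]
  · simp
  · intro i _
    rw [ModuleCat.hom_zsmul, LinearMap.smul_apply, LinearMap.mem_ker.1 ((Submodule.mem_iInf _).1 hm i),
      smul_zero]

end DoldKan

namespace FreeDiff

variable {X : Type u} (D : FreeDiff X) {n : ℕ}

/-- The simplicial vector space given by the operators `op₀`. -/
noncomputable def simp₀ : SimplicialObject (ModuleCat.{u} ℚ) where
  obj m := ModuleCat.of ℚ (D.T m.unop.len)
  map α := ModuleCat.ofHom (D.op₀ α.unop.toOrderHom).toLinearMap
  map_id m := by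
    exact ModuleCat.hom_ext (LinearMap.ext fun y => D.op₀_id y)
  map_comp α β := by
    exact ModuleCat.hom_ext (LinearMap.ext fun y => D.op₀_comp α.unop.toOrderHom β.unop.toOrderHom y)

/-- The Moore chains for the differential zero. -/
def IsMoore : (n : ℕ) → D.T n → Prop
  | 0, _ => True
  | n + 1, z => ∀ i : Fin (n + 1), D.op₀ (face i.succ) z = 0

/-- The Moore cycles for the differential zero. -/
def IsCyc : (n : ℕ) → D.T n → Prop
  | 0, _ => True
  | n + 1, z => ∀ i : Fin (n + 2), D.op₀ (face i) z = 0

theorem IsCyc.bd_eq {z : D.T n} (hz : D.IsCyc n z) : bd n (D.emb n z) = 0 := by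
  cases n with
  | zero => rfl
  | succ n =>
    rw [← emb_bdT, bdT_apply, Finset.sum_eq_zero, map_zero]
    intro i _
    rw [hz i, smul_zero]

theorem IsCyc.exists_moore {z : D.T n} (hz : D.IsCyc n z) (h : ∀ u, D.Sorted n u → cf u z = 0) :
    ∃ w : D.T (n + 1), D.IsMoore (n + 1) w ∧ D.op₀ (face 0) w = z := by
  obtain ⟨w, hw⟩ := D.exists_bdT_eq (IsCyc.bd_eq D hz) h
  rw [bdT_apply] at hw
  have hP : ∀ q, ((AlgebraicTopology.DoldKan.P q :
      AlgebraicTopology.AlternatingFaceMapComplex.obj D.simp₀ ⟶ _).f n).hom z = z := by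
    intro q
    cases n with
    | zero =>
      exact LinearMap.congr_fun (congrArg ModuleCat.Hom.hom
        (AlgebraicTopology.DoldKan.P_f_0_eq (X := D.simp₀) q)) z
    | succ n => exact P_f_apply_of_mem D.simp₀ q ((Submodule.mem_iInf _).2 fun i => hz i.succ)
  obtain ⟨w', h1, h2⟩ := exists_moore_of_boundary D.simp₀ (n := n) (z := z) hP (w := w) hw
  exact ⟨w', fun i => (Submodule.mem_iInf _).1 h1 i, h2⟩

end FreeDiff

/-! ### Top coefficients: shuffle cycles and their sorted coefficients. -/

namespace FreeDiff

variable {X : Type u} (D : FreeDiff X) {n : ℕ}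

/-- The top coefficient of the universal form of an element. -/
noncomputable def Psi (n : ℕ) : Tens X →ₗ[ℚ] D.T n := coeff Finset.univ ∘ₗ (D.E n).toLinearMap

theorem Psi_apply (a : Tens X) : D.Psi n a = D.E n a Finset.univ := rfl

theorem Psi_mem {B : Submodule ℚ (D.T n)} {a : Tens X} (h : D.E n a ∈ coeffIn B) : D.Psi n a ∈ B :=
  h Finset.univ

/-- Pigeonhole: n + 1 steps do not inject into n blocks. Consequently the faces for zero
differential annihilate every top coefficient. -/
theorem not_good_univ (α : Fin (n + 1) →o Fin (n + 2)) : ¬ Good (blk α) Finset.univ := by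
  intro h
  have h1 := h.card_shadow
  rw [Finset.card_univ, Fintype.card_fin] at h1
  have := Finset.card_le_univ (shadow (blk α) Finset.univ)
  rw [Fintype.card_fin] at this
  omega

theorem op₀_Psi (α : Fin (n + 1) →o Fin (n + 2)) (a : Tens X) : D.op₀ α (D.Psi (n + 1) a) = 0 := by
  rw [Psi_apply, op₀_E, pushBlk_of_not_good (not_good_univ α)]

theorem op_face_succ (i : Fin (n + 1)) (y : D.T (n + 1)) :
    D.op (face i.succ) y = D.op₀ (face i.succ) y :=
  D.op_eq_op₀ _ (by simp [Fin.succAbove]) y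

/-- The coface 0 sends vertex 0 to vertex 1, so θ = ω_0. The untwisted part has no top coefficient;
multiplication by ω_0 accounts for step 0, and the remaining steps are in order-preserving bijection
with the steps of [n], so no sign appears. -/
theorem op_face_zero_Psi (a : Tens X) : D.op (face 0) (D.Psi (n + 1) a) = D.Psi n (D.d a) := by
  have hz : ((face 0 : Fin (n + 1) →o Fin (n + 2)) 0).val = 1 := by simp
  have ht : (theta 1 : Form (n + 1) (D.τ n)) = omega 0 := by
    rw [theta, Finset.sum_eq_single 0]
    · intro k hk h0
      exact absurd (Fin.ext (by simpa using hk)) h0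
    · simp
  have hb : ∀ k : Fin n, blk (face (0 : Fin (n + 2))) k.succ = some k := fun k => by
    rw [blk_eq_some]; simp
  have hmem : ∀ k : Fin (n + 1), k ∈ (Finset.univ \ {0} : Finset (Fin (n + 1))) ↔
      ∃ j : Fin n, k = j.succ := by
    intro k
    rw [Finset.mem_sdiff, Finset.mem_singleton, ← ne_eq, ← Fin.exists_succ_eq]
    simp [eq_comm]
  have hg : Good (blk (face (0 : Fin (n + 2)))) (Finset.univ \ {0}) := by
    refine ⟨fun k hk => ?_, fun k hk k' hk' h => ?_⟩
    · obtain ⟨j, rfl⟩ := (hmem k).1 hk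
      exact ⟨j, hb j⟩
    · obtain ⟨j, rfl⟩ := (hmem k).1 hk
      obtain ⟨j', rfl⟩ := (hmem k').1 hk'
      rw [hb, hb, Option.some_inj] at h
      rw [h]
  have hs : shadow (blk (face (0 : Fin (n + 2)))) (Finset.univ \ {0}) = Finset.univ := by
    rw [Finset.eq_univ_iff_forall]
    exact fun j => mem_shadow.2 ⟨j.succ, (hmem _).2 ⟨j, rfl⟩, hb j⟩
  have hsg : shSign {(0 : Fin (n + 1))} (Finset.univ \ {0}) = 1 := by
    simp [shSign]
  rw [Psi_apply, op_E, opForm, Form.add_apply, pushBlk_of_not_good (not_good_univ _), zero_add, hz, ht,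
    omega_mul, if_pos (Finset.mem_univ _), hsg, one_smul, pushBlk_of_good hg, hs, Psi_apply]

theorem par_pow_wd_gen (k : ℕ) (g : SGen D.dg n) :
    (D.τ n ^ k) (wd [g]) = (-1 : ℚ) ^ (D.ideg n g * k) • wd [g] :=
  par_pow_apply _ (wd_mem_sup (by simp)) k

/-- Reading u from the left, its first letter prescribes which steps the first factor of the product
takes, so a single term with sign ±1 contributes. Coefficients on initial segments of steps are
considered so that the induction can remove the top interval. -/
theorem cf_E_ne_zero {m : ℕ} {u : List (SGen D.dg n)} (hu : Srt m (u.map D.letter)) (hm : m ≤ n) :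
    cf u (D.E n (wd (u.map fun g => g.1.1)) (Finset.univ.filter fun k => k.val < m)) ≠ 0 := by
  classical
  induction u generalizing m with
  | nil =>
    obtain rfl : m = 0 := hu
    rw [List.map_nil, wd_nil, map_one, one_apply, if_pos (by simp), ← wd_nil, cf_wd_self]
    exact one_ne_zero
  | cons g u ih =>
    obtain ⟨m', h1, h2, h3⟩ := hu
    have hg : ∀ k : Fin n, k ∈ g.1.2 ↔ m' ≤ k.val ∧ k.val < m := fun k => by
      rw [← val_mem_map_val, ← Finset.mem_Ico, ← h2]; rfl
    have hI : g.1.2 ⊆ Finset.univ.filter fun k => k.val < m := fun k hk => by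
      simpa using ((hg k).1 hk).2
    have hd : (Finset.univ.filter fun k : Fin n => k.val < m) \ g.1.2 =
        Finset.univ.filter fun k => k.val < m' := by
      ext k
      have := hg k
      simp only [Finset.mem_sdiff, Finset.mem_filter, Finset.mem_univ, true_and, this]
      omega
    rw [List.map_cons, wd_cons, map_mul, E_gen, mul_apply, map_sum,
      Finset.sum_eq_single g.1.2, D.EGen_of_card g.2, par_pow_wd_gen, hd, smul_mul_assoc, map_smul,
      map_smul, cf_cons, if_pos rfl]
    · refine smul_ne_zero ?_ (smul_ne_zero (pow_ne_zero _ (by norm_num)) (ih h3 (by omega)))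
      intro h0
      have := shSign_mul_self g.1.2 (Finset.univ.filter fun k : Fin n => k.val < m')
      rw [h0, zero_mul] at this
      exact zero_ne_one this
    · intro I _ hne
      by_cases hc : I.card = (D.dg g.1.1).1
      · rw [D.EGen_of_card hc, par_pow_wd_gen, smul_mul_assoc, map_smul, map_smul, cf_cons,
          if_neg, smul_zero, smul_zero]
        exact fun h => hne (congrArg (fun g : SGen D.dg n => g.1.2) h).symm
      · rw [D.isHom_EGen n _ I hc, map_zero, zero_mul, smul_zero, map_zero]
    · exact fun h => absurd (Finset.mem_powerset.2 hI) h

theorem cf_Psi_ne_zero {u : List (SGen D.dg n)} (hu : D.Sorted n u) :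
    cf u (D.Psi n (wd (u.map fun g => g.1.1))) ≠ 0 := by
  have := D.cf_E_ne_zero hu le_rfl
  rwa [Finset.filter_true_of_mem fun k _ => k.2] at this

theorem cf_Psi_eq_zero {u : List (SGen D.dg n)} {v : List X} (h : u.map (fun g => g.1.1) ≠ v) :
    cf u (D.Psi n (wd v)) = 0 := by
  have h' := D.Psi_mem (D.E_wd_mem n v)
  refine cf_of_mem ?_ h'
  exact h

/-- The homological degrees of the letters prescribe the lengths of the successive intervals. -/
theorem exists_srt {v : List X} {m : ℕ} (hv : (wdeg D.dg v).1 = m) (hm : m ≤ n) :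
    ∃ u : List (SGen D.dg n), u.map (fun g => g.1.1) = v ∧ Srt m (u.map D.letter) := by
  induction v generalizing m with
  | nil => exact ⟨[], rfl, hv.symm⟩
  | cons x v ih =>
    rw [wdeg_cons, Prod.fst_add] at hv
    obtain ⟨u, rfl, h2⟩ := ih (m := m - (dg D x).1) (by omega) (by omega)
    obtain ⟨I, hI⟩ : ∃ I : Finset (Fin n), I.map Fin.valEmbedding = Finset.Ico (m - (D.dg x).1) m := by
      refine ⟨Finset.univ.filter fun k => m - (D.dg x).1 ≤ k.val ∧ k.val < m, ?_⟩
      ext a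
      rw [mem_map_val, Finset.mem_Ico]
      simp only [Finset.mem_filter, Finset.mem_univ, true_and]
      exact ⟨fun ⟨_, h⟩ => h, fun h => ⟨by omega, h⟩⟩
    have hc : I.card = (D.dg x).1 := by
      rw [← Finset.card_map Fin.valEmbedding, hI, Nat.card_Ico]; omega
    refine ⟨⟨(x, I), hc⟩ :: u, rfl, m - (D.dg x).1, ?_, hI, h2⟩
    change _ + (I.map _).card = m
    rw [Finset.card_map, hc]; omega

theorem srt_unique {m : ℕ} {u u' : List (SGen D.dg n)} (hu : Srt m (u.map D.letter))
    (hu' : Srt m (u'.map D.letter)) (h : u.map (fun g => g.1.1) = u'.map fun g => g.1.1) : u = u' := by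
  induction u generalizing u' m with
  | nil => exact (List.map_eq_nil_iff.1 h.symm).symm
  | cons g u ih =>
    cases u' with
    | nil => cases h
    | cons g' u' =>
      obtain ⟨m₁, h1, h2, h3⟩ := hu
      obtain ⟨m₂, h1', h2', h3'⟩ := hu'
      rw [List.map_cons, List.map_cons, List.cons.injEq] at h
      have e1 : (D.letter g).2.card = (D.letter g').2.card := by
        rw [letter, letter, Finset.card_map, Finset.card_map, g.2, g'.2, h.1]
      obtain rfl : m₁ = m₂ := by omega
      rw [ih h3 h3' h.2, D.letter_injective (Prod.ext h.1 (h2.trans h2'.symm))]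

theorem wdeg_of_srt {m : ℕ} {u : List (SGen D.dg n)} (hu : Srt m (u.map D.letter)) :
    (wdeg D.dg (u.map fun g => g.1.1)).1 = m := by
  induction u generalizing m with
  | nil => exact hu.symm
  | cons g u ih =>
    obtain ⟨m', h1, h2, h3⟩ := hu
    rw [List.map_cons, wdeg_cons, Prod.fst_add, ih h3, ← h1, letter, Finset.card_map, g.2, add_comm]

theorem wdeg_map (u : List (SGen D.dg n)) :
    wdeg (D.ideg n) u = (wdeg D.dg (u.map fun g => g.1.1)).2 := by
  induction u with
  | nil => rfl
  | cons g w ih => rw [wdeg_cons, List.map_cons, wdeg_cons, ih]; rfl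

/-- Each word of homological degree n has exactly one sorted word above it, and with this indexing
the matrix of sorted coefficients of Ψ is diagonal with nonzero entries. -/
theorem eq_zero_of_cf_Psi {a : Tens X} (ha : a ∈ sup fun v => (wdeg D.dg v).1 = n)
    (h : ∀ u, D.Sorted n u → cf u (D.Psi n a) = 0) : a = 0 := by
  refine ext_cf fun v => ?_
  rw [map_zero]
  by_contra hv
  obtain ⟨u, rfl, hu⟩ := D.exists_srt (n := n) (mem_sup_iff.1 ha v hv) le_rfl
  refine mul_ne_zero hv (D.cf_Psi_ne_zero hu) ?_
  rw [← h u hu]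
  conv_rhs => rw [← sum_support a]
  rw [map_sum, map_sum, Finset.sum_eq_single (u.map fun g => g.1.1)]
  · rw [map_smul, map_smul, smul_eq_mul]
  · intro w _ hw
    rw [map_smul, map_smul, D.cf_Psi_eq_zero hw.symm, smul_zero]
  · exact fun h' => absurd (mem_support.2 hv) h'

/-- Subtracting a top coefficient kills the sorted coefficients. -/
theorem exists_cf_sub_Psi {P : List (SGen D.dg n) → Prop} {z : D.T n} (hz : z ∈ sup P) :
    ∃ c ∈ sup fun v => ∃ u, D.Sorted n u ∧ P u ∧ u.map (fun g => g.1.1) = v,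
      ∀ u, D.Sorted n u → cf u (z - D.Psi n c) = 0 := by
  classical
  -- The diagonal system of sorted coefficients is solved by dividing by the diagonal entries.
  refine ⟨∑ u ∈ (support z).filter (D.Sorted n), (cf u z / cf u (D.Psi n (wd (u.map fun g => g.1.1)))) •
    wd (u.map fun g => g.1.1), Submodule.sum_mem _ fun u hu => ?_, fun u hu => ?_⟩
  · rw [Finset.mem_filter] at hu
    exact Submodule.smul_mem _ _ (wd_mem_sup ⟨u, hu.2, mem_sup_iff.1 hz u (mem_support.1 hu.1), rfl⟩)
  · rw [map_sub, map_sum, map_sum, Finset.sum_eq_single u, map_smul, map_smul, smul_eq_mul,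
      div_mul_cancel₀ _ (D.cf_Psi_ne_zero hu), sub_self]
    · intro u' hu' hne
      rw [Finset.mem_filter] at hu'
      rw [map_smul, map_smul, D.cf_Psi_eq_zero fun h => hne (D.srt_unique hu'.2 hu h.symm), smul_zero]
    · intro h
      have h0 : cf u z = 0 := by
        by_contra h'
        exact h (Finset.mem_filter.2 ⟨mem_support.2 h', hu⟩)
      rw [h0, zero_div, zero_smul, map_zero, map_zero]

end FreeDiff

/-! ### Right-normed bracketing, and descent from tensors to Lie elements. -/

section Retraction

variable {Γ Γ' : Type u} {ι : Type} [AddCommMonoid ι] [DecidableEq ι] {tot : ι →+ ℕ} {deg : Γ → ι}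
  {deg' : Γ' → ι}

/-- The right-normed bracketing of a word. -/
noncomputable def rbWd (tot : ι →+ ℕ) (deg : Γ → ι) (w : List Γ) : Tens Γ :=
  freeLieIncl tot deg (rnorm (freeLie tot deg) (freeLieGen tot deg) w)

/-- The right-normed bracketing. -/
noncomputable def rb (tot : ι →+ ℕ) (deg : Γ → ι) : Tens Γ →ₗ[ℚ] Tens Γ := lift (rbWd tot deg)

theorem rbWd_single (g : Γ) : rbWd tot deg [g] = wd [g] := rfl

theorem rbWd_cons (g : Γ) {w : List Γ} (hw : w ≠ []) :
    rbWd tot deg (g :: w) = lbr (fun g => tot (deg g)) (wd [g]) (rbWd tot deg w) := by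
  rw [rbWd, rnorm_cons _ _ _ hw]; rfl

theorem rbWd_mem_tgr (w : List Γ) : rbWd tot deg w ∈ tgr deg (wdeg deg w) :=
  rnorm_mem (H := freeLie tot deg) (freeLie_isFreeOn tot deg).1 w

theorem rbWd_mem_lieSub (w : List Γ) : rbWd tot deg w ∈ lieSub tot deg :=
  Subtype.property (p := fun x => x ∈ lieSub tot deg) _

theorem rbWd_mem_tlen (w : List Γ) : rbWd tot deg w ∈ tlen w.length := by
  induction w with
  | nil => exact zero_mem _
  | cons g w ih =>
    by_cases hw : w = []
    · subst hw; exact wd_mem_sup rfl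
    · rw [rbWd_cons g hw, List.length_cons, add_comm]
      exact lbr_mem_tlen (wd_mem_sup rfl) ih

theorem rb_mem_lieSub (x : Tens Γ) : rb tot deg x ∈ lieSub tot deg := by
  refine map_mem_of_sup (fun w _ => ?_) (mem_sup_top x)
  rw [rb, lift_wd]
  exact rbWd_mem_lieSub w

theorem rb_mem_tgr {i : ι} {x : Tens Γ} (hx : x ∈ tgr deg i) : rb tot deg x ∈ tgr deg i := by
  refine map_mem_of_sup (fun w hw => ?_) hx
  rw [rb, lift_wd, ← hw]
  exact rbWd_mem_tgr w

theorem rb_mem_tlen {n : ℕ} {x : Tens Γ} (hx : x ∈ tlen n) : rb tot deg x ∈ tlen n := by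
  refine map_mem_of_sup (fun w hw => ?_) hx
  rw [rb, lift_wd, ← hw]
  exact rbWd_mem_tlen w

/-- The Dynkin–Specht–Wever theorem: on words of length n the unnormalised Dynkin map is n times the
retraction of `dynkin_self`. -/
theorem rb_of_mem {n : ℕ} {x : Tens Γ} (hx : x ∈ lieSub tot deg) (hn : x ∈ tlen n) :
    rb tot deg x = (n : ℚ) • x := by
  have h : rb tot deg = freeLieIncl tot deg ∘ₗ
      lift (rnorm (freeLie tot deg) (freeLieGen tot deg)) := lin_ext fun w => by
    rw [rb, lift_wd, LinearMap.comp_apply, lift_wd]; rfl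
  rw [h, LinearMap.comp_apply, lift_rnorm_eq _ _ hn, map_smul, dynkin_self hx]

theorem rb_mul {x y : Tens Γ} (hx : x ∈ tlen 1) (hy : y ∈ tge 1) :
    rb tot deg (x * y) = lbr (fun g => tot (deg g)) x (rb tot deg y) := by
  refine bilin_eq_on_sup (f := (LinearMap.mul ℚ (Tens Γ)).compr₂ (rb tot deg))
    (g := (lbr fun g => tot (deg g)).compl₂ (rb tot deg)) (fun w w' hw hw' => ?_) hx hy
  obtain ⟨g, rfl⟩ := List.length_eq_one_iff.1 hw
  change rb tot deg (wd [g] * wd w') = lbr _ (wd [g]) (rb tot deg (wd w'))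
  rw [← wd_cons, rb, lift_wd, lift_wd, rbWd_cons g (List.length_pos_iff.1 hw')]

/-- A map that is linear on generators and preserves degrees commutes with brackets and with
splitting off the first letter, hence with right-normed bracketing. -/
theorem rb_algHom {f : Tens Γ →ₐ[ℚ] Tens Γ'} (hf : ∀ g, f (wd [g]) ∈ tgr deg' (deg g))
    (hf' : ∀ g, f (wd [g]) ∈ tlen 1) (hl : ∀ g, f (wd [g]) ∈ lieSub tot deg') (x : Tens Γ) :
    rb tot deg' (f x) = f (rb tot deg x) := by
  refine LinearMap.congr_fun (f := rb tot deg' ∘ₗ f.toLinearMap) (g := f.toLinearMap ∘ₗ rb tot deg)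
    (lin_ext fun w => ?_) x
  change rb tot deg' (f (wd w)) = f (rb tot deg (wd w))
  induction w with
  | nil =>
    rw [wd_nil, map_one, ← wd_nil, ← wd_nil, rb, rb, lift_wd, lift_wd]
    exact (map_zero f).symm
  | cons g w ih =>
    by_cases hw : w = []
    · subst hw
      rw [rb_of_mem (hl g) (hf' g), rb, lift_wd, rbWd_single, Nat.cast_one, one_smul]
    · have h1 : (wd w : Tens Γ) ∈ tge 1 := wd_mem_sup (List.length_pos_iff.2 hw)
      have h2 : f (wd w) ∈ tge 1 := algHom_mem_tge (fun g =>
        (sup_mono fun _ hw => le_of_eq (Eq.symm hw) : (tlen 1 : Submodule ℚ (Tens Γ')) ≤ tge 1)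
          (hf' g)) h1
      have h3 : (wd [g] : Tens Γ) ∈ tlen 1 := wd_mem_sup (P := fun w => w.length = 1) rfl
      rw [wd_cons, map_mul, rb_mul (hf' g) h2, ih, rb_mul h3 h1, algHom_lbr hf]

end Retraction

namespace FreeDiff

variable {X : Type u} (D : FreeDiff X) {n : ℕ}

/-- Split off the first letter. The product of forms and, by `commutator_apply`, their graded
commutator are sums over the same splittings of K with the same signs, and `rb` turns each product
of coefficients into the corresponding bracket. -/
theorem rb_E_wd (w : List X) (K : Finset (Fin n)) :
    rb (AddMonoidHom.id ℕ) (D.ideg n) (D.E n (wd w) K) =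
      D.E n (rbWd totalDegree D.dg w) K := by
  induction w generalizing K with
  | nil =>
    have h : D.E n (rbWd totalDegree D.dg []) = 0 := map_zero (D.E n)
    rw [wd_nil, map_one, one_apply, h]
    split_ifs
    · rw [← wd_nil, rb, lift_wd]; rfl
    · exact map_zero _
  | cons x w ih =>
    have h1 : ∀ I, D.E n (wd [x]) I ∈ tlen 1 :=
      D.E_mem_tlen (wd_mem_sup (P := fun w : List X => w.length = 1) rfl)
    by_cases hw : w = []
    · subst hw
      rw [rb_of_mem (D.E_mem_lie (gen_mem_lieSub _ _ x) K) (h1 K), rbWd_single, Nat.cast_one, one_smul]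
    · have h2 : ∀ I, D.E n (wd w) I ∈ tge 1 :=
        D.E_mem_tge (wd_mem_sup (P := fun w : List X => 1 ≤ w.length) (List.length_pos_iff.2 hw))
      have hx : (wd [x] : Tens X) ∈ tgr D.dg (D.dg x) := wd_mem_sup (by simp)
      have hr := rbWd_mem_tgr (tot := totalDegree) (deg := D.dg) w
      have hE := D.E_mem_tgr (n := n) (p := (D.dg x).1) (s := (D.dg x).2) hx
      have hE' := D.E_mem_tgr (n := n) (p := (wdeg D.dg w).1) (s := (wdeg D.dg w).2) hr
      have hI := D.isHom_E (n := n) (p := (D.dg x).1) (s := (D.dg x).2) hx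
      have hI' := D.isHom_E (n := n) (p := (wdeg D.dg w).1) (s := (wdeg D.dg w).2) hr
      rw [rbWd_cons x hw, lbr_homog hx hr, map_sub, map_smul, map_mul, map_mul,
        show totalDegree (D.dg x) = (D.dg x).1 + (D.dg x).2 from rfl,
        show totalDegree (wdeg D.dg w) = (wdeg D.dg w).1 + (wdeg D.dg w).2 from rfl,
        commutator_apply hI hI' hE hE', wd_cons, map_mul, mul_apply, map_sum]
      refine Finset.sum_congr rfl fun I _ => ?_
      rw [map_smul, par_pow_apply _ (hE I), smul_mul_assoc, map_smul, rb_mul (h1 I) (h2 _), ih, smul_smul]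
      by_cases hc : (K \ I).card = (wdeg D.dg w).1
      · rw [hc]; rfl
      · rw [hI' _ hc, map_zero, map_zero, smul_zero, smul_zero]

theorem rb_Psi (a : Tens X) : rb (AddMonoidHom.id ℕ) (D.ideg n) (D.Psi n a) =
    D.Psi n (rb totalDegree D.dg a) := by
  refine LinearMap.congr_fun (f := rb (AddMonoidHom.id ℕ) (D.ideg n) ∘ₗ D.Psi n)
    (g := D.Psi n ∘ₗ rb totalDegree D.dg) (lin_ext fun w => ?_) a
  rw [LinearMap.comp_apply, LinearMap.comp_apply, Psi_apply, rb_E_wd, rb, lift_wd, Psi_apply]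

theorem op₀_gen_mem_lie {m : ℕ} (α : Fin (m + 1) →o Fin (n + 1)) (g : SGen D.dg n) :
    D.op₀ α (wd [g]) ∈ D.lieT m := D.op₀_mem_lie α (gen_mem_lieSub _ _ g)

theorem rb_op₀ {m : ℕ} (α : Fin (m + 1) →o Fin (n + 1)) (y : D.T n) :
    rb (AddMonoidHom.id ℕ) (D.ideg m) (D.op₀ α y) =
      D.op₀ α (rb (AddMonoidHom.id ℕ) (D.ideg n) y) :=
  rb_algHom (D.op₀_gen_mem_tgr α) (D.op₀_gen_mem_tlen α) (D.op₀_gen_mem_lie α) y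

theorem sel_len_op₀ {m : ℕ} (α : Fin (m + 1) →o Fin (n + 1)) (k : ℕ) (y : D.T n) :
    sel (fun w => w.length = k) (D.op₀ α y) = D.op₀ α (sel (fun w => w.length = k) y) :=
  sel_comm (f := (D.op₀ α).toLinearMap) (fun _ => D.op₀_mem_tlen α (wd_mem_sup rfl)) k y

theorem sel_deg_op₀ {m : ℕ} (α : Fin (m + 1) →o Fin (n + 1)) (k : ℕ) (y : D.T n) :
    sel (fun w => wdeg (D.ideg m) w = k) (D.op₀ α y) =
      D.op₀ α (sel (fun w => wdeg (D.ideg n) w = k) y) :=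
  sel_comm (f := (D.op₀ α).toLinearMap) (fun _ => D.op₀_mem_tgr α (wd_mem_sup rfl)) k y

/-- The homology of the associated graded complex. -/
theorem IsCyc.exists_eq {l t : ℕ} (hl : 0 < l) {z : D.T n} (hz : D.IsCyc n z) (hlie : z ∈ D.lieT n)
    (hlen : z ∈ tlen l) (ht : z ∈ tgr (D.ideg n) t) :
    ∃ c ∈ lieSub totalDegree D.dg, c ∈ tgr D.dg (n, t) ∧ c ∈ tlen l ∧
      ∃ w ∈ D.lieT (n + 1), w ∈ tgr (D.ideg (n + 1)) t ∧ w ∈ tlen l ∧ D.IsMoore (n + 1) w ∧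
        z = D.Psi n c + D.op₀ (face 0) w := by
  have hP : z ∈ sup fun u => u.length = l ∧ wdeg (D.ideg n) u = t :=
    mem_sup_iff.2 fun u hu => ⟨mem_sup_iff.1 hlen u hu, mem_sup_iff.1 ht u hu⟩
  obtain ⟨c, hc, hc'⟩ := D.exists_cf_sub_Psi hP
  have hc1 : c ∈ tgr D.dg (n, t) := by
    refine sup_mono ?_ hc
    rintro v ⟨u, hu, ⟨-, hu'⟩, rfl⟩
    exact Prod.ext (D.wdeg_of_srt hu) ((D.wdeg_map u).symm.trans hu')
  have hc2 : c ∈ tlen l := by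
    refine sup_mono ?_ hc
    rintro v ⟨u, hu, ⟨hu', -⟩, rfl⟩
    rw [List.length_map, hu']
  have hcyc : D.IsCyc n (z - D.Psi n c) := by
    cases n with
    | zero => trivial
    | succ n => exact fun i => by rw [map_sub, hz i, op₀_Psi, sub_zero]
  obtain ⟨w₀, hm, hw₀⟩ := IsCyc.exists_moore D hcyc hc'
  have hmem : z - D.Psi n c ∈ tgr (D.ideg n) t ∧ z - D.Psi n c ∈ tlen l :=
    ⟨sub_mem ht (D.Psi_mem (D.E_mem_tgr hc1)), sub_mem hlen (D.Psi_mem (D.E_mem_tlen hc2))⟩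
  have hl' : (l : ℚ) ≠ 0 := Nat.cast_ne_zero.2 hl.ne'
  -- The operators for zero differential preserve word length and internal degree, so the primitive
  -- can be projected to the length and degree of z.
  set w₁ := sel (fun w => w.length = l) (sel (fun w => wdeg (D.ideg (n + 1)) w = t) w₀) with hw₁
  have h1 : w₁ ∈ tlen l := sel_mem _ _
  have h2 : w₁ ∈ tgr (D.ideg (n + 1)) t := sel_mem_sup (sel_mem _ _)
  have hm1 : D.IsMoore (n + 1) w₁ := fun i => by
    rw [hw₁, ← sel_len_op₀, ← sel_deg_op₀, hm i, map_zero, map_zero]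
  have hf1 : D.op₀ (face 0) w₁ = z - D.Psi n c := by
    rw [hw₁, ← sel_len_op₀, ← sel_deg_op₀, hw₀, sel_of_mem hmem.1, sel_of_mem hmem.2]
  -- Bracketing divided by l fixes the Lie element z, sends c and the primitive to Lie elements, and
  -- commutes with Ψ and with the faces; so it projects the whole identity onto Lie elements.
  refine ⟨(l : ℚ)⁻¹ • rb totalDegree D.dg c, Submodule.smul_mem _ _ (rb_mem_lieSub c),
    Submodule.smul_mem _ _ (rb_mem_tgr hc1), Submodule.smul_mem _ _ (rb_mem_tlen hc2),
    (l : ℚ)⁻¹ • rb (AddMonoidHom.id ℕ) (D.ideg (n + 1)) w₁, Submodule.smul_mem _ _ (rb_mem_lieSub w₁),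
    Submodule.smul_mem _ _ (rb_mem_tgr h2), Submodule.smul_mem _ _ (rb_mem_tlen h1), fun i => ?_, ?_⟩
  · rw [map_smul, ← rb_op₀, hm1 i, map_zero, smul_zero]
  · rw [map_smul, map_smul, ← rb_op₀, ← rb_Psi, hf1, ← smul_add, ← map_add, add_sub_cancel,
      rb_of_mem hlie hlen, inv_smul_smul₀ hl']

end FreeDiff

/-! ### From the associated graded back to the twisted operators. -/

namespace Tens

variable {Γ : Type*}

theorem sub_sel_mem_tge {k : ℕ} {z : Tens Γ} (hz : z ∈ tge k) :
    z - sel (fun w => w.length = k) z ∈ tge (k + 1) := by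
  refine map_mem_of_sup (f := LinearMap.id - sel (fun w => w.length = k)) (fun w hw => ?_) hz
  rw [LinearMap.sub_apply, LinearMap.id_apply]
  by_cases h : w.length = k
  · rw [sel_wd_pos (P := fun w => w.length = k) h, sub_self]; exact zero_mem _
  · rw [sel_wd_neg (P := fun w => w.length = k) h, sub_zero]; exact wd_mem_sup (by omega)

theorem length_le_wdeg {e : Γ → ℕ} (he : ∀ g, 1 ≤ e g) (w : List Γ) : w.length ≤ wdeg e w := by
  induction w with
  | nil => exact le_rfl
  | cons g w ih => rw [List.length_cons, wdeg_cons]; have := he g; omega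

theorem eq_zero_of_tge_tgr {e : Γ → ℕ} (he : ∀ g, 1 ≤ e g) {k t : ℕ} (h : t < k) {z : Tens Γ}
    (hz : z ∈ tge k) (ht : z ∈ tgr e t) : z = 0 := by
  refine ext_cf fun w => ?_
  rw [map_zero]
  by_contra hw
  have h1 := mem_sup_iff.1 hz w hw
  have h2 := mem_sup_iff.1 ht w hw
  have h3 := length_le_wdeg he w
  omega

end Tens

theorem face_zero_comp_face {n : ℕ} (j : Fin (n + 2)) :
    (face 0).comp (face j) = (face j.succ).comp (face 0) := by
  ext x
  simp

namespace FreeDiff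

variable {X : Type u} (D : FreeDiff X) {n : ℕ}

theorem d_mem_tgr {p s : ℕ} {a : Tens X} (ha : a ∈ tgr D.dg (p + 1, s)) : D.d a ∈ tgr D.dg (p, s) := by
  have h : ∀ w, D.d (wd w) ∈ sup fun v => (wdeg D.dg v).1 + 1 = (wdeg D.dg w).1 ∧
      (wdeg D.dg v).2 = (wdeg D.dg w).2 := by
    intro w
    induction w with
    | nil => rw [wd_nil, der_one]; exact zero_mem _
    | cons x w ih =>
      rw [der_cons, wdeg_cons]
      refine add_mem ?_ (Submodule.smul_mem _ _ ?_)
      · by_cases hx : (D.dg x).1 = 0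
        · rw [D.deg_zero x hx, zero_mul]; exact zero_mem _
        · obtain ⟨p, hp⟩ := Nat.exists_eq_succ_of_ne_zero hx
          refine mul_mem_sup (fun v v' hv hv' => ?_) (D.deg_succ x p _ (Prod.ext hp rfl))
            (wd_mem_sup (P := fun v => v = w) rfl)
          subst hv'
          rw [wdeg_append, hv, Prod.fst_add, Prod.snd_add, Prod.fst_add, Prod.snd_add]
          exact ⟨by dsimp only; omega, rfl⟩
      · refine mul_mem_sup (fun v v' hv hv' => ?_) (wd_mem_sup (P := fun v => v = [x]) rfl) ih
        subst hv
        rw [wdeg_append, Prod.fst_add, Prod.snd_add, Prod.fst_add, Prod.snd_add, wdeg_cons, wdeg_nil,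
          add_zero]
        exact ⟨by omega, by omega⟩
  refine map_mem_of_sup (f := D.d) (fun w hw => sup_mono (fun v hv => ?_) (h w)) ha
  rw [hw] at hv
  exact Prod.ext (Nat.succ_injective hv.1) hv.2

/-- Moore chains whose boundary is a top coefficient. -/
def IsTwisted (t : ℕ) : (n : ℕ) → D.T n → Prop
  | 0, _ => True
  | n + 1, z => D.IsMoore (n + 1) z ∧ ∃ a ∈ tgr D.dg (n, t), D.op (face 0) z = D.Psi n a

theorem Psi_injOn {t : ℕ} {a : Tens X} (ha : a ∈ tgr D.dg (n, t)) (h : D.Psi n a = 0) : a = 0 :=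
  D.eq_zero_of_cf_Psi (sup_mono (fun _ hw => by rw [hw]) ha) fun u _ => by rw [h, map_zero]

theorem sel_len_Psi (k : ℕ) (a : Tens X) :
    sel (fun w => w.length = k) (D.Psi n a) = D.Psi n (sel (fun w => w.length = k) a) :=
  sel_comm (fun _ => D.Psi_mem (D.E_mem_tlen (wd_mem_sup rfl))) k a

/-- In the lowest length the face d_0 is untwisted, so there it equals Ψ of the length-k part of a.
Being a boundary for zero differential, this element has no sorted coefficients, and sorted
coefficients detect arguments of Ψ of homological degree n; so that part of a is zero. -/
theorem IsTwisted.isCyc {t k : ℕ} {z : D.T n} (hz : D.IsTwisted t n z) (hk : z ∈ tge k) :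
    D.IsCyc n (sel (fun w => w.length = k) z) := by
  cases n with
  | zero => trivial
  | succ n =>
    obtain ⟨hm, a, ha, hza⟩ := hz
    have hs : ∀ i : Fin (n + 1), D.op₀ (face i.succ) (sel (fun w => w.length = k) z) = 0 := fun i => by
      rw [← sel_len_op₀, hm i, map_zero]
    have h0 : D.op₀ (face 0) (sel (fun w => w.length = k) z) =
        D.Psi n (sel (fun w => w.length = k) a) := by
      rw [← sel_len_op₀, ← sel_len_Psi, ← hza, ← sub_eq_zero, ← map_sub, ← neg_sub, map_neg,
        sel_of_mem_disjoint (Q := fun w => k + 1 ≤ w.length) (fun w hw hw' => by omega)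
          (D.op_sub_mem_tge (face 0) hk), neg_zero]
    have hb : D.bdT n (sel (fun w => w.length = k) z) = D.op₀ (face 0) (sel (fun w => w.length = k) z) := by
      rw [bdT_apply, Fin.sum_univ_succ, Finset.sum_eq_zero fun i _ => by rw [hs i, smul_zero], add_zero]
      simp
    have ha0 : sel (fun w => w.length = k) a = 0 := by
      refine D.eq_zero_of_cf_Psi (n := n) (sup_mono (fun _ hw => by rw [hw]) (sel_mem_sup ha))
        fun u hu => ?_
      rw [← h0, ← hb, D.cf_bdT hu]
    intro i
    refine Fin.cases ?_ (fun i => hs i) i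
    rw [h0, ha0, map_zero]

theorem isMoore_face_zero {w : D.T (n + 1)} (hw : D.IsMoore (n + 1) w) :
    D.IsMoore n (D.op (face 0) w) := by
  cases n with
  | zero => trivial
  | succ n =>
    intro i
    rw [← op_face_succ, ← op_comp, face_zero_comp_face, op_comp, op_face_succ, hw, map_zero]

theorem op_face_zero_face_zero {w : D.T (n + 2)} (hw : D.IsMoore (n + 2) w) :
    D.op (face 0) (D.op (face 0) w) = 0 := by
  rw [← op_comp, face_zero_comp_face, op_comp, op_face_succ, hw, map_zero]

theorem isMoore_Psi (a : Tens X) : D.IsMoore n (D.Psi n a) := by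
  cases n with
  | zero => trivial
  | succ n => exact fun i => D.op₀_Psi _ a

/-- Twisted chains are boundaries up to top coefficients. -/
theorem IsTwisted.exists_eq (hpos : ∀ x, 1 ≤ (D.dg x).2) {t : ℕ} (j : ℕ) : ∀ {k : ℕ} {z : D.T n},
    D.IsTwisted t n z → t < k + j → 0 < k → z ∈ D.lieT n → z ∈ tgr (D.ideg n) t → z ∈ tge k →
    ∃ c ∈ lieSub totalDegree D.dg, c ∈ tgr D.dg (n, t) ∧
      ∃ w ∈ D.lieT (n + 1), w ∈ tgr (D.ideg (n + 1)) t ∧ D.IsMoore (n + 1) w ∧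
        z = D.Psi n c + D.op (face 0) w := by
  induction j with
  | zero =>
    intro k z _ hk _ _ ht hz
    have he : ∀ g, 1 ≤ D.ideg n g := fun g => hpos g.1.1
    -- Every letter has internal degree at least one, so words of length at least k > t do not occur
    -- in degree t. This ends the descent along the filtration.
    have h0 : z = 0 := eq_zero_of_tge_tgr he hk hz ht
    refine ⟨0, zero_mem _, zero_mem _, 0, zero_mem _, zero_mem _, fun i => map_zero _, ?_⟩
    rw [h0, map_zero, map_zero, add_zero]
  | succ j ih =>
    intro k z hz hk hk0 hlie ht hzk
    -- The length-k part is solved for zero differential. Subtracting the same Ψ(c) and the twisted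
    -- boundary of w leaves a twisted chain, since d_0 d_0 w = 0 and d_0 Ψ(c) = Ψ(dc), with words of
    -- length at least k + 1.
    obtain ⟨c, hc1, hc2, hc3, w, hw1, hw2, hw3, hw4, he⟩ := IsCyc.exists_eq D hk0 (hz.isCyc D hzk)
      (sel_len_mem_lieSub k hlie) (sel_mem _ _) (sel_mem_sup ht)
    have htw : D.IsTwisted t n (z - D.Psi n c - D.op (face 0) w) := by
      cases n with
      | zero => trivial
      | succ n =>
        obtain ⟨hm, a, ha, hza⟩ := hz
        refine ⟨fun i => ?_, a - D.d c, sub_mem ha (D.d_mem_tgr hc2), ?_⟩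
        · rw [map_sub, map_sub, hm i, D.isMoore_Psi (n := n + 1) c i, D.isMoore_face_zero (n := n + 1) hw4 i, sub_zero, sub_zero]
        · rw [map_sub, map_sub, hza, op_face_zero_Psi, D.op_face_zero_face_zero hw4, sub_zero, map_sub]
    have hge : z - D.Psi n c - D.op (face 0) w ∈ tge (k + 1) := by
      have e : z - D.Psi n c - D.op (face 0) w = (z - sel (fun w => w.length = k) z) -
          (D.op (face 0) w - D.op₀ (face 0) w) := by
        rw [he]; abel
      rw [e]
      exact sub_mem (sub_sel_mem_tge hzk)
        (D.op_sub_mem_tge _ (sup_mono (fun _ h => le_of_eq (Eq.symm h)) hw3))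
    obtain ⟨c', hc1', hc2', w', hw1', hw2', hw4', he'⟩ := ih htw (by omega) (Nat.succ_pos k)
      (sub_mem (sub_mem hlie (D.Psi_mem (D.E_mem_lie hc1))) (D.op_mem_lie _ hw1))
      (sub_mem (sub_mem ht (D.Psi_mem (D.E_mem_tgr hc2))) (D.op_mem_tgr _ hw2)) hge
    refine ⟨c + c', add_mem hc1 hc1', add_mem hc2 hc2', w + w', add_mem hw1 hw1', add_mem hw2 hw2',
      fun i => by rw [map_add, hw4 i, hw4' i, add_zero], ?_⟩
    rw [sub_sub, sub_eq_iff_eq_add] at he'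
    rw [he', map_add, map_add]
    abel

theorem exists_eq_Psi_add (hpos : ∀ x, 1 ≤ (D.dg x).2) {t : ℕ} {z : D.T n} (hz : D.IsTwisted t n z)
    (hlie : z ∈ D.lieT n) (ht : z ∈ tgr (D.ideg n) t) :
    ∃ c ∈ lieSub totalDegree D.dg, c ∈ tgr D.dg (n, t) ∧
      ∃ w ∈ D.lieT (n + 1), w ∈ tgr (D.ideg (n + 1)) t ∧ D.IsMoore (n + 1) w ∧
        z = D.Psi n c + D.op (face 0) w :=
  IsTwisted.exists_eq D hpos t hz (by omega) one_pos hlie ht (lieSub_tge hlie)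

end FreeDiff

/-! ### Degenerate generators and indecomposables. -/

theorem blk_degen {n : ℕ} (j : Fin (n + 1)) (k : Fin n) : blk (degen j) k = some (j.succAbove k) := by
  have h : ∀ i : Fin (n + 2), (degen j i).val = if j.val < i.val then i.val - 1 else i.val := by
    intro i
    change (j.predAbove i).val = _
    rw [Fin.predAbove]
    split_ifs with h1 h2 h2
    · simp
    · exact absurd h1 h2
    · exact absurd h2 h1
    · simp
  have hs : (j.succAbove k).val = if k.val < j.val then k.val else k.val + 1 := by
    rw [Fin.succAbove]
    split_ifs with h1 h2 h2
    · simp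
    · exact absurd h1 h2
    · exact absurd h2 h1
    · simp
  rw [blk_eq_some, h, h, Fin.val_castSucc, Fin.val_succ, hs]
  split_ifs <;> omega

theorem good_degen {n : ℕ} (j : Fin (n + 1)) (J : Finset (Fin n)) : Good (blk (degen j)) J := by
  refine ⟨fun k _ => ⟨_, blk_degen j k⟩, fun k _ k' _ h => ?_⟩
  rw [blk_degen, blk_degen, Option.some_inj] at h
  exact Fin.succAbove_right_injective h

theorem mem_shadow_degen {n : ℕ} (j : Fin (n + 1)) (J : Finset (Fin n)) (a : Fin (n + 1)) :
    a ∈ shadow (blk (degen j)) J ↔ ∃ k ∈ J, j.succAbove k = a := by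
  rw [mem_shadow]
  simp only [blk_degen, Option.some_inj]

section Lie

variable {Γ : Type u} {e : Γ → ℕ}

/-- The span of the words of degree at least `k`. -/
noncomputable abbrev wge (e : Γ → ℕ) (k : ℕ) : Submodule ℚ (Tens Γ) := sup fun w => k ≤ wdeg e w

theorem wge_anti {a b : ℕ} (h : a ≤ b) {x : Tens Γ} (hx : x ∈ wge e b) : x ∈ wge e a :=
  sup_mono (fun _ => h.trans) hx

theorem lbr_mem_wge {a b : ℕ} {x y : Tens Γ} (hx : x ∈ wge e a) (hy : y ∈ wge e b) :
    lbr e x y ∈ wge e (a + b) := by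
  refine map_mem_of_bilin (fun w w' hw hw' => ?_) hx hy
  rw [lbr_wd]
  refine sub_mem (wd_mem_sup ?_) (Submodule.smul_mem _ _ (wd_mem_sup ?_)) <;> rw [wdeg_append] <;> omega

theorem lbr_mem_tge {a b : ℕ} {x y : Tens Γ} (hx : x ∈ tge a) (hy : y ∈ tge b) :
    lbr e x y ∈ tge (a + b) := by
  refine map_mem_of_bilin (fun w w' hw hw' => ?_) hx hy
  rw [lbr_wd]
  refine sub_mem (wd_mem_sup ?_) (Submodule.smul_mem _ _ (wd_mem_sup ?_)) <;>
    rw [List.length_append] <;> omega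

theorem cf_single_of_tge {x : Tens Γ} (hx : x ∈ tge 2) (g : Γ) : cf [g] x = 0 :=
  cf_of_mem (P := fun w => 2 ≤ w.length) (by simp) hx

/-- A graded subalgebra containing the generators `C` modulo decomposables contains them. -/
theorem mem_of_indecomposables (he : ∀ g, 1 ≤ e g) (C : Set Γ) {S : Submodule ℚ (Tens Γ)}
    (hS1 : S ≤ tge 1) (hS : ∀ x ∈ S, ∀ y ∈ S, lbr e x y ∈ S)
    (hgr : ∀ t, ∀ x ∈ S, sel (fun w => wdeg e w = t) x ∈ S)
    (hgen : ∀ B : Submodule ℚ (Tens Γ), (∀ g ∈ C, wd [g] ∈ B) → (∀ x ∈ B, ∀ y ∈ B, lbr e x y ∈ B) →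
      S ≤ B)
    (h : ∀ g ∈ C, ∃ s ∈ S, ∀ g' ∈ C, cf [g'] s = cf [g'] (wd [g])) (t : ℕ) :
    ∀ g ∈ C, e g = t → wd [g] ∈ S := by
  induction t using Nat.strong_induction_on with
  | _ t ih =>
  intro g hg hgt
  have hpos : ∀ x ∈ (tge 1 : Submodule ℚ (Tens Γ)), x ∈ wge e 1 := fun x hx =>
    sup_mono (fun w hw => hw.trans (length_le_wdeg he w)) hx
  let DS : Submodule ℚ (Tens Γ) := S ⊓ tge 2
  let Cl : Submodule ℚ (Tens Γ) := sup fun w => ∃ g ∈ C, w = [g]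
  let Hi : Submodule ℚ (Tens Γ) := wge e (t + 1)
  -- A spanning set adapted to degree t: decomposables already in S, the generators, and everything
  -- of degree above t. Its span will be closed under brackets, hence will contain S.
  let G : Set (Tens Γ) := {x | (x ∈ S ∧ x ∈ tge 2) ∨ (∃ g ∈ C, wd [g] = x) ∨ x ∈ wge e (t + 1)}
  have hG : ∀ x ∈ G, (x ∈ S ∨ x ∈ wge e t) ∧ x ∈ wge e 1 := by
    intro x hx
    change (x ∈ S ∧ x ∈ tge 2) ∨ (∃ g ∈ C, wd [g] = x) ∨ x ∈ wge e (t + 1) at hx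
    rcases hx with hx | ⟨g, hg, hx⟩ | hx
    · exact ⟨Or.inl hx.1, hpos x (tge_anti one_le_two hx.2)⟩
    · have h0 : wdeg e [g] = e g := by rw [wdeg_cons, wdeg_nil, add_zero]
      rw [← hx]
      refine ⟨?_, wd_mem_sup (h0.symm ▸ he g)⟩
      by_cases hlt : e g < t
      · exact Or.inl (ih _ hlt g hg rfl)
      · exact Or.inr (wd_mem_sup (h0.symm ▸ Nat.le_of_not_lt hlt))
    · exact ⟨Or.inr (wge_anti (Nat.le_succ t) hx), wge_anti (Nat.succ_le_succ (Nat.zero_le t)) hx⟩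
  have hSG : S ≤ Submodule.span ℚ G := by
    refine hgen _ (fun g hg => Submodule.subset_span (Or.inr (Or.inl ⟨g, hg, rfl⟩)))
      fun x hx y hy => LinearMap.BilinMap.apply_apply_mem_of_mem_span _ _ _ _ ?_ x y hx hy
    intro x hx y hy
    obtain ⟨hx1, hx2⟩ := hG x hx
    obtain ⟨hy1, hy2⟩ := hG y hy
    -- Either both factors are in S, where generators of degree below t lie by induction, and the
    -- bracket is a decomposable of S; or one factor has degree at least t and the other at least
    -- one, and the bracket has degree above t.
    refine Submodule.subset_span ?_
    change (_ ∧ _) ∨ (∃ g ∈ C, wd [g] = lbr e x y) ∨ lbr e x y ∈ wge e (t + 1)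
    rcases hx1 with hx1 | hx1
    · rcases hy1 with hy1 | hy1
      · have h1 := hS1 hx1
        have h2 := hS1 hy1
        have h3 := lbr_mem_tge (e := e) h1 h2
        have h4 := hS x hx1 y hy1
        exact Or.inl ⟨h4, h3⟩
      · have := lbr_mem_wge hx2 hy1
        rw [Nat.add_comm] at this
        exact Or.inr (Or.inr this)
    · exact Or.inr (Or.inr (lbr_mem_wge hx1 hy2))
  have hGle : Submodule.span ℚ G ≤ DS ⊔ Cl ⊔ Hi := by
    refine Submodule.span_le.2 ?_
    rintro x (hx | ⟨g, hg, rfl⟩ | hx)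
    · exact Submodule.mem_sup_left (Submodule.mem_sup_left hx)
    · exact Submodule.mem_sup_left (Submodule.mem_sup_right (wd_mem_sup ⟨g, hg, rfl⟩))
    · exact Submodule.mem_sup_right hx
  obtain ⟨s, hs, hs'⟩ := h g hg
  have hst := hgr t s hs
  set y := sel (fun w => wdeg e w = t) s - wd [g] with hy
  have hyt : y ∈ tgr e t := sub_mem (sel_mem _ _) (wd_mem_sup (by simpa using hgt))
  have hycf : ∀ g' ∈ C, e g' = t → cf [g'] y = 0 := by
    intro g' hg' ht'
    rw [hy, map_sub, cf_sel_pos (P := fun w => wdeg e w = t) (by simpa using ht'), hs' g' hg', sub_self]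
  have hyG : y ∈ DS ⊔ Cl ⊔ Hi := sub_mem (hGle (hSG hst))
    (Submodule.mem_sup_left (Submodule.mem_sup_right (wd_mem_sup ⟨g, hg, rfl⟩)))
  obtain ⟨z, hz, hi, hhi, e1⟩ := Submodule.mem_sup.1 hyG
  obtain ⟨ds, hds, l, hl, rfl⟩ := Submodule.mem_sup.1 hz
  have hi0 : sel (fun w => wdeg e w = t) hi = 0 :=
    sel_of_mem_disjoint (Q := fun w => t + 1 ≤ wdeg e w) (fun w hw hw' => by omega) hhi
  -- The coefficients of y on the generators in C of degree t vanish by the choice of s, and neither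
  -- the decomposable part nor the part above degree t contributes to them.
  have hl0 : sel (fun w => wdeg e w = t) l = 0 := by
    refine ext_cf fun w => ?_
    rw [map_zero]
    by_cases hw : wdeg e w = t
    · rw [cf_sel_pos (P := fun w => wdeg e w = t) hw]
      by_cases hw' : ∃ g ∈ C, w = [g]
      · obtain ⟨g', hg', rfl⟩ := hw'
        have h1 := hycf g' hg' (by simpa using hw)
        have h2 : cf [g'] hi = 0 := cf_of_mem (P := fun w => t + 1 ≤ wdeg e w) (by omega) hhi
        rw [← e1, map_add, map_add, h2, cf_single_of_tge hds.2, zero_add, add_zero] at h1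
        exact h1
      · exact cf_of_mem (P := fun w => ∃ g ∈ C, w = [g]) hw' hl
    · exact cf_of_mem (P := fun w => wdeg e w = t) hw (sel_mem _ _)
  -- In degree t only the decomposable component survives. It belongs to S, and therefore so does
  -- the generator g, as the difference of the degree-t part of s and y.
  have hyS : y ∈ S := by
    rw [← sel_of_mem hyt, ← e1, map_add, map_add, hl0, hi0, add_zero, add_zero]
    exact hgr t _ hds.1
  have := sub_mem hst hyS
  rwa [hy, sub_sub_cancel] at this

end Lie

namespace FreeDiff

variable {X : Type u} (D : FreeDiff X) {n : ℕ}

/-- The degenerate generators. -/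
noncomputable def degenGen (j : Fin (n + 1)) (g : SGen D.dg n) : SGen D.dg (n + 1) :=
  ⟨(g.1.1, shadow (blk (degen j)) g.1.2), (good_degen j _).card_shadow.trans g.2⟩

theorem op_degen_gen (j : Fin (n + 1)) (g : SGen D.dg n) :
    D.op (degen j) (wd [g]) = wd [D.degenGen j g] := by
  rw [D.op_eq_op₀ _ (by simp), D.op₀_gen_of_good (good_degen j _)]; rfl

/-- If the step j is missing from I, then deleting j and applying the j-th degeneracy restores I. -/
theorem exists_degenGen {g : SGen D.dg (n + 1)} (hg : g.1.2 ≠ Finset.univ) :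
    ∃ (j : Fin (n + 1)) (g' : SGen D.dg n), D.degenGen j g' = g := by
  obtain ⟨⟨x, I⟩, hI⟩ := g
  obtain ⟨j, hj⟩ : ∃ j, j ∉ I := by
    by_contra! h
    exact hg (Finset.eq_univ_iff_forall.2 h)
  have hs : shadow (blk (degen j)) (Finset.univ.filter fun k => j.succAbove k ∈ I) = I := by
    ext a
    rw [mem_shadow_degen]
    simp only [Finset.mem_filter, Finset.mem_univ, true_and]
    constructor
    · rintro ⟨k, hk, rfl⟩; exact hk
    · intro ha
      obtain ⟨k, rfl⟩ := Fin.exists_succAbove_eq (x := a) (y := j) (by rintro rfl; exact hj ha)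
      exact ⟨k, ha, rfl⟩
  refine ⟨j, ⟨(x, Finset.univ.filter fun k => j.succAbove k ∈ I), ?_⟩, Subtype.ext (Prod.ext rfl hs)⟩
  rw [← (good_degen j _).card_shadow, hs, hI]

/-- A degeneracy sends words of generators to words of generators, each of which misses the step j.
-/
theorem cf_op_degen {g : SGen D.dg (n + 1)} (hg : g.1.2 = Finset.univ) (j : Fin (n + 1)) (y : D.T n) :
    cf [g] (D.op (degen j) y) = 0 := by
  have h : ∀ w, D.op (degen j) (wd w) = wd (w.map (D.degenGen j)) := by
    intro w
    induction w with
    | nil => rw [wd_nil, map_one]; rfl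
    | cons g w ih => rw [wd_cons, map_mul, ih, op_degen_gen, ← wd_cons]; rfl
  refine eq_on_sup (f := cf [g] ∘ₗ (D.op (degen j)).toLinearMap) (g := 0) (fun w _ => ?_) (mem_sup_top y)
  change cf [g] (D.op (degen j) (wd w)) = 0
  rw [h, cf_wd_ne]
  intro hw
  obtain ⟨g', rfl⟩ : ∃ g', D.degenGen j g' = g := by
    cases w with
    | nil => simp at hw
    | cons g' w => exact ⟨g', by simpa using (List.cons.inj hw).1.symm⟩
  have : j ∈ (D.degenGen j g').1.2 := hg ▸ Finset.mem_univ j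
  obtain ⟨k, -, hk⟩ := (mem_shadow_degen j _ j).1 this
  exact Fin.succAbove_ne j k hk

/-- A generator with all steps is a sorted word of length one. The untwisted d_0 of a Moore chain is
a boundary and has no sorted coefficients, and the correction by d consists of words of length at
least two. -/
theorem cf_op_face_zero {g : SGen D.dg n} (hg : g.1.2 = Finset.univ) {w : D.T (n + 1)}
    (hw : D.IsMoore (n + 1) w) (hw1 : w ∈ tge 1) : cf [g] (D.op (face 0) w) = 0 := by
  have hs : D.Sorted n [g] := by
    have hc : (D.letter g).2 = Finset.Ico 0 n := by
      ext a
      rw [letter, mem_map_val, hg]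
      simp
    exact ⟨0, by rw [hc]; simp, hc, rfl⟩
  have hb : D.bdT n w = D.op₀ (face 0) w := by
    rw [bdT_apply, Fin.sum_univ_succ, Finset.sum_eq_zero fun i _ => by rw [hw i, smul_zero], add_zero]
    simp
  have h1 := cf_single_of_tge (D.op_sub_mem_tge (face 0) hw1) g
  rw [map_sub, ← hb, D.cf_bdT hs, sub_zero] at h1
  exact h1

theorem Psi_gen {x : X} (h : (Finset.univ : Finset (Fin n)).card = (D.dg x).1) :
    D.Psi n (wd [x]) = wd [⟨(x, Finset.univ), h⟩] := by
  rw [Psi_apply, E_gen, EGen_of_card]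

end FreeDiff

/-! ### Transport of freeness and gradings along isomorphisms. -/

namespace GrLie

variable {ι : Type} [AddCommMonoid ι] [DecidableEq ι] {tot : ι →+ ℕ} {G H : GrLie.{u} ι tot}

theorem lin_proj (f : G ⟶ H) (i : ι) (x : G.carrier) : lin f (G.proj i x) = H.proj i (lin f x) := by
  refine G.induct (p := fun x => lin f (G.proj i x) = H.proj i (lin f x)) x ?_ (by simp)
    (fun x y hx hy => by simp only [map_add, hx, hy])
  intro j x hx
  by_cases h : j = i
  · subst h
    rw [G.proj_same hx, H.proj_same (f.map_gr hx)]
  · rw [G.proj_ne hx h, H.proj_ne (f.map_gr hx) h, map_zero]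

/-- Morphisms commute with the projections to homogeneous parts, so an injective one reflects
degrees. -/
theorem mem_gr_of_lin {f : G ⟶ H} (hf : Function.Injective (lin f)) {i : ι} {x : G.carrier}
    (hx : lin f x ∈ H.gr i) : x ∈ G.gr i := by
  have : G.proj i x = x := hf (by rw [lin_proj, H.proj_same hx])
  rw [← this]
  exact G.proj_mem i x

/-- The inverse of a bijective morphism. -/
theorem exists_inverse (f : G ⟶ H) (hf : Function.Bijective (lin f)) :
    ∃ g : H ⟶ G, (∀ x, lin g (lin f x) = x) ∧ ∀ y, lin f (lin g y) = y := by
  let e := LinearEquiv.ofBijective (lin f) hf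
  have he : ∀ y, lin f (e.symm y) = y := e.apply_symm_apply
  refine ⟨⟨e.symm.toLinearMap, fun {i y} hy => mem_gr_of_lin hf.1 ?_, fun x y => hf.1 ?_⟩,
    e.symm_apply_apply, he⟩
  · change lin f (e.symm y) ∈ _
    rwa [he]
  · change lin f (e.symm _) = lin f (G.bracket (e.symm x) (e.symm y))
    rw [he, f.map_bracket]
    change _ = H.bracket (lin f (e.symm x)) (lin f (e.symm y))
    rw [he, he]

theorem IsFreeOn.of_bijective {T : Type u} {deg : T → ι} {b : T → H.carrier} (hH : H.IsFreeOn deg b)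
    (f : G ⟶ H) (hf : Function.Bijective (lin f)) {c : T → G.carrier} (hc : ∀ t, lin f (c t) = b t) :
    G.IsFreeOn deg c := by
  obtain ⟨g, hg, hg'⟩ := exists_inverse f hf
  refine ⟨fun t => mem_gr_of_lin hf.1 (hc t ▸ hH.1 t), fun K φ hφ => ?_⟩
  obtain ⟨ψ, hψ, hψ'⟩ := hH.2 K φ hφ
  refine ⟨f ≫ ψ, fun t => ?_, fun χ hχ => ?_⟩
  · change lin ψ (lin f (c t)) = φ t
    rw [hc, hψ]
  · have h1 : g ≫ χ = ψ := hψ' _ fun t => by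
      change lin χ (lin g (b t)) = φ t
      rw [← hc, hg, hχ]
    rw [← h1]
    refine GrLie.Hom.ext (LinearMap.ext fun x => ?_)
    change lin χ x = lin χ (lin g (lin f x))
    rw [hg]

theorem IsFreeOn.hom_ext {T : Type u} {deg : T → ι} {b : T → G.carrier} (hG : G.IsFreeOn deg b)
    {φ ψ : G ⟶ H} (h : ∀ t, lin φ (b t) = lin ψ (b t)) : φ = ψ :=
  (hG.2 H (fun t => lin ψ (b t)) fun t => ψ.map_gr (hG.1 t)).unique h fun _ => rfl

/-- Free Lie algebras on the same graded set are isomorphic. -/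
theorem IsFreeOn.bijective {T : Type u} {deg : T → ι} {b : T → G.carrier} {c : T → H.carrier}
    (hG : G.IsFreeOn deg b) (hH : H.IsFreeOn deg c) {f : G ⟶ H} (hf : ∀ t, lin f (b t) = c t) :
    Function.Bijective (lin f) := by
  obtain ⟨g, hg, -⟩ := hH.2 G b hG.1
  have h1 : f ≫ g = 𝟙 G := hG.hom_ext fun t => by
    change lin g (lin f (b t)) = b t
    rw [hf, hg]
  have h2 : g ≫ f = 𝟙 H := hH.hom_ext fun t => by
    change lin f (lin g (c t)) = c t
    rw [hg, hf]
  refine Function.bijective_iff_has_inverse.2 ⟨lin g, fun x => ?_, fun x => ?_⟩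
  · exact LinearMap.congr_fun (congrArg Hom.toLin h1) x
  · exact LinearMap.congr_fun (congrArg Hom.toLin h2) x

theorem lieSpan_le {S : Set G.carrier} {B : Submodule ℚ G.carrier} (hS : S ⊆ B)
    (hB : G.BracketClosed B) : G.lieSpan S ≤ B := sInf_le ⟨hS, hB⟩

theorem IsGradedSubalgebra.proj_mem {S : Submodule ℚ G.carrier} (hS : G.IsGradedSubalgebra S) (i : ι)
    {x : G.carrier} (hx : x ∈ S) : G.proj i x ∈ S := by
  have : (⨆ j, S ⊓ G.gr j) ≤ S.comap (G.proj i) := iSup_le fun j y hy => by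
    rw [Submodule.mem_comap]
    by_cases h : j = i
    · subst h; rw [G.proj_same hy.2]; exact hy.1
    · rw [G.proj_ne hy.2 h]; exact zero_mem _
  exact this (hS.2.symm ▸ hx)

end GrLie

/-! ### The simplicial Lie algebra and its CW structure. -/

/-- A differential on a free bigraded Lie algebra, together with a quasi-isomorphism to `L`. -/
structure FreeDiff.Model {X : Type u} (D : FreeDiff X) (L : GLie.{u}) where
  pos : ∀ x, 1 ≤ (D.dg x).2
  φ : Tens X →ₗ[ℚ] L.carrier
  map_gr : ∀ x s, D.dg x = (0, s) → φ (wd [x]) ∈ L.gr s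
  map_pos : ∀ x, (D.dg x).1 ≠ 0 → φ (wd [x]) = 0
  map_bracket : ∀ a ∈ lieSub totalDegree D.dg, ∀ b ∈ lieSub totalDegree D.dg,
    φ (lbr D.tdeg a b) = L.bracket (φ a) (φ b)
  map_δ : ∀ x, φ (D.δ x) = 0
  surj : ∀ y, ∃ a ∈ lieSub totalDegree D.dg, φ a = y
  exact_succ : ∀ n t, ∀ a ∈ lieSub totalDegree D.dg, a ∈ tgr D.dg (n + 1, t) → D.d a = 0 →
    ∃ b ∈ lieSub totalDegree D.dg, b ∈ tgr D.dg (n + 2, t) ∧ D.d b = a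
  exact_zero : ∀ t, ∀ a ∈ lieSub totalDegree D.dg, a ∈ tgr D.dg (0, t) → φ a = 0 →
    ∃ b ∈ lieSub totalDegree D.dg, b ∈ tgr D.dg (1, t) ∧ D.d b = a

namespace FreeDiff

variable {X : Type u} (D : FreeDiff X)

/-- The free Lie algebra in simplicial dimension `n`. -/
noncomputable abbrev G (n : ℕ) : GLie.{u} := freeLie (AddMonoidHom.id ℕ) (D.ideg n)

/-- The simplicial operators, as morphisms. -/
noncomputable def opHom {m n : ℕ} (α : Fin (m + 1) →o Fin (n + 1)) : D.G n ⟶ D.G m where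
  toLin := (D.op α).toLinearMap.restrict (p := D.lieT n) (q := D.lieT m) fun _ hy => D.op_mem_lie α hy
  map_gr hx := D.op_mem_tgr α hx
  map_bracket x y := Subtype.ext (D.op_lbr α x.1 y.1)

/-- The simplicial graded Lie algebra of a differential on a free Lie algebra. -/
noncomputable def simplicial : SimplicialObject GLie.{u} where
  obj m := D.G m.unop.len
  map α := D.opHom α.unop.toOrderHom
  map_id _ := GrLie.Hom.ext (LinearMap.ext fun y => Subtype.ext (D.op_id y.1))
  map_comp α β := GrLie.Hom.ext (LinearMap.ext fun y =>
    Subtype.ext (D.op_comp α.unop.toOrderHom β.unop.toOrderHom y.1))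

/-- An isomorphic copy of the simplicial graded Lie algebra of a differential. -/
structure Realization (A : SimplicialObject GLie.{u}) where
  e : ∀ n, lev A n ⟶ D.G n
  bij : ∀ n, Function.Bijective (GrLie.lin (e n))
  δ : ∀ n (i : Fin (n + 2)) (x : (lev A (n + 1)).carrier),
    GrLie.lin (e n) (GrLie.lin (A.δ i) x) = GrLie.lin (D.opHom (face i)) (GrLie.lin (e (n + 1)) x)
  σ : ∀ n (j : Fin (n + 1)) (x : (lev A n).carrier),
    GrLie.lin (e (n + 1)) (GrLie.lin (A.σ j) x) = GrLie.lin (D.opHom (degen j)) (GrLie.lin (e n) x)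

namespace Realization

variable {D} {A : SimplicialObject GLie.{u}} (R : D.Realization A)

/-- The realization in the tensor algebra. -/
noncomputable def r (n : ℕ) : (lev A n).carrier →ₗ[ℚ] D.T n :=
  freeLieIncl (AddMonoidHom.id ℕ) (D.ideg n) ∘ₗ GrLie.lin (R.e n)

variable {n : ℕ}

theorem r_injective : Function.Injective (R.r n) := Subtype.val_injective.comp (R.bij n).1

theorem r_mem (x : (lev A n).carrier) : R.r n x ∈ D.lieT n :=
  Subtype.property (p := fun x => x ∈ D.lieT n) (GrLie.lin (R.e n) x)

theorem exists_r_eq {y : D.T n} (hy : y ∈ D.lieT n) : ∃ x, R.r n x = y := by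
  obtain ⟨x, hx⟩ := (R.bij n).2 (⟨y, hy⟩ : D.lieT n)
  exact ⟨x, congrArg Subtype.val hx⟩

theorem r_bracket (x y : (lev A n).carrier) :
    R.r n ((lev A n).bracket x y) = lbr (D.ideg n) (R.r n x) (R.r n y) :=
  congrArg (freeLieIncl (AddMonoidHom.id ℕ) (D.ideg n)) ((R.e n).map_bracket x y)

theorem r_mem_tgr {t : ℕ} {x : (lev A n).carrier} : R.r n x ∈ tgr (D.ideg n) t ↔ x ∈ (lev A n).gr t :=
  ⟨fun h => GrLie.mem_gr_of_lin (R.bij n).1 h, fun h => (R.e n).map_gr h⟩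

theorem r_δ (i : Fin (n + 2)) (x : (lev A (n + 1)).carrier) :
    R.r n (GrLie.lin (A.δ i) x) = D.op (face i) (R.r (n + 1) x) :=
  congrArg (freeLieIncl (AddMonoidHom.id ℕ) (D.ideg n)) (R.δ n i x)

theorem r_σ (j : Fin (n + 1)) (x : (lev A n).carrier) :
    R.r (n + 1) (GrLie.lin (A.σ j) x) = D.op (degen j) (R.r n x) :=
  congrArg (freeLieIncl (AddMonoidHom.id ℕ) (D.ideg (n + 1))) (R.σ n j x)

theorem r_proj (t : ℕ) (x : (lev A n).carrier) :
    R.r n ((lev A n).proj t x) = sel (fun w => wdeg (D.ideg n) w = t) (R.r n x) := by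
  refine (lev A n).induct (p := fun x => R.r n ((lev A n).proj t x) =
    sel (fun w => wdeg (D.ideg n) w = t) (R.r n x)) x ?_ (by simp)
    (fun x y hx hy => by simp only [map_add, hx, hy])
  intro s x hx
  by_cases h : s = t
  · subst h
    rw [(lev A n).proj_same hx, sel_of_mem (R.r_mem_tgr.2 hx)]
  · rw [(lev A n).proj_ne hx h, map_zero, sel_of_mem_disjoint (fun w hw hw' => h (hw.symm.trans hw'))
      (R.r_mem_tgr.2 hx)]

/-- The element realized by a generator. -/
noncomputable def gen (g : SGen D.dg n) : (lev A n).carrier :=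
  (R.exists_r_eq (gen_mem_lieSub (AddMonoidHom.id ℕ) (D.ideg n) g)).choose

theorem r_gen (g : SGen D.dg n) : R.r n (R.gen g) = wd [g] :=
  (R.exists_r_eq (gen_mem_lieSub (AddMonoidHom.id ℕ) (D.ideg n) g)).choose_spec

theorem isFreeOn : (lev A n).IsFreeOn (D.ideg n) R.gen :=
  (freeLie_isFreeOn (AddMonoidHom.id ℕ) (D.ideg n)).of_bijective (R.e n) (R.bij n) fun g =>
    Subtype.ext (R.r_gen g)

theorem σ_gen (j : Fin (n + 1)) (g : SGen D.dg n) :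
    GrLie.lin (A.σ j) (R.gen g) = R.gen (D.degenGen j g) :=
  R.r_injective (by rw [r_σ, r_gen, r_gen, op_degen_gen])

theorem cf_of_isDegenerate {x : (lev A n).carrier} (hx : SGLie.IsDegenerate A n x) {g : SGen D.dg n}
    (hg : g.1.2 = Finset.univ) : cf [g] (R.r n x) = 0 := by
  cases n with
  | zero => exact hx.elim
  | succ n =>
    obtain ⟨j, y, rfl⟩ := hx
    rw [r_σ, D.cf_op_degen hg]

theorem isDegenerate_gen (g : SGen D.dg n) :
    SGLie.IsDegenerate A n (R.gen g) ↔ g.1.2 ≠ Finset.univ := by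
  constructor
  · intro h hg
    have := R.cf_of_isDegenerate h hg
    rw [r_gen, cf_wd_self] at this
    exact one_ne_zero this
  · intro hg
    cases n with
    | zero => exact absurd (Subsingleton.elim _ _) hg
    | succ n =>
      obtain ⟨j, g', rfl⟩ := D.exists_degenGen hg
      exact ⟨j, R.gen g', R.σ_gen j g'⟩

theorem mem_mooreChains {x : (lev A n).carrier} :
    x ∈ SGLie.mooreChains A n ↔ D.IsMoore n (R.r n x) := by
  cases n with
  | zero => exact iff_of_true trivial trivial
  | succ n =>
    rw [SGLie.mooreChains, Submodule.mem_iInf]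
    refine forall_congr' fun i => ?_
    rw [LinearMap.mem_ker, ← op_face_succ, ← r_δ, map_eq_zero_iff _ R.r_injective]

/-- The CW structure. -/
noncomputable def cw : SGLie.CWStructure A where
  T n := SGen D.dg n
  deg n := D.ideg n
  gen n := R.gen
  free n := R.isFreeOn
  degen n j g := ⟨D.degenGen j g, R.σ_gen j g⟩
  attach n g hg i := by
    rw [isDegenerate_gen, not_not] at hg
    obtain ⟨⟨x, I⟩, hI⟩ := g
    obtain rfl : I = Finset.univ := hg
    refine R.r_injective ?_
    rw [r_δ, r_gen, op_face_succ, ← D.Psi_gen hI, op₀_Psi, map_zero]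

theorem mem_cells {x : (lev A n).carrier} :
    x ∈ R.cw.cells n ↔ ∃ g : SGen D.dg n, g.1.2 = Finset.univ ∧ R.gen g = x := by
  constructor
  · rintro ⟨h, g, rfl⟩
    exact ⟨g, not_not.1 (mt (R.isDegenerate_gen g).2 h), rfl⟩
  · rintro ⟨g, hg, rfl⟩
    exact ⟨fun h => (R.isDegenerate_gen g).1 h hg, g, rfl⟩

end Realization

end FreeDiff

/-! ### Exactness and minimality. -/

namespace FreeDiff

variable {X : Type u} {D : FreeDiff X} {L : GLie.{u}}

/-- A cycle is a twisted chain with a = 0, so z = Ψ(c) + d_0 w. Applying d_0 gives Ψ(dc) = 0, hence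
dc = 0. Exactness of the model gives c = db, and Ψ(b) + w is the required chain. -/
theorem Model.exists_moore (M : D.Model L) {n t : ℕ} {z : D.T (n + 1)} (hlie : z ∈ D.lieT (n + 1))
    (ht : z ∈ tgr (D.ideg (n + 1)) t) (hz : ∀ i, D.op (face i) z = 0) :
    ∃ w ∈ D.lieT (n + 2), D.IsMoore (n + 2) w ∧ D.op (face 0) w = z := by
  have htw : D.IsTwisted t (n + 1) z :=
    ⟨fun i => by rw [← op_face_succ, hz], 0, zero_mem _, by rw [hz, map_zero]⟩
  obtain ⟨c, hc1, hc2, w, hw1, -, hw3, rfl⟩ := D.exists_eq_Psi_add M.pos htw hlie ht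
  have h0 := hz 0
  rw [map_add, op_face_zero_Psi, D.op_face_zero_face_zero hw3, add_zero] at h0
  obtain ⟨b, hb1, hb2, rfl⟩ := M.exact_succ n t c hc1 hc2 (D.Psi_injOn (D.d_mem_tgr hc2) h0)
  refine ⟨D.Psi (n + 2) b + w, add_mem (D.Psi_mem (D.E_mem_lie hb1)) hw1, fun i => ?_, ?_⟩
  · rw [map_add, hw3 i, D.isMoore_Psi (n := n + 2) b i, add_zero]
  · rw [map_add, op_face_zero_Psi]

namespace Realization

variable {A : SimplicialObject GLie.{u}} (R : D.Realization A) {n : ℕ}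

theorem cf_δ_zero {y : (lev A (n + 1)).carrier} (hy : y ∈ SGLie.mooreChains A (n + 1))
    {g : SGen D.dg n} (hg : g.1.2 = Finset.univ) : cf [g] (R.r n (GrLie.lin (A.δ 0) y)) = 0 := by
  rw [r_δ]
  exact D.cf_op_face_zero hg (R.mem_mooreChains.1 hy) (lieSub_tge (R.r_mem y))

include R in
theorem δ_δ_zero (i : Fin (n + 2)) (x : (lev A (n + 2)).carrier) :
    GrLie.lin (A.δ i) (GrLie.lin (A.δ 0) x) = GrLie.lin (A.δ 0) (GrLie.lin (A.δ i.succ) x) :=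
  R.r_injective (by rw [r_δ, r_δ, r_δ, r_δ, ← op_comp, face_zero_comp_face, op_comp])

theorem mem_of_proj_mem_of_le {Y B : Submodule ℚ (lev A n).carrier}
    (hY : ∀ t, ∀ x ∈ Y, (lev A n).proj t x ∈ Y)
    (h : ∀ t, ∀ x ∈ Y, x ∈ (lev A n).gr t → x ∈ B) : Y ≤ B := fun x hx =>
  (lev A n).mem_of_proj_mem x B fun t => h t _ (hY t x hx) ((lev A n).proj_mem t x)

variable (M : D.Model L) {ε : lev A 0 ⟶ L} (haug : A.δ 0 ≫ ε = A.δ 1 ≫ ε)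
  (hε : ∀ x, ∀ c ∈ lieSub totalDegree D.dg, R.r 0 x = D.Psi 0 c → GrLie.lin ε x = M.φ c)

-- In positive dimensions this is `Model.exists_moore` on each homogeneous part. In dimension 0 any
-- homogeneous x is Ψ(c) + d_0 y, and ε(x) = φ(c), so exactness of the model at homological degree 0
-- applies.
include R M haug hε in
theorem isResolution : SGLie.IsResolution A ε := by
  have haug' : ∀ y, GrLie.lin ε (GrLie.lin (A.δ 0) y) = GrLie.lin ε (GrLie.lin (A.δ 1) y) := fun y =>
    LinearMap.congr_fun (congrArg GrLie.Hom.toLin haug) y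
  refine ⟨haug, fun y => ?_, fun n => le_antisymm ?_ ?_⟩
  · obtain ⟨c, hc, rfl⟩ := M.surj y
    obtain ⟨x, hx⟩ := R.exists_r_eq (D.Psi_mem (D.E_mem_lie (n := 0) hc))
    exact ⟨x, hε x c hc hx⟩
  · rintro _ ⟨y, hy, rfl⟩
    have hy' : ∀ i : Fin (n + 1), GrLie.lin (A.δ i.succ) y = 0 := fun i =>
      (Submodule.mem_iInf _).1 hy i
    cases n with
    | zero => exact (haug' y).trans (by rw [show (1 : Fin 2) = Fin.succ 0 from rfl, hy', map_zero])
    | succ n =>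
      refine (Submodule.mem_iInf _).2 fun i => ?_
      rw [LinearMap.mem_ker, R.δ_δ_zero, hy', map_zero]
  · cases n with
    | zero =>
      refine mem_of_proj_mem_of_le (fun t x hx => ?_) fun t x hx hxt => ?_
      · have hx' : GrLie.lin ε x = 0 := hx
        change GrLie.lin ε _ = 0
        rw [GrLie.lin_proj, hx', map_zero]
      · obtain ⟨c, hc1, hc2, w, hw1, -, hw3, he⟩ := D.exists_eq_Psi_add (n := 0) M.pos
          (t := t) trivial (R.r_mem x) (R.r_mem_tgr.2 hxt)
        obtain ⟨y, rfl⟩ := R.exists_r_eq hw1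
        have hy := R.mem_mooreChains.2 hw3
        have hy0 : GrLie.lin (A.δ 1) y = 0 := (Submodule.mem_iInf _).1 hy 0
        -- The augmentation takes the same value on d_0 y and on d_1 y, and the latter is zero
        -- because y is a Moore chain.
        have h0 : M.φ c = 0 := by
          rw [← hε (x - GrLie.lin (A.δ 0) y) c hc1 (by rw [map_sub, r_δ, he, add_sub_cancel_right]),
            map_sub, haug', hy0, map_zero, sub_zero]
          exact hx
        obtain ⟨b, hb1, hb2, rfl⟩ := M.exact_zero t c hc1 hc2 h0
        obtain ⟨y', hy'⟩ := R.exists_r_eq (D.Psi_mem (D.E_mem_lie (n := 1) hb1))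
        refine ⟨y' + y, add_mem (R.mem_mooreChains.2 (hy'.symm ▸ D.isMoore_Psi b)) hy,
          R.r_injective ?_⟩
        rw [r_δ, he, map_add, hy', map_add, op_face_zero_Psi]
    | succ n =>
      refine mem_of_proj_mem_of_le (fun t x hx => ?_) fun t x hx hxt => ?_
      · refine (Submodule.mem_iInf _).2 fun i => ?_
        rw [LinearMap.mem_ker, GrLie.lin_proj, LinearMap.mem_ker.1 ((Submodule.mem_iInf _).1 hx i),
          map_zero]
      · obtain ⟨w, hw1, hw2, hw3⟩ := M.exists_moore (R.r_mem x) (R.r_mem_tgr.2 hxt) fun i => by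
          rw [← r_δ, LinearMap.mem_ker.1 ((Submodule.mem_iInf _).1 hx i), map_zero]
        obtain ⟨y, rfl⟩ := R.exists_r_eq hw1
        exact ⟨y, R.mem_mooreChains.2 hw2, R.r_injective (by rw [r_δ, hw3])⟩

/-- A graded subalgebra of the CW basis that contains the generators modulo decomposables. -/
theorem eq_basis (hpos : ∀ x, 1 ≤ (D.dg x).2) {S : Submodule ℚ (lev A n).carrier}
    (hS : (lev A n).IsGradedSubalgebra S) (hle : S ≤ R.cw.basis n)
    (h : ∀ g : SGen D.dg n, g.1.2 = Finset.univ → ∃ s ∈ S, ∀ g' : SGen D.dg n, g'.1.2 = Finset.univ →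
      cf [g'] (R.r n s) = cf [g'] (wd [g])) : S = R.cw.basis n := by
  refine le_antisymm hle (GrLie.lieSpan_le (fun x hx => ?_) hS.1)
  obtain ⟨g, hg, rfl⟩ := R.mem_cells.1 hx
  have key := mem_of_indecomposables (e := D.ideg n) (fun g => hpos g.1.1) {g | g.1.2 = Finset.univ}
    (S := S.map (R.r n)) ?_ ?_ ?_ ?_ ?_ _ g hg rfl
  · obtain ⟨s, hs, hs'⟩ := key
    rw [← R.r_gen, R.r_injective.eq_iff] at hs'
    exact hs' ▸ hs
  · rintro _ ⟨s, hs, rfl⟩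
    exact lieSub_tge (R.r_mem s)
  · rintro _ ⟨s, hs, rfl⟩ _ ⟨s', hs', rfl⟩
    exact ⟨_, hS.1 s hs s' hs', R.r_bracket s s'⟩
  · rintro t _ ⟨s, hs, rfl⟩
    exact ⟨_, hS.proj_mem t hs, R.r_proj t s⟩
  · intro B hB hB'
    refine Submodule.map_le_iff_le_comap.2 (hle.trans (GrLie.lieSpan_le (fun x hx => ?_) ?_))
    · obtain ⟨g, hg, rfl⟩ := R.mem_cells.1 hx
      change R.r n _ ∈ B
      rw [r_gen]
      exact hB g hg
    · intro x hx y hy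
      change R.r n _ ∈ B
      rw [r_bracket]
      exact hB' _ hx _ hy
  · intro g hg
    obtain ⟨s, hs, hs'⟩ := h g hg
    exact ⟨_, ⟨s, hs, rfl⟩, hs'⟩

-- An element of S, or of the subalgebra generated by S and the degenerate elements, that hits the
-- required target differs from a cell by an element that the resolution makes d_0 of a Moore chain.
-- By `cf_δ_zero` that difference has no linear part on the cells, so `eq_basis` applies.
include M haug hε in
theorem isMinimal : R.cw.IsMinimal ε := by
  have hres := R.isResolution M haug hε
  refine ⟨fun S hS hle htop => R.eq_basis M.pos hS hle fun g hg => ?_,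
    fun n S hS hle hmap => R.eq_basis M.pos hS hle fun g hg => ?_⟩
  · obtain ⟨s, hs, hs'⟩ : GrLie.lin ε (R.gen g) ∈ S.map (GrLie.lin ε) := htop ▸ trivial
    refine ⟨s, hs, fun g' hg' => ?_⟩
    have hk : s - R.gen g ∈ SGLie.augCycles A ε 0 := by
      change GrLie.lin ε (s - R.gen g) = 0
      rw [map_sub, hs', sub_self]
    rw [← hres.exact 0] at hk
    obtain ⟨y, hy, hy'⟩ := hk
    have := R.cf_δ_zero hy hg'
    rw [hy', map_sub, map_sub, r_gen] at this
    exact sub_eq_zero.1 this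
  · have hm : R.gen g ∈ SGLie.mooreChains A (n + 1) := (Submodule.mem_iInf _).2 fun i =>
      R.cw.attach n g (fun h => (R.isDegenerate_gen g).1 h hg) i
    have h1 : GrLie.lin (A.δ 0) (R.gen g) ∈ SGLie.augCycles A ε n := by
      rw [← hres.exact n]
      exact ⟨_, hm, rfl⟩
    rw [← hmap] at h1
    obtain ⟨y, ⟨hy1, hy2⟩, hy3⟩ := h1
    -- Both terms are Moore chains with the same d_0, so all faces of the difference vanish.
    have hk : y - R.gen g ∈ SGLie.augCycles A ε (n + 1) := by
      refine (Submodule.mem_iInf _).2 fun i => ?_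
      rw [LinearMap.mem_ker, map_sub]
      refine Fin.cases ?_ (fun i => ?_) i
      · rw [hy3, sub_self]
      · rw [LinearMap.mem_ker.1 ((Submodule.mem_iInf _).1 hy1 i),
          LinearMap.mem_ker.1 ((Submodule.mem_iInf _).1 hm i), sub_self]
    rw [← hres.exact (n + 1)] at hk
    obtain ⟨w, hw, hw'⟩ := hk
    -- B consists of the elements whose linear part on the cells is matched by an element of S.
    -- Degenerate elements and brackets have no such linear part and are matched by 0, so B contains
    -- the subalgebra generated by S and the degenerate elements.
    let B : Submodule ℚ (lev A (n + 1)).carrier :=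
      { carrier := {y | ∃ s ∈ S, ∀ g' : SGen D.dg (n + 1), g'.1.2 = Finset.univ →
          cf [g'] (R.r (n + 1) s) = cf [g'] (R.r (n + 1) y)}
        add_mem' := by
          rintro y y' ⟨s, hs, h⟩ ⟨s', hs', h'⟩
          exact ⟨s + s', add_mem hs hs', fun g' hg' => by
            rw [map_add, map_add, h g' hg', h' g' hg', map_add, map_add]⟩
        zero_mem' := ⟨0, zero_mem _, fun _ _ => rfl⟩
        smul_mem' := by
          rintro c y ⟨s, hs, h⟩
          exact ⟨c • s, S.smul_mem c hs, fun g' hg' => by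
            rw [map_smul, map_smul, h g' hg', map_smul, map_smul]⟩ }
    have hB : (lev A (n + 1)).lieSpan (S ∪ {x | SGLie.IsDegenerate A (n + 1) x}) ≤ B := by
      refine GrLie.lieSpan_le ?_ fun x _ y _ => ?_
      · rintro x (hx | hx)
        · exact ⟨x, hx, fun _ _ => rfl⟩
        · have hx' : SGLie.IsDegenerate A (n + 1) x := hx
          exact ⟨0, zero_mem _, fun g' hg' => by
            rw [R.cf_of_isDegenerate hx' hg', map_zero, map_zero]⟩
      · refine ⟨0, zero_mem _, fun g' _ => ?_⟩
        have h1 := lieSub_tge (R.r_mem x)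
        have h2 := lieSub_tge (R.r_mem y)
        have h3 := lbr_mem_tge (e := D.ideg (n + 1)) h1 h2
        rw [map_zero, map_zero, r_bracket, cf_single_of_tge h3]
    obtain ⟨s, hs, hs'⟩ := hB hy2
    refine ⟨s, hs, fun g' hg' => ?_⟩
    have := R.cf_δ_zero hw hg'
    rw [hw', map_sub, map_sub, r_gen] at this
    rw [hs' g' hg', sub_eq_zero.1 this]

end Realization

end FreeDiff

/-! ### The simplicial DGL, its spheres and its augmentation. -/

/-- Graded Lie algebras as DGLs with zero differential. -/
def trivialFunctor : GLie.{u} ⥤ DGL.{u} where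
  obj := DGL.trivial
  map {G H} f :=
    { toLin := f.toLin
      map_gr := f.map_gr
      map_bracket := f.map_bracket
      comm := fun _ => map_zero f.toLin }

/-- Equality on faces, surjectivity and the kernel of the augmentation are all reflected by a
bijective f. -/
theorem SGLie.IsResolution.of_comp {A : SimplicialObject GLie.{u}} {B B' : GLie.{u}} {ε : lev A 0 ⟶ B}
    {f : B ⟶ B'} (hf : Function.Bijective (GrLie.lin f)) (h : SGLie.IsResolution A (ε ≫ f)) :
    SGLie.IsResolution A ε where
  aug := GrLie.Hom.ext (LinearMap.ext fun x =>
    hf.1 (LinearMap.congr_fun (congrArg GrLie.Hom.toLin h.aug) x))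
  surjective y := by
    obtain ⟨x, hx⟩ := h.surjective (GrLie.lin f y)
    exact ⟨x, hf.1 hx⟩
  exact n := by
    rw [h.exact]
    cases n with
    | zero =>
      ext x
      exact map_eq_zero_iff (GrLie.lin f) hf.1
    | succ n => rfl

namespace FreeDiff

variable {X : Type u} (D : FreeDiff X) {L : GLie.{u}}

/-- The simplicial DGL of a differential on a free Lie algebra. -/
noncomputable def sdgl : SimplicialObject DGL.{u} := D.simplicial ⋙ trivialFunctor

/-- The homology of the simplicial DGL is isomorphic to the simplicial graded Lie algebra. -/
noncomputable def realization : D.Realization (SDGL.homology D.sdgl) where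
  e n := DGL.homologyTrivial (D.G n)
  bij n := DGL.homologyTrivial_bijective (D.G n)
  δ n i x := by
    obtain ⟨y, rfl⟩ := (DGL.trivial (D.G (n + 1))).boundaries.mkQ_surjective x
    rfl
  σ n j x := by
    obtain ⟨y, rfl⟩ := (DGL.trivial (D.G n)).boundaries.mkQ_surjective x
    rfl

/-- The free structure of the simplicial DGL, without disks. -/
noncomputable def mfree : SDGL.MFreeStructure D.sdgl where
  dec n :=
    { Sph := SGen D.dg n
      Dsk := PEmpty
      sphDeg := D.ideg n
      dskDeg := PEmpty.elim
      sph := freeLieGen (AddMonoidHom.id ℕ) (D.ideg n)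
      dsk := PEmpty.elim
      sph_cycle := fun _ => rfl
      free := by
        have hG := freeLie_isFreeOn (AddMonoidHom.id ℕ) (D.ideg n)
        refine ⟨?_, fun H f hf => ?_⟩
        · rintro (g | e | e)
          · exact hG.1 g
          · exact e.elim
          · exact e.elim
        · obtain ⟨φ, hφ, huniq⟩ := hG.2 H (fun g => f (Sum.inl g)) fun g => hf (Sum.inl g)
          refine ⟨φ, ?_, fun ψ hψ => huniq ψ fun g => hψ (Sum.inl g)⟩
          rintro (g | e | e)
          · exact hφ g
          · exact e.elim
          · exact e.elim }
  degen_sph n j g := ⟨D.degenGen j g, Subtype.ext (D.op_degen_gen j g)⟩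
  degen_dsk n j e := PEmpty.elim e

theorem isDegenerate_sph {n : ℕ} (g : SGen D.dg n) :
    SDGL.IsDegenerate D.sdgl n ((D.mfree.dec n).sph g) ↔ g.1.2 ≠ Finset.univ := by
  cases n with
  | zero => exact iff_of_false id fun h => h (Subsingleton.elim _ _)
  | succ n =>
    constructor
    · rintro ⟨j, y, hy⟩ hg
      have h1 : D.op (degen j) (freeLieIncl _ _ y) = wd [g] := congrArg (freeLieIncl _ _) hy
      have h2 := D.cf_op_degen hg j (freeLieIncl _ _ y)
      rw [h1, cf_wd_self] at h2
      exact one_ne_zero h2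
    · intro hg
      obtain ⟨j, g', rfl⟩ := D.exists_degenGen hg
      exact ⟨j, freeLieGen _ _ g', Subtype.ext (D.op_degen_gen j g')⟩

/-- The generators are the non-degenerate spheres. -/
noncomputable def sphereEquiv : X ≃ D.mfree.NonDegSphere where
  toFun x := ⟨(D.dg x).1, (⟨(x, Finset.univ), Finset.card_fin _⟩ : SGen D.dg (D.dg x).1), fun h =>
    (D.isDegenerate_sph _).1 h rfl⟩
  invFun a := Subtype.val (p := fun g : X × Finset (Fin a.1) => g.2.card = (D.dg g.1).1) a.2.1 |>.1
  left_inv _ := rfl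
  right_inv := by
    rintro ⟨n, ⟨⟨x, I⟩, h⟩, hI⟩
    -- Non-degeneracy forces the full set of steps, and then its cardinality forces n to be the
    -- homological degree of x.
    obtain rfl : I = Finset.univ := not_not.1 (mt (D.isDegenerate_sph ⟨(x, I), h⟩).2 hI)
    obtain rfl : n = (D.dg x).1 := (Finset.card_fin n).symm.trans h
    rfl

theorem sphereEquiv_bideg (x : X) : (D.sphereEquiv x).bideg = D.dg x := rfl

theorem realization_gen {n : ℕ} (g : SGen D.dg n) : D.realization.gen g =
    (lev D.sdgl n).homologyClass ((D.mfree.dec n).sph g) ((D.mfree.dec n).sph_cycle g) :=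
  D.realization.r_injective (D.realization.r_gen g)

theorem mem_cells_iff (n : ℕ) (c : (lev (SDGL.homology D.sdgl) n).carrier) :
    c ∈ D.realization.cw.cells n ↔ ∃ x, (⟨n, c⟩ : Σ m, (lev (SDGL.homology D.sdgl) m).carrier) =
      ⟨(D.sphereEquiv x).1, (D.sphereEquiv x).homologyClass⟩ := by
  rw [D.realization.mem_cells]
  constructor
  · rintro ⟨⟨⟨x, I⟩, h⟩, hI, rfl⟩
    obtain rfl : I = Finset.univ := hI
    obtain rfl : n = (D.dg x).1 := (Finset.card_fin n).symm.trans h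
    refine ⟨x, ?_⟩
    rw [realization_gen]
    rfl
  · rintro ⟨x, hx⟩
    obtain ⟨rfl, hx⟩ := Sigma.mk.inj hx
    obtain rfl := eq_of_heq hx
    exact ⟨⟨(x, Finset.univ), Finset.card_fin _⟩, rfl, D.realization_gen _⟩

variable {D} (M : D.Model L)

namespace Model

theorem gen_mem (g : SGen D.dg 0) : M.φ (wd [g.1.1]) ∈ L.gr (D.ideg 0 g) := by
  refine M.map_gr g.1.1 _ (Prod.ext ?_ rfl)
  rw [← g.2, Subsingleton.elim g.1.2 ∅, Finset.card_empty]

/-- The augmentation of the simplicial graded Lie algebra. -/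
noncomputable def aug : D.G 0 ⟶ L := freeLieLift M.gen_mem

/-- The top coefficient in dimension zero, as a morphism of algebras. -/
theorem Psi_zero_eq (c : Tens X) : D.Psi 0 c =
    algLift (fun x => D.Psi 0 (wd [x])) c := by
  have h : ∀ w : List X, D.Psi 0 (wd w) = algLift (fun x => D.Psi 0 (wd [x])) (wd w) := by
    intro w
    induction w with
    | nil => rw [wd_nil, Psi_apply, map_one (D.E 0), map_one (algLift _), one_apply, if_pos (Subsingleton.elim _ _)]
    | cons x w ih =>
      rw [wd_cons, map_mul (algLift _), ← ih, algLift_gen, Psi_apply, Psi_apply, Psi_apply,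
        map_mul (D.E 0), mul_apply]
      have h0 : ∀ I : Finset (Fin 0), I = ∅ := fun I => Subsingleton.elim _ _
      simp [h0]
  exact LinearMap.congr_fun (f := D.Psi 0)
    (g := (algLift fun x => D.Psi 0 (wd [x])).toLinearMap) (lin_ext h) c

/-- In dimension 0 the map Ψ is an algebra map killing the generators of positive homological
degree. On the remaining ones total and internal degree coincide, so the commutator signs agree. -/
theorem Psi_zero_lbr (a b : Tens X) :
    D.Psi 0 (lbr D.tdeg a b) = lbr (D.ideg 0) (D.Psi 0 a) (D.Psi 0 b) := by
  rw [Psi_zero_eq, Psi_zero_eq, Psi_zero_eq]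
  refine algHom_lbr (tot := AddMonoidHom.id ℕ) (deg := D.tdeg) (deg' := D.ideg 0) (fun x => ?_) a b
  rw [algLift_gen]
  by_cases h : (D.dg x).1 = 0
  · have hs : D.tdeg x = (D.dg x).2 := by
      change (D.dg x).1 + (D.dg x).2 = _
      rw [h, zero_add]
    rw [hs]
    exact D.Psi_mem (D.E_mem_tgr (p := 0) (wd_mem_sup (by rw [wdeg_cons, wdeg_nil, add_zero]; exact Prod.ext h rfl)))
  · rw [Psi_apply, E_gen, D.isHom_EGen 0 x _ (by simpa using Ne.symm h)]
    exact zero_mem _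

/-- Both sides respect brackets, and both kill the generators of positive homological degree. -/
theorem dynkin_Psi {c : Tens X} (hc : c ∈ lieSub totalDegree D.dg) :
    dynkin L (fun g : SGen D.dg 0 => M.φ (wd [g.1.1])) (D.Psi 0 c) = M.φ c := by
  refine eqOn_lieSub (f := dynkin L (fun g : SGen D.dg 0 => M.φ (wd [g.1.1])) ∘ₗ D.Psi 0) (g := M.φ)
    (fun i n x hx => ?_) hc
  change dynkin L _ (D.Psi 0 x) = M.φ x
  induction hx with
  | gen x =>
    by_cases h : (D.dg x).1 = 0
    · rw [D.Psi_gen (by rw [Finset.card_fin, h])]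
      simp [dynkin, rnorm]
    · rw [M.map_pos x h, Psi_apply, E_gen, D.isHom_EGen 0 x _ (by simpa using Ne.symm h), map_zero]
  | @bracket i j n m x y hx hy ihx ihy =>
    rw [Psi_zero_lbr, M.map_bracket x hx.mem_lieSub y hy.mem_lieSub, ← ihx, ← ihy]
    exact dynkin_bracket (tot := AddMonoidHom.id ℕ) M.gen_mem (D.Psi_mem (D.E_mem_lie hx.mem_lieSub))
      (D.Psi_mem (D.E_mem_lie hy.mem_lieSub))

/-- On a 1-cell over x the face d_0 is Ψ(δx), which maps to φ(δx) = 0, and d_1 is zero. On a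
degenerate generator both faces are the same vertex generator. -/
theorem opHom_aug : D.opHom (face 0) ≫ M.aug = D.opHom (face 1) ≫ M.aug := by
  refine freeLie_hom_ext fun g => ?_
  change dynkin L _ (D.op (face 0) (wd [g])) = dynkin L _ (D.op (face 1) (wd [g]))
  by_cases hg : g.1.2 = Finset.univ
  · obtain ⟨⟨x, I⟩, hI⟩ := g
    obtain rfl : I = Finset.univ := hg
    rw [← D.Psi_gen hI, op_face_zero_Psi, der_gen, dynkin_Psi M (D.mem_lie x), M.map_δ,
      show (1 : Fin 2) = Fin.succ 0 from rfl, op_face_succ, op₀_Psi, map_zero]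
  · obtain ⟨j, g', rfl⟩ := D.exists_degenGen hg
    have h : ∀ i : Fin 2, (degen j).comp (face i) = OrderHom.id := fun i => by
      ext x; omega
    rw [← op_degen_gen, ← op_comp, ← op_comp, h, h]

/-- The augmentation of the simplicial DGL. -/
noncomputable def augD : lev D.sdgl 0 ⟶ DGL.trivial L := trivialFunctor.map M.aug

theorem sdgl_aug : D.sdgl.δ 0 ≫ M.augD = D.sdgl.δ 1 ≫ M.augD :=
  congrArg trivialFunctor.map M.opHom_aug

theorem homology_aug : (SDGL.homology D.sdgl).δ 0 ≫ (DGL.homologyMap M.augD ≫ DGL.homologyTrivial L) =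
    (SDGL.homology D.sdgl).δ 1 ≫ (DGL.homologyMap M.augD ≫ DGL.homologyTrivial L) := by
  have h := congrArg (fun f => DGL.homologyFunctor.map f ≫ DGL.homologyTrivial L) M.sdgl_aug
  simp only [Functor.map_comp] at h
  exact h

theorem lin_homology_aug (x : (lev (SDGL.homology D.sdgl) 0).carrier) (c : Tens X)
    (hc : c ∈ lieSub totalDegree D.dg) (h : D.realization.r 0 x = D.Psi 0 c) :
    GrLie.lin (DGL.homologyMap M.augD ≫ DGL.homologyTrivial L) x = M.φ c := by
  rw [← M.dynkin_Psi hc, ← h]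
  obtain ⟨y, rfl⟩ := (DGL.trivial (D.G 0)).boundaries.mkQ_surjective x
  rfl

theorem isMinimalCWResolution : SGLie.IsMinimalCWResolution D.realization.cw
    (DGL.homologyMap M.augD ≫ DGL.homologyTrivial L) :=
  ⟨D.realization.isResolution M M.homology_aug M.lin_homology_aug,
    D.realization.isMinimal M M.homology_aug M.lin_homology_aug⟩

theorem isResolution : SDGL.IsResolution D.sdgl M.augD :=
  ⟨M.sdgl_aug, M.isMinimalCWResolution.resolution.of_comp (DGL.homologyTrivial_bijective L)⟩

end Model

end FreeDiff

/-! ### Coordinates on a bigraded model. -/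

/-- The degrees of the images enter only through their parity. Requiring no more than this allows a
vanishing image to be given any degree of the right parity, also when there is no degree one lower.
-/
theorem der_lbr {Γ : Type*} {e : Γ → ℕ} {δ : Γ → Tens Γ} {i j i' j' : ℕ} {x y : Tens Γ}
    (hx : x ∈ tgr e i) (hy : y ∈ tgr e j) (hx' : der e δ x ∈ tgr e i') (hy' : der e δ y ∈ tgr e j')
    (hi : (-1 : ℚ) ^ i' = -(-1) ^ i) (hj : (-1 : ℚ) ^ j' = -(-1) ^ j) :
    der e δ (lbr e x y) = lbr e (der e δ x) y + (-1 : ℚ) ^ i • lbr e x (der e δ y) := by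
  have hpar : ∀ {k : ℕ} {z : Tens Γ}, z ∈ tgr e k → par e z = (-1 : ℚ) ^ k • z := fun {k z} hz => by
    have := par_pow_apply e hz 1
    rwa [pow_one, mul_one] at this
  have h1 : (-1 : ℚ) ^ (i' * j) = (-1) ^ (i * j) * (-1) ^ j := by
    rw [pow_mul, hi, neg_pow, ← pow_mul, mul_comm]
  have h2 : (-1 : ℚ) ^ (i * j') = (-1) ^ (i * j) * (-1) ^ i := by
    rw [mul_comm i, pow_mul, hj, neg_pow, ← pow_mul, mul_comm j, mul_comm]
  rw [lbr_of_mem hx hy, lbr_of_mem hx' hy, lbr_of_mem hx hy', map_sub, map_smul, der_mul, der_mul, hpar hx,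
    hpar hy, h1, h2]
  simp only [smul_mul_assoc]
  rcases neg_one_pow_eq_or ℚ i with h | h <;> rw [h] <;> module

theorem DBGL.proj_d (A : DBGL.{u}) (p s : ℕ) (x : A.carrier) :
    A.proj (p, s) (A.d x) = A.d (A.proj (p + 1, s) x) := by
  refine A.induct (p := fun x => A.proj (p, s) (A.d x) = A.d (A.proj (p + 1, s) x)) x ?_ (by simp)
    (fun x y hx hy => by simp only [map_add, hx, hy])
  rintro ⟨q, t⟩ x hx
  by_cases h : (q, t) = (p + 1, s)
  · rw [h] at hx
    rw [A.proj_same hx, A.proj_same (A.d_succ hx)]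
  · rw [A.proj_ne hx h, map_zero]
    cases q with
    | zero => rw [A.d_zero hx, map_zero]
    | succ q => exact A.proj_ne (A.d_succ hx) fun h' => h (by rw [Prod.mk.injEq] at h' ⊢; omega)

theorem DGL.QuasiIso.exists_d_eq {E F : DGL.{u}} {f : E ⟶ F} (hf : DGL.QuasiIso f) {a : E.carrier}
    (ha : E.d a = 0) (h : DGL.lin f a = 0) : ∃ w, E.d w = a := by
  have h0 : E.boundaries.mkQ ⟨a, ha⟩ = 0 := by
    refine hf.1 ?_
    have : DGL.cyclesMap f ⟨a, ha⟩ = 0 := Subtype.ext h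
    exact ((congrArg F.boundaries.mkQ this).trans (map_zero _)).trans (map_zero _).symm
  obtain ⟨w, hw⟩ := (Submodule.Quotient.mk_eq_zero _).1 h0
  exact ⟨w, hw⟩

theorem DGL.QuasiIso.surjective {E : DGL.{u}} {L : GLie.{u}} {f : E ⟶ DGL.trivial L}
    (hf : DGL.QuasiIso f) (y : L.carrier) : ∃ a, DGL.lin f a = y := by
  obtain ⟨q, hq⟩ := hf.2 ((DGL.trivial L).homologyClass y rfl)
  obtain ⟨⟨a, ha⟩, rfl⟩ := E.boundaries.mkQ_surjective q
  exact ⟨a, congrArg (GrLie.lin (DGL.homologyTrivial L)) hq⟩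

section Presentation

variable {A : DBGL.{u}} {X : Type u} {deg : X → ℕ × ℕ} {b : X → A.carrier} (hX : A.IsFreeOn deg b)

/-- The isomorphism from a free bigraded Lie algebra to the model inside the tensor algebra. -/
noncomputable def coordHom : A.toGrLie ⟶ freeLie totalDegree deg :=
  (hX.2 (freeLie totalDegree deg) (freeLieGen totalDegree deg) (freeLie_isFreeOn totalDegree deg).1).choose

theorem coordHom_gen (x : X) : GrLie.lin (coordHom hX) (b x) = freeLieGen totalDegree deg x :=
  (hX.2 (freeLie totalDegree deg) (freeLieGen totalDegree deg)
    (freeLie_isFreeOn totalDegree deg).1).choose_spec.1 x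

/-- The coordinates of a free bigraded Lie algebra in the tensor algebra. -/
noncomputable def coord : A.carrier →ₗ[ℚ] Tens X :=
  freeLieIncl totalDegree deg ∘ₗ GrLie.lin (coordHom hX)

theorem coord_gen (x : X) : coord hX (b x) = wd [x] :=
  congrArg (freeLieIncl totalDegree deg) (coordHom_gen hX x)

theorem coord_bijective : Function.Bijective (GrLie.lin (coordHom hX)) :=
  hX.bijective (freeLie_isFreeOn totalDegree deg) (coordHom_gen hX)

theorem coord_injective : Function.Injective (coord hX) :=
  Subtype.val_injective.comp (coord_bijective hX).1

theorem coord_mem (a : A.carrier) : coord hX a ∈ lieSub totalDegree deg :=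
  Subtype.property (p := fun x => x ∈ lieSub totalDegree deg) _

theorem exists_coord_eq {c : Tens X} (hc : c ∈ lieSub totalDegree deg) : ∃ a, coord hX a = c := by
  obtain ⟨a, ha⟩ := (coord_bijective hX).2 (⟨c, hc⟩ : lieSub totalDegree deg)
  exact ⟨a, congrArg Subtype.val ha⟩

theorem coord_mem_tgr {i : ℕ × ℕ} {a : A.carrier} : coord hX a ∈ tgr deg i ↔ a ∈ A.gr i :=
  ⟨fun h => GrLie.mem_gr_of_lin (coord_bijective hX).1 h, fun h => (coordHom hX).map_gr h⟩

theorem coord_bracket (x y : A.carrier) : coord hX (A.bracket x y) =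
    lbr (fun g => totalDegree (deg g)) (coord hX x) (coord hX y) :=
  congrArg (freeLieIncl totalDegree deg) ((coordHom hX).map_bracket x y)

/-- The retraction of the tensor algebra onto the free Lie algebra. -/
theorem dynkin_coord (a : A.carrier) : dynkin A.toGrLie b (coord hX a) = a := by
  refine coord_injective hX ?_
  obtain ⟨g, hg⟩ : ∃ g : freeLie totalDegree deg ⟶ A.toGrLie, ∀ x, GrLie.lin g x =
      dynkin A.toGrLie b (freeLieIncl totalDegree deg x) := ⟨freeLieLift hX.1, fun _ => rfl⟩
  have h : coordHom hX ≫ g = 𝟙 A.toGrLie := hX.hom_ext fun x => by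
    change GrLie.lin g (GrLie.lin (coordHom hX) (b x)) = b x
    rw [coordHom_gen, hg]
    change dynkin A.toGrLie b (wd [x]) = b x
    simp [dynkin, rnorm]
  refine congrArg (coord hX) ?_
  rw [coord, LinearMap.comp_apply, ← hg]
  exact LinearMap.congr_fun (congrArg GrLie.Hom.toLin h) a

/-- The values of the differential on the generators. -/
noncomputable def coordδ (x : X) : Tens X := coord hX (A.d (b x))

theorem coord_d_mem {i : ℕ × ℕ} {a : A.carrier} (ha : a ∈ A.gr i) :
    ∃ k, coord hX (A.d a) ∈ tgr (fun x => totalDegree (deg x)) k ∧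
      (-1 : ℚ) ^ k = -(-1) ^ totalDegree i := by
  obtain ⟨p, s⟩ := i
  cases p with
  | zero =>
    -- The differential vanishes in homological degree 0 and zero lies in every degree, so a degree
    -- of the opposite parity is chosen.
    refine ⟨totalDegree (0, s) + 1, ?_, by rw [pow_succ]; simp⟩
    rw [A.d_zero ha, map_zero]
    exact zero_mem _
  | succ p =>
    refine ⟨totalDegree (p, s), tgr_tot totalDegree ((coord_mem_tgr hX).2 (A.d_succ ha)), ?_⟩
    change (-1 : ℚ) ^ (p + s) = -(-1) ^ (p + 1 + s)
    rw [add_right_comm, pow_succ]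
    simp

/-- In coordinates both maps are graded derivations on Lie elements with the same values on
generators; the induction runs over iterated brackets. -/
theorem der_coord (a : A.carrier) :
    der (fun x => totalDegree (deg x)) (coordδ hX) (coord hX a) = coord hX (A.d a) := by
  have h : ∀ i n x, LieMon totalDegree deg i n x → ∀ a, coord hX a = x →
      der (fun x => totalDegree (deg x)) (coordδ hX) x = coord hX (A.d a) := by
    intro i n x hx
    induction hx with
    | gen x =>
      intro a ha
      rw [der_gen, coordδ, coord_injective hX (ha.trans (coord_gen hX x).symm)]
    | @bracket i j n m x y hx hy ihx ihy =>
      intro c hc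
      obtain ⟨a, rfl⟩ := exists_coord_eq hX hx.mem_lieSub
      obtain ⟨a', rfl⟩ := exists_coord_eq hX hy.mem_lieSub
      have ha := (coord_mem_tgr hX).1 hx.mem_tgr
      obtain ⟨k, hk, hk'⟩ := coord_d_mem hX ha
      obtain ⟨l, hl, hl'⟩ := coord_d_mem hX ((coord_mem_tgr hX).1 hy.mem_tgr)
      rw [← ihx a rfl] at hk
      rw [← ihy a' rfl] at hl
      rw [← coord_bracket] at hc
      obtain rfl := coord_injective hX hc
      rw [der_lbr (tgr_tot totalDegree hx.mem_tgr) (tgr_tot totalDegree hy.mem_tgr) hk hl hk' hl',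
        ihx a rfl, ihy a' rfl, A.leibniz (p := i.1) (s := i.2) ha, map_add, map_smul, coord_bracket,
        coord_bracket]
      rfl
  have := eqOn_lieSub (f := der (fun x => totalDegree (deg x)) (coordδ hX))
    (g := coord hX ∘ₗ A.d ∘ₗ dynkin A.toGrLie b) (fun i n x hx => ?_) (coord_mem hX a)
  · rw [this, LinearMap.comp_apply, LinearMap.comp_apply, dynkin_coord]
  · obtain ⟨c, rfl⟩ := exists_coord_eq hX hx.mem_lieSub
    rw [LinearMap.comp_apply, LinearMap.comp_apply, dynkin_coord]
    exact h i n _ hx c rfl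

theorem coord_mem_tge {a : A.carrier} (ha : a ∈ A.decomposables) : coord hX a ∈ tge 2 := by
  have : A.decomposables ≤ (tge 2).comap (coord hX) := Submodule.span_le.2 (by
    rintro _ ⟨x, y, rfl⟩
    change coord hX _ ∈ tge 2
    have h1 := lieSub_tge (coord_mem hX x)
    have h2 := lieSub_tge (coord_mem hX y)
    have h3 := lbr_mem_tge (e := fun g => totalDegree (deg g)) h1 h2
    rw [coord_bracket]
    exact h3)
  exact this ha

/-- The differential, in coordinates. -/
noncomputable def coordDiff (hd : ∀ x, A.d x ∈ A.decomposables) : FreeDiff X where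
  dg := deg
  δ := coordδ hX
  mem_lie x := coord_mem hX _
  deg_succ x p s h := (coord_mem_tgr hX).2 (A.d_succ (h ▸ hX.1 x))
  deg_zero x h := by
    have hx : b x ∈ A.gr (0, (deg x).2) := by rw [← h]; exact hX.1 x
    rw [coordδ, A.d_zero hx, map_zero]
  len x := coord_mem_tge hX (hd _)
  sq_zero x := by rw [coordδ, der_coord, A.d_d, map_zero]

variable {L : GLie.{u}} {φ : A.assoc ⟶ DGL.trivial L} (hφ : IsBigradedModel φ)

/-- The underlying linear map of a bigraded model. -/
def modelLin (φ : A.assoc ⟶ DGL.trivial L) : A.carrier →ₗ[ℚ] L.carrier := DGL.lin φ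

theorem modelLin_d (x : A.carrier) : modelLin φ (A.d x) = 0 := DGL.Hom.comm φ x

theorem modelLin_bracket (x y : A.carrier) :
    modelLin φ (A.bracket x y) = L.bracket (modelLin φ x) (modelLin φ y) :=
  (DGL.Hom.toHom φ).map_bracket x y

theorem modelLin_mem {i : ℕ × ℕ} {x : A.carrier} (hx : x ∈ A.gr i) :
    modelLin φ x ∈ L.gr (totalDegree i) :=
  (DGL.Hom.toHom φ).map_gr (show x ∈ ⨆ k : {k : ℕ × ℕ // totalDegree k = totalDegree i}, A.gr k from
    Submodule.mem_iSup_of_mem ⟨i, rfl⟩ hx)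

include hφ in
theorem exists_d_eq {a : A.carrier} (ha : A.d a = 0) (h : modelLin φ a = 0) :
    ∃ w : A.carrier, A.d w = a :=
  hφ.quasiIso.exists_d_eq ha h

include hφ in
theorem modelLin_surjective (y : L.carrier) : ∃ a : A.carrier, modelLin φ a = y :=
  hφ.quasiIso.surjective y

include hφ in
theorem exists_d_eq_homogeneous {p s : ℕ} {a : A.carrier} (hg : a ∈ A.gr (p, s)) (ha : A.d a = 0)
    (h : modelLin φ a = 0) : ∃ w ∈ A.gr (p + 1, s), A.d w = a := by
  obtain ⟨w, rfl⟩ := exists_d_eq hφ ha h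
  exact ⟨A.proj (p + 1, s) w, A.proj_mem _ _, by rw [← A.proj_d, A.proj_same hg]⟩

include hX hφ in
/-- The generators have positive internal degree. -/
theorem deg_pos (hL : L.gr 0 = ⊥) (x : X) : 1 ≤ (deg x).2 := by
  suffices h : ∀ p x, (deg x).1 = p → (deg x).2 ≠ 0 from Nat.one_le_iff_ne_zero.2 (h _ x rfl)
  intro p
  induction p using Nat.strong_induction_on with
  | _ p ih =>
  intro x hp h0
  have hx : b x ∈ A.gr (p, 0) := by rw [← hp, ← h0]; exact hX.1 x
  have key : A.d (b x) = 0 ∧ modelLin φ (b x) = 0 := by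
    cases p with
    | zero =>
      refine ⟨A.d_zero hx, ?_⟩
      have : modelLin φ (b x) ∈ L.gr 0 := modelLin_mem hx
      rwa [hL, Submodule.mem_bot] at this
    | succ p =>
      refine ⟨coord_injective hX ?_, hφ.bigraded hx⟩
      rw [map_zero]
      refine ext_cf fun w => ?_
      rw [map_zero]
      by_contra hw
      have h1 : wdeg deg w = (p, 0) := mem_sup_iff.1 ((coord_mem_tgr hX).2 (A.d_succ hx)) w hw
      have h2 : 1 ≤ w.length := mem_sup_iff.1 (lieSub_tge (coord_mem hX _)) w hw
      cases w with
      | nil => exact absurd h2 (by simp)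
      | cons y w =>
        rw [wdeg_cons, Prod.ext_iff, Prod.fst_add, Prod.snd_add] at h1
        simp only at h1
        exact ih (deg y).1 (by omega) y rfl (by omega)
  -- Hence the generator is a boundary and so decomposable, whereas the word [x] has coefficient one
  -- in it.
  obtain ⟨w, hw⟩ := exists_d_eq hφ key.1 key.2
  have h2 := coord_mem_tge hX (hφ.minimal w)
  rw [hw, coord_gen] at h2
  exact one_ne_zero ((cf_wd_self [x]).symm.trans (cf_single_of_tge h2 x))

/-- A bigraded model, in coordinates. -/
noncomputable def coordModel (hL : L.gr 0 = ⊥) : (coordDiff hX hφ.minimal).Model L where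
  pos := deg_pos hX hφ hL
  φ := modelLin φ ∘ₗ dynkin A.toGrLie b
  map_gr x s h := by
    have hx : b x ∈ A.gr (0, s) := h ▸ hX.1 x
    rw [LinearMap.comp_apply, ← coord_gen hX, dynkin_coord]
    have := modelLin_mem (φ := φ) hx
    rwa [show totalDegree (0, s) = s from Nat.zero_add s] at this
  map_pos x h := by
    obtain ⟨p, hp⟩ := Nat.exists_eq_succ_of_ne_zero h
    have hx : b x ∈ A.gr (p + 1, (deg x).2) := by
      have hp' : (deg x).1 = p + 1 := hp
      rw [← hp']
      exact hX.1 x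
    rw [LinearMap.comp_apply, ← coord_gen hX, dynkin_coord]
    exact hφ.bigraded hx
  map_bracket c hc c' hc' := by
    obtain ⟨a, rfl⟩ := exists_coord_eq hX hc
    obtain ⟨a', rfl⟩ := exists_coord_eq hX hc'
    have h := coord_bracket hX a a'
    rw [LinearMap.comp_apply, LinearMap.comp_apply, LinearMap.comp_apply, dynkin_coord, dynkin_coord,
      ← modelLin_bracket]
    exact congrArg (modelLin φ) ((congrArg _ h.symm).trans (dynkin_coord hX _))
  map_δ x := by
    rw [LinearMap.comp_apply]
    exact (congrArg (modelLin φ) (dynkin_coord hX (A.d (b x)))).trans (modelLin_d _)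
  surj y := by
    obtain ⟨a, rfl⟩ := modelLin_surjective hφ y
    exact ⟨coord hX a, coord_mem hX a, by rw [LinearMap.comp_apply, dynkin_coord]⟩
  exact_succ n t c hc ht hd := by
    obtain ⟨a, rfl⟩ := exists_coord_eq hX hc
    have ha := (coord_mem_tgr hX).1 ht
    have hda : A.d a = 0 := coord_injective hX ((der_coord hX a).symm.trans (hd.trans (map_zero _).symm))
    obtain ⟨w, hw, rfl⟩ := exists_d_eq_homogeneous hφ ha hda (hφ.bigraded ha)
    exact ⟨coord hX w, coord_mem hX w, (coord_mem_tgr hX).2 hw, der_coord hX w⟩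
  exact_zero t c hc ht h := by
    obtain ⟨a, rfl⟩ := exists_coord_eq hX hc
    have ha := (coord_mem_tgr hX).1 ht
    rw [LinearMap.comp_apply, dynkin_coord] at h
    obtain ⟨w, hw, rfl⟩ := exists_d_eq_homogeneous hφ ha (A.d_zero ha) h
    exact ⟨coord hX w, coord_mem hX w, (coord_mem_tgr hX).2 hw, der_coord hX w⟩

end Presentation

theorem mainTheorem3 (L : GLie.{u}) (hL : L.gr 0 = ⊥) (A : DBGL.{u})
    (φ : A.assoc ⟶ DGL.trivial L) (hφ : IsBigradedModel φ)
    {X : Type u} (deg : X → ℕ × ℕ) (b : X → A.carrier) (hX : A.IsFreeOn deg b) :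
    ∃ (C : SimplicialObject DGL.{u}) (ε : lev C 0 ⟶ DGL.trivial L) (M : SDGL.MFreeStructure C)
      (θ : X ≃ M.NonDegSphere),
      SDGL.IsResolution C ε ∧
      (∀ x, (θ x).bideg = deg x) ∧
      ∃ W : SGLie.CWStructure (SDGL.homology C),
        SGLie.IsMinimalCWResolution W (DGL.homologyMap ε ≫ DGL.homologyTrivial L) ∧
        ∀ n (c : (lev (SDGL.homology C) n).carrier),
          c ∈ W.cells n ↔ ∃ x, (⟨n, c⟩ : Σ m, (lev (SDGL.homology C) m).carrier) =
            ⟨(θ x).1, (θ x).homologyClass⟩ := by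
  let D := coordDiff hX hφ.minimal
  let M : D.Model L := coordModel hX hφ hL
  exact ⟨D.sdgl, M.augD, D.mfree, D.sphereEquiv, M.isResolution, D.sphereEquiv_bideg, D.realization.cw,
    M.isMinimalCWResolution, D.mem_cells_iff⟩
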